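/- Let $M$ be a closed smooth manifold of dimension $n$ with a Riemannian metric $h$, let $g:M\to M$ be an isometric diffeomorphism, and let $D=\sum_k D_kT^k$ be a finite sum, where $k\in\mathbb Z$, $Tu(x)=u(g(x))$ and the $D_k$ are scalar differential operators of order one on $M$ with smooth complex coefficients. Put $\partial g=({}^t dg)^{-1}:T^*M\to T^*M$. The symbol of $D$ at $(x,\xi)\in T^*M$ is the bounded operator on $l^2(\mathbb Z)$ $$(\sigma(D)(x,\xi)u)(m)=\sum_k\sigma(D_k)(\partial g^m(x,\xi))\,u(m+k),\qquad \sigma(\partial_{x_j})=i\xi_j .$$ Assume that $D$ is elliptic, i.e. $\sigma(D)(x,\xi)$ is invertible for all $x$ and all $\xi\neq0$. Let $\widetilde T u(x,t)=u(g(x),t+1)$ and $\widetilde D=\sum_kD_k\widetilde T^k$ on $M\times\mathbb R$, let $A=\partial_t+t$, and let $$\widetilde D\#A=\begin{pmatrix}\widetilde D&A\\-A^*&\widetilde D^*\end{pmatrix},$$ where $*$ is the formal adjoint with respect to the inner product of $L^2(M\times\mathbb R)$. This operator can be written as a finite sum $\sum_kB_k\widetilde T^k$, where the entries of the $2\times2$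 matrices $B_k$ are differential operators in $(x,t)$ of the form $u\mapsto Vu+cu+a\,\partial_tu+b\,t\,u$, with a smooth complex vector field $V$ and smooth complex functions $a,b,c$ on $M$. For each such representation, the symbol is the operator-valued function $\sigma(\widetilde D\#A)(x,\xi,t,\tau)$ that acts on $l^2(\mathbb Z)\otimes\mathbb C^2$ by $u\mapsto\big(m\mapsto\sum_k\sigma(B_k)(\partial g^m(x,\xi),t,\tau)u(m+k)\big)$, where the entry displayed above has the symbol $i\xi(V)+i\tau a+tb$. For $q\in\{0,2\}$ let $S_q=S(T^*M\times\mathbb R^q)$ be the unit sphere bundle, oriented as the boundary of the unit ball bundle, where $T^*M$ has its canonical orientation $dx_1\wedge d\xi_1\wedge\dots\wedge dx_n\wedge d\xi_n$ and $\mathbb R^2$ has the orientation $dt\wedge d\tau$. Let $\mathcal S$ be the algebra of operators $(a_{kl})$ on $l^2(\mathbb Z)$ with $\sup_{k,l}|a_{kl}|(1+|k-l|)^L<\infty$ for all $L$, and let $C^\infty(S_q,\mathcal S)^{\mathbb Z}$ be the algebra of smooth $\mathcal S$-valued functions with $a_{kl}\circ\partial g=a_{k+1,l+1}$, where $\partial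 g$ acts trivially on $\mathbb R^q$. Let $\mathrm{Td}$ be a $g$-invariant closed differential form on $M$ that represents the Todd class of the complexified cotangent bundle $T^*_{\mathbb C}M$. For an invertible matrix $a$ over $C^\infty(S_q,\mathcal S)^{\mathbb Z}$ the topological index is $$\operatorname{ind}_t a=\sum_{j\ge1}\frac{(j-1)!}{(2\pi i)^j(2j-1)!}\int_{S_q}\Big(\operatorname{tr}\,(a^{-1}da)^{2j-1}\Big)_{00}\,\mathrm{Td},$$ where $\operatorname{tr}$ is the matrix trace and the subscript $00$ denotes the matrix coefficient of index $(0,0)$ in $l^2(\mathbb Z)$. Then $\sigma(D)$ is invertible in $C^\infty(S^*M,\mathcal S)^{\mathbb Z}$, $\sigma(\widetilde D\#A)$ is an invertible $2\times2$ matrix over $C^\infty(S(T^*M\times\mathbb R^2),\mathcal S)^{\mathbb Z}$, and $$\operatorname{ind}_t\sigma(D)=\operatorname{ind}_t\sigma(\widetilde D\#A).$$ -/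

import Mathlib

open scoped Manifold ContDiff TensorProduct ComplexConjugate
open MeasureTheory

noncomputable section

namespace ShiftIndex

/-! ## Charts, partition of unity, Riemannian data -/

/-- The model space of an `n`-dimensional manifold. -/
abbrev Model (n : ℕ) := EuclideanSpace ℝ (Fin n)

/-- Smooth Riemannian metrics on `M`. -/
abbrev Metric (n : ℕ) (M : Type*) [TopologicalSpace M] [ChartedSpace (Model n) M]
    [IsManifold (𝓡 n) ∞ M] :=
  Bundle.ContMDiffRiemannianMetric (𝓡 n) ∞ (Model n) (fun x : M => TangentSpace (𝓡 n) x)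

section Basic

variable {n : ℕ} {M : Type*} [TopologicalSpace M] [ChartedSpace (Model n) M]

/-- The coordinate domain of the chart centred at `c`. -/
def chartDomain (c : M) : Set (Model n) := (extChartAt (𝓡 n) c).target

/-- The point of `M` with coordinates `y` in the chart centred at `c`. -/
def chartPoint (c : M) (y : Model n) : M := (extChartAt (𝓡 n) c).symm y

/-- The differential at `y` of the inverse of the chart centred at `c`. -/
def chartTangent (c : M) (y : Model n) : Model n →L[ℝ] TangentSpace (𝓡 n) (chartPoint c y) :=
  mfderiv 𝓘(ℝ, Model n) (𝓡 n) (extChartAt (𝓡 n) c).symm y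

/-- The coordinate vector field `∂/∂yᵢ` of the chart centred at `c`. -/
def chartVector (c : M) (y : Model n) (i : Fin n) : TangentSpace (𝓡 n) (chartPoint c y) :=
  chartTangent c y (EuclideanSpace.single i 1)

/-- The covector `∑ᵢ ηᵢ dyᵢ` in the chart centred at `c`. -/
def chartCovector (c : M) (y : Model n) (η : Fin n → ℝ) :
    TangentSpace (𝓡 n) (chartPoint c y) →L[ℝ] ℝ :=
  (innerSL ℝ (WithLp.toLp 2 η : Model n)).comp
    (mfderiv (𝓡 n) 𝓘(ℝ, Model n) (extChartAt (𝓡 n) c) (chartPoint c y))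

/-- A smooth partition of unity on `M` subordinate to the chart domains. -/
def chartPartition (n : ℕ) (M : Type*) [TopologicalSpace M] [ChartedSpace (Model n) M]
    [IsManifold (𝓡 n) ∞ M] [CompactSpace M] [T2Space M] :
    SmoothPartitionOfUnity M (𝓡 n) M Set.univ :=
  (SmoothPartitionOfUnity.exists_isSubordinate_chartAt_source (𝓡 n) M).choose

variable [IsManifold (𝓡 n) ∞ M]

/-- The coefficients `hᵢⱼ` of the metric in the chart centred at `c`. -/
def gram (h : Metric n M) (c : M) (y : Model n) : Matrix (Fin n) (Fin n) ℝ :=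
  Matrix.of fun i j => h.inner (chartPoint c y) (chartVector c y i) (chartVector c y j)

/-- The integral of a function on `M` against the Riemannian volume. -/
def riemannIntegral [CompactSpace M] [T2Space M] (h : Metric n M) (f : M → ℂ) : ℂ :=
  ∑ᶠ c : M, ∫ y in chartDomain c,
    ((chartPartition n M c (chartPoint c y) * Real.sqrt (gram h c y).det : ℝ) : ℂ)
      * f (chartPoint c y)

/-- The square `∑ hⁱʲ ξᵢ ξⱼ` of the length of a covector; the components are taken in the standard
basis of the tangent space `TangentSpace (𝓡 n) x = EuclideanSpace ℝ (Fin n)` (the result does not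
depend on the basis). -/
def covectorNormSq (h : Metric n M) (x : M) (ξ : TangentSpace (𝓡 n) x →L[ℝ] ℝ) : ℝ :=
  let e : Fin n → TangentSpace (𝓡 n) x := fun i => (EuclideanSpace.single i 1 : Model n)
  (fun i => ξ (e i)) ⬝ᵥ
    ((Matrix.of fun i j => h.inner x (e i) (e j))⁻¹.mulVec fun i => ξ (e i))

/-- The radius `(|ξ|² + |w|²)^(1/2)` of a point `(x, ξ, w)` of `T*M × ℝ^q`. -/
def radius {q : ℕ} (h : Metric n M) (x : M) (ξ : TangentSpace (𝓡 n) x →L[ℝ] ℝ)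
    (w : Fin q → ℝ) : ℝ :=
  Real.sqrt (covectorNormSq h x ξ + ∑ j, w j ^ 2)

/-- The diffeomorphism `g` preserves the metric `h`. -/
def IsIsometry (h : Metric n M) (g : M ≃ₘ^∞⟮𝓡 n, 𝓡 n⟯ M) : Prop :=
  ∀ (x : M) (v w : TangentSpace (𝓡 n) x),
    h.inner (g x) (mfderiv (𝓡 n) (𝓡 n) g x v) (mfderiv (𝓡 n) (𝓡 n) g x w) = h.inner x v w

/-- The iterate `g^m`, `m ∈ ℤ`. -/
def iter (g : M ≃ₘ^∞⟮𝓡 n, 𝓡 n⟯ M) (m : ℤ) : M → M := ⇑(g.toEquiv ^ m : Equiv.Perm M)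

/-- The covector component of the codifferential
`∂g^m (x, ξ) = (g^m x, (ᵗd(g^m))⁻¹ ξ)`, a covector at `g^m x`. -/
def codiff (g : M ≃ₘ^∞⟮𝓡 n, 𝓡 n⟯ M) (m : ℤ) (x : M) (ξ : TangentSpace (𝓡 n) x →L[ℝ] ℝ) :
    TangentSpace (𝓡 n) (iter g m x) →L[ℝ] ℝ :=
  ξ.comp (mfderiv (𝓡 n) (𝓡 n) (iter g m) x).inverse

end Basic

/-! ## Operators on `l²(ℤ)` -/

/-- The space `l²(ℤ)`. -/
abbrev L2Z := lp (fun _ : ℤ => ℂ) 2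

/-- Bounded operators on `l²(ℤ)`. -/
abbrev BoundedOp := L2Z →L[ℂ] L2Z

/-- The matrix coefficient `a_{kl}` of a bounded operator on `l²(ℤ)`. -/
def coeff (A : BoundedOp) (k l : ℤ) : ℂ := (A (lp.single 2 l (1 : ℂ)) : ℤ → ℂ) k

open Classical in
/-- The bounded operator `∑_{k ∈ K} s_k 𝒯^k` on `l²(ℤ)`, where `𝒯 u (m) = u (m + 1)` and `s_k` acts
as multiplication by the sequence `m ↦ s k m`
(and `0` if these formulas do not define a bounded operator). -/
def shiftSum (K : Finset ℤ) (s : ℤ → ℤ → ℂ) : BoundedOp :=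
  if hA : ∃ A : BoundedOp, ∀ (u : L2Z) (m : ℤ),
      (A u : ℤ → ℂ) m = ∑ k ∈ K, s k m * (u : ℤ → ℂ) (m + k)
  then hA.choose else 0

/-! ## Differential operators and operators with shifts -/

section Operators

variable (n : ℕ) (M : Type*) [TopologicalSpace M] [ChartedSpace (Model n) M]
  [IsManifold (𝓡 n) ∞ M]

/-- A differential operator of order one on `M` with smooth complex coefficients:
`u ↦ du (X + iY) + c u` with smooth real vector fields `X`, `Y` and a smooth function `c`. -/
structure DiffOp where
  X : ∀ x : M, TangentSpace (𝓡 n) x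
  Y : ∀ x : M, TangentSpace (𝓡 n) x
  c : M → ℂ
  smooth_X : ContMDiff (𝓡 n) (𝓡 n).tangent ∞ (fun x => (⟨x, X x⟩ : TangentBundle (𝓡 n) M))
  smooth_Y : ContMDiff (𝓡 n) (𝓡 n).tangent ∞ (fun x => (⟨x, Y x⟩ : TangentBundle (𝓡 n) M))
  smooth_c : ContMDiff (𝓡 n) 𝓘(ℝ, ℂ) ∞ c

/-- A differential operator in the variables `x ∈ M`, `t ∈ ℝ` with coefficients smooth in `x` and
polynomial in `t`, of order one (`∂/∂x`, `∂/∂t` and multiplication by `t` all have order one):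
`u ↦ du (X + iY) + c u + a ∂u/∂t + b t u`. -/
structure CylDiffOp extends DiffOp n M where
  a : M → ℂ
  b : M → ℂ
  smooth_a : ContMDiff (𝓡 n) 𝓘(ℝ, ℂ) ∞ a
  smooth_b : ContMDiff (𝓡 n) 𝓘(ℝ, ℂ) ∞ b

/-- An operator with shifts `∑_{k ∈ supp} D_k T^k` on `M`. -/
structure ShiftOp where
  supp : Finset ℤ
  op : ℤ → DiffOp n M

/-- A two by two matrix operator `∑_{k ∈ supp} B_k T̃^k` on `M × ℝ`. -/
structure CylShiftOp where
  supp : Finset ℤ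
  op : ℤ → Matrix (Fin 2) (Fin 2) (CylDiffOp n M)

end Operators

section OperatorsAction

variable {n : ℕ} {M : Type*} [TopologicalSpace M] [ChartedSpace (Model n) M]
  [IsManifold (𝓡 n) ∞ M]

/-- The action on functions. -/
def DiffOp.apply (P : DiffOp n M) (u : M → ℂ) (x : M) : ℂ :=
  let du : TangentSpace (𝓡 n) x →L[ℝ] ℂ := mfderiv (𝓡 n) 𝓘(ℝ, ℂ) u x
  du (P.X x) + Complex.I * du (P.Y x) + P.c x * u x

/-- The principal symbol; `∂/∂xⱼ` has the symbol `i ξⱼ`. -/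
def DiffOp.symbol (P : DiffOp n M) (x : M) (ξ : TangentSpace (𝓡 n) x →L[ℝ] ℝ) : ℂ :=
  Complex.I * ((ξ (P.X x) : ℂ) + Complex.I * (ξ (P.Y x) : ℂ))

/-- The action on functions on `M × ℝ`. -/
def CylDiffOp.apply (P : CylDiffOp n M) (u : M × ℝ → ℂ) (p : M × ℝ) : ℂ :=
  P.toDiffOp.apply (fun x => u (x, p.2)) p.1 + P.a p.1 * deriv (fun t => u (p.1, t)) p.2
    + P.b p.1 * (p.2 : ℂ) * u p

/-- The principal symbol at `(x, ξ, t, τ)`, where `w = (t, τ)`;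
`∂/∂t` has the symbol `i τ` and multiplication by `t` has the symbol `t`. -/
def CylDiffOp.symbol (P : CylDiffOp n M) (x : M) (ξ : TangentSpace (𝓡 n) x →L[ℝ] ℝ)
    (w : Fin 2 → ℝ) : ℂ :=
  P.toDiffOp.symbol x ξ + P.a x * (Complex.I * (w 1 : ℂ)) + P.b x * (w 0 : ℂ)

/-- `T̃^k u (x, t) = u (g^k x, t + k)`. -/
def cylShift (g : M ≃ₘ^∞⟮𝓡 n, 𝓡 n⟯ M) (k : ℤ) (u : M × ℝ → ℂ) (p : M × ℝ) : ℂ :=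
  u (iter g k p.1, p.2 + k)

/-- The operator `D = ∑ D_k T^k` on `M`, `T u (x) = u (g x)`. -/
def ShiftOp.apply (g : M ≃ₘ^∞⟮𝓡 n, 𝓡 n⟯ M) (D : ShiftOp n M) (u : M → ℂ) (x : M) : ℂ :=
  ∑ k ∈ D.supp, (D.op k).apply (fun y => u (iter g k y)) x

/-- The operator `D̃ = ∑ D_k T̃^k` on `M × ℝ`. -/
def ShiftOp.cylApply (g : M ≃ₘ^∞⟮𝓡 n, 𝓡 n⟯ M) (D : ShiftOp n M) (u : M × ℝ → ℂ)
    (p : M × ℝ) : ℂ :=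
  ∑ k ∈ D.supp, (D.op k).apply (fun y => cylShift g k u (y, p.2)) p.1

/-- The entry `(a, b)` of the matrix operator `∑ B_k T̃^k`, acting on functions on `M × ℝ`. -/
def CylShiftOp.apply (g : M ≃ₘ^∞⟮𝓡 n, 𝓡 n⟯ M) (B : CylShiftOp n M) (a b : Fin 2)
    (u : M × ℝ → ℂ) (p : M × ℝ) : ℂ :=
  ∑ k ∈ B.supp, (B.op k a b).apply (cylShift g k u) p

/-- The operator `A = ∂/∂t + t`. -/
def opA (u : M × ℝ → ℂ) (p : M × ℝ) : ℂ :=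
  deriv (fun t => u (p.1, t)) p.2 + (p.2 : ℂ) * u p

/-- The symbol `σ(D)(x, ξ) = ∑_k σ(D_k)(∂g^m(x, ξ)) 𝒯^k` on `l²(ℤ)`. -/
def ShiftOp.symbol (g : M ≃ₘ^∞⟮𝓡 n, 𝓡 n⟯ M) (D : ShiftOp n M) (x : M)
    (ξ : TangentSpace (𝓡 n) x →L[ℝ] ℝ) : BoundedOp :=
  shiftSum D.supp fun k m => (D.op k).symbol (iter g m x) (codiff g m x ξ)

/-- `D` is elliptic: `σ(D)(x, ξ)` is invertible for all `x` and `ξ ≠ 0`. -/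
def ShiftOp.IsElliptic (g : M ≃ₘ^∞⟮𝓡 n, 𝓡 n⟯ M) (D : ShiftOp n M) : Prop :=
  ∀ (x : M) (ξ : TangentSpace (𝓡 n) x →L[ℝ] ℝ), ξ ≠ 0 → IsUnit (D.symbol g x ξ)

/-- Functions on `T*M × ℝ^q` with values in `N × N` matrices of bounded operators on `l²(ℤ)`. -/
abbrev OpFunction (n : ℕ) (M : Type*) [TopologicalSpace M] [ChartedSpace (Model n) M]
    (q N : ℕ) :=
  ∀ x : M, (TangentSpace (𝓡 n) x →L[ℝ] ℝ) → (Fin q → ℝ) → Matrix (Fin N) (Fin N) BoundedOp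

/-- `σ(D)` as a function on `T*M × ℝ⁰`. -/
def ShiftOp.symbolFun (g : M ≃ₘ^∞⟮𝓡 n, 𝓡 n⟯ M) (D : ShiftOp n M) : OpFunction n M 0 1 :=
  fun x ξ _ => Matrix.of fun _ _ => D.symbol g x ξ

/-- The symbol `σ(B) = ∑_k σ(B_k)(∂g^m(x, ξ), t, τ) 𝒯^k` of `B = ∑_k B_k T̃^k`, a function on
`T*M × ℝ²`, where `w = (t, τ)`; the action of `g` is trivial along `t`, `τ`. -/
def CylShiftOp.symbolFun (g : M ≃ₘ^∞⟮𝓡 n, 𝓡 n⟯ M) (B : CylShiftOp n M) : OpFunction n M 2 2 :=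
  fun x ξ w => Matrix.of fun a b =>
    shiftSum B.supp fun k m => (B.op k a b).symbol (iter g m x) (codiff g m x ξ) w

variable [CompactSpace M] [T2Space M]

/-- The inner product of `L²(M × ℝ)`. -/
def cylInner (h : Metric n M) (u v : M × ℝ → ℂ) : ℂ :=
  ∫ t : ℝ, riemannIntegral h fun x => u (x, t) * conj (v (x, t))

/-- `Q` is the formal adjoint of `P` with respect to the inner product of `L²(M × ℝ)`. -/
def IsFormalAdjoint (h : Metric n M) (P Q : (M × ℝ → ℂ) → M × ℝ → ℂ) : Prop :=
  ∀ u v : M × ℝ → ℂ,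
    ContMDiff ((𝓡 n).prod 𝓘(ℝ, ℝ)) 𝓘(ℝ, ℂ) ∞ u → HasCompactSupport u →
    ContMDiff ((𝓡 n).prod 𝓘(ℝ, ℝ)) 𝓘(ℝ, ℂ) ∞ v → HasCompactSupport v →
    cylInner h (P u) v = cylInner h u (Q v)

/-- The matrix operator `B = ∑ B_k T̃^k` on `M × ℝ` is the external product
`D̃ # A = ((D̃, A), (-A*, D̃*))`. -/
structure IsExternalProduct (h : Metric n M) (g : M ≃ₘ^∞⟮𝓡 n, 𝓡 n⟯ M) (D : ShiftOp n M)
    (B : CylShiftOp n M) : Prop where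
  entry00 : ∀ u : M × ℝ → ℂ, ContMDiff ((𝓡 n).prod 𝓘(ℝ, ℝ)) 𝓘(ℝ, ℂ) ∞ u →
    B.apply g 0 0 u = D.cylApply g u
  entry01 : ∀ u : M × ℝ → ℂ, ContMDiff ((𝓡 n).prod 𝓘(ℝ, ℝ)) 𝓘(ℝ, ℂ) ∞ u →
    B.apply g 0 1 u = opA u
  entry10 : IsFormalAdjoint h opA fun v => -B.apply g 1 0 v
  entry11 : IsFormalAdjoint h (D.cylApply g) (B.apply g 1 1)

end OperatorsAction

/-! ## Coordinates on `T*M × ℝ^q` and the algebra of symbols -/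

section Symbols

variable {n q N : ℕ}

/-- The base coordinates `yᵢ = z_{2i}` of `z ∈ ℝ^{2n+q}`. -/
def baseCoord (z : Fin (2 * n + q) → ℝ) : Model n :=
  WithLp.toLp 2 fun i => z ⟨2 * i, by omega⟩

/-- The covector components `ηᵢ = z_{2i+1}`. -/
def fibreCoord (z : Fin (2 * n + q) → ℝ) : Fin n → ℝ := fun i => z ⟨2 * i + 1, by omega⟩

/-- The coordinates `wⱼ = z_{2n+j}` in `ℝ^q`. -/
def extraCoord (z : Fin (2 * n + q) → ℝ) : Fin q → ℝ := fun j => z (Fin.natAdd (2 * n) j)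

variable {M : Type*} [TopologicalSpace M] [ChartedSpace (Model n) M] [IsManifold (𝓡 n) ∞ M]

/-- The restriction of `a` to the sphere bundle `S(T*M × ℝ^q)`, extended to the complement of the
zero section as a homogeneous function of degree zero. -/
def homExt (h : Metric n M) (a : OpFunction n M q N) : OpFunction n M q N :=
  fun x ξ w => a x ((radius h x ξ w)⁻¹ • ξ) ((radius h x ξ w)⁻¹ • w)

/-- The function `homExt h a` in the chart centred at `c`. -/
def inChart (h : Metric n M) (a : OpFunction n M q N) (c : M) (z : Fin (2 * n + q) → ℝ) :
    Matrix (Fin N) (Fin N) BoundedOp :=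
  homExt h a (chartPoint c (baseCoord z)) (chartCovector c (baseCoord z) (fibreCoord z))
    (extraCoord z)

/-- The coordinate domain over the chart centred at `c`, without the zero section. -/
def coneDomain (q : ℕ) (c : M) : Set (Fin (2 * n + q) → ℝ) :=
  {z | baseCoord z ∈ chartDomain c ∧ (fibreCoord z ≠ 0 ∨ extraCoord z ≠ 0)}

/-- Membership in the algebra `C^∞(S(T*M × ℝ^q), 𝒮)^ℤ` (with `N × N` matrix coefficients):
the matrix coefficients are smooth, all their derivatives satisfy the estimates of the seminorms
`sup_{kl} |a_{kl}| (1 + |k - l|)^L` of `𝒮` locally uniformly, and the function is invariant: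
`a_{kl}(∂g^m p) = a_{k+m,l+m}(p)`. -/
structure IsSymbol (h : Metric n M) (g : M ≃ₘ^∞⟮𝓡 n, 𝓡 n⟯ M) (a : OpFunction n M q N) :
    Prop where
  smooth : ∀ (c : M) (i j : Fin N) (k l : ℤ),
    ContDiffOn ℝ ∞ (fun z => coeff (inChart h a c z i j) k l) (coneDomain q c)
  decay : ∀ (c : M) (i j : Fin N) (K : Set (Fin (2 * n + q) → ℝ)), IsCompact K →
    K ⊆ coneDomain q c → ∀ r L : ℕ, ∃ C : ℝ, ∀ z ∈ K, ∀ k l : ℤ,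
      ‖iteratedFDeriv ℝ r (fun z => coeff (inChart h a c z i j) k l) z‖
        * (1 + |((k - l : ℤ) : ℝ)|) ^ L ≤ C
  invariant : ∀ (x : M) (ξ : TangentSpace (𝓡 n) x →L[ℝ] ℝ) (w : Fin q → ℝ), (ξ ≠ 0 ∨ w ≠ 0) →
    ∀ (i j : Fin N) (m k l : ℤ),
      coeff (homExt h a (iter g m x) (codiff g m x ξ) w i j) k l
        = coeff (homExt h a x ξ w i j) (k + m) (l + m)

/-- `a` is an invertible `N × N` matrix over the algebra `C^∞(S(T*M × ℝ^q), 𝒮)^ℤ`. -/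
def IsInvertibleSymbol (h : Metric n M) (g : M ≃ₘ^∞⟮𝓡 n, 𝓡 n⟯ M) (a : OpFunction n M q N) :
    Prop :=
  IsSymbol h g a ∧ ∃ b : OpFunction n M q N, IsSymbol h g b ∧
    ∀ (x : M) (ξ : TangentSpace (𝓡 n) x →L[ℝ] ℝ) (w : Fin q → ℝ), radius h x ξ w = 1 →
      a x ξ w * b x ξ w = 1 ∧ b x ξ w * a x ξ w = 1

end Symbols

/-! ## Differential forms -/

/-- Exterior forms in `d` coordinates with complex coefficients. -/
abbrev Forms (d : ℕ) := ExteriorAlgebra ℂ (Fin d → ℂ)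

/-- The form `dzᵢ`. -/
def dz {d : ℕ} (i : Fin d) : Forms d := ExteriorAlgebra.ι ℂ (Pi.single i 1)

/-- The coefficient of `dz₀ ∧ dz₁ ∧ ⋯ ∧ dz_{d-1}`. -/
def topCoeff (d : ℕ) : Forms d →ₗ[ℂ] ℂ :=
  ExteriorAlgebra.liftAlternating
    (Pi.single d (Matrix.detRowAlternating : (Fin d → ℂ) [⋀^Fin d]→ₗ[ℂ] ℂ))

/-- The alternating form `φ` on `ℝⁿ` written as
`∑_{s₁ < ⋯ < s_k} φ(e_{s₁}, …, e_{s_k}) dy_{s₁} ∧ ⋯ ∧ dy_{s_k}`, the given forms being put in place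
of the `dyᵢ`. -/
def expand {n d k : ℕ} (dy : Fin n → Forms d) (φ : Model n [⋀^Fin k]→L[ℝ] ℂ) : Forms d :=
  ((k.factorial : ℂ))⁻¹ • ∑ s : Fin k → Fin n,
    φ (fun i => EuclideanSpace.single (s i) 1) • (List.ofFn fun i => dy (s i)).prod

section TotalForms

variable {n : ℕ} {M : Type*} [TopologicalSpace M] [ChartedSpace (Model n) M]

/-- Complex differential forms on `M` of mixed degree; the `k`-th term is the component of
degree `k`. -/
abbrev TotalForm (n : ℕ) (M : Type*) [TopologicalSpace M] [ChartedSpace (Model n) M] :=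
  ∀ (k : ℕ) (x : M), TangentSpace (𝓡 n) x [⋀^Fin k]→L[ℝ] ℂ

/-- The degree `k` component of the form in the chart centred at `c`. -/
def TotalForm.local (T : TotalForm n M) (k : ℕ) (c : M) (y : Model n) :
    Model n [⋀^Fin k]→L[ℝ] ℂ :=
  (T k (chartPoint c y)).compContinuousLinearMap (chartTangent c y)

/-- The form is smooth. -/
def TotalForm.IsSmooth (T : TotalForm n M) : Prop :=
  ∀ (k : ℕ) (c : M), ContDiffOn ℝ ∞ (T.local k c) (chartDomain c)

/-- The form is closed. -/
def TotalForm.IsClosed (T : TotalForm n M) : Prop :=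
  ∀ (k : ℕ) (c : M), ∀ y ∈ chartDomain c, extDeriv (T.local k c) y = 0

/-- The form is invariant under `g`. -/
def TotalForm.IsInvariant (T : TotalForm n M) (g : M ≃ₘ^∞⟮𝓡 n, 𝓡 n⟯ M) : Prop :=
  ∀ (k : ℕ) (x : M),
    (T k (g x)).compContinuousLinearMap (mfderiv (𝓡 n) (𝓡 n) g x) = T k x

variable [IsManifold (𝓡 n) ∞ M]

/-- The Christoffel symbol `Γᵏᵢⱼ` of the Levi-Civita connection. -/
def christoffel (h : Metric n M) (c : M) (y : Model n) (k i j : Fin n) : ℝ :=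
  ∑ l, (1 / 2) * (gram h c y)⁻¹ k l *
    (fderiv ℝ (fun y => gram h c y j l) y (EuclideanSpace.single i 1)
      + fderiv ℝ (fun y => gram h c y i l) y (EuclideanSpace.single j 1)
      - fderiv ℝ (fun y => gram h c y i j) y (EuclideanSpace.single l 1))

/-- The connection forms `∑ᵢ Γᵏᵢₗ dyᵢ`. -/
def connectionForm (h : Metric n M) (c : M) (y : Model n) (k l : Fin n) : Forms n :=
  ∑ i, (christoffel h c y k i l : ℂ) • dz i

/-- The curvature forms `Ωᵏₗ = dΓᵏₗ + ∑ₘ Γᵏₘ ∧ Γᵐₗ` of the tangent bundle. -/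
def curvatureForm (h : Metric n M) (c : M) (y : Model n) (k l : Fin n) : Forms n :=
  ∑ i, ∑ j, ((fderiv ℝ (fun y => christoffel h c y k j l) y (EuclideanSpace.single i 1) : ℝ) : ℂ)
      • (dz i * dz j)
    + ∑ m, connectionForm h c y k m * connectionForm h c y m l

/-- The matrix `X = (i / 2π) Ω*`, where `Ω* = -ᵗΩ` is the curvature of the complexified cotangent
bundle. -/
def normalizedCurvature (h : Metric n M) (c : M) (y : Model n) :
    Matrix (Fin n) (Fin n) (Forms n) :=
  Matrix.of fun k l => (Complex.I / (2 * Real.pi)) • (-curvatureForm h c y l k)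

/-- The Chern–Weil form `det (X / (1 - e^{-X}))` of the Levi-Civita connection, which represents the
Todd class of the complexified cotangent bundle, in the chart centred at `c`. Here
`x / (1 - e^{-x}) = ∑ₘ B'ₘ xᵐ / m!`, and the series is finite because `Xᵐ = 0` for `2m > n`. -/
def toddForm (h : Metric n M) (c : M) (y : Model n) : Forms n :=
  let Y : Matrix (Fin n) (Fin n) (Forms n) := ∑ m ∈ Finset.range (n + 1),
    ((bernoulli' m / (m.factorial : ℚ) : ℚ) : ℂ) • normalizedCurvature h c y ^ m
  ∑ s : Equiv.Perm (Fin n), (Equiv.Perm.sign s : ℤ) • (List.ofFn fun i => Y (s i) i).prod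

/-- The closed form `T` represents the Todd class of the complexified cotangent bundle: it differs
from the Chern–Weil form by an exact form. -/
def TotalForm.RepresentsTodd (h : Metric n M) (T : TotalForm n M) : Prop :=
  T.IsSmooth ∧ T.IsClosed ∧ ∃ β : TotalForm n M, β.IsSmooth ∧
    ∀ (c : M), ∀ y ∈ chartDomain c,
      ∑ k ∈ Finset.range (n + 1), expand dz (T.local k c y)
        = toddForm h c y + ∑ k ∈ Finset.range (n + 1), expand dz (extDeriv (β.local k c) y)

end TotalForms

/-! ## The topological index -/

section Index

variable {n q N : ℕ} {M : Type*} [TopologicalSpace M] [ChartedSpace (Model n) M]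
  [IsManifold (𝓡 n) ∞ M]

/-- Exterior forms whose coefficients are `N × N` matrices of operators on `l²(ℤ)`. -/
abbrev OpForms (N d : ℕ) := Matrix (Fin N) (Fin N) BoundedOp ⊗[ℂ] Forms d

/-- The functional `a ↦ ∑ᵢ (aᵢᵢ)₀₀`. -/
def trace00 (N : ℕ) : Matrix (Fin N) (Fin N) BoundedOp →ₗ[ℂ] ℂ where
  toFun a := ∑ i, coeff (a i i) 0 0
  map_add' a b := by simp [coeff, Finset.sum_add_distrib]
  map_smul' r a := by simp [coeff, Finset.mul_sum]

/-- The functional `trace00` applied to the coefficients of a form. -/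
def formTrace (N d : ℕ) : OpForms N d →ₗ[ℂ] Forms d :=
  (TensorProduct.lid ℂ (Forms d)).toLinearMap ∘ₗ (trace00 N).rTensor (Forms d)

/-- The form `a⁻¹ da`. As `𝒮` is continuously embedded in the bounded operators, the derivative of a
smooth `𝒮`-valued function in the operator norm is the componentwise one. -/
def logDifferential (h : Metric n M) (a : OpFunction n M q N) (c : M) (z : Fin (2 * n + q) → ℝ) :
    OpForms N (2 * n + q) :=
  ∑ l, (Ring.inverse (inChart h a c z) *
    Matrix.of fun i j => fderiv ℝ (fun z => inChart h a c z i j) z (Pi.single l 1)) ⊗ₜ[ℂ] dz l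

/-- The pullback to `T*M × ℝ^q` of a form on `M`. -/
def pullback (q : ℕ) (T : TotalForm n M) (c : M) (z : Fin (2 * n + q) → ℝ) : Forms (2 * n + q) :=
  ∑ k ∈ Finset.range (n + 1),
    expand (fun i : Fin n => dz ⟨2 * i, by omega⟩) (T.local k c (baseCoord z))

/-- The radius function in the chart centred at `c`. -/
def chartRadius (h : Metric n M) (c : M) (z : Fin (2 * n + q) → ℝ) : ℝ :=
  radius h (chartPoint c (baseCoord z)) (chartCovector c (baseCoord z) (fibreCoord z))
    (extraCoord z)

/-- The differential of the radius function. -/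
def dRadius (h : Metric n M) (c : M) (z : Fin (2 * n + q) → ℝ) : Forms (2 * n + q) :=
  ∑ l, ((fderiv ℝ (chartRadius h c) z (Pi.single l 1) : ℝ) : ℂ) • dz l

/-- The integral over the sphere bundle `S(T*M × ℝ^q)` of a form `φ`, which is extended to the
complement of the zero section as a homogeneous form (that is, pulled back along
`p ↦ p / |p|`) and given in charts. By Fubini's theorem
`∫_{S} φ = ∫_{1 < r < 2} dr ∧ φ`. The orientation of `T*M × ℝ^q` is the one of
`dy₁ ∧ dη₁ ∧ ⋯ ∧ dyₙ ∧ dηₙ ∧ dw₁ ∧ ⋯ ∧ dw_q`, and the sphere bundle is oriented as the boundary of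
the ball bundle (outward normal first). -/
def sphereIntegral [CompactSpace M] [T2Space M] (h : Metric n M)
    (φ : M → (Fin (2 * n + q) → ℝ) → Forms (2 * n + q)) : ℂ :=
  ∑ᶠ c : M, ∫ z in {z : Fin (2 * n + q) → ℝ |
      baseCoord z ∈ chartDomain c ∧ 1 < chartRadius h c z ∧ chartRadius h c z < 2},
    (chartPartition n M c (chartPoint c (baseCoord z)) : ℂ)
      * topCoeff (2 * n + q) (dRadius h c z * φ c z)

/-- The constants `C_j = (j - 1)! / ((2πi)^j (2j - 1)!)`. -/
def indexConst (j : ℕ) : ℂ :=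
  ((j - 1).factorial : ℂ) / ((2 * Real.pi * Complex.I) ^ j * ((2 * j - 1).factorial : ℂ))

/-- The topological index
`ind_t a = ∑_j C_j ∫_{S(T*M × ℝ^q)} ((a⁻¹ da)^{2j-1})₀₀ ∧ T`, where `T` represents the Todd class.
The terms with `2j > 2n + q` vanish. -/
def topIndex [CompactSpace M] [T2Space M] (h : Metric n M) (T : TotalForm n M)
    (a : OpFunction n M q N) : ℂ :=
  ∑ j ∈ Finset.Icc 1 (n + q), indexConst j * sphereIntegral h fun c z =>
    formTrace N (2 * n + q) (logDifferential h a c z ^ (2 * j - 1)) * pullback q T c z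

end Index

end ShiftIndex

end

open scoped Manifold ContDiff TensorProduct ComplexConjugate Topology
open MeasureTheory Set Filter

noncomputable section

namespace ShiftIndex

set_option linter.unusedSectionVars false
set_option maxSynthPendingDepth 3

open ContinuousLinearMap (comp_apply det inverse_equiv comp_assoc adjoint_inner_left fst snd inr prodₗᵢ flipₗᵢ compL opNorm_le_bound proj)
open Finset (sum_congr sum_nonneg mul_sum sum_le_sum sum_mul smul_sum sum_add_distrib sum_comm sum_eq_zero sum_neg_distrib sum_eq_single sum_smul)
open Complex (exp ofRealCLM norm_I norm_real real_smul ofReal_one continuous_ofReal ofReal_sum ofReal_zero continuous_conj re_ofReal_mul ofReal_mul coe_smul I)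
open Matrix (of of_apply linftyOpNormedRing)
open EuclideanSpace (single basisFun)
open LinearMap (toMatrix det_toMatrix mk₂ rTensor_tmul)
open Algebra.TensorProduct (tmul_mul_tmul map_tmul)
open Ring (mul_inverse_cancel inverse_mul_cancel)
open Pi (single_apply)
open ExteriorAlgebra (ιMulti map_apply_ι lhom_ext ι_add_mul_swap map_comp_map ι_sq_zero ιMulti_apply ι)
open TensorProduct (induction_on)
open Function (Injective ne_iff uncurry)
open BoundedContinuousFunction (norm_le)
open ContinuousAlternatingMap (alternatizeUncurryFin)
open Real (sqrt cos sin)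
open Metric (ball mem_ball_self sphere)
open Bundle.Trivialization (coe_linearMapAt_of_mem)
open WithLp (toLp)
open Subsingleton (elim)
open Fin (last natAdd)

/-- Diffeomorphisms of a manifold. -/
abbrev Diffeo (n : ℕ) (M : Type*) [TopologicalSpace M] [ChartedSpace (Model n) M] := M ≃ₘ^∞⟮𝓡 n, 𝓡 n⟯ M

/-- The coordinates on a chart of `T*M × ℝ^q`. -/
abbrev Coord (n q : ℕ) := Fin (2 * n + q) → ℝ

/-- Square matrices of bounded operators on `ℓ²(ℤ)`. -/
abbrev OpMatrix (N : ℕ) := Matrix (Fin N) (Fin N) BoundedOp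

/-- Endomorphisms of the model space. -/
abbrev ModelEnd (n : ℕ) := Model n →L[ℝ] Model n

/-- Covectors on the model space. -/
abbrev Covec (n : ℕ) := Model n →L[ℝ] ℝ

/-- Bilinear forms on the model space. -/
abbrev Bilin (n : ℕ) := Model n →L[ℝ] Covec n

/-- Smoothness of a vector field. -/
abbrev SmoothField {n : ℕ} {M : Type*} [TopologicalSpace M] [ChartedSpace (Model n) M]
    [IsManifold (𝓡 n) ∞ M] (X : ∀ x : M, TangentSpace (𝓡 n) x) : Prop :=
  ContMDiff (𝓡 n) (𝓡 n).tangent ∞ fun x => (⟨x, X x⟩ : TangentBundle (𝓡 n) M)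

section
variable {E F : Type*} [NormedAddCommGroup E] [NormedSpace ℝ E] [NormedAddCommGroup F] [NormedSpace ℝ F]
  {f : E → F} {Ω : Set E}

theorem _root_.ContDiffOn.diffAt {z : E} (hf : ContDiffOn ℝ ∞ f Ω) (hΩ : IsOpen Ω) (hz : z ∈ Ω) :
    DifferentiableAt ℝ f z :=
  (hf.contDiffAt (hΩ.mem_nhds hz)).differentiableAt (by simp)

theorem _root_.ContDiffOn.fderivOn (hf : ContDiffOn ℝ ∞ f Ω) (hΩ : IsOpen Ω) :
    ContDiffOn ℝ ∞ (fderiv ℝ f) Ω :=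
  ((contDiffOn_infty_iff_fderiv_of_isOpen hΩ).1 hf).2

end

local notation "SmoothOn" => ContDiffOn ℝ ∞
local notation "SmoothFn[" n "]" => ContMDiff (𝓡 n) 𝓘(ℝ, ℂ) ∞

variable {n q N : ℕ} {M : Type*} [TopologicalSpace M] [ChartedSpace (Model n) M]
  [IsManifold (𝓡 n) ∞ M] {g : Diffeo n M} {h : Metric n M} {c c' : M} {m : ℤ} {y : Model n}
  {z : Coord n q} {T : TotalForm n M} {D : ShiftOp n M} {X : ∀ x : M, TangentSpace (𝓡 n) x}
  {f : M → ℂ} {κ : ℝ → ℝ}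

section Charts

theorem isOpen_chartDomain (c : M) : IsOpen (chartDomain (n := n) c) := isOpen_extChartAt_target c

theorem chartPoint_mem (hy : y ∈ chartDomain c) :
    chartPoint c y ∈ (chartAt (Model n) c).source := by
  have := (extChartAt (𝓡 n) c).map_target hy
  rwa [extChartAt_source] at this

theorem extChartAt_chartPoint (hy : y ∈ chartDomain c) : extChartAt (𝓡 n) c (chartPoint c y) = y :=
  (extChartAt (𝓡 n) c).right_inv hy

theorem chartPoint_extChartAt {x : M} (hx : x ∈ (chartAt (Model n) c).source) :
    chartPoint (n := n) c (extChartAt (𝓡 n) c x) = x :=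
  (extChartAt (𝓡 n) c).left_inv (by rwa [extChartAt_source])

theorem extChartAt_mem_chartDomain {x : M} (hx : x ∈ (chartAt (Model n) c).source) :
    extChartAt (𝓡 n) c x ∈ chartDomain (n := n) c :=
  (extChartAt (𝓡 n) c).map_source (by rwa [extChartAt_source])

theorem continuousOn_chartPoint (c : M) : ContinuousOn (chartPoint (n := n) c) (chartDomain c) :=
  continuousOn_extChartAt_symm c

def chartDiff (c x : M) : ModelEnd n := mfderiv (𝓡 n) 𝓘(ℝ, Model n) (extChartAt (𝓡 n) c) x

def iterDiff (g : Diffeo n M) (m : ℤ) (x : M) : ModelEnd n := mfderiv (𝓡 n) (𝓡 n) (iter g m) x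

/-- The differential of an inverse chart, as an endomorphism of the model space. -/
def chartTan (c : M) (y : Model n) : ModelEnd n := chartTangent c y

theorem iter_zero (g : Diffeo n M) : iter g 0 = id := by
  ext x; simp [iter]

theorem iter_one (g : Diffeo n M) : iter g 1 = g := by
  ext x; simp [iter]

theorem iter_add (g : Diffeo n M) (m k : ℤ) (x : M) : iter g (m + k) x = iter g m (iter g k x) := by
  simp [iter, zpow_add, Equiv.Perm.mul_apply]

theorem iter_neg_iter (g : Diffeo n M) (m : ℤ) (x : M) : iter g (-m) (iter g m x) = x := by
  rw [← iter_add]; simp [iter_zero]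

theorem iter_iter_neg (g : Diffeo n M) (m : ℤ) (x : M) : iter g m (iter g (-m) x) = x := by
  rw [← iter_add]; simp [iter_zero]

theorem iter_neg_one (g : Diffeo n M) : iter g (-1) = g.symm := by
  ext x
  apply g.injective
  have : iter g 1 (iter g (-1) x) = x := iter_iter_neg g 1 x
  rw [iter_one] at this
  exact this.trans (g.apply_symm_apply x).symm

theorem contMDiff_iter (g : Diffeo n M) (m : ℤ) : ContMDiff (𝓡 n) (𝓡 n) ∞ (iter g m) := by
  induction m using Int.induction_on with
  | zero => rw [iter_zero]; exact contMDiff_id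
  | succ i hi =>
    have : iter g (i + 1) = iter g i ∘ g := by
      ext x; rw [iter_add, iter_one]; rfl
    rw [this]; exact hi.comp g.contMDiff
  | pred i hi =>
    have : iter g (-i - 1) = iter g (-i) ∘ g.symm := by
      ext x; rw [sub_eq_add_neg, iter_add, iter_neg_one]; rfl
    rw [this]; exact hi.comp g.symm.contMDiff

theorem iterDiff_zero (g : Diffeo n M) (x : M) : iterDiff g 0 x = .id ℝ _ := by
  unfold iterDiff
  rw [iter_zero]
  exact mfderiv_id

theorem iterDiff_add (g : Diffeo n M) (m k : ℤ) (x : M) :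
    iterDiff g (m + k) x = (iterDiff g m (iter g k x)).comp (iterDiff g k x) := by
  have h : iter g (m + k) = iter g m ∘ iter g k := by
    ext x; exact iter_add g m k x
  unfold iterDiff
  rw [h]
  exact mfderiv_comp x ((contMDiff_iter g m).mdifferentiable (by simp) _)
    ((contMDiff_iter g k).mdifferentiable (by simp) _)

theorem iterDiff_neg_comp (g : Diffeo n M) (m : ℤ) (x : M) :
    (iterDiff g (-m) (iter g m x)).comp (iterDiff g m x) = .id ℝ _ := by
  rw [← iterDiff_add, neg_add_cancel, iterDiff_zero]

theorem iterDiff_comp_neg (g : Diffeo n M) (m : ℤ) (x : M) :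
    (iterDiff g m x).comp (iterDiff g (-m) (iter g m x)) = .id ℝ _ := by
  have := iterDiff_neg_comp g (-m) (iter g m x)
  rwa [neg_neg, iter_neg_iter] at this

theorem iterDiff_inverse (g : Diffeo n M) (m : ℤ) (x : M) :
    (iterDiff g m x).inverse = iterDiff g (-m) (iter g m x) :=
  ContinuousLinearMap.inverse_eq (iterDiff_comp_neg g m x) (iterDiff_neg_comp g m x)

theorem codiff_eq (g : Diffeo n M) (m : ℤ) (x : M) (ξ : Covec n) :
    codiff g m x ξ = ξ.comp (iterDiff g (-m) (iter g m x)) := by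
  rw [← iterDiff_inverse]; rfl

theorem contMDiffOn_chartPoint (c : M) :
    ContMDiffOn 𝓘(ℝ, Model n) (𝓡 n) ∞ (chartPoint (n := n) c) (chartDomain c) :=
  contMDiffOn_extChartAt_symm c

theorem isManifold_one : IsManifold (𝓡 n) 1 M := IsManifold.of_le (n := ∞) (by simp)

theorem chartDiff_comp_chartTan (hy : y ∈ chartDomain c) :
    (chartDiff c (chartPoint c y)).comp (chartTan c y) = .id ℝ _ := by
  have : IsManifold (𝓡 n) 1 M := isManifold_one
  have := mfderiv_extChartAt_comp_mfderivWithin_extChartAt_symm (I := 𝓡 n) hy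
  simp at this
  exact this

theorem chartTan_comp_chartDiff (hy : y ∈ chartDomain c) :
    (chartTan c y).comp (chartDiff c (chartPoint c y)) = .id ℝ _ := by
  have : IsManifold (𝓡 n) 1 M := isManifold_one
  have := mfderivWithin_extChartAt_symm_comp_mfderiv_extChartAt (I := 𝓡 n) hy
  simp at this
  exact this

def innerAt (h : Metric n M) (x : M) : Bilin n := h.inner x

theorem innerAt_symm (h : Metric n M) (x : M) (v w : Model n) :
    innerAt h x v w = innerAt h x w v := h.symm x v w

theorem innerAt_pos (h : Metric n M) (x : M) {v : Model n} (hv : v ≠ 0) :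
    0 < innerAt h x v v := h.pos x v hv

/-- The metric in a chart, as a bilinear form. -/
def metricForm (h : Metric n M) (c : M) (y : Model n) : Bilin n :=
  (innerAt h (chartPoint c y)).bilinearComp (chartTan c y) (chartTan c y)

theorem metricForm_apply (h : Metric n M) (c : M) (y u v : Model n) :
    metricForm h c y u v = innerAt h (chartPoint c y) (chartTan c y u) (chartTan c y v) := rfl

theorem chartTan_injective (hy : y ∈ chartDomain c) : Injective (chartTan c y) := by
  intro u v huv
  have := congrArg (chartDiff c (chartPoint c y)) huv
  simpa [← comp_apply, chartDiff_comp_chartTan hy] using this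

theorem metricForm_pos (h : Metric n M) (hy : y ∈ chartDomain c)
    {v : Model n} (hv : v ≠ 0) : 0 < metricForm h c y v v := by
  apply innerAt_pos
  intro h0
  exact hv (chartTan_injective hy (h0.trans (map_zero _).symm))

theorem metricForm_symm (h : Metric n M) (c : M) (y u v : Model n) :
    metricForm h c y u v = metricForm h c y v u := innerAt_symm ..

theorem gram_eq (h : Metric n M) (c : M) (y : Model n) (i j : Fin n) :
    gram h c y i j = metricForm h c y (single i 1) (single j 1) := rfl

theorem contMDiffOn_coordinateSection (c : M) (u : Model n) :
    ContMDiffOn (𝓡 n) (𝓡 n).tangent ∞ (fun x : M => (⟨x, chartTan c (extChartAt (𝓡 n) c x) u⟩ :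
      TangentBundle (𝓡 n) M)) (chartAt (Model n) c).source := by
  have : IsManifold (𝓡 n) 1 M := isManifold_one
  have key := (Bundle.Trivialization.contMDiffOn_section_iff (IB := 𝓡 n) (n := ∞)
    (F := Model n) (E := fun x => TangentSpace (𝓡 n) x)
    (s := fun x => (chartTan c (extChartAt (𝓡 n) c x) u : TangentSpace (𝓡 n) x))
    (trivializationAt (Model n) (fun x => TangentSpace (𝓡 n) x) c)
    (chartAt (Model n) c).open_source (by simp)).2
  apply key
  refine (contMDiffOn_const (c := u)).congr fun x hx => ?_
  have h1 := TangentBundle.continuousLinearMapAt_trivializationAt (I := 𝓡 n) hx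
  have h2 := congrArg (fun A => A (chartTan c (extChartAt (𝓡 n) c x) u)) h1
  have h3 := chartDiff_comp_chartTan (extChartAt_mem_chartDomain hx)
  rw [chartPoint_extChartAt hx] at h3
  have h4 := congrArg (fun A => A u) h3
  have h5 : ((trivializationAt (Model n) (TangentSpace (𝓡 n)) c)
      ⟨x, (chartTan c (extChartAt (𝓡 n) c x) u : TangentSpace (𝓡 n) x)⟩).2 =
      (trivializationAt (Model n) (TangentSpace (𝓡 n)) c).continuousLinearMapAt ℝ x
        (chartTan c (extChartAt (𝓡 n) c x) u) := by
    rw [Bundle.Trivialization.continuousLinearMapAt_apply, coe_linearMapAt_of_mem]; simpa using hx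
  exact h5.trans (h2.trans h4)

theorem contDiffOn_metricForm (h : Metric n M) (c : M) :
    SmoothOn (metricForm h c) (chartDomain c) := by
  refine contDiffOn_clm_apply.2 fun u => contDiffOn_clm_apply.2 fun v => ?_
  have h2 : ContMDiffOn (𝓡 n) 𝓘(ℝ, ℝ) ∞ (fun x =>
      (h.inner x (chartTan c (extChartAt (𝓡 n) c x) u) (chartTan c (extChartAt (𝓡 n) c x) v)))
      (chartAt (Model n) c).source := by
    intro x hx; exact (Bundle.contMDiffWithinAt_totalSpace.1 ((ContMDiffOn.clm_bundle_apply₂ (F₁ :=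
      Model n) (F₂ := Model n) (F₃ := ℝ) (E₁ := fun x : M => TangentSpace (𝓡 n) x) (E₂ := fun x :
      M => TangentSpace (𝓡 n) x) (E₃ := Bundle.Trivial M ℝ) h.contMDiff.contMDiffOn
      (contMDiffOn_coordinateSection c u) (contMDiffOn_coordinateSection c v)) x hx)).2
  have h3 := h2.comp (contMDiffOn_chartPoint c) (fun y hy => chartPoint_mem hy)
  rw [contMDiffOn_iff_contDiffOn] at h3
  refine h3.congr fun y hy => ?_
  simp only [Function.comp, extChartAt_chartPoint hy]
  rfl

end Charts

/-! ### Linear algebra -/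

section LinearAlgebra

theorem det_of_blockTriangular {V W : Type*} [AddCommGroup V] [Module ℝ V] [FiniteDimensional ℝ V]
    [AddCommGroup W] [Module ℝ W] [FiniteDimensional ℝ W] (D : V × W →ₗ[ℝ] V × W)
    (J : V →ₗ[ℝ] V) (K : W →ₗ[ℝ] W) (h1 : ∀ u w, (D (u, w)).1 = J u)
    (h2 : ∀ w, (D (0, w)).2 = K w) : LinearMap.det D = LinearMap.det J * LinearMap.det K := by
  classical
  let b₁ := Module.finBasis ℝ V
  let b₂ := Module.finBasis ℝ W
  let B : V →ₗ[ℝ] W := LinearMap.snd ℝ V W ∘ₗ D ∘ₗ LinearMap.inl ℝ V W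
  have : toMatrix (b₁.prod b₂) (b₁.prod b₂) D =
      Matrix.fromBlocks (toMatrix b₁ b₁ J) 0 (toMatrix b₁ b₂ B) (toMatrix b₂ b₂ K) := by
    ext i j
    rcases i with i | i <;> rcases j with j | j <;> simp [LinearMap.toMatrix_apply, h1, h2, B]
  rw [← det_toMatrix (b₁.prod b₂), this, Matrix.det_fromBlocks_zero₁₂, det_toMatrix, det_toMatrix]

theorem det_adjoint (A : ModelEnd n) : (ContinuousLinearMap.adjoint A).det = A.det := by
  let b := basisFun (Fin n) ℝ
  have h := LinearMap.toMatrix_adjoint b b A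
  have h2 : ((ContinuousLinearMap.adjoint A) : Model n →ₗ[ℝ] Model n) = LinearMap.adjoint A := by
    rw [LinearMap.adjoint_eq_toCLM_adjoint]; rfl
  unfold det
  rw [h2, ← det_toMatrix b.toBasis, h, Matrix.det_conjTranspose, det_toMatrix]
  simp

end LinearAlgebra

section BilinearForms

/-- The square `ξ(ξ^♯)` of the length of a covector with respect to a bilinear form. -/
def dualNormSq (B : Bilin n) (ξ : Covec n) : ℝ := ξ (B.inverse ξ)

/-- Positive definite symmetric bilinear forms. -/
structure IsPosDefForm (B : Bilin n) : Prop where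
  symm : ∀ u v, B u v = B v u
  pos : ∀ v, v ≠ 0 → 0 < B v v

theorem finrank_dual_model : Module.finrank ℝ (Covec n) = Module.finrank ℝ (Model n) :=
  ((InnerProductSpace.toDual ℝ (Model n)).toLinearEquiv.finrank_eq).symm

theorem IsPosDefForm.isInvertible {B : Bilin n} (hB : IsPosDefForm B) : B.IsInvertible := by
  have hinj : Injective (B : Model n →ₗ[ℝ] (Covec n)) := by
    rw [← LinearMap.ker_eq_bot, LinearMap.ker_eq_bot']; intro v hv
    by_contra h0
    have := hB.pos v h0
    have h1 : B v = 0 := hv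
    rw [h1] at this; simp at this
  refine ⟨(LinearEquiv.ofInjectiveOfFinrankEq _ hinj
    finrank_dual_model.symm).toContinuousLinearEquiv, ?_⟩
  ext v
  rfl

theorem IsPosDefForm.inverse_eq {B : Bilin n} (hB : IsPosDefForm B)
    {v : Model n} {ξ : Covec n} (h : B v = ξ) : B.inverse ξ = v := by
  obtain ⟨e, he⟩ := hB.isInvertible
  rw [← h, ← he, inverse_equiv]
  simp

theorem IsPosDefForm.apply_inverse {B : Bilin n} (hB : IsPosDefForm B)
    (ξ : Covec n) : B (B.inverse ξ) = ξ := by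
  obtain ⟨e, he⟩ := hB.isInvertible
  rw [← he, inverse_equiv]
  simp

theorem IsPosDefForm.dualNormSq_eq {B : Bilin n} (hB : IsPosDefForm B)
    (ξ : Covec n) : dualNormSq B ξ = B (B.inverse ξ) (B.inverse ξ) := by
  rw [hB.apply_inverse]; rfl

theorem IsPosDefForm.dualNormSq_pos {B : Bilin n} (hB : IsPosDefForm B)
    {ξ : Covec n} (hξ : ξ ≠ 0) : 0 < dualNormSq B ξ := by
  rw [hB.dualNormSq_eq]
  apply hB.pos
  intro h
  apply hξ
  rw [← hB.apply_inverse ξ, h, map_zero]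

theorem dualNormSq_zero (B : Bilin n) : dualNormSq B 0 = 0 := by
  simp [dualNormSq]

theorem IsPosDefForm.dualNormSq_nonneg {B : Bilin n} (hB : IsPosDefForm B)
    (ξ : Covec n) : 0 ≤ dualNormSq B ξ := by
  by_cases h : ξ = 0
  · rw [h, dualNormSq_zero]
  · exact (hB.dualNormSq_pos h).le

theorem dualNormSq_smul (B : Bilin n) (t : ℝ) (ξ : Covec n) :
    dualNormSq B (t • ξ) = t ^ 2 * dualNormSq B ξ := by
  simp [dualNormSq]; ring

theorem dualNormSq_comp {B B' : Bilin n} (hB : IsPosDefForm B)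
    (hB' : IsPosDefForm B') {A A' : ModelEnd n}
    (hAA' : A.comp A' = .id ℝ _)
    (hA'A : A'.comp A = .id ℝ _)
    (hA : ∀ u v, B' (A u) (A v) = B u v) (ξ : Covec n) :
    dualNormSq B' (ξ.comp A') = dualNormSq B ξ := by
  have h1 : ∀ v, A (A' v) = v := fun v => congrArg (fun L => L v) hAA'
  have h2 : ∀ v, A' (A v) = v := fun v => congrArg (fun L => L v) hA'A
  have : B'.inverse (ξ.comp A') = A (B.inverse ξ) := by
    apply hB'.inverse_eq; ext v
    conv_lhs => rw [← h1 v, hA, hB.apply_inverse]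
    rfl
  unfold dualNormSq
  rw [this]
  simp [h2]

theorem IsPosDefForm.dotProduct_inverse {B : Bilin n} (hB : IsPosDefForm B) (ξ : Covec n) :
    (fun i => ξ (single i 1)) ⬝ᵥ ((of fun i j => B (single i 1) (single j 1))⁻¹.mulVec
        fun i => ξ (single i 1)) = dualNormSq B ξ := by
  set G : Matrix (Fin n) (Fin n) ℝ := of fun i j => B (single i 1) (single j 1) with hG
  have hsum : ∀ w : Model n, w = ∑ i, w i • single i 1 := by
    intro w
    have := (basisFun (Fin n) ℝ).sum_repr w
    simpa using this.symm
  have hmul : ∀ w i, B w (single i 1) = G.mulVec w i := by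
    intro w i
    conv_lhs => rw [hsum w]
    simp only [map_sum, map_smul, _root_.sum_apply, _root_.smul_apply,
      Matrix.mulVec, dotProduct, hG, of_apply, smul_eq_mul]
    refine sum_congr rfl fun j _ => ?_
    rw [hB.symm, mul_comm]
  set w := B.inverse ξ with hw
  have hv : (fun i => ξ (single i 1)) = G.mulVec w := by
    ext i; rw [← hmul, hw, hB.apply_inverse]
  have hdet : IsUnit G.det := by
    rw [isUnit_iff_ne_zero]; intro h0
    obtain ⟨v, hv0, hv1⟩ := Matrix.exists_mulVec_eq_zero_iff.2 h0
    have hBv : B (toLp 2 v) (toLp 2 v) = 0 := by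
      conv_lhs => arg 2; rw [hsum (toLp 2 v)]
      simp only [map_sum, map_smul, hmul]; simp [hv1]
    refine absurd (hB.pos (toLp 2 v) fun h => hv0 ?_) (by rw [hBv]; simp)
    simpa using h
  rw [hv, Matrix.mulVec_mulVec, Matrix.nonsing_inv_mul _ hdet, Matrix.one_mulVec, ← hv]
  unfold dualNormSq
  rw [← hw]
  conv_rhs => rw [hsum w]
  simp [dotProduct, mul_comm]

end BilinearForms

section Charts

theorem isPosDefForm_innerAt (h : Metric n M) (x : M) : IsPosDefForm (innerAt h x) :=
  ⟨innerAt_symm h x, fun _ hv => innerAt_pos h x hv⟩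

theorem isPosDefForm_metricForm (h : Metric n M) (hy : y ∈ chartDomain c) :
    IsPosDefForm (metricForm h c y) :=
  ⟨metricForm_symm h c y, fun _ hv => metricForm_pos h hy hv⟩

theorem covectorNormSq_eq (h : Metric n M) (x : M) (ξ : Covec n) :
    covectorNormSq h x ξ = dualNormSq (innerAt h x) ξ :=
  (isPosDefForm_innerAt h x).dotProduct_inverse ξ

/-- The covector with components `η`, with the tangent spaces identified with the model space. -/
def chartCov (c : M) (y η : Model n) : Covec n := (innerSL ℝ η).comp (chartDiff c (chartPoint c y))

theorem covectorNormSq_chartCov (h : Metric n M) (hy : y ∈ chartDomain c) (η : Model n) :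
    covectorNormSq h (chartPoint c y) (chartCov c y η) =
      dualNormSq (metricForm h c y) (innerSL ℝ η) := by
  rw [covectorNormSq_eq]
  exact dualNormSq_comp (isPosDefForm_metricForm h hy) (isPosDefForm_innerAt h _)
    (chartTan_comp_chartDiff hy) (chartDiff_comp_chartTan hy) (fun u v => rfl) _

theorem IsIsometry.innerAt_iter (hg : IsIsometry h g) (m : ℤ) (x : M) (v w : Model n) :
    innerAt h (iter g m x) (iterDiff g m x v) (iterDiff g m x w) = innerAt h x v w := by
  have h1 : ∀ x (v w),
      innerAt h (iter g 1 x) (iterDiff g 1 x v) (iterDiff g 1 x w) = innerAt h x v w := by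
    intro x v w; unfold iterDiff; rw [iter_one]; exact hg x v w
  have h2 : ∀ x (v w),
      innerAt h (iter g (-1) x) (iterDiff g (-1) x v) (iterDiff g (-1) x w) = innerAt h x v w := by
    intro x v w; rw [← h1 (iter g (-1) x), iter_iter_neg]
    have h3 := iterDiff_neg_comp g (-1) x
    rw [neg_neg] at h3
    have h4 : ∀ v, iterDiff g 1 (iter g (-1) x) (iterDiff g (-1) x v) = v :=
      fun v => congrArg (fun L => L v) h3
    rw [h4, h4]
  induction m using Int.induction_on generalizing x v w with
  | zero => rw [iter_zero, iterDiff_zero]; rfl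
  | succ i hi => rw [iter_add, iterDiff_add]; exact (hi _ _ _).trans (h1 _ _ _)
  | pred i hi =>
    rw [sub_eq_add_neg, iter_add, iterDiff_add]; exact (hi _ _ _).trans (h2 _ _ _)

theorem IsIsometry.covectorNormSq_codiff (hg : IsIsometry h g) (m : ℤ) (x : M) (ξ : Covec n) :
    covectorNormSq h (iter g m x) (codiff g m x ξ) = covectorNormSq h x ξ := by
  rw [codiff_eq, covectorNormSq_eq]
  erw [covectorNormSq_eq]
  exact dualNormSq_comp (isPosDefForm_innerAt h _) (isPosDefForm_innerAt h _)
    (iterDiff_comp_neg g m x) (iterDiff_neg_comp g m x) (hg.innerAt_iter m x) _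

theorem IsIsometry.radius_codiff (hg : IsIsometry h g) (m : ℤ) (x : M) (ξ : Covec n) (w :
    Fin q → ℝ) :
    radius h (iter g m x) (codiff g m x ξ) w = radius h x ξ w := by
  unfold radius
  rw [hg.covectorNormSq_codiff]

/-! ### Transition maps -/

/-- The map `g^m` from the chart centred at `c` to the chart centred at `c'`. -/
def trans (g : Diffeo n M) (m : ℤ) (c c' : M) (y : Model n) : Model n :=
  extChartAt (𝓡 n) c' (iter g m (chartPoint c y))

def transDom (g : Diffeo n M) (m : ℤ) (c c' : M) : Set (Model n) :=
  {y | y ∈ chartDomain c ∧ iter g m (chartPoint c y) ∈ (chartAt (Model n) c').source}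

def transDiff (g : Diffeo n M) (m : ℤ) (c c' : M) (y : Model n) : ModelEnd n :=
  ((chartDiff c' (iter g m (chartPoint c y))).comp (iterDiff g m (chartPoint c y))).comp
    (chartTan c y)

theorem isOpen_transDom : IsOpen (transDom g m c c') := by
  exact ((contMDiff_iter g m).continuous.comp_continuousOn (continuousOn_chartPoint
    c)).isOpen_inter_preimage (isOpen_chartDomain c) (chartAt (Model n) c').open_source

theorem trans_mem (hy : y ∈ transDom g m c c') : trans g m c c' y ∈ chartDomain c' :=
  extChartAt_mem_chartDomain hy.2

theorem chartPoint_trans (hy : y ∈ transDom g m c c') :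
    chartPoint c' (trans g m c c' y) = iter g m (chartPoint c y) :=
  chartPoint_extChartAt hy.2

theorem trans_mem_transDom (hy : y ∈ transDom g m c c') :
    trans g m c c' y ∈ transDom g (-m) c' c := by
  refine ⟨trans_mem hy, ?_⟩
  rw [chartPoint_trans hy, iter_neg_iter]
  exact chartPoint_mem hy.1

theorem trans_neg_trans (hy : y ∈ transDom g m c c') :
    trans g (-m) c' c (trans g m c c' y) = y := by
  unfold trans
  rw [show extChartAt (𝓡 n) c' (iter g m (chartPoint c y)) = trans g m c c' y from rfl,
    chartPoint_trans hy, iter_neg_iter, extChartAt_chartPoint hy.1]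

theorem contDiffOn_trans : SmoothOn (trans g m c c') (transDom g m c c') := by
  rw [← contMDiffOn_iff_contDiffOn]
  exact (contMDiffOn_extChartAt (I := 𝓡 n) (n := ∞)).comp ((contMDiff_iter g m).comp_contMDiffOn
    ((contMDiffOn_chartPoint c).mono fun y hy => hy.1)) fun y hy => hy.2

theorem hasFDerivAt_trans (hy : y ∈ transDom g m c c') :
    HasFDerivAt (trans g m c c') (transDiff g m c c' y) y := by
  have : IsManifold (𝓡 n) 1 M := isManifold_one
  exact (((mdifferentiableAt_extChartAt hy.2).hasMFDerivAt.comp _ ((contMDiff_iter g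
    m).mdifferentiable (by simp) _).hasMFDerivAt).comp _ (((contMDiffOn_chartPoint c).contMDiffAt
    ((isOpen_chartDomain c).mem_nhds hy.1) ).mdifferentiableAt (by simp)).hasMFDerivAt).hasFDerivAt

theorem contDiffOn_transDiff : SmoothOn (transDiff g m c c') (transDom g m c c') := by
  have := ((contDiffOn_trans (g := g) (m := m) (c := c) (c' := c')).fderivOn isOpen_transDom)
  exact this.congr fun y hy => (hasFDerivAt_trans hy).fderiv.symm

theorem transDiff_neg_comp (hy : y ∈ transDom g m c c') :
    (transDiff g (-m) c' c (trans g m c c' y)).comp (transDiff g m c c' y) = .id ℝ _ := by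
  have h1 := (hasFDerivAt_trans (trans_mem_transDom hy)).comp y (hasFDerivAt_trans hy)
  have h2 : (trans g (-m) c' c ∘ trans g m c c') =ᶠ[𝓝 y] id := by
    filter_upwards [isOpen_transDom.mem_nhds hy] with z hz using trans_neg_trans hz
  exact h1.unique ((hasFDerivAt_id y).congr_of_eventuallyEq h2)

theorem transDiff_comp_neg (hy : y ∈ transDom g m c c') :
    (transDiff g m c c' y).comp (transDiff g (-m) c' c (trans g m c c' y)) = .id ℝ _ := by
  have := transDiff_neg_comp (trans_mem_transDom hy)
  rwa [neg_neg, trans_neg_trans hy] at this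

theorem chartTan_transDiff (hy : y ∈ transDom g m c c') :
    (chartTan c' (trans g m c c' y)).comp (transDiff g m c c' y) =
      (iterDiff g m (chartPoint c y)).comp (chartTan c y) := by
  have := chartTan_comp_chartDiff (trans_mem hy)
  rw [chartPoint_trans hy] at this
  unfold transDiff
  rw [← comp_assoc, ← comp_assoc, this]
  rfl

theorem IsIsometry.metricForm_trans (hg : IsIsometry h g)
    (hy : y ∈ transDom g m c c') (u v : Model n) :
    metricForm h c' (trans g m c c' y) (transDiff g m c c' y u) (transDiff g m c c' y v) =
      metricForm h c y u v := by
  have h1 : ∀ u, chartTan c' (trans g m c c' y) (transDiff g m c c' y u) =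
      iterDiff g m (chartPoint c y) (chartTan c y u) :=
    fun u => congrArg (fun L => L u) (chartTan_transDiff hy)
  rw [metricForm_apply, h1, h1, chartPoint_trans hy, hg.innerAt_iter]
  rfl

theorem codiff_chartCov (hy : y ∈ transDom g m c c') (η : Model n) :
    codiff g m (chartPoint c y) (chartCov c y η) = chartCov c' (trans g m c c' y)
      (ContinuousLinearMap.adjoint (transDiff g (-m) c' c (trans g m c c' y)) η) := by
  erw [codiff_eq]
  have hA : ∀ A : ModelEnd n,
      innerSL ℝ (ContinuousLinearMap.adjoint A η) = (innerSL ℝ η).comp A := by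
    intro A; ext v; simp [adjoint_inner_left]
  unfold chartCov
  rw [hA]
  have h1 := chartTan_comp_chartDiff (trans_mem hy)
  unfold transDiff
  rw [chartPoint_trans hy] at h1 ⊢
  rw [iter_neg_iter, comp_assoc, comp_assoc, comp_assoc, comp_assoc, h1]
  rfl

/-! ### Vector fields in charts -/

def fieldCoord (X : ∀ x : M, TangentSpace (𝓡 n) x) (c : M) (y : Model n) : Model n :=
  chartDiff c (chartPoint c y) (X (chartPoint c y))

theorem contDiffOn_fieldCoord (hX : SmoothField X) (c : M) :
    SmoothOn (fieldCoord X c) (chartDomain c) := by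
  have : IsManifold (𝓡 n) 1 M := isManifold_one
  have h1 := (Bundle.Trivialization.contMDiffOn_section_iff (IB := 𝓡 n) (n := ∞)
    (F := Model n) (E := fun x => TangentSpace (𝓡 n) x)
    (trivializationAt (Model n) (fun x : M => TangentSpace (𝓡 n) x) c)
    (chartAt (Model n) c).open_source (by simp)).1 hX.contMDiffOn
  have h2 := h1.comp (contMDiffOn_chartPoint c) (fun y hy => chartPoint_mem hy)
  rw [contMDiffOn_iff_contDiffOn] at h2
  refine h2.congr fun y hy => ?_
  have h3 := TangentBundle.continuousLinearMapAt_trivializationAt (I := 𝓡 n) (chartPoint_mem hy)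
  have h4 := congrArg (fun A => A (X (chartPoint c y))) h3
  refine h4.symm.trans ?_
  have h5 := chartPoint_mem hy
  simp only [Function.comp]
  rw [Bundle.Trivialization.continuousLinearMapAt_apply, coe_linearMapAt_of_mem]
  simpa using h5

theorem chartTan_fieldCoord (X : ∀ x : M, TangentSpace (𝓡 n) x) (hy : y ∈ chartDomain c) :
    chartTan c y (fieldCoord X c y) = X (chartPoint c y) :=
  congrArg (fun L => L (X (chartPoint c y) : Model n)) (chartTan_comp_chartDiff hy)

end Charts

/-! ### Coordinates on `T*M × ℝ^q` -/

section Coordinates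

/-- The covector components as a vector. -/
def fibreVec (z : Coord n q) : Model n := toLp 2 (fibreCoord z)

def coordLinearEquiv (n q : ℕ) : (Coord n q) ≃ₗ[ℝ] Model n × (Model n × (Fin q → ℝ)) where
  toFun z := (baseCoord z, fibreVec z, extraCoord z)
  invFun p k := if hk : (k : ℕ) < 2 * n then
      if (k : ℕ) % 2 = 0 then p.1 ⟨k / 2, by omega⟩ else p.2.1 ⟨k / 2, by omega⟩
    else p.2.2 ⟨k - 2 * n, by omega⟩
  map_add' _ _ := rfl
  map_smul' _ _ := rfl
  left_inv z := by
    ext k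
    by_cases hk : (k : ℕ) < 2 * n
    · by_cases hk2 : (k : ℕ) % 2 = 0
      · simp only [hk, hk2, dite_true, if_true, baseCoord]; congr 1; ext; simp only; omega
      · simp only [hk, hk2, dite_true, if_false, fibreVec, fibreCoord]
        congr 1; ext; simp only; omega
    · simp only [hk, dite_false, extraCoord]; congr 1; ext; simp only [Fin.natAdd_mk]; omega
  right_inv p := by
    obtain ⟨y, η, w⟩ := p
    refine Prod.ext ?_ (Prod.ext ?_ ?_)
    · ext i
      have h1 : 2 * (i : ℕ) < 2 * n := by omega
      simp [baseCoord]
    · ext i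
      have h1 : 2 * (i : ℕ) + 1 < 2 * n := by omega
      have h2 : (2 * (i : ℕ) + 1) / 2 = i := by omega
      simp [fibreVec, fibreCoord, h1, h2]
    · ext j; simp [extraCoord]

def coordEquiv (n q : ℕ) : (Coord n q) ≃L[ℝ] Model n × (Model n × (Fin q → ℝ)) :=
  (coordLinearEquiv n q).toContinuousLinearEquiv

theorem coordEquiv_apply (z : Coord n q) :
    coordEquiv n q z = (baseCoord z, fibreVec z, extraCoord z) := rfl

theorem baseCoord_symm (p : Model n × (Model n × (Fin q → ℝ))) :
    baseCoord ((coordEquiv n q).symm p) = p.1 :=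
  congrArg Prod.fst ((coordEquiv n q).apply_symm_apply p)

theorem fibreVec_symm (p : Model n × (Model n × (Fin q → ℝ))) :
    fibreVec ((coordEquiv n q).symm p) = p.2.1 :=
  congrArg (fun r => r.2.1) ((coordEquiv n q).apply_symm_apply p)

theorem extraCoord_symm (p : Model n × (Model n × (Fin q → ℝ))) :
    extraCoord ((coordEquiv n q).symm p) = p.2.2 :=
  congrArg (fun r => r.2.2) ((coordEquiv n q).apply_symm_apply p)

theorem coord_ext {z' : Coord n q} (h1 : baseCoord z = baseCoord z')
    (h2 : fibreVec z = fibreVec z') (h3 : extraCoord z = extraCoord z') : z = z' := by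
  apply (coordEquiv n q).injective
  rw [coordEquiv_apply, coordEquiv_apply, h1, h2, h3]

theorem contDiff_baseCoord : ContDiff ℝ ∞ (baseCoord (n := n) (q := q)) :=
  contDiff_fst.comp (coordEquiv n q).contDiff

theorem contDiff_fibreVec : ContDiff ℝ ∞ (fibreVec (n := n) (q := q)) :=
  (contDiff_fst.comp contDiff_snd).comp (coordEquiv n q).contDiff

theorem contDiff_extraCoord : ContDiff ℝ ∞ (extraCoord (n := n) (q := q)) :=
  (contDiff_snd.comp contDiff_snd).comp (coordEquiv n q).contDiff

theorem fibreVec_eq_zero : fibreVec z = 0 ↔ fibreCoord z = 0 := by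
  unfold fibreVec
  simp

end Coordinates

section Charts

/-- The square of the length of the covector with components `η` in the chart centred at `c`. -/
def fibreNormSq (h : Metric n M) (c : M) (y η : Model n) : ℝ :=
  dualNormSq (metricForm h c y) (innerSL ℝ η)

theorem innerSL_eq_zero {η : Model n} : innerSL ℝ η = 0 ↔ η = 0 := by
  constructor
  · intro h
    have := congrArg (fun L => L η) h
    simpa using this
  · rintro rfl; simp

theorem fibreNormSq_pos (h : Metric n M) {η : Model n} (hy : y ∈ chartDomain c)
    (hη : η ≠ 0) : 0 < fibreNormSq h c y η :=
  (isPosDefForm_metricForm h hy).dualNormSq_pos fun h0 => hη (innerSL_eq_zero.1 h0)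

theorem fibreNormSq_nonneg (h : Metric n M) (hy : y ∈ chartDomain c)
    (η : Model n) : 0 ≤ fibreNormSq h c y η :=
  (isPosDefForm_metricForm h hy).dualNormSq_nonneg _

theorem fibreNormSq_smul (h : Metric n M) (c : M) (y η : Model n) (t : ℝ) :
    fibreNormSq h c y (t • η) = t ^ 2 * fibreNormSq h c y η := by
  unfold fibreNormSq
  rw [map_smul, dualNormSq_smul]

theorem contDiffOn_fibreNormSq (h : Metric n M) (c : M) :
    SmoothOn (fun p : Model n × Model n => fibreNormSq h c p.1 p.2) (chartDomain c ×ˢ univ) := by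
  have h1 : SmoothOn (fun p : Model n × Model n => (metricForm h c p.1).inverse)
      (chartDomain c ×ˢ univ) := by
    intro p hp
    have h2 := (isPosDefForm_metricForm h hp.1).isInvertible.contDiffAt_map_inverse (n := ∞)
    exact h2.comp_contDiffWithinAt p
      (((contDiffOn_metricForm h c).comp contDiffOn_fst fun p hp => hp.1) p hp)
  have h3 : SmoothOn (fun p : Model n × Model n => innerSL ℝ p.2) (chartDomain c ×ˢ univ) :=
    ((innerSL ℝ).contDiff.comp contDiff_snd).contDiffOn
  exact h3.clm_apply (h1.clm_apply h3)

theorem contDiffOn_fibreNormSq_coord (q : ℕ) (h : Metric n M) (c : M) :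
    SmoothOn (fun z : Coord n q => fibreNormSq h c (baseCoord z) (fibreVec z))
      {z | baseCoord z ∈ chartDomain c} :=
  ContDiffOn.comp (g := fun p : Model n × Model n => fibreNormSq h c p.1 p.2)
    (f := fun z => (baseCoord z, fibreVec z)) (contDiffOn_fibreNormSq h c)
    (contDiff_baseCoord.prodMk contDiff_fibreVec).contDiffOn fun _ hz => ⟨hz, trivial⟩

theorem chartRadius_eq (h : Metric n M) (hz : baseCoord z ∈ chartDomain c) : chartRadius h c z =
      sqrt (fibreNormSq h c (baseCoord z) (fibreVec z) + ∑ j, extraCoord z j ^ 2) := by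
  unfold chartRadius radius
  congr 2
  exact covectorNormSq_chartCov h hz (fibreVec z)

theorem isOpen_coneDomain (q : ℕ) (c : M) : IsOpen (coneDomain (n := n) q c) := by
  have h2 : IsOpen {z : Coord n q | fibreVec z ≠ 0} :=
    isOpen_ne.preimage contDiff_fibreVec.continuous
  have h3 : IsOpen {z : Coord n q | extraCoord z ≠ 0} :=
    isOpen_ne.preimage contDiff_extraCoord.continuous
  have := ((isOpen_chartDomain c).preimage contDiff_baseCoord.continuous).inter (h2.union h3)
  convert! this using 1
  ext z
  simp [coneDomain, fibreVec_eq_zero]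

theorem normSq_pos_of_mem_coneDomain (h : Metric n M) (hz : z ∈ coneDomain q c) :
    0 < fibreNormSq h c (baseCoord z) (fibreVec z) + ∑ j, extraCoord z j ^ 2 := by
  have h2 : 0 ≤ ∑ j, extraCoord z j ^ 2 := sum_nonneg fun j _ => sq_nonneg _
  rcases hz.2 with h1 | h1
  · have := fibreNormSq_pos h hz.1 (mt fibreVec_eq_zero.1 h1)
    linarith
  · have h3 := fibreNormSq_nonneg h hz.1 (fibreVec z)
    obtain ⟨j, hj⟩ := ne_iff.1 h1
    have : 0 < ∑ j, extraCoord z j ^ 2 :=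
      Finset.sum_pos' (fun j _ => sq_nonneg _) ⟨j, Finset.mem_univ _, by
        have : extraCoord z j ≠ 0 := hj
        positivity⟩
    linarith

theorem chartRadius_pos (h : Metric n M) (hz : z ∈ coneDomain q c) : 0 < chartRadius h c z := by
  rw [chartRadius_eq h hz.1]
  exact Real.sqrt_pos.2 (normSq_pos_of_mem_coneDomain h hz)

theorem contDiffOn_chartRadius (h : Metric n M) (c : M) :
    SmoothOn (chartRadius (q := q) h c) (coneDomain q c) := by
  have h1 : SmoothOn (fun z =>
      fibreNormSq h c (baseCoord z) (fibreVec z) + ∑ j, extraCoord z j ^ 2) (coneDomain q c) := by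
    refine ContDiffOn.add ?_ ?_
    · exact (contDiffOn_fibreNormSq_coord q h c).mono fun z hz => hz.1
    · refine ContDiffOn.sum fun j _ => ContDiff.contDiffOn ?_
      exact ((contDiff_apply ℝ ℝ j).comp contDiff_extraCoord).pow 2
  exact (h1.sqrt fun z hz => (normSq_pos_of_mem_coneDomain h hz).ne').congr
    fun z hz => chartRadius_eq h hz.1

/-! ### The action of `∂g^m` in charts -/

/-- The map `∂g^m × id` from the chart centred at `c` to the chart centred at `c'`. -/
def cotrans {q : ℕ} (g : Diffeo n M) (m : ℤ) (c c' : M) (z : Coord n q) : Coord n q :=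
  (coordEquiv n q).symm (trans g m c c' (baseCoord z),
    ContinuousLinearMap.adjoint (transDiff g (-m) c' c (trans g m c c' (baseCoord z)))
      (fibreVec z), extraCoord z)

def cotransDom (q : ℕ) (g : Diffeo n M) (m : ℤ) (c c' : M) :
    Set (Coord n q) := {z | baseCoord z ∈ transDom g m c c'}

theorem baseCoord_cotrans : baseCoord (cotrans g m c c' z) = trans g m c c' (baseCoord z) :=
  baseCoord_symm _

theorem fibreVec_cotrans : fibreVec (cotrans g m c c' z) =
    ContinuousLinearMap.adjoint (transDiff g (-m) c' c (trans g m c c' (baseCoord z)))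
      (fibreVec z) := fibreVec_symm _

theorem extraCoord_cotrans : extraCoord (cotrans g m c c' z) = extraCoord z := extraCoord_symm _

theorem isOpen_cotransDom : IsOpen (cotransDom q g m c c') :=
  isOpen_transDom.preimage contDiff_baseCoord.continuous

theorem cotrans_mem (hz : z ∈ cotransDom q g m c c') :
    cotrans g m c c' z ∈ cotransDom q g (-m) c' c := by
  unfold cotransDom
  rw [mem_ofPred_eq, baseCoord_cotrans]
  exact trans_mem_transDom hz

theorem cotrans_neg_cotrans (hz : z ∈ cotransDom q g m c c') :
    cotrans g (-m) c' c (cotrans g m c c' z) = z := by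
  apply coord_ext
  · rw [baseCoord_cotrans, baseCoord_cotrans, trans_neg_trans hz]
  · rw [fibreVec_cotrans, fibreVec_cotrans, baseCoord_cotrans, trans_neg_trans hz, neg_neg,
      ← comp_apply, ← ContinuousLinearMap.adjoint_comp, transDiff_neg_comp hz,
      ContinuousLinearMap.adjoint_id]
    rfl
  · rw [extraCoord_cotrans, extraCoord_cotrans]

theorem contDiffOn_cotrans : SmoothOn (cotrans (q := q) g m c c') (cotransDom q g m c c') := by
  have h0 : SmoothOn (fun z => trans g m c c' (baseCoord z)) (cotransDom q g m c c') :=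
    contDiffOn_trans.comp contDiff_baseCoord.contDiffOn fun z hz => hz
  refine (coordEquiv n q).symm.contDiff.comp_contDiffOn (h0.prodMk (ContDiffOn.prodMk ?_
    contDiff_extraCoord.contDiffOn))
  exact (((ContinuousLinearMap.adjoint (𝕜 := ℝ) (E := Model n) (F := Model n)
    ).toContinuousLinearEquiv.contDiff).comp_contDiffOn (contDiffOn_transDiff.comp h0 fun z hz =>
    trans_mem_transDom hz)).clm_apply contDiff_fibreVec.contDiffOn

theorem hasFDerivAt_cotrans (hz : z ∈ cotransDom q g m c c') :
    HasFDerivAt (cotrans g m c c') (fderiv ℝ (cotrans g m c c') z) z :=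
  (contDiffOn_cotrans.diffAt isOpen_cotransDom hz).hasFDerivAt

theorem det_fderiv_cotrans (hz : z ∈ cotransDom q g m c c') :
    (fderiv ℝ (cotrans g m c c') z).det = 1 := by
  set e := coordEquiv n q
  set D := fderiv ℝ (cotrans g m c c') z
  have hD := hasFDerivAt_cotrans hz
  set A := transDiff g (-m) c' c (trans g m c c' (baseCoord z)) with hA
  have hbase : (fst ℝ (Model n) (Model n × (Fin q → ℝ))).comp ((e : (Coord n q) →L[ℝ] _).comp D) =
      (transDiff g m c c' (baseCoord z)).comp ((fst ℝ (Model n) (Model n × (Fin q → ℝ))).comp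
          (e : (Coord n q) →L[ℝ] _)) := by
    have h1 : HasFDerivAt (fun z => baseCoord (cotrans g m c c' z)) ((fst ℝ
        (Model n) (Model n × (Fin q → ℝ))).comp
        ((e : (Coord n q) →L[ℝ] _).comp D)) z :=
      (fst ℝ (Model n) (Model n × (Fin q → ℝ))).hasFDerivAt.comp z (e.hasFDerivAt.comp z hD)
    have h2 := (hasFDerivAt_trans (y := baseCoord z) hz).comp z
        ((fst ℝ (Model n) (Model n × (Fin q → ℝ))).hasFDerivAt.comp z e.hasFDerivAt)
    simp only [baseCoord_cotrans] at h1; exact h1.unique h2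
  set K : (Model n × (Fin q → ℝ)) →L[ℝ] (Model n × (Fin q → ℝ)) :=
    (ContinuousLinearMap.adjoint A).prodMap (ContinuousLinearMap.id ℝ _) with hK
  have hfib : ∀ w, (e (D (e.symm (0, w)))).2 = K w := by
    intro w
    have h1 : HasFDerivAt (fun w' => (e (cotrans g m c c' (e.symm (baseCoord z, w')))).2)
        (((snd ℝ (Model n) (Model n × (Fin q → ℝ))).comp
        ((e : (Coord n q) →L[ℝ] _).comp (D.comp ((e.symm : _ →L[ℝ] (Coord n q)).comp
            (inr ℝ (Model n) (Model n × (Fin q → ℝ)))))))) (e z).2 := by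
      have h3 : e.symm (baseCoord z, (e z).2) = z := e.symm_apply_apply z
      have h4 : HasFDerivAt (fun w' => e.symm (baseCoord z, w'))
          ((e.symm : _ →L[ℝ] (Coord n q)).comp (inr ℝ (Model n) (Model n × (Fin q → ℝ)))) (e z).2 :=
        e.symm.hasFDerivAt.comp _ (hasFDerivAt_prodMk_right _ _)
      have hD' : HasFDerivAt (cotrans g m c c') D (e.symm (baseCoord z, (e z).2)) := by
        rw [h3]; exact hD
      exact (snd ℝ (Model n) (Model n × (Fin q → ℝ))).hasFDerivAt.comp _
        (e.hasFDerivAt.comp _ (HasFDerivAt.comp (f := fun w' => e.symm (baseCoord z, w')) _ hD' h4))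
    have h2 : (fun w' => (e (cotrans g m c c' (e.symm (baseCoord z, w')))).2) = K := by
      ext1 w'
      rw [coordEquiv_apply, fibreVec_cotrans, extraCoord_cotrans, baseCoord_symm, fibreVec_symm,
        extraCoord_symm]
      rfl
    rw [h2] at h1; exact congrArg (fun L => L w) (h1.unique K.hasFDerivAt)
  have h3 := det_of_blockTriangular ((e.toLinearEquiv ∘ₗ (D : (Coord n q) →ₗ[ℝ] (Coord n q))) ∘ₗ
      e.toLinearEquiv.symm)
    (transDiff g m c c' (baseCoord z) : Model n →ₗ[ℝ] Model n) K
    (fun u w => by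
      have := congrArg (fun L => L (e.symm (u, w))) hbase
      simpa using this)
    (fun w => hfib w)
  rw [LinearMap.comp_assoc] at h3
  have h3' := (LinearMap.det_conj D e.toLinearEquiv).symm.trans h3
  have h4 : LinearMap.det (K : (Model n × (Fin q → ℝ)) →ₗ[ℝ] _) = A.det := by
    have h6 : (K : (Model n × (Fin q → ℝ)) →ₗ[ℝ] (Model n × (Fin q → ℝ))) =
        LinearMap.prodMap (ContinuousLinearMap.adjoint A) LinearMap.id := rfl
    rw [h6, LinearMap.det_prodMap]
    have := det_adjoint A
    unfold det at this ⊢; rw [this]; simp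
  have h5 := congrArg det (transDiff_comp_neg hz)
  unfold det at h5 h4 ⊢
  rw [ContinuousLinearMap.toLinearMap_comp, LinearMap.det_comp] at h5
  rw [h3', h4, h5]
  simp

theorem OpFunction.congr_point (a : OpFunction n M q N) {x x' : M} (hx : x = x')
    {ξ ξ' : Covec n} (hξ : ξ = ξ') (w : Fin q → ℝ) : a x ξ w = a x' ξ' w := by
  subst hx; subst hξ; rfl

theorem inChart_cotrans (h : Metric n M) (a : OpFunction n M q N) (hz : z ∈ cotransDom q g m c c') :
    inChart h a c' (cotrans g m c c' z) = homExt h a (iter g m (chartPoint c (baseCoord z)))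
      (codiff g m (chartPoint c (baseCoord z)) (chartCov c (baseCoord z) (fibreVec z)))
      (extraCoord z) := by
  unfold inChart
  rw [extraCoord_cotrans]
  apply OpFunction.congr_point
  · rw [baseCoord_cotrans, chartPoint_trans hz]
  · rw [codiff_chartCov hz, ← fibreVec_cotrans, ← baseCoord_cotrans]; rfl

theorem IsIsometry.fibreNormSq_cotrans (hg : IsIsometry h g) (hz : z ∈ cotransDom q g m c c') :
    fibreNormSq h c' (baseCoord (cotrans g m c c' z)) (fibreVec (cotrans g m c c' z)) =
      fibreNormSq h c (baseCoord z) (fibreVec z) := by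
  have hA : ∀ (A : ModelEnd n) η,
      innerSL ℝ (ContinuousLinearMap.adjoint A η) = (innerSL ℝ η).comp A := by
    intro A η; ext v; simp [adjoint_inner_left]
  rw [fibreVec_cotrans, baseCoord_cotrans]
  unfold fibreNormSq
  rw [hA]
  exact dualNormSq_comp (isPosDefForm_metricForm h hz.1)
    (isPosDefForm_metricForm h (trans_mem hz)) (transDiff_comp_neg hz) (transDiff_neg_comp hz)
    (hg.metricForm_trans hz) _

end Charts

/-! ### Derivatives of solutions of first order systems -/

section FirstOrderSystems

theorem exists_iteratedFDeriv_formula {E F G : Type*} [NormedAddCommGroup E] [NormedSpace ℝ E]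
    [NormedAddCommGroup F] [NormedSpace ℝ F] [NormedAddCommGroup G] [NormedSpace ℝ G]
    {Ω : Set (E × F)} (hΩ : IsOpen Ω) {K : E × F → E →L[ℝ] F} (hK : SmoothOn K Ω)
    {Q : E × F → G} (hQ : SmoothOn Q Ω) (r : ℕ) :
    ∃ C : E × F → ContinuousMultilinearMap ℝ (fun _ : Fin r => E) G, SmoothOn C Ω ∧
      ∀ (U : Set E) (φ : E → F), IsOpen U → (∀ y ∈ U, (y, φ y) ∈ Ω ∧ HasFDerivAt φ (K (y, φ y)) y) →
        ∀ y ∈ U, iteratedFDeriv ℝ r (fun y => Q (y, φ y)) y = C (y, φ y) := by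
  induction r with
  | zero =>
    refine ⟨fun p => (continuousMultilinearCurryFin0 ℝ E G).symm (Q p),
      (continuousMultilinearCurryFin0 ℝ E G).symm.toContinuousLinearEquiv.contDiff.comp_contDiffOn
        hQ, ?_⟩
    intro U φ _ _ y _; rw [iteratedFDeriv_zero_eq_comp]; rfl
  | succ r ih =>
    obtain ⟨C, hC, hCφ⟩ := ih
    refine ⟨fun p => (continuousMultilinearCurryLeftEquiv ℝ (fun _ => E) G).symm
      ((fderiv ℝ C p).comp ((ContinuousLinearMap.id ℝ E).prod (K p))), ?_, ?_⟩
    · refine (continuousMultilinearCurryLeftEquiv ℝ (fun _ => E) G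
        ).symm.toContinuousLinearEquiv.contDiff.comp_contDiffOn ?_
      have h1 := (hC.fderivOn hΩ)
      refine h1.clm_comp ?_
      exact (prodₗᵢ ℝ : ((E →L[ℝ] E) × (E →L[ℝ] F)) ≃ₗᵢ[ℝ] _
        ).toContinuousLinearEquiv.contDiff.comp_contDiffOn (contDiffOn_const.prodMk hK)
    · intro U φ hU hφ y hy; rw [iteratedFDeriv_succ_eq_comp_left]
      have h1 : iteratedFDeriv ℝ r (fun y => Q (y, φ y)) =ᶠ[𝓝 y] fun y => C (y, φ y) := by
        filter_upwards [hU.mem_nhds hy] with z hz using hCφ U φ hU hφ z hz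
      have h3 : HasFDerivAt (fun y => C (y, φ y)) ((fderiv ℝ C (y, φ y)).comp
          ((ContinuousLinearMap.id ℝ E).prod (K (y, φ y)))) y :=
        HasFDerivAt.comp (f := fun y => (y, φ y)) y (((hC.contDiffAt (hΩ.mem_nhds
          (hφ y hy).1)).differentiableAt (by simp)).hasFDerivAt) ((hasFDerivAt_id y).prodMk
          (hφ y hy).2)
      simp; rw [h1.fderiv_eq, h3.fderiv]

end FirstOrderSystems

/-! ### Second derivatives of isometries -/

section IsometryEquation

/-- The combination `T(w,u,v) + T(u,w,v) - T(v,w,u)` of permutations of a trilinear form. -/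
def christoffelSum (T : Model n →L[ℝ] Bilin n) : Model n →L[ℝ] Bilin n :=
  T + T.flip - ((flipₗᵢ ℝ (Model n) (Model n) ℝ ).toContinuousLinearEquiv : _ →L[ℝ] _).comp T.flip

theorem christoffelSum_apply (T : Model n →L[ℝ] Bilin n)
    (w u v : Model n) : christoffelSum T w u v = T w u v + T u w v - T v w u := rfl

/-- The second derivative of an isometry in terms of the metrics and its first derivative. -/
def isometryHessian (B' : Bilin n) (T T' : Model n →L[ℝ] Bilin n) (A : ModelEnd n) :
    Model n →L[ℝ] ModelEnd n :=
  (1 / 2 : ℝ) • ((compL ℝ (Model n) (Covec n) (Model n)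
      (B'.inverse.comp ((compL ℝ (Model n) (Model n) ℝ).flip A.inverse))).comp (christoffelSum T)
    - (compL ℝ (Model n) (Covec n) (Model n) B'.inverse).comp
        ((christoffelSum T').bilinearComp A A))

theorem isometryHessian_apply (B' : Bilin n) (T T' : Model n →L[ℝ] Bilin n) (A : ModelEnd n)
    (w u : Model n) : isometryHessian B' T T' A w u =
      (1 / 2 : ℝ) • (B'.inverse ((christoffelSum T w u).comp A.inverse)
        - B'.inverse (christoffelSum T' (A w) (A u))) := rfl

theorem contDiffOn_christoffelSum {E : Type*} [NormedAddCommGroup E] [NormedSpace ℝ E] {s : Set E}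
    {T : E → Model n →L[ℝ] Bilin n} (hT : SmoothOn T s) :
    SmoothOn (fun p => christoffelSum (T p)) s := by
  have h1 := (flipₗᵢ ℝ (Model n) (Model n) (Covec n)
      ).toContinuousLinearEquiv.contDiff.comp_contDiffOn hT
  exact (hT.add h1).sub (contDiffOn_const.clm_comp h1)

theorem contDiffOn_isometryHessian {E : Type*} [NormedAddCommGroup E] [NormedSpace ℝ E] {s : Set E}
    {B' : E → Bilin n}
    {T T' : E → Model n →L[ℝ] Bilin n} {A : E → ModelEnd n}
    (hB' : SmoothOn B' s) (hT : SmoothOn T s) (hT' : SmoothOn T' s)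
    (hA : SmoothOn A s) (hBi : ∀ p ∈ s, (B' p).IsInvertible)
    (hAi : ∀ p ∈ s, (A p).IsInvertible) :
    SmoothOn (fun p => isometryHessian (B' p) (T p) (T' p) (A p)) s := by
  refine contDiffOn_clm_apply.2 fun w => contDiffOn_clm_apply.2 fun u => ?_
  simp only [isometryHessian_apply]
  have h1 : SmoothOn (fun p => (B' p).inverse) s := fun p hp =>
    ((hBi p hp).contDiffAt_map_inverse (n := ∞)).comp_contDiffWithinAt p (hB' p hp)
  have h3 := contDiffOn_christoffelSum hT
  have h4 := contDiffOn_christoffelSum hT'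
  refine ContDiffOn.const_smul _ (ContDiffOn.sub ?_ ?_)
  · exact h1.clm_apply (((h3.clm_apply contDiffOn_const).clm_apply contDiffOn_const).clm_comp (fun p
      hp => ((hAi p hp).contDiffAt_map_inverse (n := ∞)).comp_contDiffWithinAt p (hA p hp)))
  · exact h1.clm_apply ((h4.clm_apply (hA.clm_apply contDiffOn_const)).clm_apply
      (hA.clm_apply contDiffOn_const))

theorem hessian_eq_isometryHessian {U : Set (Model n)} (hU : IsOpen U)
    {f : Model n → Model n} {A : Model n → ModelEnd n}
    {B B' : Model n → Bilin n} (hy : y ∈ U)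
    (hf : ∀ y ∈ U, HasFDerivAt f (A y) y) (hA : DifferentiableAt ℝ A y)
    (hB : DifferentiableAt ℝ B y) (hB' : DifferentiableAt ℝ B' (f y))
    (hpos : IsPosDefForm (B' (f y))) (hAi : (A y).IsInvertible)
    (hiso : ∀ y ∈ U, ∀ u v, B' (f y) (A y u) (A y v) = B y u v) :
    HasFDerivAt A (isometryHessian (B' (f y)) (fderiv ℝ B y) (fderiv ℝ B' (f y)) (A y)) y := by
  set D2 := fderiv ℝ A y with hD2
  have hAd := hA.hasFDerivAt
  have hsymm : ∀ w u, D2 w u = D2 u w := by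
    intro w u
    exact second_derivative_symmetric_of_eventually
      (by filter_upwards [hU.mem_nhds hy] with z hz using hf z hz) hAd w u
  set T := fderiv ℝ B y with hT
  set T' := fderiv ℝ B' (f y) with hT'
  have hderiv : ∀ w u v, T' (A y w) (A y u) (A y v) + B' (f y) (D2 w u) (A y v)
      + B' (f y) (A y u) (D2 w v) = T w u v := by
    intro w u v
    have h1 := ((hB'.hasFDerivAt.comp y (hf y hy)).clm_apply
        (hAd.clm_apply (hasFDerivAt_const u y))).clm_apply (hAd.clm_apply (hasFDerivAt_const v y))
    have h2 := (hB.hasFDerivAt.clm_apply (hasFDerivAt_const u y)).clm_apply (hasFDerivAt_const v y)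
    have h3 : (fun y => B' (f y) (A y u) (A y v)) =ᶠ[𝓝 y] fun y => B y u v := by
      filter_upwards [hU.mem_nhds hy] with z hz using hiso z hz u v
    have h4 := congrArg (fun L => L w) (h1.unique (h2.congr_of_eventuallyEq h3))
    simp at h4; linarith
  have hcalc : ∀ w u v, B' (f y) (D2 w u) (A y v) =
      1 / 2 * (christoffelSum T w u v - christoffelSum T' (A y w) (A y u) (A y v)) := by
    intro w u v
    have h1 := hderiv w u v
    have h2 := hderiv u w v
    have h3 := hderiv v w u
    rw [hsymm u w, hpos.symm (A y w) (D2 u v)] at h2; rw [hsymm v w, hsymm v u] at h3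
    rw [hpos.symm (A y u) (D2 w v)] at h1; rw [hpos.symm (A y w) (D2 u v)] at h3
    rw [christoffelSum_apply, christoffelSum_apply]; linarith
  have hAinv : ∀ v, A y ((A y).inverse v) = v := by
    intro v
    obtain ⟨e, he⟩ := hAi
    rw [← he, inverse_equiv]; simp
  have : D2 = isometryHessian (B' (f y)) T T' (A y) := by
    ext1 w
    ext1 u
    rw [isometryHessian_apply, ← map_sub, ← map_smul]; symm; apply hpos.inverse_eq; ext v
    conv_lhs => rw [← hAinv v, hcalc]
    simp [hAinv]
  rw [← this]
  exact hAd

end IsometryEquation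

/-! ### Smooth families indexed by `ℤ` -/

section Families

open scoped BoundedContinuousFunction

open Classical in
/-- A bounded sequence as a bounded function on `ℤ` (and `0` for unbounded sequences). -/
def boundedSeq {G : Type*} [NormedAddCommGroup G] (f : ℤ → G) : ℤ →ᵇ G :=
  if h : ∃ C, ∀ m, ‖f m‖ ≤ C then
    BoundedContinuousFunction.ofNormedAddCommGroupDiscrete f h.choose h.choose_spec else 0

theorem boundedSeq_apply {G : Type*} [NormedAddCommGroup G] {f : ℤ → G} {C : ℝ}
    (h : ∀ m, ‖f m‖ ≤ C) (m : ℤ) : boundedSeq f m = f m := by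
  have h' : ∃ C, ∀ m, ‖f m‖ ≤ C := ⟨C, h⟩
  simp [boundedSeq, h']

def boundedSeqSwap (E G : Type*) [NormedAddCommGroup E] [NormedSpace ℝ E] [NormedAddCommGroup G]
    [NormedSpace ℝ G] : (ℤ →ᵇ (E →L[ℝ] G)) →L[ℝ] E →L[ℝ] (ℤ →ᵇ G) :=
  LinearMap.mkContinuous₂ (mk₂ ℝ
    (fun h v => (ContinuousLinearMap.apply ℝ G v).compLeftContinuousBounded ℤ h)
    (fun _ _ _ => by ext; simp) (fun _ _ _ => by ext; simp) (fun _ _ _ => by ext; simp)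
    (fun _ _ _ => by ext; simp)) 1 (fun h v => by
      rw [norm_le (by positivity)]
      intro m; rw [one_mul]
      exact ((h m).le_opNorm v).trans (by gcongr; exact h.norm_coe_le_norm m))

theorem boundedSeqSwap_apply {E G : Type*} [NormedAddCommGroup E] [NormedSpace ℝ E]
    [NormedAddCommGroup G] [NormedSpace ℝ G] (h : ℤ →ᵇ (E →L[ℝ] G)) (v : E) (m : ℤ) :
    boundedSeqSwap E G h v m = h m v := rfl

/-- A family of smooth functions whose derivatives of any order are locally uniformly bounded. -/
structure IsUniformFamily {E G : Type*} [NormedAddCommGroup E] [NormedSpace ℝ E]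
    [NormedAddCommGroup G] [NormedSpace ℝ G] (f : ℤ → E → G) (Ω : Set E) : Prop where
  smooth : ∀ m, SmoothOn (f m) Ω
  bound : ∀ z ∈ Ω, ∃ U ∈ 𝓝 z, ∀ r : ℕ, ∃ C, ∀ m, ∀ y ∈ U, ‖iteratedFDeriv ℝ r (f m) y‖ ≤ C

theorem IsUniformFamily.fderiv {E G : Type*} [NormedAddCommGroup E] [NormedSpace ℝ E]
    [NormedAddCommGroup G] [NormedSpace ℝ G] {f : ℤ → E → G} {Ω : Set E} (hΩ : IsOpen Ω)
    (hf : IsUniformFamily f Ω) : IsUniformFamily (fun m => fderiv ℝ (f m)) Ω where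
  smooth m := ((hf.smooth m).fderivOn hΩ)
  bound z hz := by
    obtain ⟨U, hU, h⟩ := hf.bound z hz
    refine ⟨U, hU, fun r => ?_⟩
    obtain ⟨C, hC⟩ := h (r + 1)
    exact ⟨C, fun m y hy => by rw [norm_iteratedFDeriv_fderiv]; exact hC m y hy⟩

theorem IsUniformFamily.exists_ball {E G : Type*} [NormedAddCommGroup E] [NormedSpace ℝ E]
    [NormedAddCommGroup G] [NormedSpace ℝ G] {f : ℤ → E → G} {Ω : Set E} (hΩ : IsOpen Ω)
    (hf : IsUniformFamily f Ω) {z : E} (hz : z ∈ Ω) : ∃ δ > 0, ∃ C : ℝ, 0 ≤ C ∧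
      ball z δ ⊆ Ω ∧ (∀ m, ∀ y ∈ ball z δ, ‖f m y‖ ≤ C) ∧
      (∀ m, ∀ y ∈ ball z δ, ‖_root_.fderiv ℝ (f m) y‖ ≤ C) := by
  obtain ⟨U, hU, h⟩ := hf.bound z hz
  obtain ⟨C0, hC0⟩ := h 0
  obtain ⟨C1, hC1⟩ := h 1
  obtain ⟨δ, hδ, hsub⟩ := Metric.mem_nhds_iff.1 (inter_mem hU (hΩ.mem_nhds hz))
  refine ⟨δ, hδ, max (max C0 C1) 0, le_max_right _ _, fun y hy => (hsub hy).2, ?_, ?_⟩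
  · intro m y hy
    have := hC0 m y (hsub hy).1
    rw [norm_iteratedFDeriv_zero] at this; exact this.trans (le_max_of_le_left (le_max_left _ _))
  · intro m y hy
    have := hC1 m y (hsub hy).1
    rw [← zero_add 1, ← norm_iteratedFDeriv_fderiv, norm_iteratedFDeriv_zero] at this
    exact this.trans (le_max_of_le_left (le_max_right _ _))

theorem IsUniformFamily.hasFDerivAt {E G : Type*} [NormedAddCommGroup E] [NormedSpace ℝ E]
    [NormedAddCommGroup G] [NormedSpace ℝ G] {f : ℤ → E → G} {Ω : Set E} (hΩ : IsOpen Ω)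
    (hf : IsUniformFamily f Ω) {z : E} (hz : z ∈ Ω) :
    HasFDerivAt (fun z => boundedSeq fun m => f m z)
      (boundedSeqSwap E G (boundedSeq fun m => _root_.fderiv ℝ (f m) z)) z := by
  obtain ⟨δ₀, hδ₀, C₀, hC₀, hsub₀, hf₀, hf₁⟩ := hf.exists_ball hΩ hz
  obtain ⟨δ₁, hδ₁, C₁, hC₁, hsub₁, hf₁', hf₂⟩ := (hf.fderiv hΩ).exists_ball hΩ hz
  rw [hasFDerivAt_iff_isLittleO, Asymptotics.isLittleO_iff]
  intro ε hε
  have hρ : 0 < min (min δ₀ δ₁) (ε / (C₁ + 1)) := lt_min (lt_min hδ₀ hδ₁) (by positivity)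
  filter_upwards [Metric.ball_mem_nhds z hρ] with y hy
  rw [norm_le (by positivity)]
  intro m
  simp only [BoundedContinuousFunction.coe_sub, Pi.sub_apply]
  rw [boundedSeq_apply (fun m => hf₀ m y (Metric.ball_subset_ball ((min_le_left _ _).trans
    (min_le_left _ _)) hy)),
    boundedSeq_apply (fun m => hf₀ m z (mem_ball_self hδ₀)), boundedSeqSwap_apply,
    boundedSeq_apply (fun m => hf₁ m z (mem_ball_self hδ₀))]
  have hd : ∀ x ∈ ball z (min (min δ₀ δ₁) (ε / (C₁ + 1))),
      ‖_root_.fderiv ℝ (f m) x - _root_.fderiv ℝ (f m) z‖ ≤ ε := by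
    intro x hx
    have h1 := (convex_ball z δ₁).norm_image_sub_le_of_norm_fderiv_le
      (f := _root_.fderiv ℝ (f m)) (fun w hw => ((hf.fderiv hΩ).smooth m).diffAt hΩ (hsub₁ hw))
      (fun w hw => hf₂ m w hw) (mem_ball_self hδ₁) (Metric.ball_subset_ball ((min_le_left _ _).trans
        (min_le_right _ _)) hx)
    have h2 : ‖x - z‖ ≤ ε / (C₁ + 1) := by
      rw [← dist_eq_norm]; exact (Metric.mem_ball.1 hx).le.trans (min_le_right _ _)
    calc _ ≤ C₁ * ‖x - z‖ := h1
      _ ≤ (C₁ + 1) * (ε / (C₁ + 1)) := by gcongr; linarith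
      _ = ε := by field_simp
  exact (convex_ball z _).norm_image_sub_le_of_norm_hasFDerivWithin_le'
    (f' := fun x => _root_.fderiv ℝ (f m) x) (fun w hw =>
      ((hf.smooth m).diffAt hΩ (hsub₀ (Metric.ball_subset_ball ((min_le_left _ _).trans (min_le_left
        _ _)) hw))).hasFDerivAt.hasFDerivWithinAt) hd (mem_ball_self hρ) hy

theorem IsUniformFamily.contDiffOn {E G : Type} [NormedAddCommGroup E] [NormedSpace ℝ E]
    [NormedAddCommGroup G] [NormedSpace ℝ G] {f : ℤ → E → G} {Ω : Set E} (hΩ : IsOpen Ω)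
    (hf : IsUniformFamily f Ω) : SmoothOn (fun z => boundedSeq fun m => f m z) Ω := by
  rw [contDiffOn_infty]
  intro k
  induction k generalizing G with
  | zero =>
    rw [Nat.cast_zero, contDiffOn_zero]
    exact fun z hz => (hf.hasFDerivAt hΩ hz).continuousAt.continuousWithinAt
  | succ k ih =>
    rw [Nat.cast_succ, contDiffOn_succ_iff_fderiv_of_isOpen hΩ]
    refine ⟨fun z hz => (hf.hasFDerivAt hΩ hz).differentiableAt.differentiableWithinAt, by simp, ?_⟩
    refine ContDiffOn.congr ?_ fun z hz => (hf.hasFDerivAt hΩ hz).fderiv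
    exact (boundedSeqSwap E G).contDiff.comp_contDiffOn (ih (hf.fderiv hΩ))

end Families

variable [CompactSpace M] [T2Space M]

/-! ### Uniform bounds for pulled back vector fields -/

section UniformBounds

/-- The components in the chart centred at `c` of the pullback of a vector field under `g^m`. -/
def pullField (g : Diffeo n M) (X : ∀ x : M, TangentSpace (𝓡 n) x) (m : ℤ) (c : M)
    (y : Model n) : Model n :=
  chartDiff c (chartPoint c y) (iterDiff g (-m) (iter g m (chartPoint c y))
    (X (iter g m (chartPoint c y))))

theorem pullField_eq (X : ∀ x : M, TangentSpace (𝓡 n) x) (hy : y ∈ transDom g m c c') :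
    pullField g X m c y =
      transDiff g (-m) c' c (trans g m c c' y) (fieldCoord X c' (trans g m c c' y)) := by
  unfold transDiff pullField
  rw [comp_apply, comp_apply, ((chartTan_fieldCoord X (trans_mem hy)).trans (congrArg (fun x =>
    (X x : Model n)) (chartPoint_trans hy))), chartPoint_trans hy, iter_neg_iter]

theorem transDiff_inverse (hy : y ∈ transDom g m c c') :
    (transDiff g m c c' y).inverse = transDiff g (-m) c' c (trans g m c c' y) :=
  ContinuousLinearMap.inverse_eq (transDiff_comp_neg hy) (transDiff_neg_comp hy)

theorem isInvertible_transDiff (hy : y ∈ transDom g m c c') : (transDiff g m c c' y).IsInvertible :=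
  ContinuousLinearMap.IsInvertible.of_inverse (transDiff_comp_neg hy) (transDiff_neg_comp hy)

theorem contDiffOn_pullField (hX : SmoothField X) (g : Diffeo n M) (m : ℤ) (c : M) :
    SmoothOn (pullField g X m c) (chartDomain c) := by
  intro y hy
  set c' := iter g m (chartPoint c y)
  have h3 : SmoothOn (pullField g X m c) (transDom g m c c') :=
    ((contDiffOn_transDiff.comp contDiffOn_trans fun z hz => trans_mem_transDom hz).clm_apply
      ((contDiffOn_fieldCoord hX c').comp contDiffOn_trans fun z hz => trans_mem hz)).congr fun z
      hz => pullField_eq X hz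
  exact (h3.contDiffAt (isOpen_transDom.mem_nhds (⟨hy, mem_chart_source _ _⟩))).contDiffWithinAt

theorem contDiffOn_clm_inverse {E : Type*} [NormedAddCommGroup E] [NormedSpace ℝ E] {s : Set E}
    {A : E → ModelEnd n} (hA : SmoothOn A s)
    (hAi : ∀ p ∈ s, (A p).IsInvertible) : SmoothOn (fun p => (A p).inverse) s :=
  fun p hp => ((hAi p hp).contDiffAt_map_inverse (n := ∞)).comp_contDiffWithinAt p (hA p hp)

def isometryDomain (c c' : M) : Set (Model n × (Model n × (ModelEnd n))) :=
  {p | p.1 ∈ chartDomain c ∧ p.2.1 ∈ chartDomain c' ∧ p.2.2.IsInvertible}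

theorem isOpen_isInvertible : IsOpen {A : ModelEnd n | A.IsInvertible} :=
  ContinuousLinearEquiv.isOpen

theorem isOpen_isometryDomain (c c' : M) : IsOpen (isometryDomain (n := n) c c') :=
  ((isOpen_chartDomain c).preimage continuous_fst).inter
    (((isOpen_chartDomain c').preimage (continuous_fst.comp continuous_snd)).inter
      (isOpen_isInvertible.preimage (continuous_snd.comp continuous_snd)))

/-- The right hand side of the first order system satisfied by isometries between two charts. -/
def isometrySystem (h : Metric n M) (c c' : M) (p : Model n × (Model n × (ModelEnd n))) :
    Model n →L[ℝ] (Model n × (ModelEnd n)) :=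
  p.2.2.prod (isometryHessian (metricForm h c' p.2.1) (fderiv ℝ (metricForm h c) p.1)
    (fderiv ℝ (metricForm h c') p.2.1) p.2.2)

theorem contDiffOn_isometrySystem (h : Metric n M) (c c' : M) :
    SmoothOn (isometrySystem h c c') (isometryDomain c c') := by
  have h2 : SmoothOn (fun p : Model n × (Model n × (ModelEnd n)) => p.2.1)
    (isometryDomain c c') := (contDiff_fst.comp contDiff_snd).contDiffOn
  have h3 : SmoothOn (fun p : Model n × (Model n × (ModelEnd n)) => p.2.2)
    (isometryDomain c c') := (contDiff_snd.comp contDiff_snd).contDiffOn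
  have hd := fun c => ((contDiffOn_metricForm h c).fderivOn (isOpen_chartDomain c))
  refine (prodₗᵢ ℝ : ((ModelEnd n) × (Model n →L[ℝ] (ModelEnd n))) ≃ₗᵢ[ℝ] _
    ).toContinuousLinearEquiv.contDiff.comp_contDiffOn (h3.prodMk ?_)
  exact contDiffOn_isometryHessian ((contDiffOn_metricForm h c').comp h2 fun p hp => hp.2.1)
    ((hd c).comp contDiffOn_fst fun p hp => hp.1) ((hd c').comp h2 fun p hp => hp.2.1) h3
    (fun p hp => (isPosDefForm_metricForm h hp.2.1).isInvertible) fun p hp => hp.2.2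

theorem IsIsometry.hasFDerivAt_system (hg : IsIsometry h g) (hy : y ∈ transDom g m c c') :
    HasFDerivAt (fun y => (trans g m c c' y, transDiff g m c c' y))
      (isometrySystem h c c' (y, trans g m c c' y, transDiff g m c c' y)) y := by
  have hd : ∀ {c : M} {y : Model n}, y ∈ chartDomain c → DifferentiableAt ℝ (metricForm h c) y :=
    fun {c y} hy => (contDiffOn_metricForm h c).diffAt (isOpen_chartDomain c) hy
  have key := hessian_eq_isometryHessian (f := trans g m c c') (A := transDiff g m c c')
    (B := metricForm h c) (B' := metricForm h c') isOpen_transDom hy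
    (fun z hz => hasFDerivAt_trans hz) (contDiffOn_transDiff.diffAt isOpen_transDom hy) (hd hy.1)
      (hd (trans_mem hy))
    (isPosDefForm_metricForm h (trans_mem hy))
    (isInvertible_transDiff hy) fun z hz u v => hg.metricForm_trans hz u v
  exact (hasFDerivAt_trans hy).prodMk key

theorem isInvertible_of_form_eq {B B' : Bilin n} (hB : IsPosDefForm B)
    {A : ModelEnd n} (hA : ∀ v, B' (A v) (A v) = B v v) : A.IsInvertible := by
  have hinj : Injective (A : Model n →ₗ[ℝ] Model n) := by
    rw [← LinearMap.ker_eq_bot, LinearMap.ker_eq_bot']; intro v hv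
    by_contra h0
    have h1 := hB.pos v h0
    have h2 : A v = 0 := hv
    rw [← hA, h2] at h1; simp at h1
  refine ⟨(LinearEquiv.ofInjectiveOfFinrankEq _ hinj rfl).toContinuousLinearEquiv, ?_⟩
  ext v
  rfl

theorem isCompact_isometries (h : Metric n M) {K L : Set (Model n)} (hK : IsCompact K)
    (hKc : K ⊆ chartDomain c) (hL : IsCompact L) (hLc : L ⊆ chartDomain c') :
    IsCompact {p : Model n × (Model n × (ModelEnd n)) | p.1 ∈ K ∧ p.2.1 ∈ L ∧
      ∀ v, metricForm h c' p.2.1 (p.2.2 v) (p.2.2 v) = metricForm h c p.1 v v} := by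
  have hcont : ContinuousOn (fun p => metricForm h c' p.1 p.2 p.2) (L ×ˢ sphere 0 1) := by
    have h1 : ContinuousOn (fun p : Model n × Model n => metricForm h c' p.1) (L ×ˢ sphere 0 1) :=
      (contDiffOn_metricForm h c').continuousOn.comp continuousOn_fst fun p hp => hLc hp.1
    exact (h1.clm_apply continuousOn_snd).clm_apply continuousOn_snd
  obtain ⟨lam, hlam, hlow⟩ : ∃ lam > 0, ∀ u ∈ L, ∀ v : Model n,
      lam * ‖v‖ ^ 2 ≤ metricForm h c' u v v := by
    have key : ∃ lam > 0, ∀ p ∈ L ×ˢ sphere 0 1, lam ≤ metricForm h c' p.1 p.2 p.2 := by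
      rcases (L ×ˢ sphere (0 : Model n) 1).eq_empty_or_nonempty with h0 | h0
      · exact ⟨1, one_pos, by simp [h0]⟩
      · obtain ⟨p, hp, hmin⟩ := (hL.prod (isCompact_sphere 0 1)).exists_isMinOn h0 hcont
        refine ⟨_, metricForm_pos h (hLc hp.1) (v := p.2) ?_, fun q hq => hmin hq⟩
        intro h1
        have := hp.2
        simp [h1] at this
    obtain ⟨lam, hlam, hl⟩ := key
    refine ⟨lam, hlam, fun u hu v => ?_⟩
    by_cases hv : v = 0
    · simp [hv]
    · have hn := norm_pos_iff.2 hv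
      have h1 := hl (u, ‖v‖⁻¹ • v) ⟨hu, by simp [norm_smul, hn.ne']⟩
      simp at h1
      calc lam * ‖v‖ ^ 2 ≤ (‖v‖⁻¹ * (‖v‖⁻¹ * metricForm h c' u v v)) * ‖v‖ ^ 2 := by gcongr
        _ = metricForm h c' u v v := by field_simp
  obtain ⟨Lam, hLam⟩ : ∃ Lam : ℝ, ∀ y ∈ K, ‖metricForm h c y‖ ≤ Lam :=
    hK.exists_bound_of_continuousOn ((contDiffOn_metricForm h c).continuousOn.mono hKc)
  set P : Set (Model n × (Model n × (ModelEnd n))) :=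
    K ×ˢ (L ×ˢ Metric.closedBall 0 (sqrt (Lam / lam))) with hP
  have hPc : IsCompact P := hK.prod (hL.prod (isCompact_closedBall _ _))
  have hf : ∀ v : Model n, ContinuousOn (fun p : Model n × (Model n × (ModelEnd n)) =>
        metricForm h c' p.2.1 (p.2.2 v) (p.2.2 v) - metricForm h c p.1 v v) P := by
    intro v
    have h1 : ContinuousOn (fun p : Model n × (Model n × (ModelEnd n)) =>
        metricForm h c' p.2.1) P :=
      (contDiffOn_metricForm h c').continuousOn.comp
        (continuous_fst.comp continuous_snd).continuousOn fun p hp => hLc hp.2.1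
    have h2 : ContinuousOn (fun p : Model n × (Model n × (ModelEnd n)) => metricForm h c p.1) P :=
      (contDiffOn_metricForm h c).continuousOn.comp continuousOn_fst fun p hp => hKc hp.1
    have h3 : ContinuousOn (fun p : Model n × (Model n × (ModelEnd n)) => p.2.2 v) P :=
      ((continuous_snd.comp continuous_snd).clm_apply continuous_const).continuousOn
    exact ((h1.clm_apply h3).clm_apply h3).sub
      ((h2.clm_apply continuousOn_const).clm_apply continuousOn_const)
  have hset : {p : Model n × (Model n × (ModelEnd n)) | p.1 ∈ K ∧ p.2.1 ∈ L ∧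
      ∀ v, metricForm h c' p.2.1 (p.2.2 v) (p.2.2 v) = metricForm h c p.1 v v} =
      P ∩ ⋂ v : Model n, P ∩ (fun p : Model n × (Model n × (ModelEnd n)) =>
        metricForm h c' p.2.1 (p.2.2 v) (p.2.2 v) - metricForm h c p.1 v v) ⁻¹' {0} := by
    ext p
    simp only [mem_ofPred_eq, mem_inter_iff, mem_iInter, mem_preimage, mem_singleton_iff,
      sub_eq_zero]
    constructor
    · rintro ⟨h1, h2, h3⟩
      have hp : p ∈ P := by
        refine ⟨h1, h2, ?_⟩; rw [mem_closedBall_zero_iff]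
        refine opNorm_le_bound _ (Real.sqrt_nonneg _) fun v => ?_
        have h4 := hlow _ h2 (p.2.2 v)
        rw [h3] at h4
        have h5 : metricForm h c p.1 v v ≤ Lam * ‖v‖ ^ 2 := by
          refine (Real.le_norm_self _).trans ?_
          refine ((metricForm h c p.1).le_opNorm₂ v v).trans ?_; rw [mul_assoc, ← sq]; gcongr
          exact hLam _ h1
        have h6 : ‖p.2.2 v‖ ^ 2 ≤ Lam / lam * ‖v‖ ^ 2 := by
          rw [div_mul_eq_mul_div, le_div_iff₀ hlam]; linarith
        have h7 := Real.sqrt_le_sqrt h6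
        rwa [Real.sqrt_sq (norm_nonneg _), Real.sqrt_mul' _ (sq_nonneg _),
          Real.sqrt_sq (norm_nonneg _)] at h7
      exact ⟨hp, fun v => ⟨hp, h3 v⟩⟩
    · rintro ⟨h1, h2⟩
      exact ⟨h1.1, h1.2.1, fun v => (h2 v).2⟩
  rw [hset]
  exact hPc.inter_right (isClosed_iInter fun v =>
    (hf v).preimage_isClosed_of_isClosed hPc.isClosed isClosed_singleton)

theorem IsIsometry.exists_bound_pullField_of_charts (hg : IsIsometry h g) (hX : SmoothField X)
    (c c' : M) {K : Set (Model n)} {N : Set M} (hK : IsCompact K) (hKc : K ⊆ chartDomain c)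
    (hN : IsCompact N) (hNc : N ⊆ (chartAt (Model n) c').source) (r : ℕ) :
    ∃ C, ∀ (m : ℤ), ∀ y ∈ K, iter g m (chartPoint c y) ∈ N →
      ‖iteratedFDeriv ℝ r (pullField g X m c) y‖ ≤ C := by
  set Q : Model n × (Model n × (ModelEnd n)) → Model n :=
    fun p => p.2.2.inverse (fieldCoord X c' p.2.1) with hQ
  have hQs : SmoothOn Q (isometryDomain c c') := by
    have h2 : SmoothOn (fun p : Model n × (Model n × (ModelEnd n)) => p.2.1)
      (isometryDomain c c') := (contDiff_fst.comp contDiff_snd).contDiffOn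
    have h3 : SmoothOn (fun p : Model n × (Model n × (ModelEnd n)) => p.2.2)
      (isometryDomain c c') := (contDiff_snd.comp contDiff_snd).contDiffOn
    exact (contDiffOn_clm_inverse h3 fun p hp => hp.2.2).clm_apply ((contDiffOn_fieldCoord hX
      c').comp h2 fun p hp => hp.2.1)
  obtain ⟨F, hF, hFφ⟩ := exists_iteratedFDeriv_formula (isOpen_isometryDomain c c')
    (contDiffOn_isometrySystem h c c') hQs r
  set L := extChartAt (𝓡 n) c' '' N with hL
  have hLc : L ⊆ chartDomain c' := by
    rintro _ ⟨x, hx, rfl⟩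
    exact extChartAt_mem_chartDomain (hNc hx)
  have hZ := isCompact_isometries h hK hKc (hN.image_of_continuousOn ((continuousOn_extChartAt
    c').mono (by rw [extChartAt_source]; exact hNc))) hLc
  obtain ⟨C, hC⟩ := hZ.exists_bound_of_continuousOn (hF.continuousOn.mono (by
    rintro p ⟨h1, h2, h3⟩
    exact ⟨hKc h1, hLc h2, isInvertible_of_form_eq (isPosDefForm_metricForm h (hKc h1)) h3⟩))
  refine ⟨C, fun m y hy hyN => ?_⟩
  have hy' : y ∈ transDom g m c c' := ⟨hKc hy, hNc hyN⟩
  have h1 : pullField g X m c =ᶠ[𝓝 y] fun y => Q (y, trans g m c c' y, transDiff g m c c' y) := by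
    filter_upwards [isOpen_transDom.mem_nhds hy'] with z hz
    rw [pullField_eq X hz, hQ]; simp only; rw [transDiff_inverse hz]
  rw [(Filter.EventuallyEq.iteratedFDeriv ℝ h1 r).eq_of_nhds, hFφ (transDom g m c c')
    (fun y => (trans g m c c' y, transDiff g m c c' y)) isOpen_transDom (fun z hz =>
      ⟨⟨hz.1, trans_mem hz, isInvertible_transDiff hz⟩, hg.hasFDerivAt_system hz⟩) y hy']
  exact hC _ ⟨hy, ⟨_, hyN, rfl⟩, fun v => hg.metricForm_trans hy' v v⟩

theorem IsIsometry.isUniformFamily_pullField (hg : IsIsometry h g) (hX : SmoothField X)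
    (c : M) : IsUniformFamily (fun m => pullField g X m c) (chartDomain c) where
  smooth m := contDiffOn_pullField hX g m c
  bound z hz := by
    have : LocallyCompactSpace M := ChartedSpace.locallyCompactSpace (Model n) M
    obtain ⟨ε, hε, hsub⟩ := Metric.nhds_basis_closedBall.mem_iff.1
      ((isOpen_chartDomain c).mem_nhds hz)
    refine ⟨Metric.closedBall z ε, Metric.closedBall_mem_nhds z hε, fun r => ?_⟩
    choose N hN hNsub hNc using fun x : M => local_compact_nhds (chart_source_mem_nhds (Model n) x)
    obtain ⟨t, ht⟩ := CompactSpace.elim_nhds_subcover N hN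
    choose C hC using fun c' => hg.exists_bound_pullField_of_charts hX c c'
      (isCompact_closedBall z ε) hsub (hNc c') (hNsub c') r
    refine ⟨∑ c' ∈ t, |C c'|, fun m y hy => ?_⟩
    have : iter g m (chartPoint c y) ∈ ⋃ x ∈ t, N x := by rw [ht]; trivial
    simp at this
    obtain ⟨c', hc', hmem⟩ := this
    exact ((hC c' m y hy hmem).trans (le_abs_self _)).trans
      (Finset.single_le_sum (f := fun c' => |C c'|) (fun _ _ => abs_nonneg _) hc')

end UniformBounds

/-! ### Operators on `l²(ℤ)` -/

section WeightedShifts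

open scoped BoundedContinuousFunction

theorem sum_norm_weightedShift_le (k : ℤ) (f : ℤ →ᵇ ℂ) (u : L2Z) (s : Finset ℤ) :
    ∑ m ∈ s, ‖f m * u (m + k)‖ ^ (2 : ENNReal).toReal ≤ (‖f‖ * ‖u‖) ^ (2 : ENNReal).toReal := by
  have h2 := lp.sum_rpow_le_norm_rpow (by norm_num) u (s.map (Equiv.addRight k).toEmbedding)
  rw [Finset.sum_map] at h2
  rw [Real.mul_rpow (norm_nonneg _) (norm_nonneg _)]
  refine le_trans ?_ (mul_le_mul_of_nonneg_left h2 (by positivity))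
  rw [mul_sum]
  refine sum_le_sum fun m _ => ?_
  rw [norm_mul, Real.mul_rpow (norm_nonneg _) (norm_nonneg _)]
  gcongr
  · exact f.norm_coe_le_norm m
  · rfl

/-- The operator `u ↦ (m ↦ f m * u (m + k))`. -/
def weightedShift (k : ℤ) : (ℤ →ᵇ ℂ) →L[ℂ] BoundedOp := LinearMap.mkContinuous₂ (mk₂ ℂ
    (fun (f : ℤ →ᵇ ℂ) (u : L2Z) =>
      (⟨fun m => f m * u (m + k), memℓp_gen' (sum_norm_weightedShift_le k f u)⟩ : L2Z))
    (fun _ _ _ => by ext; exact add_mul _ _ _) (fun _ _ _ => by ext; simp [mul_assoc])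
    (fun _ _ _ => by ext; exact mul_add _ _ _) (fun _ _ _ => by ext; simp [mul_left_comm])) 1
    (fun f u => by
      rw [one_mul]
      exact lp.norm_le_of_forall_sum_le (by norm_num) (by positivity)
        (sum_norm_weightedShift_le k f u))

theorem weightedShift_apply (k : ℤ) (f : ℤ →ᵇ ℂ) (u : L2Z) (m : ℤ) :
    (weightedShift k f u : ℤ → ℂ) m = f m * u (m + k) := rfl

theorem shiftSum_eq {K : Finset ℤ} {s : ℤ → ℤ → ℂ} (hs : ∀ k ∈ K, ∃ C, ∀ m, ‖s k m‖ ≤ C) :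
    shiftSum K s = ∑ k ∈ K, weightedShift k (boundedSeq (s k)) := by
  have key : ∀ u m, ((∑ k ∈ K, weightedShift k (boundedSeq (s k))) u : ℤ → ℂ) m
        = ∑ k ∈ K, s k m * u (m + k) := by
    intro u m; rw [_root_.sum_apply, lp.coeFn_sum, Finset.sum_apply]
    refine sum_congr rfl fun k hk => ?_
    obtain ⟨C, hC⟩ := hs k hk
    rw [weightedShift_apply, boundedSeq_apply hC]
  have hA : ∃ A : BoundedOp, ∀ u m, (A u) m = ∑ k ∈ K, s k m * u (m + k) := ⟨_, key⟩
  rw [shiftSum, dif_pos hA]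
  ext u m
  rw [hA.choose_spec u m, key u m]

/-- The matrix coefficients as continuous functionals. -/
def coeffL (k l : ℤ) : BoundedOp →L[ℂ] ℂ := (lp.evalCLM ℂ (fun _ : ℤ => ℂ) 2 k).comp
    (ContinuousLinearMap.apply ℂ L2Z (lp.single 2 l (1 : ℂ) : L2Z))

theorem coeffL_apply (A : BoundedOp) (k l : ℤ) : coeffL k l A = coeff A k l := rfl

theorem norm_coeff_le (A : BoundedOp) (k l : ℤ) : ‖coeff A k l‖ ≤ ‖A‖ := by
  refine (lp.norm_apply_le_norm (by norm_num) _ k).trans ((A.le_opNorm _).trans ?_)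
  rw [lp.norm_single (by norm_num)]
  simp

theorem coeff_weightedShift (k : ℤ) (f : ℤ →ᵇ ℂ) (i j : ℤ) :
    coeff (weightedShift k f) i j = if i + k = j then f i else 0 := by
  rw [coeff, weightedShift_apply, lp.single_apply, single_apply]
  split_ifs <;> simp

theorem hasSum_coeff_apply (A : BoundedOp) (u : L2Z) (k : ℤ) :
    HasSum (fun l => coeff A k l * u l) ((A u : ℤ → ℂ) k) := by
  have h := (lp.hasSum_single (E := fun _ => ℂ) (by norm_num) u).mapL
    ((lp.evalCLM ℂ (fun _ => ℂ) 2 k).comp A)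
  suffices hfun : (fun l => coeff A k l * u l) = fun l =>
      ((lp.evalCLM ℂ (fun _ => ℂ) 2 k).comp A) (lp.single 2 l (u l)) by
    rw [hfun]; exact h
  funext l
  have : lp.single 2 l (u l) = u l • (lp.single 2 l 1 : L2Z) := by
    rw [← lp.single_smul]; simp
  rw [this, map_smul, smul_eq_mul, mul_comm]
  rfl

theorem boundedOp_ext {A B : BoundedOp} (h : ∀ k l, coeff A k l = coeff B k l) : A = B := by
  ext u k
  refine (hasSum_coeff_apply A u k).unique ?_
  simp_rw [h]
  exact hasSum_coeff_apply B u k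

theorem hasSum_coeff_mul (A B : BoundedOp) (k l : ℤ) :
    HasSum (fun m => coeff A k m * coeff B m l) (coeff (A * B) k l) :=
  hasSum_coeff_apply A (B (lp.single 2 l 1)) k

theorem coeff_star (A : BoundedOp) (k l : ℤ) : coeff (star A) k l = conj (coeff A l k) := by
  have h1 : ∀ B (i j), coeff B i j = inner ℂ (lp.single 2 i 1 : L2Z) (B (lp.single 2 j 1)) := by
    intro B i j; rw [lp.inner_single_left]; simp [coeff]
  rw [h1, h1, ContinuousLinearMap.star_eq_adjoint, ContinuousLinearMap.adjoint_inner_right,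
    inner_conj_symm]

end WeightedShifts

section Smooth

variable {E : Type*} [NormedAddCommGroup E] [NormedSpace ℝ E] {Ω : Set E} {A B : E → BoundedOp}

theorem contDiffOn_op_mul {k : WithTop ℕ∞} (hA : ContDiffOn ℝ k A Ω) (hB : ContDiffOn ℝ k B Ω) :
    ContDiffOn ℝ k (fun z => A z * B z) Ω := by
  have : ContDiff ℝ k fun p : BoundedOp × BoundedOp => p.1 * p.2 :=
    ContDiff.restrict_scalars ℝ (contDiff_mul (𝕜 := ℂ))
  exact this.comp_contDiffOn (hA.prodMk hB)

theorem contDiffOn_op_inverse {k : WithTop ℕ∞} (hA : ContDiffOn ℝ k A Ω)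
    (hu : ∀ z ∈ Ω, IsUnit (A z)) : ContDiffOn ℝ k (fun z => Ring.inverse (A z)) Ω := by
  intro z hz
  obtain ⟨U, hU⟩ := hu z hz
  have : ContDiffAt ℝ k Ring.inverse (A z) := by
    rw [← hU]; exact (contDiffAt_ringInverse ℂ U).restrict_scalars ℝ
  exact this.comp_contDiffWithinAt z (hA z hz)

theorem ring_inverse_eq {R : Type*} [MonoidWithZero R] {x y : R} (h1 : x * y = 1)
    (h2 : y * x = 1) : Ring.inverse x = y :=
  Ring.inverse_unit ⟨x, y, h1, h2⟩

def starCLM : BoundedOp →L[ℝ] BoundedOp :=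
  AddMonoidHom.toRealLinearMap (starAddEquiv : BoundedOp ≃+ BoundedOp).toAddMonoidHom
    (by exact continuous_star)

theorem starCLM_apply (A : BoundedOp) : starCLM A = star A := rfl

/-- The unitary operator `u ↦ (m ↦ e^{ism} u(m))`. -/
def phase (s : ℝ) : BoundedOp :=
  weightedShift 0 (BoundedContinuousFunction.ofNormedAddCommGroupDiscrete
    (fun m : ℤ => exp ((s * m : ℝ) * I)) 1
    (fun _ => (Complex.norm_exp_ofReal_mul_I _).le))

theorem phase_apply (s : ℝ) (u : L2Z) (m : ℤ) :
    (phase s u : ℤ → ℂ) m = exp ((s * m : ℝ) * I) * u m := by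
  rw [phase, weightedShift_apply, add_zero]
  rfl

theorem phase_add (s t : ℝ) : phase (s + t) = phase s * phase t := by
  ext u m
  rw [mul_apply_eq_comp, phase_apply, phase_apply, phase_apply, ← mul_assoc, ← Complex.exp_add]
  push_cast
  ring_nf

theorem phase_zero : phase 0 = 1 := by
  ext u m
  simp [phase_apply]

theorem phase_mul_neg (s : ℝ) : phase s * phase (-s) = 1 := by
  rw [← phase_add, add_neg_cancel, phase_zero]

theorem phase_neg_mul (s : ℝ) : phase (-s) * phase s = 1 := by
  rw [← phase_add, neg_add_cancel, phase_zero]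

theorem coeff_phase_conj (s : ℝ) (A : BoundedOp) (k l : ℤ) : coeff (phase s * A * phase (-s)) k l
      = exp ((s * (k - l : ℤ) : ℝ) * I) * coeff A k l := by
  have h : phase (-s) (lp.single 2 l 1) = exp ((-s * l) * I) • (lp.single 2 l 1 : L2Z) := by
    ext m; rw [phase_apply, lp.coeFn_smul, Pi.smul_apply, lp.single_apply, single_apply]
    split_ifs with h
    · rw [h]; simp
    · simp
  rw [coeff, mul_apply_eq_comp, mul_apply_eq_comp, phase_apply, h,
    map_smul, lp.coeFn_smul, Pi.smul_apply, smul_eq_mul, ← mul_assoc, ← Complex.exp_add, coeff]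
  push_cast
  ring_nf

theorem star_phase (s : ℝ) : star (phase s) = phase (-s) := by
  refine boundedOp_ext fun k l => ?_
  rw [coeff_star, phase, coeff_weightedShift, phase, coeff_weightedShift]
  by_cases h : k = l
  · subst h; simp; change conj (exp _) = exp _; rw [← Complex.exp_conj]; simp
  · simp [h, Ne.symm h]

/-- The family `A` is smooth together with its conjugates by the operators `phase s`. -/
def IsGood (A : E → BoundedOp) (Ω : Set E) : Prop :=
  SmoothOn (fun p : E × ℝ => phase p.2 * A p.1 * phase (-p.2)) (Ω ×ˢ univ)

theorem IsGood.congr (hA : IsGood A Ω) (h : ∀ z ∈ Ω, B z = A z) : IsGood B Ω :=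
  ContDiffOn.congr hA fun p hp => by rw [h p.1 hp.1]

theorem IsGood.contDiffOn (hA : IsGood A Ω) : SmoothOn A Ω := by
  have := ContDiffOn.comp hA (f := fun z => ((z, 0) : E × ℝ)) (by fun_prop)
    (fun z hz => ⟨hz, trivial⟩)
  refine this.congr fun z _ => ?_
  simp [phase_zero]

theorem IsGood.mono {Ω' : Set E} (hA : IsGood A Ω) (h : Ω' ⊆ Ω) : IsGood A Ω' :=
  ContDiffOn.mono hA (prod_mono h subset_rfl)

theorem isGood_const_one : IsGood (fun _ : E => (1 : BoundedOp)) Ω := by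
  refine ContDiffOn.congr (f := fun _ => 1) contDiffOn_const fun p _ => ?_
  rw [mul_one, phase_mul_neg]

theorem IsGood.add (hA : IsGood A Ω) (hB : IsGood B Ω) : IsGood (fun z => A z + B z) Ω :=
  (ContDiffOn.add hA hB).congr fun p _ => by simp [mul_add, add_mul]

theorem IsGood.neg (hA : IsGood A Ω) : IsGood (fun z => -A z) Ω :=
  (ContDiffOn.neg hA).congr fun p _ => by simp

theorem IsGood.sum {ι : Type*} {s : Finset ι} {A : ι → E → BoundedOp}
    (hA : ∀ i ∈ s, IsGood (A i) Ω) : IsGood (fun z => ∑ i ∈ s, A i z) Ω :=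
  (ContDiffOn.sum hA).congr fun p _ => by simp [mul_sum, sum_mul]

theorem IsGood.smul {f : E → ℂ} (hf : SmoothOn f Ω) (hA : IsGood A Ω) :
    IsGood (fun z => f z • A z) Ω := by
  have : ContDiff ℝ ∞ fun p : ℂ × BoundedOp => p.1 • p.2 :=
    ContDiff.restrict_scalars ℝ (contDiff_smul (𝕜 := ℂ))
  refine (this.comp_contDiffOn ((hf.comp contDiff_fst.contDiffOn fun _ hp => hp.1).prodMk
    hA)).congr fun p _ => ?_
  simp

theorem IsGood.mul (hA : IsGood A Ω) (hB : IsGood B Ω) : IsGood (fun z => A z * B z) Ω := by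
  refine (contDiffOn_op_mul hA hB).congr fun p _ => ?_
  rw [mul_assoc (phase p.2 * A p.1), ← mul_assoc (phase (-p.2)), ← mul_assoc (phase (-p.2)),
    phase_neg_mul, one_mul]
  simp only [mul_assoc]

theorem IsGood.star (hA : IsGood A Ω) : IsGood (fun z => star (A z)) Ω := by
  refine (starCLM.contDiff.comp_contDiffOn hA).congr fun p _ => ?_
  simp [starCLM_apply, star_phase, mul_assoc]

theorem IsGood.inverse (hA : IsGood A Ω) (hu : ∀ z ∈ Ω, IsUnit (A z)) :
    IsGood (fun z => Ring.inverse (A z)) Ω := by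
  have hU : ∀ s, IsUnit (phase s) := fun s =>
    ⟨⟨phase s, phase (-s), phase_mul_neg s, phase_neg_mul s⟩, rfl⟩
  refine (contDiffOn_op_inverse hA fun p hp => ((hU _).mul (hu _ hp.1)).mul (hU _)).congr
    fun p hp => ?_
  symm
  refine ring_inverse_eq ?_ ?_
  · calc phase p.2 * A p.1 * phase (-p.2) * (phase p.2 * Ring.inverse (A p.1) * phase (-p.2))
        = phase p.2 * A p.1 * (phase (-p.2) * phase p.2) * Ring.inverse (A p.1) * phase (-p.2) := by
          simp only [mul_assoc]
      _ = 1 := by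
          rw [phase_neg_mul, mul_one, mul_assoc (phase _), mul_inverse_cancel _ (hu _ hp.1),
            mul_one, phase_mul_neg]
  · calc phase p.2 * Ring.inverse (A p.1) * phase (-p.2) * (phase p.2 * A p.1 * phase (-p.2))
        = phase p.2 * Ring.inverse (A p.1) * (phase (-p.2) * phase p.2) * A p.1 * phase (-p.2) := by
          simp only [mul_assoc]
      _ = 1 := by
          rw [phase_neg_mul, mul_one, mul_assoc (phase _), inverse_mul_cancel _ (hu _ hp.1),
            mul_one, phase_mul_neg]

theorem phase_conj_weightedShift (s : ℝ) (k : ℤ) (f : BoundedContinuousFunction ℤ ℂ) :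
    phase s * weightedShift k f * phase (-s) = exp ((-(s * k) : ℝ) * I) • weightedShift k f := by
  refine boundedOp_ext fun i j => ?_
  have hs : ∀ a A, coeff (a • A) i j = a * coeff A i j := fun a A => by
    rw [← coeffL_apply, map_smul, smul_eq_mul, coeffL_apply]
  rw [coeff_phase_conj, hs, coeff_weightedShift]
  split_ifs with h
  · rw [← h]; push_cast
    ring_nf
  · simp

theorem isGood_weightedShift (k : ℤ) {f : E → BoundedContinuousFunction ℤ ℂ}
    (hf : SmoothOn f Ω) : IsGood (fun z => weightedShift k (f z)) Ω := by
  have h2 : ContDiff ℝ ∞ fun p : E × ℝ => exp ((-(p.2 * k) : ℝ) * I) := by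
    refine Complex.contDiff_exp.comp (ContDiff.mul ?_ contDiff_const)
    exact ofRealCLM.contDiff.comp (contDiff_snd.mul contDiff_const).neg
  exact ((ContDiff.restrict_scalars ℝ (contDiff_smul (𝕜 := ℂ))).comp_contDiffOn
    (h2.contDiffOn.prodMk (((weightedShift k).restrictScalars ℝ).contDiff.comp_contDiffOn (hf.comp
    contDiff_fst.contDiffOn fun _ hp => hp.1)))).congr fun p _ =>
    phase_conj_weightedShift _ _ _

def phaseDeriv (A : BoundedOp) : BoundedOp := deriv (fun s => phase s * A * phase (-s)) 0

theorem IsGood.hasDerivAt (hA : IsGood A Ω) (hΩ : IsOpen Ω) {z : E} (hz : z ∈ Ω) :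
    HasDerivAt (fun s => phase s * A z * phase (-s)) (phaseDeriv (A z)) 0 := by
  have h := (hA.contDiffAt ((hΩ.prod isOpen_univ).mem_nhds
    (show ((z, 0) : E × ℝ) ∈ Ω ×ˢ univ from ⟨hz, trivial⟩)))
  exact ((h.comp (0 : ℝ) (f := fun s : ℝ => ((z, s) : E × ℝ)) (by fun_prop)).differentiableAt
    (by simp)).hasDerivAt

theorem IsGood.phaseDeriv (hA : IsGood A Ω) (hΩ : IsOpen Ω) :
    IsGood (fun z => phaseDeriv (A z)) Ω := by
  have hO : IsOpen (Ω ×ˢ (univ : Set ℝ)) := hΩ.prod isOpen_univ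
  have h1 := (hA.fderivOn hO)
  have h2 : SmoothOn (fun p =>
      fderiv ℝ (fun p => phase p.2 * A p.1 * phase (-p.2)) p ((0, 1) : E × ℝ))
      (Ω ×ˢ univ) := h1.clm_apply contDiffOn_const
  refine h2.congr fun p hp => ?_
  have hd := (hA.diffAt hO hp).hasFDerivAt
  have h4 := HasFDerivAt.comp_hasDerivAt 0 (f := fun s => ((p.1, p.2 + s) : E × ℝ))
    (by simpa using hd) ((hasDerivAt_const _ _).prodMk ((hasDerivAt_id' (0 : ℝ)).const_add p.2))
  have hl : LipschitzWith 1 (fun x : ℝ => x) := LipschitzWith.id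
  have h5 := hA.hasDerivAt hΩ hp.1
  have h6 : HasDerivAt (fun s => phase p.2 * (phase s * A p.1 * phase (-s)) * phase (-p.2))
      (phase p.2 * ShiftIndex.phaseDeriv (A p.1) * phase (-p.2)) 0 := by
    have h7 := ((((ContinuousLinearMap.mul ℂ BoundedOp).flip (phase (-p.2))).comp
      ((ContinuousLinearMap.mul ℂ BoundedOp) (phase p.2))).restrictScalars ℝ).hasFDerivAt
        (x := phase 0 * A p.1 * phase (-0)) |>.comp_hasDerivAt 0 h5
    exact h7
  refine h6.unique ?_
  refine h4.congr_deriv rfl |>.congr_of_eventuallyEq (Eventually.of_forall fun s => ?_)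
  simp only [Function.comp]
  rw [phase_add, neg_add_rev, phase_add]
  simp only [mul_assoc]

theorem IsGood.coeff_phaseDeriv (hA : IsGood A Ω) (hΩ : IsOpen Ω) {z : E} (hz : z ∈ Ω) (k l : ℤ) :
    coeff (ShiftIndex.phaseDeriv (A z)) k l = (((k - l : ℤ) : ℝ) * I) * coeff (A z) k l := by
  have h1 := ((coeffL k l).restrictScalars ℝ).hasFDerivAt
    (x := phase 0 * A z * phase (-0)) |>.comp_hasDerivAt 0 (hA.hasDerivAt hΩ hz)
  have h2 : HasDerivAt (fun s => exp ((s * (k - l : ℤ) : ℝ) * I)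
      * coeff (A z) k l) ((((k - l : ℤ) : ℝ) * I) * coeff (A z) k l) 0 := by
    have h3 : HasDerivAt (fun s => ((s * (k - l) : ℝ) : ℂ) * I) (((k - l) : ℝ) * I) 0 := by
      have := ((hasDerivAt_id' 0).mul_const ((k - l) : ℝ)).ofReal_comp.mul_const I
      simpa using this
    have h4 := h3.cexp.mul_const (coeff (A z) k l)
    simpa using h4
  refine h1.unique (h2.congr_of_eventuallyEq (Eventually.of_forall fun s => ?_))
  exact coeff_phase_conj _ _ _ _

theorem IsGood.contDiffOn_coeff (hA : IsGood A Ω) (k l : ℤ) :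
    SmoothOn (fun z => coeff (A z) k l) Ω :=
  ((coeffL k l).restrictScalars ℝ).contDiff.comp_contDiffOn hA.contDiffOn

theorem norm_coeffL_le (k l : ℤ) : ‖(coeffL k l).restrictScalars ℝ‖ ≤ 1 :=
  opNorm_le_bound _ zero_le_one fun A => by
    rw [one_mul]; exact norm_coeff_le A k l

theorem IsGood.exists_decay_bound (hA : IsGood A Ω) (hΩ : IsOpen Ω) {K : Set E} (hK : IsCompact K)
    (hKΩ : K ⊆ Ω) (r L : ℕ) : ∃ C : ℝ, ∀ z ∈ K, ∀ k l : ℤ,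
      ‖iteratedFDeriv ℝ r (fun z => coeff (A z) k l) z‖ * (1 + |((k - l : ℤ) : ℝ)|) ^ L ≤ C := by
  induction L generalizing A with
  | zero =>
    have hc : ContinuousOn (iteratedFDeriv ℝ r A) Ω := by
      have := hA.contDiffOn.continuousOn_iteratedFDerivWithin (m := r) (by exact_mod_cast le_top)
        hΩ.uniqueDiffOn
      exact this.congr fun z hz => (iteratedFDerivWithin_of_isOpen r hΩ hz).symm
    obtain ⟨C, hC⟩ := hK.exists_bound_of_continuousOn (hc.mono hKΩ)
    refine ⟨C, fun z hz k l => ?_⟩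
    rw [pow_zero, mul_one]
    have h1 := ContinuousLinearMap.iteratedFDeriv_comp_left ((coeffL k l).restrictScalars ℝ)
      (hA.contDiffOn.contDiffAt (hΩ.mem_nhds (hKΩ hz))) (i := r) (by exact_mod_cast le_top)
    change ‖iteratedFDeriv ℝ r ((coeffL k l).restrictScalars ℝ ∘ A) z‖ ≤ C; rw [h1]
    refine (ContinuousLinearMap.norm_compContinuousMultilinearMap_le _ _).trans ?_
    exact (mul_le_mul (norm_coeffL_le k l) (hC z hz) (norm_nonneg _) zero_le_one).trans_eq
      (one_mul C)
  | succ L ih =>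
    obtain ⟨C1, h1⟩ := ih hA
    obtain ⟨C2, h2⟩ := ih (hA.phaseDeriv hΩ)
    refine ⟨C1 + C2, fun z hz k l => ?_⟩
    have h3 : ‖iteratedFDeriv ℝ r (fun z => coeff (ShiftIndex.phaseDeriv (A z)) k l) z‖
        = |((k - l : ℤ) : ℝ)| * ‖iteratedFDeriv ℝ r (fun z => coeff (A z) k l) z‖ := by
      have h4 : (fun z => coeff (ShiftIndex.phaseDeriv (A z)) k l) =ᶠ[𝓝 z]
          fun z => (((k - l : ℤ) : ℝ) * I : ℂ) • coeff (A z) k l := by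
        filter_upwards [hΩ.mem_nhds (hKΩ hz)] with w hw
        exact hA.coeff_phaseDeriv hΩ hw k l
      rw [(h4.iteratedFDeriv ℝ r).eq_of_nhds]
      rw [iteratedFDeriv_const_smul_apply' (((hA.contDiffOn_coeff k l).contDiffAt
        (hΩ.mem_nhds (hKΩ hz))).of_le (by exact_mod_cast le_top)), norm_smul,
        norm_mul, norm_I, mul_one, norm_real, Real.norm_eq_abs]
    have h4 := h1 z hz k l
    have h5 := h2 z hz k l
    rw [h3] at h5
    calc _ = ‖iteratedFDeriv ℝ r (fun z => coeff (A z) k l) z‖ * (1 + |((k - l : ℤ) : ℝ)|) ^ L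
          + |((k - l : ℤ) : ℝ)| * ‖iteratedFDeriv ℝ r (fun z => coeff (A z) k l) z‖
            * (1 + |((k - l : ℤ) : ℝ)|) ^ L := by ring
      _ ≤ C1 + C2 := add_le_add h4 h5

end Smooth

/-! ### Symbols of operators with shifts -/

section ShiftConj

open scoped BoundedContinuousFunction

def unitShift (m : ℤ) : BoundedOp := weightedShift m (BoundedContinuousFunction.const ℤ 1)

theorem unitShift_apply (m : ℤ) (u : L2Z) (j : ℤ) : (unitShift m u : ℤ → ℂ) j = u (j + m) := by
  rw [unitShift, weightedShift_apply]; simp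

theorem unitShift_mul (m k : ℤ) : unitShift m * unitShift k = unitShift (m + k) := by
  ext u j
  rw [mul_apply_eq_comp, unitShift_apply, unitShift_apply, unitShift_apply, add_assoc]

theorem unitShift_zero : unitShift 0 = 1 := by
  ext u j
  simp [unitShift_apply]

theorem unitShift_mul_neg (m : ℤ) : unitShift m * unitShift (-m) = 1 := by
  rw [unitShift_mul, add_neg_cancel, unitShift_zero]

theorem unitShift_neg_mul (m : ℤ) : unitShift (-m) * unitShift m = 1 := by
  rw [unitShift_mul, neg_add_cancel, unitShift_zero]

def shiftConj (m : ℤ) : BoundedOp →L[ℂ] BoundedOp :=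
  ((ContinuousLinearMap.mul ℂ BoundedOp).flip (unitShift (-m))).comp
    ((ContinuousLinearMap.mul ℂ BoundedOp) (unitShift m))

theorem shiftConj_apply (m : ℤ) (A : BoundedOp) :
    shiftConj m A = unitShift m * A * unitShift (-m) := rfl

theorem coeff_shiftConj (m : ℤ) (A : BoundedOp) (k l : ℤ) :
    coeff (shiftConj m A) k l = coeff A (k + m) (l + m) := by
  have h : unitShift (-m) (lp.single 2 l 1) = (lp.single 2 (l + m) 1 : L2Z) := by
    ext j; rw [unitShift_apply, lp.single_apply, lp.single_apply, single_apply, single_apply]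
    congr 1; exact propext ⟨fun h => by omega, fun h => by omega⟩
  rw [coeff, shiftConj_apply, mul_apply_eq_comp, mul_apply_eq_comp, unitShift_apply, h, coeff]

theorem shiftConj_mul (m : ℤ) (A B : BoundedOp) :
    shiftConj m (A * B) = shiftConj m A * shiftConj m B := by
  simp only [shiftConj_apply]
  rw [mul_assoc (unitShift m * A), ← mul_assoc (unitShift (-m)), ← mul_assoc (unitShift (-m)),
    unitShift_neg_mul, one_mul]
  simp only [mul_assoc]

theorem shiftConj_one (m : ℤ) : shiftConj m 1 = 1 := by
  rw [shiftConj_apply, mul_one, unitShift_mul_neg]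

theorem shiftConj_star (m : ℤ) (A : BoundedOp) : shiftConj m (star A) = star (shiftConj m A) := by
  refine boundedOp_ext fun k l => ?_
  rw [coeff_shiftConj, coeff_star, coeff_star, coeff_shiftConj]

theorem shiftConj_inverse (m : ℤ) {A : BoundedOp} (hA : IsUnit A) :
    shiftConj m (Ring.inverse A) = Ring.inverse (shiftConj m A) := by
  symm
  refine ring_inverse_eq ?_ ?_
  · rw [← shiftConj_mul, mul_inverse_cancel _ hA, shiftConj_one]
  · rw [← shiftConj_mul, inverse_mul_cancel _ hA, shiftConj_one]

end ShiftConj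

section ExternalSymbol

/-- The matrix `((a, b), (-b̄, a*))`. -/
def extMatrix (a : BoundedOp) (b : ℂ) : Matrix (Fin 2) (Fin 2) BoundedOp :=
  !![a, b • 1; -(conj b • 1), star a]

def extMatrixInv (a : BoundedOp) (b : ℂ) : Matrix (Fin 2) (Fin 2) BoundedOp :=
  !![star a * Ring.inverse (a * star a + (conj b * b) • 1),
    -(b • Ring.inverse (star a * a + (conj b * b) • 1));
    conj b • Ring.inverse (a * star a + (conj b * b) • 1),
    a * Ring.inverse (star a * a + (conj b * b) • 1)]

theorem isUnit_mul_star_add {a : BoundedOp} {b : ℂ} (h : IsUnit a ∨ b ≠ 0) :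
    IsUnit (star a * a + (conj b * b) • (1 : BoundedOp)) := by
  by_cases hb : b = 0
  · have ha := h.resolve_right (by simpa using hb)
    simpa [hb] using ha.star.mul ha
  · have h1 : -(‖b‖ ^ 2) ∉ spectrum ℝ (star a * a) := by
      intro h2
      have := spectrum_star_mul_self_nonneg _ h2
      have h3 : 0 < ‖b‖ ^ 2 := by positivity
      linarith
    rw [spectrum.notMem_iff] at h1
    have h2 : star a * a + (conj b * b) • 1
        = -(algebraMap ℝ BoundedOp (-(‖b‖ ^ 2)) - star a * a) := by
      have h3 : algebraMap ℝ BoundedOp (-(‖b‖ ^ 2)) = (-(conj b * b)) • 1 := by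
        rw [Complex.conj_mul', Algebra.algebraMap_eq_smul_one]; ext u k
        simp only [neg_smul, _root_.neg_apply, _root_.smul_apply, one_apply_eq_self, lp.coeFn_neg,
          lp.coeFn_smul, Pi.neg_apply, Pi.smul_apply, real_smul, smul_eq_mul]
        push_cast; rfl
      rw [h3, neg_smul]; abel
    rw [h2]; exact h1.neg

theorem isUnit_star_mul_add {a : BoundedOp} {b : ℂ} (h : IsUnit a ∨ b ≠ 0) :
    IsUnit (a * star a + (conj b * b) • (1 : BoundedOp)) := by
  have := isUnit_mul_star_add (a := star a) (h.imp_left IsUnit.star)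
  rwa [star_star] at this

theorem extMatrix_mul_inv {a : BoundedOp} {b : ℂ} (h : IsUnit a ∨ b ≠ 0) :
    extMatrix a b * extMatrixInv a b = 1 := by
  have h1 := mul_inverse_cancel _ (isUnit_mul_star_add h)
  have h2 := mul_inverse_cancel _ (isUnit_star_mul_add h)
  unfold extMatrix extMatrixInv
  generalize Ring.inverse (a * star a + (conj b * b) • 1) = p at h2 ⊢
  generalize Ring.inverse (star a * a + (conj b * b) • 1) = q at h1 ⊢
  rw [add_mul, smul_mul_assoc, one_mul, mul_assoc] at h1 h2
  rw [Matrix.mul_fin_two, Matrix.one_fin_two]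
  refine Matrix.ext fun i j => ?_
  fin_cases i <;> fin_cases j
  · simpa [smul_smul, mul_comm] using h2
  · simp
  · simp
  · simpa [smul_smul, mul_comm, add_comm] using h1

theorem inv_mul_extMatrix {a : BoundedOp} {b : ℂ} (h : IsUnit a ∨ b ≠ 0) :
    extMatrixInv a b * extMatrix a b = 1 := by
  have h1 := inverse_mul_cancel _ (isUnit_mul_star_add h)
  have h2 := inverse_mul_cancel _ (isUnit_star_mul_add h)
  set Y : Matrix (Fin 2) (Fin 2) BoundedOp :=
    !![Ring.inverse (star a * a + (conj b * b) • 1) * star a,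
      -(b • Ring.inverse (star a * a + (conj b * b) • 1));
      conj b • Ring.inverse (a * star a + (conj b * b) • 1),
      Ring.inverse (a * star a + (conj b * b) • 1) * a] with hY
  have key : Y * extMatrix a b = 1 := by
    rw [hY]
    generalize Ring.inverse (a * star a + (conj b * b) • 1) = p at h2 ⊢
    generalize Ring.inverse (star a * a + (conj b * b) • 1) = q at h1 ⊢
    rw [mul_add, mul_smul_comm, mul_one, ← mul_assoc] at h1 h2; unfold extMatrix
    rw [Matrix.mul_fin_two, Matrix.one_fin_two]
    refine Matrix.ext fun i j => ?_
    fin_cases i <;> fin_cases j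
    · simpa [smul_smul, mul_comm] using h1
    · simp
    · simp
    · simpa [smul_smul, mul_comm, add_comm] using h2
  have := left_inv_eq_right_inv key (extMatrix_mul_inv h)
  rw [← this, key]

theorem ringInverse_extMatrix {a : BoundedOp} {b : ℂ} (h : IsUnit a ∨ b ≠ 0) :
    Ring.inverse (extMatrix a b) = extMatrixInv a b :=
  ring_inverse_eq (extMatrix_mul_inv h) (inv_mul_extMatrix h)

end ExternalSymbol

/-! ### Symbols of operators with shifts in charts -/

section ChartSymbols

open scoped BoundedContinuousFunction

theorem DiffOp.symbol_codiff (P : DiffOp n M) (g : Diffeo n M) (m : ℤ) (x : M) (ξ : Covec n) :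
    P.symbol (iter g m x) (codiff g m x ξ) = I *
      ((ξ (iterDiff g (-m) (iter g m x) (P.X (iter g m x))) : ℂ)
        + I * (ξ (iterDiff g (-m) (iter g m x) (P.Y (iter g m x))) : ℂ)) := by
  rw [codiff_eq]
  rfl

theorem DiffOp.symbol_codiff_chart (P : DiffOp n M) (g : Diffeo n M) (m : ℤ) (c : M)
    (y η : Model n) :
    P.symbol (iter g m (chartPoint c y)) (codiff g m (chartPoint c y) (chartCov c y η))
      = I * ((inner ℝ η (pullField g P.X m c y) : ℂ)
        + I * (inner ℝ η (pullField g P.Y m c y) : ℂ)) :=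
  P.symbol_codiff g m _ (chartCov c y η)

theorem DiffOp.symbol_codiff_add (P : DiffOp n M) (g : Diffeo n M) (i m : ℤ) (x : M) (ξ : Covec n) :
    P.symbol (iter g i (iter g m x)) (codiff g i (iter g m x) (codiff g m x ξ))
      = P.symbol (iter g (i + m) x) (codiff g (i + m) x ξ) := by
  have h1 := P.symbol_codiff g i (iter g m x) (codiff g m x ξ)
  rw [h1, P.symbol_codiff g (i + m) x ξ, codiff_eq]
  have key : ∀ v : Model n, iterDiff g (-m) (iter g m x) (iterDiff g (-i) (iter g i (iter g m x)) v)
      = iterDiff g (-(i + m)) (iter g (i + m) x) v := by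
    intro v; rw [iter_add, neg_add_rev, iterDiff_add, iter_neg_iter]; rfl
  have hX : (P.X (iter g i (iter g m x)) : Model n) = P.X (iter g (i + m) x) := by rw [iter_add]
  have hY : (P.Y (iter g i (iter g m x)) : Model n) = P.Y (iter g (i + m) x) := by rw [iter_add]
  rw [comp_apply, comp_apply]
  erw [key, key, hX, hY]

theorem IsIsometry.exists_bound_field (hg : IsIsometry h g) (hX : SmoothField X)
    (x : M) (ξ : Covec n) :
    ∃ C, ∀ m, |ξ (iterDiff g (-m) (iter g m x) (X (iter g m x)))| ≤ C := by
  set y := extChartAt (𝓡 n) x x with hy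
  have hy' : y ∈ chartDomain x := mem_extChartAt_target x
  have hyx : chartPoint x y = x := extChartAt_to_inv x
  obtain ⟨δ, hδ, C, -, -, hC, -⟩ := (hg.isUniformFamily_pullField hX x).exists_ball
    (isOpen_chartDomain x) hy'
  refine ⟨‖ξ.comp (chartTan x y)‖ * C, fun m => ?_⟩
  have h1 := hC m y (mem_ball_self hδ)
  have h2 := (ξ.comp (chartTan x y)).le_opNorm (pullField g X m x y)
  have h3 : ∀ v : Model n, chartTan x y (chartDiff x (chartPoint x y) v) = v := fun v =>
    congrArg (fun L => L v) (chartTan_comp_chartDiff hy')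
  rw [comp_apply, pullField, h3] at h2
  have h4 : ∀ x', x' = x → ξ (iterDiff g (-m) (iter g m x') (X (iter g m x')))
      = ξ (iterDiff g (-m) (iter g m x) (X (iter g m x))) := fun x' hx' => by rw [hx']
  rw [h4 _ hyx] at h2
  exact h2.trans (mul_le_mul_of_nonneg_left h1 (norm_nonneg _))

theorem IsIsometry.exists_bound_symbol (hg : IsIsometry h g)
    (P : DiffOp n M) (x : M) (ξ : Covec n) :
    ∃ C, ∀ m, ‖P.symbol (iter g m x) (codiff g m x ξ)‖ ≤ C := by
  obtain ⟨C1, h1⟩ := hg.exists_bound_field P.smooth_X x ξ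
  obtain ⟨C2, h2⟩ := hg.exists_bound_field P.smooth_Y x ξ
  refine ⟨C1 + C2, fun m => ?_⟩
  rw [P.symbol_codiff, norm_mul, norm_I, one_mul]
  refine (norm_add_le _ _).trans (add_le_add ?_ ?_)
  · rw [norm_real]; exact h1 m
  · rw [norm_mul, norm_I, one_mul, norm_real]; exact h2 m

theorem IsIsometry.symbol_eq (hg : IsIsometry h g) (D : ShiftOp n M) (x : M) (ξ : Covec n) :
    D.symbol g x ξ = ∑ k ∈ D.supp, weightedShift k
      (boundedSeq fun m => (D.op k).symbol (iter g m x) (codiff g m x ξ)) :=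
  shiftSum_eq fun k _ => hg.exists_bound_symbol (D.op k) x ξ

theorem IsIsometry.coeff_symbol (hg : IsIsometry h g)
    (D : ShiftOp n M) (x : M) (ξ : Covec n) (i j : ℤ) :
    coeff (D.symbol g x ξ) i j = ∑ k ∈ D.supp,
      if i + k = j then (D.op k).symbol (iter g i x) (codiff g i x ξ) else 0 := by
  rw [hg.symbol_eq, ← coeffL_apply, map_sum]
  refine sum_congr rfl fun k _ => ?_
  obtain ⟨C, hC⟩ := hg.exists_bound_symbol (D.op k) x ξ
  rw [coeffL_apply, coeff_weightedShift, boundedSeq_apply hC]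

theorem IsIsometry.symbol_smul (hg : IsIsometry h g)
    (D : ShiftOp n M) (x : M) (ξ : Covec n) (r : ℝ) :
    D.symbol g x (r • ξ) = (r : ℂ) • D.symbol g x ξ := by
  refine boundedOp_ext fun i j => ?_
  rw [← coeffL_apply ((r : ℂ) • _), map_smul, coeffL_apply, hg.coeff_symbol, hg.coeff_symbol,
    smul_sum]
  refine sum_congr rfl fun k _ => ?_
  split_ifs
  · rw [DiffOp.symbol_codiff, DiffOp.symbol_codiff, smul_eq_mul]; simp; push_cast; ring
  · simp

theorem IsIsometry.symbol_codiff (hg : IsIsometry h g)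
    (D : ShiftOp n M) (m : ℤ) (x : M) (ξ : Covec n) :
    D.symbol g (iter g m x) (codiff g m x ξ) = shiftConj m (D.symbol g x ξ) := by
  refine boundedOp_ext fun i j => ?_
  have h1 := hg.coeff_symbol D (iter g m x) (codiff g m x ξ) i j
  rw [h1, coeff_shiftConj, hg.coeff_symbol]
  refine sum_congr rfl fun k _ => ?_
  rw [DiffOp.symbol_codiff_add]
  exact if_congr (by omega) rfl rfl

def coordSeq (i : Fin n) : (ℤ →ᵇ Model n) →L[ℝ] (ℤ →ᵇ ℂ) :=
  (ofRealCLM.comp (EuclideanSpace.proj i)).compLeftContinuousBounded ℤ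

theorem coordSeq_apply (i : Fin n) (f : ℤ →ᵇ Model n) (m : ℤ) :
    coordSeq i f m = ((f m i : ℝ) : ℂ) := rfl

/-- The components of the vector fields `(g^m)^* (X + iY)` in the chart centred at `c`. -/
def DiffOp.fieldSeq (P : DiffOp n M) (g : Diffeo n M) (c : M) (i : Fin n) (y : Model n) : ℤ →ᵇ ℂ :=
  coordSeq i (boundedSeq fun m => pullField g P.X m c y)
    + I • coordSeq i (boundedSeq fun m => pullField g P.Y m c y)

theorem IsIsometry.contDiffOn_fieldSeq (hg : IsIsometry h g)
    (P : DiffOp n M) (c : M) (i : Fin n) : SmoothOn (P.fieldSeq g c i) (chartDomain c) := by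
  have hX := (hg.isUniformFamily_pullField P.smooth_X c).contDiffOn (isOpen_chartDomain c)
  have hY := (hg.isUniformFamily_pullField P.smooth_Y c).contDiffOn (isOpen_chartDomain c)
  exact ((coordSeq i).contDiff.comp_contDiffOn hX).add
    (((coordSeq i).contDiff.comp_contDiffOn hY).const_smul I)

theorem IsIsometry.boundedSeq_symbol (hg : IsIsometry h g)
    (P : DiffOp n M) (hy : y ∈ chartDomain c) (η : Model n) :
    (boundedSeq fun m => P.symbol (iter g m (chartPoint c y))
        (codiff g m (chartPoint c y) (chartCov c y η)))
      = ∑ i, ((η i : ℝ) * I) • P.fieldSeq g c i y := by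
  obtain ⟨C, hC⟩ := hg.exists_bound_symbol P (chartPoint c y) (chartCov c y η)
  obtain ⟨δ, hδ, CX, -, -, hX, -⟩ := (hg.isUniformFamily_pullField P.smooth_X c).exists_ball
    (isOpen_chartDomain c) hy
  obtain ⟨δ', hδ', CY, -, -, hY, -⟩ := (hg.isUniformFamily_pullField P.smooth_Y c).exists_ball
    (isOpen_chartDomain c) hy
  ext m
  rw [boundedSeq_apply hC, P.symbol_codiff_chart, BoundedContinuousFunction.sum_apply,
    PiLp.inner_apply, PiLp.inner_apply]
  push_cast
  rw [mul_sum, ← sum_add_distrib, mul_sum]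
  refine sum_congr rfl fun i _ => ?_
  change _ = ((η i) * I) * (coordSeq i (boundedSeq fun m => pullField g P.X m c y) m
    + I * coordSeq i (boundedSeq fun m => pullField g P.Y m c y) m)
  rw [coordSeq_apply, coordSeq_apply, boundedSeq_apply (fun m => hX m y (mem_ball_self hδ)),
    boundedSeq_apply (fun m => hY m y (mem_ball_self hδ'))]
  simp
  ring

/-- The symbol of `D` in the chart centred at `c`. -/
def ShiftOp.chartSymbol (g : Diffeo n M) (D : ShiftOp n M) (c : M) (z : Coord n q) : BoundedOp :=
  D.symbol g (chartPoint c (baseCoord z)) (chartCov c (baseCoord z) (fibreVec z))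

theorem IsIsometry.isGood_chartSymbol (hg : IsIsometry h g)
    (D : ShiftOp n M) (c : M) : IsGood (D.chartSymbol g c)
      {z : Coord n q | baseCoord z ∈ chartDomain c} := by
  have h1 : IsGood (fun z => ∑ k ∈ D.supp, weightedShift k
      (∑ i, ((fibreVec z i) * I) • (D.op k).fieldSeq g c i (baseCoord z)))
      {z : Coord n q | baseCoord z ∈ chartDomain c} := by
    refine IsGood.sum fun k _ => isGood_weightedShift k (ContDiffOn.sum fun i _ => ?_)
    exact (ContDiff.restrict_scalars ℝ (contDiff_smul (𝕜 := ℂ))).comp_contDiffOn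
      ((((ofRealCLM.contDiff.comp ((EuclideanSpace.proj i).contDiff.comp contDiff_fibreVec))).mul
      contDiff_const).contDiffOn.prodMk ((hg.contDiffOn_fieldSeq (D.op k) c i).comp
      contDiff_baseCoord.contDiffOn fun z hz => hz))
  refine h1.congr fun z hz => ?_
  unfold ShiftOp.chartSymbol
  rw [hg.symbol_eq]
  exact sum_congr rfl fun k _ => by rw [hg.boundedSeq_symbol _ hz]

theorem ShiftOp.IsElliptic.isUnit_chartSymbol (hD : D.IsElliptic g) (hz :
    baseCoord z ∈ chartDomain c) (hη : fibreVec z ≠ 0) :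
    IsUnit (D.chartSymbol g c z) := by
  refine hD _ _ fun h0 => hη ?_
  have h1 : (chartCov c (baseCoord z) (fibreVec z)).comp (chartTan c (baseCoord z)) = 0 := by
    change chartCov c (baseCoord z) (fibreVec z) = 0 at h0; rw [h0]; rfl
  rw [chartCov, comp_assoc, chartDiff_comp_chartTan hz] at h1
  exact innerSL_eq_zero.1 h1

end ChartSymbols

/-! ### Invertibility of the symbols -/

section SymbolAlgebra

theorem isSymbol_of_isGood {a : OpFunction n M q N}
    (hgood : ∀ (c : M) (i j : Fin N), IsGood (fun z => inChart h a c z i j) (coneDomain q c))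
    (hinv : ∀ (x : M) (ξ : TangentSpace (𝓡 n) x →L[ℝ] ℝ) (w : Fin q → ℝ), (ξ ≠ 0 ∨ w ≠ 0) →
      ∀ (i j : Fin N) (m : ℤ), homExt h a (iter g m x) (codiff g m x ξ) w i j
        = shiftConj m (homExt h a x ξ w i j)) : IsSymbol h g a where
  smooth c i j k l := (hgood c i j).contDiffOn_coeff k l
  decay c i j K hK hKc r L := (hgood c i j).exists_decay_bound (isOpen_coneDomain q c) hK hKc r L
  invariant x ξ w hξ i j m k l := by rw [hinv x ξ w hξ i j m, coeff_shiftConj]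

theorem isGood_extMatrix {E : Type*} [NormedAddCommGroup E] [NormedSpace ℝ E] {Ω : Set E}
    {a : E → BoundedOp} {b : E → ℂ} (ha : IsGood a Ω) (hb : SmoothOn b Ω) (i j : Fin 2) :
    IsGood (fun z => extMatrix (a z) (b z) i j) Ω := by
  fin_cases i <;> fin_cases j
  · exact ha
  · exact isGood_const_one.smul hb
  · exact (isGood_const_one.smul (Complex.conjCLE.contDiff.comp_contDiffOn hb)).neg
  · exact ha.star

theorem isGood_extMatrixInv {E : Type*} [NormedAddCommGroup E] [NormedSpace ℝ E] {Ω : Set E}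
    {a : E → BoundedOp} {b : E → ℂ} (ha : IsGood a Ω) (hb : SmoothOn b Ω)
    (hu : ∀ z ∈ Ω, IsUnit (a z) ∨ b z ≠ 0) (i j : Fin 2) :
    IsGood (fun z => extMatrixInv (a z) (b z) i j) Ω := by
  have hb' := Complex.conjCLE.contDiff.comp_contDiffOn hb
  have hp := ((ha.mul ha.star).add (isGood_const_one.smul (hb'.mul hb))).inverse
      fun z hz => isUnit_star_mul_add (hu z hz)
  have hq := ((ha.star.mul ha).add (isGood_const_one.smul (hb'.mul hb))).inverse
      fun z hz => isUnit_mul_star_add (hu z hz)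
  fin_cases i <;> fin_cases j
  · exact ha.star.mul hp
  · exact (hq.smul hb).neg
  · exact hp.smul hb'
  · exact ha.mul hq

theorem shiftConj_extMatrix (m : ℤ) (a : BoundedOp) (b : ℂ) (i j : Fin 2) :
    extMatrix (shiftConj m a) b i j = shiftConj m (extMatrix a b i j) := by
  fin_cases i <;> fin_cases j <;> simp [extMatrix, shiftConj_star, shiftConj_one, map_neg, map_smul]

theorem shiftConj_extMatrixInv (m : ℤ) {a : BoundedOp} {b : ℂ} (hu : IsUnit a ∨ b ≠ 0)
    (i j : Fin 2) : extMatrixInv (shiftConj m a) b i j = shiftConj m (extMatrixInv a b i j) := by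
  have h1 := shiftConj_inverse m (isUnit_mul_star_add hu)
  have h2 := shiftConj_inverse m (isUnit_star_mul_add hu)
  simp only [map_add, map_smul, shiftConj_mul, shiftConj_star, shiftConj_one] at h1 h2
  fin_cases i <;> fin_cases j
  · simp only [extMatrixInv]; simp [shiftConj_mul, shiftConj_star, h2]
  · simp [extMatrixInv, h1]
  · simp [extMatrixInv, h2]
  · simp [extMatrixInv, shiftConj_mul, h1]

/-- The complex number `t + iτ`. -/
def extraComplex (w : Fin 2 → ℝ) : ℂ := w 0 + w 1 * I

theorem extraComplex_eq_zero {w : Fin 2 → ℝ} : extraComplex w = 0 ↔ w = 0 := by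
  constructor
  · intro h
    have h0 := congrArg Complex.re h
    have h1 := congrArg Complex.im h
    simp [extraComplex] at h0 h1; ext i; fin_cases i <;> assumption
  · rintro rfl; simp [extraComplex]

theorem extraComplex_smul (r : ℝ) (w : Fin 2 → ℝ) :
    extraComplex (r • w) = (r : ℂ) * extraComplex w := by
  simp [extraComplex]; ring

theorem contDiff_extraComplex : ContDiff ℝ ∞ extraComplex := by
  have : ∀ i : Fin 2, ContDiff ℝ ∞ fun w : Fin 2 → ℝ => ((w i) : ℂ) := fun i =>
    ofRealCLM.contDiff.comp (contDiff_apply ℝ ℝ i)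
  exact (this 0).add ((this 1).mul contDiff_const)

/-- The symbol of `D̃ # A`. -/
def extSymbol (g : Diffeo n M) (D : ShiftOp n M) : OpFunction n M 2 2 :=
  fun x ξ w => extMatrix (D.symbol g x ξ) (extraComplex w)

theorem radius_ne_zero (h : Metric n M) (x : M) {ξ : Covec n} {w : Fin q → ℝ}
    (hr : radius h x ξ w ≠ 0) : ξ ≠ 0 ∨ w ≠ 0 := by
  by_contra! h0
  refine hr ?_
  obtain ⟨h1, h2⟩ := h0
  subst h1; subst h2
  unfold radius
  erw [((covectorNormSq_eq h x 0).trans (dualNormSq_zero _))]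
  simp

theorem radius_pos (h : Metric n M) (x : M) {ξ : Covec n} {w : Fin q → ℝ}
    (hξ : ξ ≠ 0 ∨ w ≠ 0) : 0 < radius h x ξ w := by
  refine Real.sqrt_pos.2 ?_
  rw [(covectorNormSq_eq h x ξ)]
  rcases hξ with h1 | h1
  · exact add_pos_of_pos_of_nonneg ((isPosDefForm_innerAt h x).dualNormSq_pos h1)
      (sum_nonneg fun _ _ => sq_nonneg _)
  · obtain ⟨j, hj⟩ := ne_iff.1 h1
    refine add_pos_of_nonneg_of_pos ((isPosDefForm_innerAt h x).dualNormSq_nonneg ξ) ?_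
    exact Finset.sum_pos' (fun _ _ => sq_nonneg _) ⟨j, Finset.mem_univ _, by
      simp at hj; positivity⟩

theorem IsIsometry.homExt_symbolFun (hg : IsIsometry h g) (D : ShiftOp n M) (x : M)
    (ξ : Covec n) (w : Fin 0 → ℝ) (i j : Fin 1) :
    homExt h (D.symbolFun g) x ξ w i j = (((radius h x ξ w)⁻¹ : ℝ) : ℂ) • D.symbol g x ξ :=
  hg.symbol_smul D x ξ _

theorem IsIsometry.homExt_extSymbol (hg : IsIsometry h g) (D : ShiftOp n M) (x : M)
    (ξ : Covec n) (w : Fin 2 → ℝ) :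
    homExt h (extSymbol g D) x ξ w = extMatrix ((((radius h x ξ w)⁻¹ : ℝ) : ℂ) • D.symbol g x ξ)
        ((((radius h x ξ w)⁻¹ : ℝ) : ℂ) * extraComplex w) := by
  rw [← hg.symbol_smul, ← extraComplex_smul]
  rfl

theorem IsIsometry.inChart_symbolFun (hg : IsIsometry h g) (D : ShiftOp n M) (c : M)
    (z : Coord n 0) (i j : Fin 1) :
    inChart h (D.symbolFun g) c z i j = (((chartRadius h c z)⁻¹ : ℝ) : ℂ) • D.chartSymbol g c z :=
  hg.homExt_symbolFun D _ (chartCov c (baseCoord z) (fibreVec z)) _ i j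

theorem IsIsometry.inChart_extSymbol (hg : IsIsometry h g) (D : ShiftOp n M) (c : M)
    (z : Coord n 2) :
    inChart h (extSymbol g D) c z
      = extMatrix ((((chartRadius h c z)⁻¹ : ℝ) : ℂ) • D.chartSymbol g c z)
        ((((chartRadius h c z)⁻¹ : ℝ) : ℂ) * extraComplex (extraCoord z)) :=
  hg.homExt_extSymbol D _ (chartCov c (baseCoord z) (fibreVec z)) _

theorem contDiffOn_ofReal_inv_chartRadius (h : Metric n M) (c : M) :
    SmoothOn (fun z => (((chartRadius (q := q) h c z)⁻¹ : ℝ) : ℂ)) (coneDomain q c) :=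
  ofRealCLM.contDiff.comp_contDiffOn
    ((contDiffOn_chartRadius h c).inv fun _ hz => (chartRadius_pos h hz).ne')

theorem fibreVec_ne_zero_or (hz : z ∈ coneDomain q c) : fibreVec z ≠ 0 ∨ extraCoord z ≠ 0 :=
  hz.2.imp_left fun h0 h1 => h0 (fibreVec_eq_zero.1 h1)

theorem IsIsometry.isGood_scaledSymbol (hg : IsIsometry h g) (D : ShiftOp n M) (c : M) :
    IsGood (fun z => (((chartRadius (q := q) h c z)⁻¹ : ℝ) : ℂ) • D.chartSymbol g c z)
      (coneDomain q c) :=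
  ((hg.isGood_chartSymbol D c).mono fun _ hz => hz.1).smul (contDiffOn_ofReal_inv_chartRadius h c)

theorem isUnit_ofReal_smul {r : ℝ} (hr : r ≠ 0) {A : BoundedOp} (hA : IsUnit A) :
    IsUnit ((r : ℂ) • A) := by
  have : (r : ℂ) • A = Units.mk0 r (by exact_mod_cast hr) • A := rfl
  rw [this]
  exact (isUnit_smul_iff _ _).2 hA

theorem IsIsometry.isUnit_or_extSymbol (hD : D.IsElliptic g) (x : M)
    {ξ : Covec n} {w : Fin 2 → ℝ} (hξ : ξ ≠ 0 ∨ w ≠ 0) {r : ℝ} (hr : r ≠ 0) :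
    IsUnit ((r : ℂ) • D.symbol g x ξ) ∨ (r : ℂ) * extraComplex w ≠ 0 := by
  refine hξ.imp (fun h1 => isUnit_ofReal_smul hr (hD x ξ h1)) fun h1 => ?_
  exact mul_ne_zero (by exact_mod_cast hr) (extraComplex_eq_zero.not.2 h1)

theorem ShiftOp.IsElliptic.isUnit_or_chart (hD : D.IsElliptic g) {z : Coord n 2} (hz :
    z ∈ coneDomain 2 c) {r : ℝ} (hr : r ≠ 0) :
    IsUnit ((r : ℂ) • D.chartSymbol g c z) ∨ (r : ℂ) * extraComplex (extraCoord z) ≠ 0 :=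
  (fibreVec_ne_zero_or hz).imp (fun h1 => isUnit_ofReal_smul hr (hD.isUnit_chartSymbol hz.1 h1))
    fun h1 => mul_ne_zero (by exact_mod_cast hr) (extraComplex_eq_zero.not.2 h1)

theorem IsIsometry.isInvertibleSymbol_symbolFun (hg : IsIsometry h g) (hD : D.IsElliptic g) :
    IsInvertibleSymbol h g (D.symbolFun g) := by
  refine ⟨isSymbol_of_isGood (fun c i j => ?_) fun x ξ w _ i j m => ?_,
    fun x ξ _ => of fun _ _ => Ring.inverse (D.symbol g x ξ),
    isSymbol_of_isGood (fun c i j => ?_) fun x ξ w hξ i j m => ?_, fun x ξ w hr => ?_⟩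
  · exact (hg.isGood_scaledSymbol D c).congr fun z _ => hg.inChart_symbolFun D c z i j
  · have h1 := hg.homExt_symbolFun D (iter g m x) (codiff g m x ξ) w i j
    have h2 := hg.homExt_symbolFun D x ξ w i j
    refine h1.trans ((congrArg₂ (fun r A => ((r⁻¹ : ℝ) : ℂ) • A) (hg.radius_codiff m x ξ w)
      (hg.symbol_codiff D m x ξ)).trans ?_)
    rw [h2, map_smul]
  · have h0 : ∀ z ∈ coneDomain 0 c,
        IsUnit ((((chartRadius h c z)⁻¹ : ℝ) : ℂ) • D.chartSymbol g c z) := by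
      intro z hz
      refine isUnit_ofReal_smul (inv_ne_zero (chartRadius_pos h hz).ne')
        (hD.isUnit_chartSymbol hz.1 ((fibreVec_ne_zero_or hz).resolve_right fun h => h ?_))
      exact elim _ _
    refine ((hg.isGood_scaledSymbol D c).inverse h0).congr fun z _ => ?_
    exact congrArg Ring.inverse (hg.inChart_symbolFun D c z 0 0)
  · have hξ' := hξ.resolve_right fun h => h (elim _ _)
    have h1 := hg.homExt_symbolFun D (iter g m x) (codiff g m x ξ) w 0 0
    have h2 := hg.homExt_symbolFun D x ξ w 0 0
    have h3 := shiftConj_inverse m (isUnit_ofReal_smul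
      (inv_ne_zero (radius_pos h x (w := w) (Or.inl hξ')).ne') (hD x ξ hξ'))
    refine (congrArg Ring.inverse h1).trans (Eq.trans ?_ (congrArg (fun A =>
      shiftConj m (Ring.inverse A)) h2).symm)
    refine (congrArg₂ (fun r A => Ring.inverse (((r⁻¹ : ℝ) : ℂ) • A))
      (hg.radius_codiff m x ξ w) (hg.symbol_codiff D m x ξ)).trans ?_
    rw [h3, map_smul]
  · have hξ' : ξ ≠ 0 := (radius_ne_zero h x (by rw [hr]; exact one_ne_zero)).resolve_right
      fun h => h (elim _ _)
    constructor
    · refine Matrix.ext fun i j => ?_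
      rw [Matrix.mul_apply, Finset.univ_unique, Finset.sum_singleton, elim i j, Matrix.one_apply_eq]
      exact mul_inverse_cancel _ (hD x ξ hξ')
    · refine Matrix.ext fun i j => ?_
      rw [Matrix.mul_apply, Finset.univ_unique, Finset.sum_singleton, elim i j, Matrix.one_apply_eq]
      exact inverse_mul_cancel _ (hD x ξ hξ')

theorem contDiffOn_scaledExtra (h : Metric n M) (c : M) :
    SmoothOn (fun z : Coord n 2 => (((chartRadius h c z)⁻¹ : ℝ) : ℂ)
      * extraComplex (extraCoord z)) (coneDomain 2 c) :=
  (contDiffOn_ofReal_inv_chartRadius h c).mul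
    (contDiff_extraComplex.comp contDiff_extraCoord).contDiffOn

theorem IsIsometry.isInvertibleSymbol_extSymbol (hg : IsIsometry h g) (hD : D.IsElliptic g) :
    IsInvertibleSymbol h g (extSymbol g D) := by
  have hI : ∀ x (ξ : Covec n) w,
      homExt h (fun x ξ w => extMatrixInv (D.symbol g x ξ) (extraComplex w)) x ξ w
        = extMatrixInv ((((radius h x ξ w)⁻¹ : ℝ) : ℂ) • D.symbol g x ξ)
          ((((radius h x ξ w)⁻¹ : ℝ) : ℂ) * extraComplex w) := by
    intro x ξ w; rw [← hg.symbol_smul, ← extraComplex_smul]; rfl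
  refine ⟨isSymbol_of_isGood (fun c i j => ?_) fun x ξ w _ i j m => ?_,
    fun x ξ w => extMatrixInv (D.symbol g x ξ) (extraComplex w),
    isSymbol_of_isGood (fun c i j => ?_) fun x ξ w hξ i j m => ?_, fun x ξ w hr => ?_⟩
  · refine (isGood_extMatrix (hg.isGood_scaledSymbol D c) (contDiffOn_scaledExtra h c) i j).congr
      fun z _ => ?_
    rw [hg.inChart_extSymbol]
  · have h1 := hg.homExt_extSymbol D (iter g m x) (codiff g m x ξ) w
    have h2 := hg.homExt_extSymbol D x ξ w
    rw [h1, h2, ← shiftConj_extMatrix, map_smul]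
    exact congrArg₂ (fun r A => extMatrix (((r⁻¹ : ℝ) : ℂ) • A)
      (((r⁻¹ : ℝ) : ℂ) * extraComplex w) i j) (hg.radius_codiff m x ξ w)
      (hg.symbol_codiff D m x ξ)
  · refine (isGood_extMatrixInv (hg.isGood_scaledSymbol D c) (contDiffOn_scaledExtra h c)
      (fun z hz => hD.isUnit_or_chart hz (inv_ne_zero (chartRadius_pos h hz).ne')) i j).congr
      fun z _ => ?_
    exact congrArg (fun A => A i j) (hI _ (chartCov c (baseCoord z) (fibreVec z)) _)
  · have h1 := hI (iter g m x) (codiff g m x ξ) w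
    have h2 := hI x ξ w
    rw [h1, h2, ← shiftConj_extMatrixInv m (IsIsometry.isUnit_or_extSymbol hD x hξ
      (inv_ne_zero (radius_pos h x hξ).ne')), map_smul]
    exact congrArg₂ (fun r A => extMatrixInv (((r⁻¹ : ℝ) : ℂ) • A)
      (((r⁻¹ : ℝ) : ℂ) * extraComplex w) i j) (hg.radius_codiff m x ξ w)
      (hg.symbol_codiff D m x ξ)
  · have hξ := radius_ne_zero h x (ξ := ξ) (by rw [hr]; exact one_ne_zero)
    have h1 := IsIsometry.isUnit_or_extSymbol hD x hξ one_ne_zero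
    rw [ofReal_one, one_smul, one_mul] at h1; exact ⟨extMatrix_mul_inv h1, inv_mul_extMatrix h1⟩

end SymbolAlgebra

/-! ### Integrals over charts -/

section ChartIntegrals

section Partition

variable (n M) in
theorem chartPartition_subordinate (c : M) :
    tsupport (chartPartition n M c) ⊆ (chartAt (Model n) c).source :=
  (SmoothPartitionOfUnity.exists_isSubordinate_chartAt_source (𝓡 n) M).choose_spec c

variable (n M) in
/-- The finite set of indices of nonzero functions of the partition of unity. -/
def chartIndex : Finset M :=
  ((chartPartition n M).locallyFinite.finite_nonempty_of_compact).toFinset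

theorem chartPartition_eq_zero (hc : c ∉ chartIndex n M) (x : M) : chartPartition n M c x = 0 := by
  by_contra h
  exact hc ((Set.Finite.mem_toFinset _).2 ⟨x, h⟩)

theorem chartPartition_eq_zero_of_notMem {x : M} (hx : x ∉ (chartAt (Model n) c).source) :
    chartPartition n M c x = 0 :=
  image_eq_zero_of_notMem_tsupport fun h => hx (chartPartition_subordinate n M c h)

theorem sum_chartPartition (x : M) : ∑ c ∈ chartIndex n M, chartPartition n M c x = 1 := by
  rw [← (chartPartition n M).sum_eq_one (mem_univ x)]
  refine (finsum_eq_sum_of_support_subset _ fun c hc => ?_).symm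
  by_contra h
  exact hc (chartPartition_eq_zero h x)

end Partition

/-- A lift of the transition maps of the iterates of `g` to a space over the charts. -/
structure ChartLift (g : Diffeo n M) (V : Type*) [NormedAddCommGroup V]
    [NormedSpace ℝ V] where
  base : V → Model n
  lift : ℤ → M → M → V → V
  continuous_base : Continuous base
  base_lift : ∀ {m c c' z}, base z ∈ transDom g m c c' →
    base (lift m c c' z) = trans g m c c' (base z)
  lift_lift : ∀ {m c c' z}, base z ∈ transDom g m c c' → lift (-m) c' c (lift m c c' z) = z
  differentiableAt : ∀ {m c c' z}, base z ∈ transDom g m c c' → DifferentiableAt ℝ (lift m c c') z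

def baseLift (g : Diffeo n M) : ChartLift g (Model n) where
  base y := y
  lift := trans g
  continuous_base := continuous_id
  base_lift _ := rfl
  lift_lift := trans_neg_trans
  differentiableAt hy := (hasFDerivAt_trans hy).differentiableAt

def cotangentLift (q : ℕ) (g : Diffeo n M) : ChartLift g (Coord n q) where
  base := baseCoord
  lift := cotrans g
  continuous_base := contDiff_baseCoord.continuous
  base_lift _ := baseCoord_cotrans
  lift_lift hz := cotrans_neg_cotrans hz
  differentiableAt hz := (hasFDerivAt_cotrans hz).differentiableAt

namespace ChartLift

variable {V : Type*} [NormedAddCommGroup V] [NormedSpace ℝ V] (L : ChartLift g V)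

def domain (c : M) : Set V := L.base ⁻¹' chartDomain c

def point (c : M) (z : V) : M := chartPoint c (L.base z)

def liftDom (m : ℤ) (c c' : M) : Set V := L.base ⁻¹' transDom g m c c'

variable {L} {z : V}

theorem isOpen_domain : IsOpen (L.domain c) := (isOpen_chartDomain c).preimage L.continuous_base

theorem isOpen_liftDom : IsOpen (L.liftDom m c c') := isOpen_transDom.preimage L.continuous_base

theorem liftDom_subset : L.liftDom m c c' ⊆ L.domain c := fun _ hz => hz.1

theorem continuousOn_point : ContinuousOn (L.point c) (L.domain c) :=
  (continuousOn_chartPoint c).comp L.continuous_base.continuousOn fun _ hz => hz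

theorem lift_mem (hz : z ∈ L.liftDom m c c') : L.lift m c c' z ∈ L.liftDom (-m) c' c := by
  change L.base (L.lift m c c' z) ∈ transDom g (-m) c' c
  rw [L.base_lift hz]
  exact trans_mem_transDom hz

theorem point_lift (hz : z ∈ L.liftDom m c c') :
    L.point c' (L.lift m c c' z) = iter g m (L.point c z) := by
  unfold point
  rw [L.base_lift hz]
  exact chartPoint_trans hz

theorem mem_liftDom_iff (hz : z ∈ L.domain c) :
    z ∈ L.liftDom m c c' ↔ iter g m (L.point c z) ∈ (chartAt (Model n) c').source :=
  ⟨fun h => h.2, fun h => ⟨hz, h⟩⟩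

theorem image_lift : L.lift m c c' '' L.liftDom m c c' = L.liftDom (-m) c' c := by
  refine Subset.antisymm (image_subset_iff.2 fun z hz => lift_mem hz) fun z hz => ?_
  have h1 := lift_mem hz
  have h2 := L.lift_lift hz
  rw [neg_neg] at h1 h2
  exact ⟨_, h1, h2⟩

theorem injOn_lift : InjOn (L.lift m c c') (L.liftDom m c c') := fun z hz z' hz' h => by
  rw [← L.lift_lift hz, h, L.lift_lift hz']

variable [FiniteDimensional ℝ V] [MeasureSpace V] [BorelSpace V]
  [(volume : Measure V).IsAddHaarMeasure]

theorem integral_lift {G G' : V → ℂ}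
    (hG : ∀ z ∈ L.liftDom m c c', G z = |(fderiv ℝ (L.lift m c c') z).det| • G' (L.lift m c c' z)) :
    ∫ z in L.liftDom m c c', G z = ∫ z in L.liftDom (-m) c' c, G' z := by
  rw [← image_lift, integral_image_eq_integral_abs_det_fderiv_smul volume
    isOpen_liftDom.measurableSet
    (fun z hz => (L.differentiableAt hz).hasFDerivAt.hasFDerivWithinAt) injOn_lift]
  exact setIntegral_congr_fun isOpen_liftDom.measurableSet hG

theorem integral_pair {G G' : V → ℂ}
    (hG : ∀ z ∈ L.liftDom m c c', G z = |(fderiv ℝ (L.lift m c c') z).det| • G' (L.lift m c c' z))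
    (hG' : ∀ z ∈ L.domain c', iter g (-m) (L.point c' z) ∉ (chartAt (Model n) c).source →
      G' z = 0) :
    ∫ z in L.domain c, (chartPartition n M c' (iter g m (L.point c z)) : ℂ) * G z
      = ∫ z in L.domain c', (chartPartition n M c' (L.point c' z) : ℂ) * G' z := by
  rw [setIntegral_eq_of_subset_of_forall_sdiff_eq_zero isOpen_domain.measurableSet
    (liftDom_subset (c' := c')), setIntegral_eq_of_subset_of_forall_sdiff_eq_zero
    (t := L.domain c') isOpen_domain.measurableSet (liftDom_subset (m := -m) (c' := c))]
  · refine integral_lift fun z hz => ?_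
    rw [hG z hz, point_lift hz]; simp; ring
  · rintro z ⟨hz, hz'⟩
    rw [hG' z hz fun h => hz' ((mem_liftDom_iff hz).2 h), mul_zero]
  · rintro z ⟨hz, hz'⟩
    rw [chartPartition_eq_zero_of_notMem fun h => hz' ((mem_liftDom_iff hz).2 h)]
    simp

variable (L) in
/-- The integral of a density given in charts. -/
def total (F : M → V → ℂ) : ℂ :=
  ∑ᶠ c : M, ∫ z in L.domain c, (chartPartition n M c (L.point c z) : ℂ) * F c z

theorem total_eq_sum (F : M → V → ℂ) : L.total F = ∑ c ∈ chartIndex n M,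
    ∫ z in L.domain c, (chartPartition n M c (L.point c z) : ℂ) * F c z := by
  refine finsum_eq_sum_of_support_subset _ fun c hc => ?_
  by_contra h
  refine hc ?_
  simp only [chartPartition_eq_zero (fun h' => h (by simpa using h'))]
  simp

/-- The density, multiplied by the partition of unity, is integrable in every chart. -/
def HasTotal (L : ChartLift g V) (F : M → V → ℂ) : Prop :=
  ∀ c, IntegrableOn (fun z => (chartPartition n M c (L.point c z) : ℂ) * F c z) (L.domain c)

theorem continuousOn_partition (m : ℤ) (c c' : M) :
    ContinuousOn (fun z => (chartPartition n M c' (iter g m (L.point c z)) : ℂ)) (L.domain c) :=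
  continuous_ofReal.comp_continuousOn ((chartPartition n M c').contMDiff.continuous
    |>.comp_continuousOn ((contMDiff_iter g m).continuous.comp_continuousOn continuousOn_point))

theorem integrableOn_partition_mul {G : V → ℂ} (hG : IntegrableOn G (L.domain c)) (m : ℤ) (c' : M) :
    IntegrableOn (fun z => (chartPartition n M c' (iter g m (L.point c z)) : ℂ) * G z)
      (L.domain c) := by
  refine Integrable.bdd_mul (c := 1) hG ?_ (Eventually.of_forall fun z => ?_)
  · exact (continuousOn_partition m c c').aestronglyMeasurable isOpen_domain.measurableSet
  · rw [norm_real, Real.norm_eq_abs, abs_of_nonneg ((chartPartition n M).nonneg _ _)]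
    exact (chartPartition n M).le_one _ _

theorem integral_eq_sum_partition {G : V → ℂ} (hG : IntegrableOn G (L.domain c)) (m : ℤ) :
    ∫ z in L.domain c, G z = ∑ c' ∈ chartIndex n M,
      ∫ z in L.domain c, (chartPartition n M c' (iter g m (L.point c z)) : ℂ) * G z := by
  rw [← integral_finsetSum _ fun c' _ => integrableOn_partition_mul hG m c']
  refine integral_congr_ae (Eventually.of_forall fun z => ?_)
  simp only
  rw [← sum_mul, ← ofReal_sum, sum_chartPartition, ofReal_one, one_mul]

theorem total_eq_of_lift {F F' : M → V → ℂ} (hFi : L.HasTotal F) (hFi' : L.HasTotal F') (m : ℤ)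
    (hF : ∀ c c', ∀ z ∈ L.liftDom m c c',
      F c z = |(fderiv ℝ (L.lift m c c') z).det| • F' c' (L.lift m c c' z)) :
    L.total F = L.total F' := by
  rw [total_eq_sum, total_eq_sum]
  have h1 : ∀ c, ∫ z in L.domain c, (chartPartition n M c (L.point c z) : ℂ) * F c z
      = ∑ c' ∈ chartIndex n M, ∫ z in L.domain c', (chartPartition n M c' (L.point c' z) : ℂ)
        * ((chartPartition n M c (iter g (-m) (L.point c' z)) : ℂ) * F' c' z) := by
    intro c; rw [integral_eq_sum_partition (hFi c) m]
    refine sum_congr rfl fun c' _ => integral_pair (fun z hz => ?_) fun z _ hz' => ?_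
    · rw [hF c c' z hz, point_lift hz, iter_neg_iter]; simp; ring
    · rw [chartPartition_eq_zero_of_notMem hz', ofReal_zero, zero_mul]
  simp_rw [h1]
  rw [sum_comm]
  refine sum_congr rfl fun c' _ => ?_
  rw [integral_eq_sum_partition (hFi' c') (-m)]
  refine sum_congr rfl fun c _ => integral_congr_ae (Eventually.of_forall fun z => ?_)
  ring

theorem total_eq_of_support {F : M → V → ℂ} (hF : ∀ c', ∀ z ∈ L.liftDom 0 c c',
      F c z = |(fderiv ℝ (L.lift 0 c c') z).det| • F c' (L.lift 0 c c' z))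
    (hF0 : ∀ c', ∀ z ∈ L.domain c', L.point c' z ∉ (chartAt (Model n) c).source → F c' z = 0)
    (hFi : IntegrableOn (F c) (L.domain c)) :
    L.total F = ∫ z in L.domain c, F c z := by
  rw [total_eq_sum, integral_eq_sum_partition hFi 0]
  refine sum_congr rfl fun c' _ => (integral_pair (hF c') fun z hz hz' => hF0 c' z hz ?_).symm
  rwa [neg_zero, iter_zero] at hz'

end ChartLift

end ChartIntegrals

/-! ### Integration over `M` and divergences -/

section ZeroExtension

variable {E F : Type*} [NormedAddCommGroup E] [NormedSpace ℝ E] [NormedAddCommGroup F]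
  [NormedSpace ℝ F] {U K : Set E} {f : E → F}

theorem tsupport_indicator_subset [T2Space E] (hK : IsCompact K) (h0 : ∀ y ∈ U, y ∉ K → f y = 0) :
    tsupport (U.indicator f) ⊆ K := by
  refine closure_minimal (fun y hy => ?_) hK.isClosed
  by_contra hyK
  refine hy ?_
  by_cases hyU : y ∈ U
  · rw [indicator_of_mem hyU, h0 y hyU hyK]
  · exact indicator_of_notMem hyU f

theorem contDiff_indicator (hU : IsOpen U) (hK : IsCompact K) (hKU : K ⊆ U)
    (hf : SmoothOn f U) (h0 : ∀ y ∈ U, y ∉ K → f y = 0) :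
    ContDiff ℝ ∞ (U.indicator f) := by
  refine contDiff_iff_contDiffAt.2 fun y => ?_
  by_cases hy : y ∈ U
  · refine (hf.contDiffAt (hU.mem_nhds hy)).congr_of_eventuallyEq ?_
    filter_upwards [hU.mem_nhds hy] with w hw using indicator_of_mem hw f
  · have h1 := fun h => hy (hKU (tsupport_indicator_subset hK h0 h))
    exact contDiffAt_const.congr_of_eventuallyEq (notMem_tsupport_iff_eventuallyEq.1 h1)

theorem integrableOn_of_compact_support [MeasurableSpace E] [BorelSpace E]
    {μ : Measure E} [IsFiniteMeasureOnCompacts μ] (hU : IsOpen U)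
    (hK : IsCompact K) (hKU : K ⊆ U) (hf : ContinuousOn f U) (h0 : ∀ y ∈ U, y ∉ K → f y = 0) :
    IntegrableOn f U μ :=
  ((hf.mono hKU).integrableOn_compact hK).of_forall_sdiff_eq_zero hU.measurableSet
    fun y hy => h0 y hy.1 hy.2

end ZeroExtension

section BaseIntegrals

/-- The density of the Riemannian volume in the chart centred at `c`. -/
def volDensity (h : Metric n M) (c : M) (y : Model n) : ℝ := sqrt (gram h c y).det

theorem gram_mulVec (h : Metric n M) (c : M) (y : Model n) (v : Model n) :
    v.ofLp ⬝ᵥ (gram h c y).mulVec v.ofLp = metricForm h c y v v := by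
  have h1 : v = ∑ i, v i • single i 1 := by
    ext j; simp [single_apply]
  conv_rhs => rw [h1]
  simp only [map_sum, map_smul, _root_.sum_apply, _root_.smul_apply, smul_eq_mul, dotProduct,
    Matrix.mulVec, gram_eq, mul_sum]
  rw [sum_comm]
  refine sum_congr rfl fun i _ => sum_congr rfl fun j _ => ?_
  ring

theorem det_gram_pos (h : Metric n M) (hy : y ∈ chartDomain c) : 0 < (gram h c y).det := by
  refine Matrix.PosDef.det_pos (Matrix.PosDef.of_dotProduct_mulVec_pos ?_ fun v hv => ?_)
  · ext i j; simp [gram_eq, metricForm_symm h c y (single i 1)]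
  · have h1 := gram_mulVec h c y (toLp 2 v)
    simp; rw [h1]; exact metricForm_pos h hy fun h0 => hv (by simpa using congrArg WithLp.ofLp h0)

theorem volDensity_pos (h : Metric n M) (hy : y ∈ chartDomain c) : 0 < volDensity h c y :=
  Real.sqrt_pos.2 (det_gram_pos h hy)

theorem contDiffOn_volDensity (h : Metric n M) (c : M) :
    SmoothOn (volDensity h c) (chartDomain c) := by
  have h1 : SmoothOn (fun y => (gram h c y).det) (chartDomain c) := by
    simp only [Matrix.det_apply]
    refine ContDiffOn.sum fun σ _ => ContDiffOn.const_smul _ (contDiffOn_prod fun i _ => ?_)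
    exact ((contDiffOn_metricForm h c).clm_apply contDiffOn_const).clm_apply contDiffOn_const
  exact h1.sqrt fun y hy => (det_gram_pos h hy).ne'

theorem IsIsometry.volDensity_trans (hg : IsIsometry h g) (hy : y ∈ transDom g m c c') :
    volDensity h c y = |(fderiv ℝ (trans g m c c') y).det| * volDensity h c' (trans g m c c'
      y) := by
  rw [(hasFDerivAt_trans hy).fderiv]
  set b := (basisFun (Fin n) ℝ).toBasis
  set J := toMatrix b b (transDiff g m c c' y) with hJ
  have hdet : (transDiff g m c c' y).det = J.det := (det_toMatrix b _).symm
  have hJe : ∀ j, transDiff g m c c' y (single j 1) = ∑ i, J i j • single i 1 := by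
    intro j
    have h1 : ∀ i, J i j = transDiff g m c c' y (single j 1) i := by
      intro i; simp [hJ, LinearMap.toMatrix_apply, b]
    ext k; simp [h1, single_apply]
  have hgram : gram h c y = J.transpose * gram h c' (trans g m c c' y) * J := by
    ext i j; rw [gram_eq, ← hg.metricForm_trans hy, hJe, hJe]
    simp only [map_sum, map_smul, _root_.sum_apply, _root_.smul_apply, smul_eq_mul,
      Matrix.mul_apply, Matrix.transpose_apply, gram_eq, sum_mul, mul_sum]
    refine sum_congr rfl fun k _ => sum_congr rfl fun l _ => ?_
    ring
  unfold volDensity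
  rw [hgram, Matrix.det_mul, Matrix.det_mul, Matrix.det_transpose, hdet,
    show J.det * (gram h c' (trans g m c c' y)).det * J.det
      = J.det ^ 2 * (gram h c' (trans g m c c' y)).det by ring,
    Real.sqrt_mul (sq_nonneg _), Real.sqrt_sq_eq_abs]

def fieldDeriv {F : Type*} [NormedAddCommGroup F] [NormedSpace ℝ F]
    (X : ∀ x : M, TangentSpace (𝓡 n) x) (u : M → F) (x : M) : F :=
  mfderiv (𝓡 n) 𝓘(ℝ, F) u x (X x)

theorem fieldDeriv_chartPoint {F : Type*} [NormedAddCommGroup F] [NormedSpace ℝ F] {u : M → F}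
    (hu : MDifferentiableAt (𝓡 n) 𝓘(ℝ, F) u (chartPoint c y)) (hy : y ∈ chartDomain c)
    (X : ∀ x : M, TangentSpace (𝓡 n) x) :
    fieldDeriv X u (chartPoint c y)
      = fderiv ℝ (fun y => u (chartPoint c y)) y (fieldCoord X c y) := by
  have : IsManifold (𝓡 n) 1 M := isManifold_one
  have h2 := (hu.hasMFDerivAt.comp y (((contMDiffOn_chartPoint c).contMDiffAt ((isOpen_chartDomain
    c).mem_nhds hy) ).mdifferentiableAt (by simp)).hasMFDerivAt).mfderiv
  rw [mfderiv_eq_fderiv] at h2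
  have h3 := chartTan_fieldCoord X hy
  have h4 := congrArg (fun L => L (fieldCoord X c y)) h2
  exact (h4.trans (congrArg (fun v => (mfderiv (𝓡 n) 𝓘(ℝ, F) u (chartPoint c y) v : F)) h3)).symm

theorem contDiffOn_comp_chartPoint {F : Type*} [NormedAddCommGroup F] [NormedSpace ℝ F] {u : M → F}
    (hu : ContMDiff (𝓡 n) 𝓘(ℝ, F) ∞ u) (c : M) :
    SmoothOn (fun y : Model n => u (chartPoint c y)) (chartDomain c) := by
  rw [← contMDiffOn_iff_contDiffOn]
  exact hu.comp_contMDiffOn (contMDiffOn_chartPoint c)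

variable (n) in
/-- The support of the function of the partition of unity in its chart. -/
def partSupport (c : M) : Set (Model n) := extChartAt (𝓡 n) c '' tsupport (chartPartition n M c)

theorem isCompact_partSupport (c : M) : IsCompact (partSupport n c) :=
  (isClosed_tsupport _).isCompact.image_of_continuousOn ((continuousOn_extChartAt c).mono (by
    rw [extChartAt_source]; exact chartPartition_subordinate n M c))

theorem partSupport_subset (c : M) : partSupport n c ⊆ chartDomain c := by
  rintro _ ⟨x, hx, rfl⟩
  exact extChartAt_mem_chartDomain (chartPartition_subordinate n M c hx)

theorem chartPartition_eq_zero_of_chart (hy : y ∈ chartDomain c) (hyK : y ∉ partSupport n c) :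
    chartPartition n M c (chartPoint c y) = 0 :=
  image_eq_zero_of_notMem_tsupport fun h0 => hyK ⟨_, h0, extChartAt_chartPoint hy⟩

theorem hasTotal_of_continuousOn {F : M → Model n → ℂ}
    (hF : ∀ c, ContinuousOn (F c) (chartDomain c)) : (baseLift g).HasTotal F := by
  intro c
  refine integrableOn_of_compact_support ChartLift.isOpen_domain (isCompact_partSupport c)
    (partSupport_subset c) ?_ fun y hy hyK => ?_
  · exact ((continuous_ofReal.comp_continuousOn ((chartPartition n M c).contMDiff.continuous
      |>.comp_continuousOn ChartLift.continuousOn_point))).mul (hF c)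
  · have : chartPartition n M c ((baseLift g).point c y) = 0 :=
      chartPartition_eq_zero_of_chart hy hyK
    simp [this]

theorem riemannIntegral_eq_total (g : Diffeo n M) (h : Metric n M) (f : M → ℂ) : riemannIntegral h f
      = (baseLift g).total fun c y => (volDensity h c y : ℂ) * f (chartPoint c y) := by
  refine finsum_congr fun c => integral_congr_ae (Eventually.of_forall fun y => ?_)
  simp only [volDensity, ChartLift.point, baseLift]
  push_cast
  ring

theorem continuousOn_density_mul (h : Metric n M) (hf : Continuous f) (c : M) :
    ContinuousOn (fun y => (volDensity h c y : ℂ) * f (chartPoint c y)) (chartDomain c) :=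
  (continuous_ofReal.comp_continuousOn (contDiffOn_volDensity h c).continuousOn).mul
    (hf.comp_continuousOn (continuousOn_chartPoint c))

theorem riemannIntegral_add (h : Metric n M) {f' : M → ℂ} (hf : Continuous f)
    (hf' : Continuous f') :
    riemannIntegral h (fun x => f x + f' x) = riemannIntegral h f + riemannIntegral h f' := by
  have h1 := fun f => riemannIntegral_eq_total (Diffeomorph.refl (𝓡 n) M ∞) h f
  simp only [h1, ChartLift.total_eq_sum]
  rw [← sum_add_distrib]
  refine sum_congr rfl fun c _ => ?_
  rw [← integral_add (hasTotal_of_continuousOn (continuousOn_density_mul h hf) c)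
    (hasTotal_of_continuousOn (continuousOn_density_mul h hf') c)]
  refine integral_congr_ae (Eventually.of_forall fun y => ?_)
  ring

theorem riemannIntegral_const_mul (h : Metric n M) (a : ℂ) (f : M → ℂ) :
    riemannIntegral h (fun x => a * f x) = a * riemannIntegral h f := by
  have h1 := fun f => riemannIntegral_eq_total (Diffeomorph.refl (𝓡 n) M ∞) h f
  simp only [h1, ChartLift.total_eq_sum, mul_sum, ← integral_const_mul]
  refine sum_congr rfl fun c _ => integral_congr_ae (Eventually.of_forall fun y => ?_)
  ring

theorem riemannIntegral_sum (h : Metric n M) {ι : Type*} (s : Finset ι) {f : ι → M → ℂ}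
    (hf : ∀ i ∈ s, Continuous (f i)) :
    riemannIntegral h (fun x => ∑ i ∈ s, f i x) = ∑ i ∈ s, riemannIntegral h (f i) := by
  classical
  induction s using Finset.induction_on with
  | empty => simpa using riemannIntegral_const_mul h 0 fun _ => 0
  | insert i s hi ih =>
    simp only [Finset.sum_insert hi]
    rw [riemannIntegral_add h (hf i (Finset.mem_insert_self _ _))
      (continuous_finsetSum _ fun j hj => hf j (Finset.mem_insert_of_mem hj)),
      ih fun j hj => hf j (Finset.mem_insert_of_mem hj)]

theorem IsIsometry.riemannIntegral_comp (hg : IsIsometry h g) (m : ℤ) (hf : Continuous f) :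
    riemannIntegral h (fun x => f (iter g m x)) = riemannIntegral h f := by
  rw [riemannIntegral_eq_total g, riemannIntegral_eq_total g]
  refine ChartLift.total_eq_of_lift (hasTotal_of_continuousOn (continuousOn_density_mul h
    (hf.comp (contMDiff_iter g m).continuous))) (hasTotal_of_continuousOn
    (continuousOn_density_mul h hf)) m fun c c' y hy => ?_
  have h1 := hg.volDensity_trans (c' := c') hy
  simp only [baseLift]
  rw [(chartPoint_trans hy), h1, real_smul]
  push_cast
  ring

theorem riemannIntegral_of_support (hg : IsIsometry h g) (hf0 : ∀ x ∉ (chartAt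
    (Model n) c).source, f x = 0)
    (hfi : IntegrableOn (fun y => (volDensity h c y : ℂ) * f (chartPoint c y)) (chartDomain c)) :
    riemannIntegral h f = ∫ y in chartDomain c, (volDensity h c y : ℂ) * f (chartPoint c y) := by
  rw [riemannIntegral_eq_total g]
  refine ChartLift.total_eq_of_support (fun c' y hy => ?_) (fun c' y hy hx => ?_) hfi
  · have h1 := hg.volDensity_trans (c' := c') hy
    simp only [baseLift]; rw [(chartPoint_trans hy), h1, real_smul, iter_zero, id]; push_cast; ring
  · have : f (chartPoint c' y) = 0 := hf0 _ hx
    rw [this, mul_zero]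

end BaseIntegrals

/-! ### Divergences and formal adjoints on `M` -/

section Divergence

/-- The components of the vector field in the chart centred at `c`, multiplied by the volume density
and the partition of unity, and extended by zero. -/
def flux (h : Metric n M) (X : ∀ x : M, TangentSpace (𝓡 n) x) (c : M) (i : Fin n) : Model n → ℝ :=
  (chartDomain c).indicator fun y =>
    chartPartition n M c (chartPoint c y) * (volDensity h c y * fieldCoord X c y i)

theorem flux_eq_zero (c : M) (i : Fin n) (y : Model n) (hy : y ∈ chartDomain c)
    (hyK : y ∉ partSupport n c) :
    chartPartition n M c (chartPoint c y) * (volDensity h c y * fieldCoord X c y i) = 0 := by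
  rw [chartPartition_eq_zero_of_chart hy hyK, zero_mul]

theorem contDiff_flux (h : Metric n M) (hX : SmoothField X)
    (c : M) (i : Fin n) : ContDiff ℝ ∞ (flux h X c i) := by
  refine contDiff_indicator (isOpen_chartDomain c) (isCompact_partSupport c) (partSupport_subset c)
    ?_ (flux_eq_zero c i)
  exact (contDiffOn_comp_chartPoint (chartPartition n M c).contMDiff c).mul
    ((contDiffOn_volDensity h c).mul
      ((EuclideanSpace.proj (𝕜 := ℝ) i).contDiff.comp_contDiffOn (contDiffOn_fieldCoord hX c)))

theorem tsupport_flux_subset (c : M) (i : Fin n) : tsupport (flux h X c i) ⊆ partSupport n c :=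
  tsupport_indicator_subset (isCompact_partSupport c) (flux_eq_zero c i)

/-- The divergence of a vector field, multiplied by a function of the partition of unity. -/
def localDivergence (h : Metric n M) (X : ∀ x : M, TangentSpace (𝓡 n) x) (c : M) : M → ℝ :=
  (chartAt (Model n) c).source.indicator fun x => (volDensity h c (extChartAt (𝓡 n) c x))⁻¹ *
    ∑ i, fderiv ℝ (flux h X c i) (extChartAt (𝓡 n) c x) (single i 1)

theorem contMDiff_localDivergence (h : Metric n M) (hX : SmoothField X)
    (c : M) : ContMDiff (𝓡 n) 𝓘(ℝ, ℝ) ∞ (localDivergence h X c) := by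
  intro x
  by_cases hx : x ∈ (chartAt (Model n) c).source
  · have h1 : SmoothOn (fun y => (volDensity h c y)⁻¹ *
        ∑ i, fderiv ℝ (flux h X c i) y (single i 1)) (chartDomain c) := by
      refine ((contDiffOn_volDensity h c).inv fun y hy => (volDensity_pos h hy).ne').mul
        (ContDiffOn.sum fun i _ => ContDiff.contDiffOn ?_)
      exact ((contDiff_flux h hX c i).fderiv_right (m := ∞) (by simp)).clm_apply contDiff_const
    have h2 := (contMDiffOn_iff_contDiffOn.2 h1).comp (contMDiffOn_extChartAt (I := 𝓡 n) (n := ∞)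
     ) (fun x hx => extChartAt_mem_chartDomain hx)
    refine (h2.contMDiffAt ((chartAt (Model n) c).open_source.mem_nhds hx)).congr_of_eventuallyEq ?_
    filter_upwards [(chartAt (Model n) c).open_source.mem_nhds hx] with w hw
    exact indicator_of_mem hw _
  · have h1 := fun h0 => hx (chartPartition_subordinate n M c h0)
    refine (contMDiffAt_const (c := 0)).congr_of_eventuallyEq ?_
    filter_upwards [(isClosed_tsupport _).isOpen_compl.mem_nhds h1] with w hw
    by_cases hws : w ∈ (chartAt (Model n) c).source
    · rw [localDivergence, indicator_of_mem hws]
      refine mul_eq_zero_of_right _ (sum_eq_zero fun i _ => ?_)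
      have h2 : extChartAt (𝓡 n) c w ∉ tsupport (flux h X c i) := by
        intro h3
        obtain ⟨w', hw', heq⟩ := tsupport_flux_subset c i h3
        have hws' := chartPartition_subordinate n M c hw'
        have : w' = w := by
          rw [← chartPoint_extChartAt hws', heq, chartPoint_extChartAt hws]
        exact hw (this ▸ hw')
      rw [(notMem_tsupport_iff_eventuallyEq.1 h2).fderiv_eq]; simp
    · exact indicator_of_notMem hws _

def divergence (h : Metric n M) (X : ∀ x : M, TangentSpace (𝓡 n) x) (x : M) : ℝ :=
  ∑ c ∈ chartIndex n M, localDivergence h X c x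

theorem contMDiff_divergence (h : Metric n M) (hX : SmoothField X) :
    ContMDiff (𝓡 n) 𝓘(ℝ, ℝ) ∞ (divergence h X) :=
  contMDiff_finsetSum fun c _ => contMDiff_localDivergence h hX c

theorem integral_flux (h : Metric n M) (hX : SmoothField X)
    (c : M) {F : Model n → ℂ} (hF : SmoothOn F (chartDomain c)) (i : Fin n) :
    ∫ y in chartDomain c, (flux h X c i y : ℂ) * fderiv ℝ F y (single i 1) = -∫ y in chartDomain c,
        ((fderiv ℝ (flux h X c i) y (single i 1) : ℝ) : ℂ) * F y := by
  set v : Model n := single i 1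
  have hφ := contDiff_flux h hX c i
  have hφd : ∀ y, HasFDerivAt (fun y => (flux h X c i y : ℂ))
      (ofRealCLM.comp (fderiv ℝ (flux h X c i) y)) y := fun y =>
    ofRealCLM.hasFDerivAt.comp y (hφ.differentiable (by simp) y).hasFDerivAt
  have hsupp : ∀ y ∉ partSupport n c, flux h X c i y = 0 ∧ fderiv ℝ (flux h X c i) y v = 0 := by
    intro y hy
    have h2 : y ∉ tsupport (flux h X c i) := fun h0 => hy (tsupport_flux_subset c i h0)
    have h3 := notMem_tsupport_iff_eventuallyEq.1 h2
    refine ⟨h3.eq_of_nhds, ?_⟩; rw [h3.fderiv_eq]; simp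
  have hint : ∀ {G : Model n → ℂ}, ContinuousOn G (chartDomain c) →
      (∀ y ∉ partSupport n c, G y = 0) → Integrable G ∧ ∫ y in chartDomain c, G y = ∫ y, G y := by
    intro G hG hG0
    refine ⟨?_, setIntegral_eq_integral_of_forall_compl_eq_zero fun y hy =>
      hG0 y fun h0 => hy (partSupport_subset c h0)⟩
    rw [← integrableOn_univ]
    exact ((hG.mono (partSupport_subset c)).integrableOn_compact
      (isCompact_partSupport c)).of_forall_sdiff_eq_zero MeasurableSet.univ
      fun y hy => hG0 y hy.2
  have hcφ : Continuous fun y => (flux h X c i y : ℂ) := continuous_ofReal.comp hφ.continuous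
  have hcφ' : Continuous fun y => ((fderiv ℝ (flux h X c i) y v : ℝ) : ℂ) :=
    continuous_ofReal.comp ((hφ.continuous_fderiv (by simp)).clm_apply continuous_const)
  obtain ⟨h1, h1'⟩ := hint (hcφ.continuousOn.mul (((hF.fderivOn (isOpen_chartDomain
    c)).continuousOn).clm_apply continuousOn_const)) fun y hy => by
    simp; rw [(hsupp y hy).1]; simp
  obtain ⟨h2, h2'⟩ := hint (hcφ'.continuousOn.mul hF.continuousOn) fun y hy => by
    simp; rw [(hsupp y hy).2]; simp
  obtain ⟨h3, -⟩ := hint (hcφ.continuousOn.mul hF.continuousOn) fun y hy => by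
    simp; rw [(hsupp y hy).1]; simp
  refine h1'.trans (Eq.trans ?_ (congrArg Neg.neg h2').symm)
  have key := integral_mul_fderiv_eq_neg_fderiv_mul_of_integrable (μ := volume)
    (f := fun y => (flux h X c i y : ℂ))
    (h2.congr (Eventually.of_forall fun y => by simp [(hφd y).fderiv])) h1 h3
    (fun y _ => (hφd y).differentiableAt) fun y hy => ?_
  · refine key.trans (congrArg Neg.neg (integral_congr_ae (Eventually.of_forall fun y => ?_)))
    simp [(hφd y).fderiv]
  · have hy' : y ∈ chartDomain c := by
      refine partSupport_subset c (closure_minimal (fun w hw => ?_)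
        (isCompact_partSupport c).isClosed hy)
      by_contra hwK
      exact hw (by simp [(hsupp w hwK).1])
    exact hF.diffAt (isOpen_chartDomain c) hy'

theorem IsIsometry.riemannIntegral_fieldDeriv (hg : IsIsometry h g) (hX : SmoothField X)
    (hf : SmoothFn[n] f) :
    riemannIntegral h (fieldDeriv X f) = -riemannIntegral h (fun x => f x * divergence h X x) := by
  have hF := contDiffOn_comp_chartPoint hf
  have hdiv : ∀ c, Continuous fun x => f x * (localDivergence h X c x) := fun c =>
    hf.continuous.mul (continuous_ofReal.comp (contMDiff_localDivergence h hX c).continuous)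
  have hR : riemannIntegral h (fun x => f x * divergence h X x)
      = ∑ c ∈ chartIndex n M, riemannIntegral h (fun x => f x * (localDivergence h X c x)) := by
    rw [← riemannIntegral_sum h _ fun c _ => hdiv c]
    congr 1; ext x; rw [divergence, ofReal_sum, mul_sum]
  rw [hR, riemannIntegral_eq_total g, ChartLift.total_eq_sum, ← sum_neg_distrib]
  refine sum_congr rfl fun c _ => ?_
  have hdivc : ∀ y ∈ chartDomain c, (volDensity h c y) * (f (chartPoint c y) *
      (localDivergence h X c (chartPoint c y) : ℂ))
      = ∑ i, ((fderiv ℝ (flux h X c i) y (single i 1) : ℝ) : ℂ) * f (chartPoint c y) := by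
    intro y hy; rw [localDivergence, indicator_of_mem (chartPoint_mem hy), extChartAt_chartPoint hy]
    have := (volDensity_pos h hy).ne'
    have h2 : (volDensity h c y : ℂ) ≠ 0 := by exact_mod_cast this
    push_cast; rw [← sum_mul]; field_simp
  have hint : ∀ i, IntegrableOn (fun y => ((fderiv ℝ (flux h X c i) y
      (single i 1) : ℝ) : ℂ) * f (chartPoint c y)) (chartDomain c) := by
    intro i
    refine integrableOn_of_compact_support (isOpen_chartDomain c) (isCompact_partSupport c)
      (partSupport_subset c) ?_ fun y hy hyK => ?_
    · exact (continuous_ofReal.comp (((contDiff_flux h hX c i).continuous_fderiv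
        (by simp)).clm_apply continuous_const)).continuousOn.mul (hF c).continuousOn
    · have h3 : flux h X c i =ᶠ[𝓝 y] fun _ => 0 := notMem_tsupport_iff_eventuallyEq.1
        fun h0 => hyK (tsupport_flux_subset c i h0)
      rw [h3.fderiv_eq]; simp
  have hint' : ∀ i, IntegrableOn (fun y => (flux h X c i y) *
      fderiv ℝ (fun y => f (chartPoint c y)) y (single i 1)) (chartDomain c) := by
    intro i
    refine integrableOn_of_compact_support (isOpen_chartDomain c) (isCompact_partSupport c)
      (partSupport_subset c) ?_ fun y hy hyK => ?_
    · exact (continuous_ofReal.comp (contDiff_flux h hX c i).continuous).continuousOn.mul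
        ((((hF c).fderivOn (isOpen_chartDomain c)).continuousOn).clm_apply continuousOn_const)
    · rw [image_eq_zero_of_notMem_tsupport fun h0 => hyK (tsupport_flux_subset c i h0)]
      simp
  have hsupp0 : ∀ x ∉ (chartAt (Model n) c).source,
      f x * (localDivergence h X c x) = 0 := fun x hx => by
    rw [localDivergence, indicator_of_notMem hx]; simp
  have hsum := setIntegral_congr_fun (μ := volume) (isOpen_chartDomain c).measurableSet hdivc
  rw [riemannIntegral_of_support hg hsupp0 (((integrable_finsetSum _ fun i _ => hint i).congr
    ((ae_restrict_iff' (isOpen_chartDomain c).measurableSet).2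
      (Eventually.of_forall fun y hy => (hdivc y hy).symm)))), hsum,
    integral_finsetSum _ fun i _ => hint i, ← sum_neg_distrib]
  rw [← sum_congr rfl fun i _ => integral_flux h hX c (hF c) i,
    ← integral_finsetSum _ fun i _ => hint' i]
  refine setIntegral_congr_fun (isOpen_chartDomain c).measurableSet fun y hy => ?_
  have h1 := fieldDeriv_chartPoint (hf.mdifferentiable (by simp) (chartPoint c y)) hy X
  have h2 : fieldCoord X c y = ∑ i, fieldCoord X c y i • single i 1 := by
    ext j; simp [single_apply]
  simp only [ChartLift.point, baseLift]
  rw [h1]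
  conv_lhs => rw [h2, map_sum]
  rw [mul_sum, mul_sum]
  refine sum_congr rfl fun i _ => ?_
  rw [flux, indicator_of_mem (show y ∈ chartDomain c from hy), map_smul, real_smul]
  push_cast
  ring

end Divergence

/-! ### Derivatives of functions on `M × ℝ` -/

section Cylinder

variable {u v : M × ℝ → ℂ}

/-- Smooth functions on `M × ℝ`. -/
abbrev CylSmooth (u : M × ℝ → ℂ) : Prop := ContMDiff ((𝓡 n).prod 𝓘(ℝ, ℝ)) 𝓘(ℝ, ℂ) ∞ u

theorem CylSmooth.slice (hu : CylSmooth (n := n) u) (t : ℝ) : SmoothFn[n] fun x => u (x, t) :=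
  hu.comp (contMDiff_id.prodMk contMDiff_const)

theorem CylSmooth.slice' (hu : CylSmooth (n := n) u) (x : M) : ContDiff ℝ ∞ fun t => u (x, t) :=
  (contMDiff_iff_contDiff).1 (hu.comp (contMDiff_const.prodMk contMDiff_id))

theorem CylSmooth.contDiffOn_chart (hu : CylSmooth (n := n) u) (c : M) :
    SmoothOn (fun p : Model n × ℝ => u (chartPoint c p.1, p.2)) (chartDomain c ×ˢ univ) := by
  rw [← contMDiffOn_iff_contDiffOn]
  exact hu.comp_contMDiffOn (((contMDiffOn_chartPoint c).comp contDiff_fst.contMDiff.contMDiffOn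
    fun p hp => hp.1).prodMk contDiff_snd.contMDiff.contMDiffOn)

theorem contMDiff_cylShift (hu : CylSmooth (n := n) u) (g : Diffeo n M) (k : ℤ) :
    CylSmooth (n := n) (cylShift g k u) :=
  hu.comp (((contMDiff_iter g k).comp contMDiff_fst).prodMk
    ((contDiff_id.add contDiff_const).contMDiff.comp contMDiff_snd))

theorem continuous_of_chart {Z : M × ℝ → ℂ}
    (hZ : ∀ c : M, ContinuousOn (fun p : Model n × ℝ => Z (chartPoint c p.1, p.2))
      (chartDomain c ×ˢ univ)) : Continuous Z := by
  refine continuous_iff_continuousAt.2 fun p => ?_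
  have h2 : ContinuousOn (fun q : M × ℝ => (extChartAt (𝓡 n) p.1 q.1, q.2))
      ((chartAt (Model n) p.1).source ×ˢ univ) := by
    refine ContinuousOn.prodMk ?_ continuousOn_snd
    refine (continuousOn_extChartAt (I := 𝓡 n) p.1).comp continuousOn_fst fun q hq => ?_
    rw [extChartAt_source]; exact hq.1
  have h3 := (hZ p.1).comp h2 fun q hq => ⟨extChartAt_mem_chartDomain hq.1, trivial⟩
  refine (h3.congr fun q hq => ?_).continuousAt (((chartAt (Model n) p.1).open_source.prod
    isOpen_univ).mem_nhds ⟨mem_chart_source _ _, trivial⟩)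
  simp only [Function.comp]
  rw [chartPoint_extChartAt hq.1]

theorem CylSmooth.continuous_fieldDeriv (hu : CylSmooth (n := n) u) (hX : SmoothField X) :
    Continuous fun p : M × ℝ => fieldDeriv X (fun x => u (x, p.2)) p.1 := by
  refine continuous_of_chart (n := n) fun c => ?_
  have hO := (isOpen_chartDomain (n := n) c).prod (isOpen_univ (X := ℝ))
  have h1 := ((hu.contDiffOn_chart c).fderivOn hO).continuousOn
  have h2 : ContinuousOn (fun p : Model n × ℝ => ((fieldCoord X c p.1, 0) : Model n × ℝ))
      (chartDomain c ×ˢ univ) :=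
    ((contDiffOn_fieldCoord hX c).continuousOn.comp continuousOn_fst fun p hp => hp.1).prodMk
      continuousOn_const
  refine (h1.clm_apply h2).congr fun p hp => ?_
  have h3 := ((hu.contDiffOn_chart c).diffAt hO hp).hasFDerivAt
  have h5 := (HasFDerivAt.comp p.1 (f := fun y => ((y, p.2) : Model n × ℝ)) h3
    (hasFDerivAt_prodMk_left p.1 p.2)).fderiv
  have h6 := fieldDeriv_chartPoint ((hu.slice p.2).mdifferentiable (by simp) (chartPoint c p.1))
    hp.1 X
  rw [h6]
  exact congrArg (fun L => L (fieldCoord X c p.1)) h5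

theorem CylSmooth.continuous_deriv (hu : CylSmooth (n := n) u) :
    Continuous fun p : M × ℝ => deriv (fun t => u (p.1, t)) p.2 := by
  refine continuous_of_chart (n := n) fun c => ?_
  have hO := (isOpen_chartDomain (n := n) c).prod (isOpen_univ (X := ℝ))
  have h1 := ((hu.contDiffOn_chart c).fderivOn hO).continuousOn
  refine (h1.clm_apply (continuousOn_const (c := ((0, 1) : Model n × ℝ)))).congr fun p hp => ?_
  have h3 := ((hu.contDiffOn_chart c).diffAt hO hp).hasFDerivAt
  exact (HasFDerivAt.comp_hasDerivAt p.2 (f := fun t => ((p.1, t) : Model n × ℝ)) h3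
    ((hasDerivAt_const _ _).prodMk (hasDerivAt_id' p.2))).deriv

theorem contMDiff_complex_mul {E H N : Type*} [NormedAddCommGroup E] [NormedSpace ℝ E]
    [TopologicalSpace H] {I : ModelWithCorners ℝ E H} [TopologicalSpace N] [ChartedSpace H N]
    {f f' : N → ℂ} (hf : ContMDiff I 𝓘(ℝ, ℂ) ∞ f) (hf' : ContMDiff I 𝓘(ℝ, ℂ) ∞ f') :
    ContMDiff I 𝓘(ℝ, ℂ) ∞ fun x => f x * f' x :=
  (contDiff_mul).contMDiff.comp (hf.prodMk_space hf')

theorem fieldDeriv_mul {f' : M → ℂ} (hf : SmoothFn[n] f) (hf' : SmoothFn[n] f') (x : M) :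
    fieldDeriv X (fun x => f x * f' x) x = fieldDeriv X f x * f' x + f x * fieldDeriv X f' x := by
  have hx := mem_chart_source (Model n) x
  have hy := extChartAt_mem_chartDomain hx
  rw [← chartPoint_extChartAt hx,
    fieldDeriv_chartPoint ((contMDiff_complex_mul hf hf').mdifferentiable (by simp) _) hy,
    fieldDeriv_chartPoint (hf.mdifferentiable (by simp) _) hy,
    fieldDeriv_chartPoint (hf'.mdifferentiable (by simp) _) hy]
  have hd : ∀ {f : M → ℂ}, SmoothFn[n] f → DifferentiableAt ℝ
      (fun y => f (chartPoint x y)) (extChartAt (𝓡 n) x x) := fun hf =>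
    (contDiffOn_comp_chartPoint hf x).diffAt (isOpen_chartDomain x) hy
  rw [fderiv_fun_mul (hd hf) (hd hf')]
  simp
  ring

theorem fieldDeriv_conj (hf : SmoothFn[n] f) (x : M) :
    fieldDeriv X (fun x => conj (f x)) x = conj (fieldDeriv X f x) := by
  have hx := mem_chart_source (Model n) x
  have hy := extChartAt_mem_chartDomain hx
  have hfc : SmoothFn[n] fun x => conj (f x) := Complex.conjCLE.contDiff.contMDiff.comp hf
  rw [← chartPoint_extChartAt hx, fieldDeriv_chartPoint (hfc.mdifferentiable (by simp) _) hy,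
    fieldDeriv_chartPoint (hf.mdifferentiable (by simp) _) hy]
  have h1 := (contDiffOn_comp_chartPoint hf x).diffAt (isOpen_chartDomain x) hy |>.hasFDerivAt
  have h2 := (Complex.conjCLE.hasFDerivAt.comp _ h1).fderiv
  exact congrArg (fun L : Model n →L[ℝ] ℂ => L _) h2

theorem continuous_fieldDeriv (hf : SmoothFn[n] f) (hX : SmoothField X) :
    Continuous (fieldDeriv X f) := by
  have h1 : CylSmooth fun p => f p.1 := hf.comp contMDiff_fst
  exact (h1.continuous_fieldDeriv hX).comp (continuous_id.prodMk (continuous_const (y := 0)))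

theorem fieldDeriv_comp_iter (g : Diffeo n M) (k : ℤ) (hf : SmoothFn[n] f) (x : M) :
    fieldDeriv X (fun x => f (iter g k x)) (iter g (-k) x)
      = fieldDeriv (fun x => iterDiff g k (iter g (-k) x) (X (iter g (-k) x))) f x := by
  have h1 := (((hf.mdifferentiable (by simp)) (iter g k (iter g (-k) x))).hasMFDerivAt.comp
    (iter g (-k) x) ((contMDiff_iter g k).mdifferentiable (by simp) _).hasMFDerivAt).mfderiv
  have h2 := congrArg (fun L => L (X (iter g (-k) x))) h1
  refine h2.trans ?_
  have h3 : ∀ x', x' = x → (mfderiv (𝓡 n) 𝓘(ℝ, ℂ) f x' : Model n →L[ℝ] ℂ)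
      = mfderiv (𝓡 n) 𝓘(ℝ, ℂ) f x := fun x' h => by rw [h]
  exact congrArg (fun L : Model n →L[ℝ] ℂ => L (iterDiff g k (iter g (-k) x) (X (iter g (-k) x))))
    (h3 _ (iter_iter_neg g k x))

theorem contMDiff_pushField (g : Diffeo n M) (k : ℤ) (hX : SmoothField X) :
    ContMDiff (𝓡 n) (𝓡 n).tangent ∞ (fun x =>
      (⟨x, iterDiff g k (iter g (-k) x) (X (iter g (-k) x))⟩ : TangentBundle (𝓡 n) M)) := by
  have h1 := ((contMDiff_iter g k).contMDiff_tangentMap (m := ∞) (by simp)).comp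
    (hX.comp (contMDiff_iter g (-k)))
  have h2 : ∀ x x' : M, x = x' → ∀ w : Model n, (⟨x, w⟩ : TangentBundle (𝓡 n) M) = ⟨x', w⟩ := by
    rintro x _ rfl w; rfl
  convert h1 using 1
  funext x
  exact h2 _ _ (iter_iter_neg g k x).symm _

/-- The operator `T^k P T^{-k}` with `k` replaced by `-k`. -/
def DiffOp.push (g : Diffeo n M) (k : ℤ) (P : DiffOp n M) : DiffOp n M where
  X x := iterDiff g k (iter g (-k) x) (P.X (iter g (-k) x))
  Y x := iterDiff g k (iter g (-k) x) (P.Y (iter g (-k) x))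
  c x := P.c (iter g (-k) x)
  smooth_X := contMDiff_pushField g k P.smooth_X
  smooth_Y := contMDiff_pushField g k P.smooth_Y
  smooth_c := P.smooth_c.comp (contMDiff_iter g (-k))

theorem DiffOp.apply_eq (P : DiffOp n M) (f : M → ℂ) (x : M) :
    P.apply f x = fieldDeriv P.X f x + I * fieldDeriv P.Y f x + P.c x * f x := rfl

theorem DiffOp.push_apply (g : Diffeo n M) (k : ℤ) (P : DiffOp n M) (hf : SmoothFn[n] f) (x : M) :
    (P.push g k).apply (fun x => f (iter g (-k) x)) x = P.apply f (iter g (-k) x) := by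
  have hf' : SmoothFn[n] fun x => f (iter g (-k) x) := hf.comp (contMDiff_iter g (-k))
  have h1 : (fun x => f (iter g (-k) (iter g k x))) = f := funext fun x => by rw [iter_neg_iter]
  rw [DiffOp.apply_eq, DiffOp.apply_eq]
  have hX := fieldDeriv_comp_iter (X := P.X) g k hf' x
  have hY := fieldDeriv_comp_iter (X := P.Y) g k hf' x
  rw [h1] at hX hY
  rw [hX, hY]
  rfl

/-- The formal adjoint with respect to the Riemannian volume. -/
def DiffOp.adjoint (h : Metric n M) (P : DiffOp n M) : DiffOp n M where
  X x := -P.X x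
  Y := P.Y
  c x := conj (P.c x) - divergence h P.X x + I * divergence h P.Y x
  smooth_X := ContMDiff.neg_section P.smooth_X
  smooth_Y := P.smooth_Y
  smooth_c := by
    have h1 : SmoothFn[n] fun x => conj (P.c x) :=
      Complex.conjCLE.contDiff.contMDiff.comp P.smooth_c
    have h2 : ∀ {X : ∀ x : M, TangentSpace (𝓡 n) x}, SmoothField X →
        SmoothFn[n] fun x => (divergence h X x : ℂ) := fun hX =>
      ofRealCLM.contDiff.contMDiff.comp (contMDiff_divergence h hX)
    exact (h1.sub (h2 P.smooth_X)).add (contMDiff_complex_mul contMDiff_const (h2 P.smooth_Y))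

theorem IsIsometry.riemannIntegral_apply (hg : IsIsometry h g) (P : DiffOp n M) {f' : M → ℂ} (hf :
    SmoothFn[n] f) (hf' : SmoothFn[n] f') :
    riemannIntegral h (fun x => P.apply f x * conj (f' x))
      = riemannIntegral h fun x => f x * conj ((P.adjoint h).apply f' x) := by
  have hfc : SmoothFn[n] fun x => conj (f' x) := Complex.conjCLE.contDiff.contMDiff.comp hf'
  have hm := contMDiff_complex_mul hf hfc
  have hcX := continuous_fieldDeriv hm P.smooth_X
  have hcY := continuous_fieldDeriv hm P.smooth_Y
  have hdX := continuous_ofReal.comp (contMDiff_divergence h P.smooth_X).continuous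
  have hdY := continuous_ofReal.comp (contMDiff_divergence h P.smooth_Y).continuous
  set w : M → ℂ := fun x => f x * (-conj (fieldDeriv P.X f' x)
    - I * conj (fieldDeriv P.Y f' x) + P.c x * conj (f' x)) with hw
  have hwc : Continuous w := hf.continuous.mul (((continuous_conj.comp
    (continuous_fieldDeriv hf' P.smooth_X)).neg.sub (continuous_const.mul
      (continuous_conj.comp (continuous_fieldDeriv hf' P.smooth_Y)))).add
    (P.smooth_c.continuous.mul hfc.continuous))
  have h1 : (fun x => P.apply f x * conj (f' x)) = fun x =>
      (fieldDeriv P.X (fun x => f x * conj (f' x)) x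
        + I * fieldDeriv P.Y (fun x => f x * conj (f' x)) x) + w x := by
    funext x
    rw [DiffOp.apply_eq, fieldDeriv_mul hf hfc, fieldDeriv_mul hf hfc, fieldDeriv_conj hf',
      fieldDeriv_conj hf', hw]
    ring
  have h2 : (fun x => f x * conj ((P.adjoint h).apply f' x)) = fun x =>
      ((-1) * (f x * conj (f' x) * divergence h P.X x)
        + (-I) * (f x * conj (f' x) * divergence h P.Y x)) + w x := by
    funext x
    have hX : fieldDeriv (P.adjoint h).X f' x = -fieldDeriv P.X f' x :=
      map_neg (mfderiv (𝓡 n) 𝓘(ℝ, ℂ) f' x) (P.X x)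
    rw [DiffOp.apply_eq, hX, hw]
    simp only [DiffOp.adjoint, map_add, map_mul, map_sub, map_neg, Complex.conj_I,
      Complex.conj_ofReal, Complex.conj_conj]
    ring
  have hcI : Continuous fun x => I * fieldDeriv P.Y (fun x => f x * conj (f' x)) x :=
    continuous_const.mul hcY
  have hc1 : Continuous fun x => fieldDeriv P.X (fun x => f x * conj (f' x)) x
    + I * fieldDeriv P.Y (fun x => f x * conj (f' x)) x := hcX.add hcI
  have hc2 : Continuous fun x => (-1) * (f x * conj (f' x) * divergence h P.X x) :=
    continuous_const.mul (hm.continuous.mul hdX)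
  have hc3 : Continuous fun x => (-I) * (f x * conj (f' x) * divergence h P.Y x) :=
    continuous_const.mul (hm.continuous.mul hdY)
  have hc4 : Continuous fun x => (-1) * (f x * conj (f' x) * divergence h P.X x)
      + (-I) * (f x * conj (f' x) * divergence h P.Y x) := hc2.add hc3
  rw [h1, h2, riemannIntegral_add h hc1 hwc, riemannIntegral_add h hc4 hwc,
    riemannIntegral_add h hcX hcI, riemannIntegral_add h hc2 hc3, riemannIntegral_const_mul,
    riemannIntegral_const_mul, riemannIntegral_const_mul]
  have hX := hg.riemannIntegral_fieldDeriv P.smooth_X hm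
  have hY := hg.riemannIntegral_fieldDeriv P.smooth_Y hm
  rw [hX, hY]
  ring

end Cylinder

/-! ### Integration over `M × ℝ` -/

section CylinderIntegral

variable {u v Z : M × ℝ → ℂ}

/-- The localization of a function on `M × ℝ` in a chart, multiplied by the volume density. -/
def cylLocal (h : Metric n M) (c : M) (Z : M × ℝ → ℂ) : Model n × ℝ → ℂ :=
  indicator (chartDomain c ×ˢ univ) fun p =>
    ((chartPartition n M c (chartPoint c p.1) * volDensity h c p.1 : ℝ) : ℂ)
      * Z (chartPoint c p.1, p.2)

theorem cylLocal_of_mem {p : Model n × ℝ} (hp : p.1 ∈ chartDomain c) :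
    cylLocal h c Z p = ((chartPartition n M c (chartPoint c p.1) * volDensity h c p.1 : ℝ) : ℂ)
      * Z (chartPoint c p.1, p.2) :=
  indicator_of_mem (s := chartDomain c ×ˢ univ) ⟨hp, trivial⟩ _

theorem cylLocal_of_notMem {p : Model n × ℝ} (hp : p.1 ∉ partSupport n c) :
    cylLocal h c Z p = 0 := by
  by_cases hy : p.1 ∈ chartDomain c
  · rw [cylLocal_of_mem hy, chartPartition_eq_zero_of_chart hy hp]; simp
  · exact indicator_of_notMem (s := chartDomain c ×ˢ univ) (fun h => hy h.1) _

theorem continuous_cylLocal (h : Metric n M) (c : M) (hZ : Continuous Z) :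
    Continuous (cylLocal h c Z) := by
  refine continuous_iff_continuousAt.2 fun p => ?_
  by_cases hp : p.1 ∈ partSupport n c
  · have hO := (isOpen_chartDomain (n := n) c).prod (isOpen_univ (X := ℝ))
    have hf : ContinuousOn (fun p : Model n × ℝ => p.1) (chartDomain c ×ˢ univ) := continuousOn_fst
    have hmap : MapsTo (fun p : Model n × ℝ => p.1) (chartDomain c ×ˢ univ) (chartDomain c) :=
      fun p hp => hp.1
    have hc := (continuousOn_chartPoint c).comp hf hmap
    have h1 : ContinuousOn (fun p =>
        ((chartPartition n M c (chartPoint c p.1) * volDensity h c p.1 : ℝ) : ℂ)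
          * Z (chartPoint c p.1, p.2)) (chartDomain c ×ˢ univ) := by
      refine ContinuousOn.mul (continuous_ofReal.comp_continuousOn (ContinuousOn.mul
        ((chartPartition n M c).contMDiff.continuous.comp_continuousOn hc)
        ((contDiffOn_volDensity h c).continuousOn.comp hf hmap)))
        (hZ.comp_continuousOn (hc.prodMk continuousOn_snd))
    exact (h1.congr fun q hq => cylLocal_of_mem hq.1).continuousAt (hO.mem_nhds (⟨partSupport_subset
      c hp, trivial⟩))
  · have hO := ((isCompact_partSupport c).isClosed.isOpen_compl.preimage continuous_fst).mem_nhds hp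
    exact (continuousAt_const (y := 0)).congr (by
      filter_upwards [hO] with q hq using (cylLocal_of_notMem hq).symm)

theorem hasCompactSupport_cylLocal (h : Metric n M) (c : M) (hZ : HasCompactSupport Z) :
    HasCompactSupport (cylLocal h c Z) := by
  refine HasCompactSupport.intro ((isCompact_partSupport c).prod
    (hZ.image continuous_snd)) fun p hp => ?_
  by_cases h1 : p.1 ∈ partSupport n c
  · rw [cylLocal_of_mem (partSupport_subset c h1)]
    rw [(image_eq_zero_of_notMem_tsupport fun h3 => hp ⟨h1, _, h3, rfl⟩), mul_zero]
  · exact cylLocal_of_notMem h1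

theorem riemannIntegral_slice (h : Metric n M) (Z : M × ℝ → ℂ) (t : ℝ) :
    riemannIntegral h (fun x => Z (x, t)) = ∑ c ∈ chartIndex n M, ∫ y, cylLocal h c Z (y, t) := by
  rw [riemannIntegral_eq_total (Diffeomorph.refl (𝓡 n) M ∞), ChartLift.total_eq_sum]
  refine sum_congr rfl fun c _ => ?_
  have h1 : (fun y => cylLocal h c Z (y, t)) = indicator (chartDomain c) fun y =>
      cylLocal h c Z (y, t) := by
    funext y
    by_cases hy : y ∈ chartDomain c
    · rw [indicator_of_mem hy]
    · rw [indicator_of_notMem hy]; exact cylLocal_of_notMem fun h => hy (partSupport_subset c h)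
  rw [h1, integral_indicator (isOpen_chartDomain c).measurableSet]
  refine setIntegral_congr_fun (isOpen_chartDomain c).measurableSet fun y hy => ?_
  refine Eq.trans ?_ (cylLocal_of_mem (p := (y, t)) hy).symm
  have hp : chartPartition n M c ((baseLift (Diffeomorph.refl (𝓡 n) M ∞)).point c y)
    = chartPartition n M c (chartPoint c y) := rfl
  rw [hp]
  push_cast
  ring

theorem continuous_riemannIntegral (h : Metric n M) (hZ : Continuous Z) :
    Continuous fun t => riemannIntegral h fun x => Z (x, t) := by
  rw [funext (riemannIntegral_slice h Z)]
  refine continuous_finsetSum _ fun c _ => ?_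
  have h2 : Continuous (uncurry fun t y => cylLocal h c Z (y, t)) :=
    (continuous_cylLocal h c hZ).comp continuous_swap
  have h1 := continuous_parametric_integral_of_continuous (μ := volume) h2 (isCompact_partSupport c)
  refine h1.congr fun t => ?_
  refine setIntegral_eq_integral_of_forall_compl_eq_zero fun y hy => ?_
  exact cylLocal_of_notMem hy

theorem hasCompactSupport_riemannIntegral (h : Metric n M) (hZ : HasCompactSupport Z) :
    HasCompactSupport fun t => riemannIntegral h fun x => Z (x, t) := by
  refine HasCompactSupport.intro (hZ.image continuous_snd) fun t ht => ?_
  have h1 : (fun x => Z (x, t)) = fun _ => 0 * 0 := by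
    funext x
    rw [zero_mul]; exact image_eq_zero_of_notMem_tsupport fun h3 => ht ⟨_, h3, rfl⟩
  rw [h1, riemannIntegral_const_mul, zero_mul]

theorem integrable_riemannIntegral (h : Metric n M) (hZ : Continuous Z)
    (hZ' : HasCompactSupport Z) : Integrable fun t => riemannIntegral h fun x => Z (x, t) :=
  (continuous_riemannIntegral h hZ).integrable_of_hasCompactSupport
    (hasCompactSupport_riemannIntegral h hZ')

theorem integral_riemannIntegral_eq_zero (h : Metric n M) (hZ : Continuous Z)
    (hZ' : HasCompactSupport Z) (h0 : ∀ x, ∫ t, Z (x, t) = 0) :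
    ∫ t, riemannIntegral h (fun x => Z (x, t)) = 0 := by
  simp only [riemannIntegral_slice]
  have hs : ∀ c : M, ∀ t, HasCompactSupport fun y => cylLocal h c Z (y, t) := fun c t =>
    HasCompactSupport.intro (isCompact_partSupport c) fun y hy => cylLocal_of_notMem hy
  have hc : ∀ c : M, Continuous (uncurry fun t y => cylLocal h c Z (y, t)) :=
    fun c => (continuous_cylLocal h c hZ).comp continuous_swap
  have hcs := fun c =>
    (hasCompactSupport_cylLocal h c hZ').comp_homeomorph (Homeomorph.prodComm ℝ (Model n))
  have hi : ∀ c : M, Integrable fun t => ∫ y, cylLocal h c Z (y, t) := fun c =>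
    ((hc c).integrable_of_hasCompactSupport (μ := volume.prod volume) (hcs c)).integral_prod_left
  rw [integral_finsetSum _ fun c _ => hi c]
  refine sum_eq_zero fun c _ => ?_
  rw [integral_integral_swap_of_hasCompactSupport (hc c) (hcs c)]
  refine integral_eq_zero_of_ae (Eventually.of_forall fun y => ?_)
  by_cases hy : y ∈ chartDomain c
  · simp only [cylLocal_of_mem (p := (y, _)) hy]; rw [integral_const_mul, h0, mul_zero]; rfl
  · simp only [cylLocal_of_notMem (p := (y, _)) fun h => hy (partSupport_subset c h), integral_zero]
    rfl

theorem re_integral_riemannIntegral_pos (h : Metric n M) (hZ : Continuous Z)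
    (hZ' : HasCompactSupport Z) (h0 : ∀ p, 0 ≤ (Z p).re) {p : M × ℝ} (hp : (Z p).re ≠ 0) :
    0 < (∫ t, riemannIntegral h fun x => Z (x, t)).re := by
  have hL : ∀ c q, 0 ≤ (cylLocal h c Z q).re := by
    intro c q
    by_cases hy : q.1 ∈ chartDomain c
    · rw [cylLocal_of_mem hy, re_ofReal_mul]
      exact mul_nonneg (mul_nonneg ((chartPartition n M).nonneg _ _)
        (volDensity_pos h hy).le) (h0 _)
    · rw [cylLocal_of_notMem fun h => hy (partSupport_subset c h)]; rfl
  have hs : ∀ c : M, ∀ t, HasCompactSupport fun y => cylLocal h c Z (y, t) := fun c t =>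
    HasCompactSupport.intro (isCompact_partSupport c) fun y hy => cylLocal_of_notMem hy
  have hc : ∀ c : M, ∀ t, Continuous fun y => cylLocal h c Z (y, t) := fun c t =>
    (continuous_cylLocal h c hZ).comp (continuous_id.prodMk continuous_const)
  have hre : ∀ t, (riemannIntegral h fun x => Z (x, t)).re
      = ∑ c ∈ chartIndex n M, ∫ y, (cylLocal h c Z (y, t)).re := by
    intro t; rw [riemannIntegral_slice, Complex.re_sum]
    exact sum_congr rfl fun c _ => (integral_re
      ((hc c t).integrable_of_hasCompactSupport (hs c t))).symm
  have hin : ∀ t, 0 ≤ (riemannIntegral h fun x => Z (x, t)).re := fun t => by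
    rw [hre]; exact sum_nonneg fun c _ => integral_nonneg fun y => hL c _
  have hpos : 0 < (riemannIntegral h fun x => Z (x, p.2)).re := by
    obtain ⟨c, hcm, hcp⟩ : ∃ c ∈ chartIndex n M, chartPartition n M c p.1 ≠ 0 := by
      by_contra! h1
      have h2 := sum_chartPartition (n := n) p.1
      rw [sum_eq_zero h1] at h2; exact zero_ne_one h2
    have hsrc : p.1 ∈ (chartAt (Model n) c).source := by
      by_contra h1
      exact hcp (chartPartition_eq_zero_of_notMem h1)
    rw [hre]
    refine Finset.sum_pos' (fun c _ => integral_nonneg fun y => hL c _) ⟨c, hcm, ?_⟩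
    have hy := extChartAt_mem_chartDomain hsrc
    refine Continuous.integral_pos_of_hasCompactSupport_nonneg_nonzero
      (x := extChartAt (𝓡 n) c p.1) (Complex.continuous_re.comp (hc c p.2))
      ((hs c p.2).comp_left Complex.zero_re) (fun y => hL c _) ?_
    rw [cylLocal_of_mem (p := (extChartAt (𝓡 n) c p.1, p.2)) hy, re_ofReal_mul,
      chartPoint_extChartAt hsrc]
    exact mul_ne_zero (mul_ne_zero hcp (volDensity_pos h hy).ne') hp
  have h1 := integral_re (integrable_riemannIntegral h hZ hZ')
  refine lt_of_lt_of_eq ?_ h1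
  refine Continuous.integral_pos_of_hasCompactSupport_nonneg_nonzero (x := p.2)
    (Complex.continuous_re.comp (continuous_riemannIntegral h hZ))
    ((hasCompactSupport_riemannIntegral h hZ').comp_left Complex.zero_re) hin hpos.ne'

theorem eq_zero_of_cylInner {W : M × ℝ → ℂ} (h : Metric n M) (hW : Continuous W)
    (h0 : ∀ u : M × ℝ → ℂ, CylSmooth (n := n) u → HasCompactSupport u → cylInner h u W = 0) :
    W = 0 := by
  by_contra hne
  obtain ⟨p, hp⟩ := ne_iff.1 hne
  have hp' := hp
  have hO : {q | 0 < (W p * conj (W q)).re} ∈ 𝓝 p := by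
    have hc : Continuous fun q => (W p * conj (W q)).re :=
      Complex.continuous_re.comp (continuous_const.mul (continuous_conj.comp hW))
    refine (isOpen_lt continuous_const hc).mem_nhds ?_
    rw [mem_ofPred_eq, Complex.mul_conj, Complex.ofReal_re]; exact Complex.normSq_pos.2 hp'
  obtain ⟨φ, -, hφ⟩ := (SmoothBumpFunction.nhds_basis_tsupport
    (I := (𝓡 n).prod 𝓘(ℝ, ℝ)) p).mem_iff.1 hO
  have hφs : CylSmooth fun q => ((φ q) : ℂ) * W p :=
    contMDiff_complex_mul (ofRealCLM.contDiff.contMDiff.comp φ.contMDiff) contMDiff_const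
  have hφc := φ.hasCompactSupport.comp_left (g := fun r : ℝ => r * W p) (by simp)
  refine (re_integral_riemannIntegral_pos h (Z := fun q => φ q * W p * conj (W q)) (p := p)
    (hφs.continuous.mul (continuous_conj.comp hW)) hφc.mul_right (fun q => ?_) ?_).ne'
    (congrArg Complex.re (h0 _ hφs hφc))
  · rw [mul_assoc, re_ofReal_mul]
    by_cases hq : q ∈ tsupport φ
    · exact mul_nonneg φ.nonneg (le_of_lt (hφ hq))
    · rw [image_eq_zero_of_notMem_tsupport hq, zero_mul]
  · rw [mul_assoc, re_ofReal_mul, φ.eq_one, one_mul]; rw [Complex.mul_conj, Complex.ofReal_re]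
    exact (Complex.normSq_pos.2 hp').ne'

end CylinderIntegral

/-! ### The external product -/

section ExternalProduct

variable {u v : M × ℝ → ℂ}

variable (n M) in
def DiffOp.zero : DiffOp n M where
  X _ := (0 : Model n)
  Y _ := (0 : Model n)
  c _ := 0
  smooth_X := Bundle.contMDiff_zeroSection ℝ (TangentSpace (𝓡 n) : M → Type _)
  smooth_Y := Bundle.contMDiff_zeroSection ℝ (TangentSpace (𝓡 n) : M → Type _)
  smooth_c := contMDiff_const

theorem DiffOp.zero_apply (f : M → ℂ) (x : M) : (DiffOp.zero n M).apply f x = 0 := by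
  have h0 : fieldDeriv (DiffOp.zero n M).X f x = 0 := map_zero (mfderiv (𝓡 n) 𝓘(ℝ, ℂ) f x)
  have h1 : fieldDeriv (DiffOp.zero n M).Y f x = 0 := h0
  rw [DiffOp.apply_eq, h0, h1]
  simp [DiffOp.zero]

theorem DiffOp.zero_symbol (x : M) (ξ : TangentSpace (𝓡 n) x →L[ℝ] ℝ) :
    (DiffOp.zero n M).symbol x ξ = 0 := by
  refine (congrArg (fun a : ℝ => I * (a + I * a)) (map_zero ξ)).trans ?_
  simp

def DiffOp.toCyl (P : DiffOp n M) (a b : ℂ) : CylDiffOp n M where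
  toDiffOp := P
  a _ := a
  b _ := b
  smooth_a := contMDiff_const
  smooth_b := contMDiff_const

theorem DiffOp.toCyl_apply (P : DiffOp n M) (a b : ℂ) (u : M × ℝ → ℂ) (p : M × ℝ) :
    (P.toCyl a b).apply u p = P.apply (fun x => u (x, p.2)) p.1
      + a * deriv (fun t => u (p.1, t)) p.2 + b * (p.2 : ℂ) * u p := rfl

theorem DiffOp.toCyl_symbol (P : DiffOp n M) (a b : ℂ) (x : M)
    (ξ : TangentSpace (𝓡 n) x →L[ℝ] ℝ) (w : Fin 2 → ℝ) : (P.toCyl a b).symbol x ξ w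
      = P.symbol x ξ + a * (I * (w 1 : ℂ)) + b * (w 0 : ℂ) := rfl

theorem cylShift_zero (g : Diffeo n M) (u : M × ℝ → ℂ) : cylShift g 0 u = u := by
  funext p
  simp [cylShift, iter_zero]

theorem CylSmooth.continuous_apply (hu : CylSmooth (n := n) u) (P : DiffOp n M) :
    Continuous fun p : M × ℝ => P.apply (fun x => u (x, p.2)) p.1 :=
  ((hu.continuous_fieldDeriv P.smooth_X).add (continuous_const.mul
    (hu.continuous_fieldDeriv P.smooth_Y))).add
    ((P.smooth_c.continuous.comp continuous_fst).mul hu.continuous)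

theorem CylSmooth.continuous_cylApply (hu : CylSmooth (n := n) u) (P : CylDiffOp n M) :
    Continuous (P.apply u) :=
  ((hu.continuous_apply P.toDiffOp).add ((P.smooth_a.continuous.comp continuous_fst).mul
    hu.continuous_deriv)).add (((P.smooth_b.continuous.comp continuous_fst).mul
    (continuous_ofReal.comp continuous_snd)).mul hu.continuous)

theorem CylSmooth.continuous_matrixApply (hu : CylSmooth (n := n) u)
    (g : Diffeo n M) (B : CylShiftOp n M) (i j : Fin 2) : Continuous (B.apply g i j u) :=
  continuous_finsetSum _ fun k _ => (contMDiff_cylShift hu g k).continuous_cylApply (B.op k i j)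

/-- The coefficient of `T̃^{-k}` in `D̃^*`. -/
def ShiftOp.adjointOp (h : Metric n M) (g : Diffeo n M) (D : ShiftOp n M) (k : ℤ) :
    DiffOp n M := ((D.op k).adjoint h).push g k

open Classical in
/-- The external product `D̃ # A`. -/
def externalProduct (h : Metric n M) (g : Diffeo n M) (D : ShiftOp n M) : CylShiftOp n M where
  supp := D.supp ∪ (D.supp.image (-·) ∪ {0})
  op k := !![(if k ∈ D.supp then D.op k else DiffOp.zero n M).toCyl 0 0,
      (DiffOp.zero n M).toCyl (if k = 0 then 1 else 0) (if k = 0 then 1 else 0);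
      (DiffOp.zero n M).toCyl (if k = 0 then 1 else 0) (if k = 0 then -1 else 0),
      (if -k ∈ D.supp then D.adjointOp h g (-k) else DiffOp.zero n M).toCyl 0 0]

theorem externalProduct_apply00 (D : ShiftOp n M) (u : M × ℝ → ℂ) (p : M × ℝ) :
    (externalProduct h g D).apply g 0 0 u p = D.cylApply g u p := by
  classical
  refine (Finset.sum_subset_zero_on_sdiff Finset.subset_union_left (fun k hk => ?_)
    fun k hk => ?_).symm
  · have h0 := (Finset.mem_sdiff.1 hk).2
    change ((if k ∈ D.supp then D.op k else DiffOp.zero n M).toCyl 0 0).apply _ _ = 0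
    rw [if_neg h0, DiffOp.toCyl_apply, DiffOp.zero_apply]; simp
  · change _ = ((if k ∈ D.supp then D.op k else DiffOp.zero n M).toCyl 0 0).apply _ _
    rw [if_pos hk, DiffOp.toCyl_apply]; simp

theorem externalProduct_apply_offDiag (D : ShiftOp n M) (i j : Fin 2) (b : ℂ)
    (hij : ∀ k, (externalProduct h g D).op k i j
      = (DiffOp.zero n M).toCyl (if k = 0 then 1 else 0) (if k = 0 then b else 0))
    (u : M × ℝ → ℂ) (p : M × ℝ) :
    (externalProduct h g D).apply g i j u p
      = deriv (fun t => u (p.1, t)) p.2 + b * (p.2 : ℂ) * u p := by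
  classical
  unfold CylShiftOp.apply
  rw [sum_eq_single 0]
  · rw [hij, DiffOp.toCyl_apply, DiffOp.zero_apply, cylShift_zero]; simp
  · intro k _ hk; rw [hij, DiffOp.toCyl_apply, DiffOp.zero_apply]; simp [hk]
  · intro h0
    exact absurd (Finset.mem_union_right _ (Finset.mem_union_right _ (Finset.mem_singleton_self _)))
      h0

theorem externalProduct_apply11 (D : ShiftOp n M) (u : M × ℝ → ℂ) (p : M × ℝ) :
    (externalProduct h g D).apply g 1 1 u p = ∑ k ∈ D.supp,
      (D.adjointOp h g k).apply (fun x => cylShift g (-k) u (x, p.2)) p.1 := by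
  classical
  have h1 : ∑ k ∈ D.supp, (D.adjointOp h g k).apply (fun x => cylShift g (-k) u (x, p.2)) p.1
      = ∑ k ∈ D.supp.image (-·), (D.adjointOp h g (-k)).apply
        (fun x => cylShift g k u (x, p.2)) p.1 := by
    rw [Finset.sum_image (neg_injective.injOn)]; simp
  rw [h1]
  refine (Finset.sum_subset_zero_on_sdiff (Finset.subset_union_left.trans
    Finset.subset_union_right) (fun k hk => ?_) fun k hk => ?_).symm
  · have h0 := fun h0 => (Finset.mem_sdiff.1 hk).2 (Finset.mem_image.2 ⟨-k, h0, neg_neg k⟩)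
    change ((if -k ∈ D.supp then D.adjointOp h g (-k) else DiffOp.zero n M).toCyl 0 0).apply _ _ = 0
    rw [if_neg h0, DiffOp.toCyl_apply, DiffOp.zero_apply]; simp
  · obtain ⟨j, hj, rfl⟩ := Finset.mem_image.1 hk
    change _ = ((if - -j ∈ D.supp then D.adjointOp h g (- -j) else DiffOp.zero n M).toCyl 0 0
      ).apply _ _
    rw [if_pos (by rwa [neg_neg]), DiffOp.toCyl_apply]
    simp

theorem integral_deriv_eq_zero {f : ℝ → ℂ} (hf : ContDiff ℝ ∞ f) (hc : HasCompactSupport f) :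
    ∫ t, deriv f t = 0 :=
  integral_eq_zero_of_hasDerivAt_of_integrable (fun t => (hf.differentiable (by simp) t).hasDerivAt)
    ((hf.continuous_deriv (by simp)).integrable_of_hasCompactSupport hc.deriv)
    (hf.continuous.integrable_of_hasCompactSupport hc)

theorem hasCompactSupport_slice (hu : HasCompactSupport u) (x : M) :
    HasCompactSupport fun t => u (x, t) :=
  HasCompactSupport.intro (hu.image continuous_snd) fun _ ht =>
    image_eq_zero_of_notMem_tsupport fun h3 => ht ⟨_, h3, rfl⟩

theorem hasCompactSupport_deriv (hu : HasCompactSupport u) :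
    HasCompactSupport fun p : M × ℝ => deriv (fun t => u (p.1, t)) p.2 := by
  refine HasCompactSupport.intro ((isCompact_univ).prod (hu.image continuous_snd)) fun p hp => ?_
  have h2 : (fun t => u (p.1, t)) =ᶠ[𝓝 p.2] fun _ => 0 := by
    filter_upwards [(hu.image continuous_snd).isClosed.isOpen_compl.mem_nhds (fun h1 => hp ⟨trivial,
      h1⟩)] with t ht
    exact image_eq_zero_of_notMem_tsupport fun h3 => ht ⟨_, h3, rfl⟩
  rw [h2.deriv_eq, deriv_const]

theorem deriv_mul_conj (hu : CylSmooth (n := n) u) (hv : CylSmooth (n := n) v) (p : M × ℝ) :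
    deriv (fun t => u (p.1, t) * conj (v (p.1, t))) p.2
      = deriv (fun t => u (p.1, t)) p.2 * conj (v p)
        + u p * conj (deriv (fun t => v (p.1, t)) p.2) := by
  have h1 := ((hu.slice' p.1).differentiable (by simp) p.2).hasDerivAt
  have h2 := ((hv.slice' p.1).differentiable (by simp) p.2).hasDerivAt
  exact (h1.mul h2.star).deriv

theorem isFormalAdjoint_opA (h : Metric n M) :
    IsFormalAdjoint h opA fun v p => -(deriv (fun t => v (p.1, t)) p.2 + -1 * (p.2 : ℂ) * v p) := by
  intro u v hu huc hv hvc
  have hw : CylSmooth fun p => u p * conj (v p) := contMDiff_complex_mul hu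
    (Complex.conjCLE.contDiff.contMDiff.comp hv)
  have hwc : HasCompactSupport fun p => u p * conj (v p) := huc.mul_right
  have hwd := hw.continuous_deriv
  have hwdc := hasCompactSupport_deriv (u := fun p => u p * conj (v p)) hwc
  have h0 := integral_riemannIntegral_eq_zero h hwd hwdc (fun x => integral_deriv_eq_zero (hw.slice'
    x) (hasCompactSupport_slice hwc x))
  have hd := deriv_mul_conj hu hv
  have hA : Continuous fun p => u p
      * conj (-(deriv (fun t => v (p.1, t)) p.2 + -1 * p.2 * v p)) := by
    refine hu.continuous.mul (continuous_conj.comp ?_)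
    exact ((CylSmooth.continuous_deriv hv).add ((continuous_const.mul
      (continuous_ofReal.comp continuous_snd)).mul hv.continuous)).neg
  have key : ∀ t, (riemannIntegral h fun x => opA u (x, t) * conj (v (x, t)))
      = (riemannIntegral h fun x => deriv (fun t => u (x, t) * conj (v (x, t))) t)
        + riemannIntegral h fun x => u (x, t)
          * conj (-(deriv (fun t => v (x, t)) t + -1 * t * v (x, t))) := by
    intro t
    have hc1 : Continuous fun x => deriv (fun t => u (x, t) * conj (v (x, t))) t :=
      hwd.comp (continuous_id.prodMk continuous_const)
    have hc2 : Continuous fun x => u (x, t)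
        * conj (-(deriv (fun t => v (x, t)) t + -1 * t * v (x, t))) :=
      hA.comp (continuous_id.prodMk (continuous_const))
    rw [← riemannIntegral_add h hc1 hc2]; congr 1; funext x
    rw [hd (x, t)]; simp only [opA, map_neg, map_add, map_mul, map_one, Complex.conj_ofReal]; ring
  calc cylInner h (opA u) v = _ := integral_congr_ae (Eventually.of_forall key)
    _ = _ := integral_add (integrable_riemannIntegral h hwd hwdc) (integrable_riemannIntegral h hA
      huc.mul_right)
    _ = _ := by rw [h0, zero_add]; rfl

theorem IsIsometry.isFormalAdjoint_cylApply (hg : IsIsometry h g) (D : ShiftOp n M) :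
    IsFormalAdjoint h (D.cylApply g) ((externalProduct h g D).apply g 1 1) := by
  intro u v hu huc hv hvc
  have hE : ∀ k, Continuous fun p => u p * conj ((D.adjointOp h g k).apply
      (fun x => cylShift g (-k) v (x, p.2)) p.1) := fun k =>
    hu.continuous.mul (continuous_conj.comp ((contMDiff_cylShift hv g (-k)).continuous_apply _))
  have hint := fun k => integrable_riemannIntegral h (hE k) huc.mul_right
  have key : ∀ k t, (riemannIntegral h fun x =>
      (D.op k).apply (fun y => cylShift g k u (y, t)) x * conj (v (x, t)))
      = riemannIntegral h fun x => u (x, t + k)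
        * conj ((D.adjointOp h g k).apply (fun x => cylShift g (-k) v (x, t + k)) x) := by
    intro k t
    have hc : Continuous fun x => u (x, t + k)
        * conj ((D.adjointOp h g k).apply (fun x => cylShift g (-k) v (x, t + k)) x) :=
      (hE k).comp (continuous_id.prodMk (continuous_const (y := t + k)))
    rw [hg.riemannIntegral_apply (D.op k) ((contMDiff_cylShift hu g k).slice t)
      (CylSmooth.slice hv t), ← hg.riemannIntegral_comp k hc]
    congr 1; funext x
    have h1 := ((D.op k).adjoint h).push_apply g k (CylSmooth.slice hv t) (iter g k x)
    rw [iter_neg_iter] at h1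
    have h2 : (fun x => cylShift g (-k) v (x, t + k)) = fun x => v (iter g (-k) x, t) := by
      funext x
      simp [cylShift]
    simp only [h2]; simp only [cylShift]
    exact congrArg (fun a => u (iter g k x, t + k) * conj a) h1.symm
  have hL : ∀ t, (riemannIntegral h fun x => D.cylApply g u (x, t) * conj (v (x, t)))
      = ∑ k ∈ D.supp, riemannIntegral h fun x => u (x, t + k)
        * conj ((D.adjointOp h g k).apply (fun x => cylShift g (-k) v (x, t + k)) x) := by
    intro t; rw [← sum_congr rfl fun k _ => key k t, ← riemannIntegral_sum]
    · simp only [ShiftOp.cylApply, sum_mul]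
    · intro k _
      exact (((contMDiff_cylShift hu g k).continuous_apply (D.op k)).comp
        (continuous_id.prodMk continuous_const)).mul
        (continuous_conj.comp (CylSmooth.slice hv t).continuous)
  have hR : ∀ t, (riemannIntegral h fun x => u (x, t)
      * conj ((externalProduct h g D).apply g 1 1 v (x, t)))
      = ∑ k ∈ D.supp, riemannIntegral h fun x => u (x, t)
        * conj ((D.adjointOp h g k).apply (fun x => cylShift g (-k) v (x, t)) x) := by
    intro t; rw [← riemannIntegral_sum]
    · congr 1; funext x
      rw [externalProduct_apply11, map_sum, mul_sum]
    · exact fun k _ => (hE k).comp (continuous_id.prodMk continuous_const)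
  unfold cylInner
  rw [integral_congr_ae (Eventually.of_forall hL), integral_congr_ae (Eventually.of_forall hR),
    integral_finsetSum _ fun k _ => hint k,
    integral_finsetSum _ fun k _ => (hint k).comp_add_right k]
  exact sum_congr rfl fun k _ => integral_add_right_eq_self (fun t =>
    riemannIntegral h fun x => u (x, t)
      * conj ((D.adjointOp h g k).apply (fun x => cylShift g (-k) v (x, t)) x)) k

theorem IsIsometry.isExternalProduct_externalProduct (hg : IsIsometry h g) (D : ShiftOp n M) :
    IsExternalProduct h g D (externalProduct h g D) where
  entry00 u _ := funext fun p => externalProduct_apply00 D u p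
  entry01 u _ := funext fun p => by
    rw [externalProduct_apply_offDiag D 0 1 1 fun k => rfl, one_mul]; rfl
  entry10 := by
    have h1 : (fun v => -(externalProduct h g D).apply g 1 0 v) = fun v p =>
        -(deriv (fun t => v (p.1, t)) p.2 + -1 * (p.2 : ℂ) * v p) := by
      funext v p
      rw [Pi.neg_apply, externalProduct_apply_offDiag D 1 0 (-1) fun k => rfl]
    rw [h1]; exact isFormalAdjoint_opA h
  entry11 := hg.isFormalAdjoint_cylApply D

end ExternalProduct

/-! ### Uniqueness of the symbol of the external product -/

section Uniqueness

theorem shiftSum_congr {K K' : Finset ℤ} {s s' : ℤ → ℤ → ℂ}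
    (h : ∀ k m, (if k ∈ K then s k m else 0) = if k ∈ K' then s' k m else 0) :
    shiftSum K s = shiftSum K' s' := by
  classical
  have h1 : ∀ K (s : ℤ → ℤ → ℂ) (u : L2Z) m, ∑ k ∈ K, s k m * u (m + k)
        = ∑ᶠ k, (if k ∈ K then s k m else 0) * u (m + k) := by
    intro K s u m; rw [finsum_eq_sum_of_support_subset]
    · exact sum_congr rfl fun k hk => by rw [if_pos hk]
    · intro k hk
      by_contra h0
      have h0' : k ∉ K := h0
      simp [h0'] at hk
  simp only [shiftSum, h1, h]

theorem shiftSum_eq_of_coeff {K : Finset ℤ} {s : ℤ → ℤ → ℂ} {A : BoundedOp}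
    (hA : ∀ i j, coeff A i j = ∑ k ∈ K, if i + k = j then s k i else 0) : shiftSum K s = A := by
  have key : ∀ u m, (A u) m = ∑ k ∈ K, s k m * u (m + k) := by
    intro u m; refine (hasSum_coeff_apply A u m).unique ?_; simp only [hA, sum_mul]
    refine hasSum_sum fun k _ => ?_
    have h1 : (fun j => (if m + k = j then s k m else 0) * u j)
        = fun j => if j = m + k then s k m * u (m + k) else 0 := by
      funext j
      split_ifs with h2 h3 h3
      · rw [h3]
      · exact absurd h2.symm h3
      · exact absurd h3.symm h2
      · rw [zero_mul]
    rw [h1]; exact hasSum_ite_eq _ _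
  have hex : ∃ A : BoundedOp, ∀ u m, (A u) m = ∑ k ∈ K, s k m * u (m + k) := ⟨A, key⟩
  rw [shiftSum, dif_pos hex]
  ext u m
  rw [hex.choose_spec, key]

theorem exists_fieldDeriv_eq (x : M) (ξ : Covec n) : ∃ f : M → ℂ, SmoothFn[n] f ∧ f x = 0 ∧
      ∀ X : ∀ x : M, TangentSpace (𝓡 n) x, fieldDeriv X f x = (ξ (X x) : ℂ) := by
  obtain ⟨φ⟩ : Nonempty (SmoothBumpFunction (𝓡 n) x) := inferInstance
  let L : Model n →L[ℝ] ℂ := ofRealCLM.comp (ξ.comp (chartTan x (extChartAt (𝓡 n) x x)))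
  let G : M → ℂ := fun x' => L (extChartAt (𝓡 n) x x' - extChartAt (𝓡 n) x x)
  have hG : ContMDiffOn (𝓡 n) 𝓘(ℝ, ℂ) ∞ G (chartAt (Model n) x).source :=
    (L.contDiff.comp (contDiff_id.sub contDiff_const)).contMDiff.comp_contMDiffOn
      (contMDiffOn_extChartAt (I := 𝓡 n))
  have hf := φ.contMDiff_smul hG
  refine ⟨_, hf, by simp [G], fun X => ?_⟩
  have hx := mem_chart_source (Model n) x
  have hy := extChartAt_mem_chartDomain hx
  have h1 := fieldDeriv_chartPoint (u := fun x' => φ x' • G x')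
    (hf.mdifferentiable (by simp) (chartPoint x (extChartAt (𝓡 n) x x))) hy X
  rw [chartPoint_extChartAt hx] at h1
  rw [h1]
  have h2 : (fun y => φ (chartPoint x y) • G (chartPoint x y))
      =ᶠ[𝓝 (extChartAt (𝓡 n) x x)] fun y => L (y - extChartAt (𝓡 n) x x) := by
    have h3 : Tendsto (fun y => chartPoint x y) (𝓝 (extChartAt (𝓡 n) x x)) (𝓝 x) := by
      have := ((continuousOn_chartPoint x).continuousAt ((isOpen_chartDomain x).mem_nhds
        hy)).tendsto
      rwa [chartPoint_extChartAt hx] at this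
    filter_upwards [h3.eventually φ.eventuallyEq_one, (isOpen_chartDomain x).mem_nhds hy]
      with y hy1 hy2
    rw [hy1]; simp only [G, Pi.one_apply, one_smul]; rw [extChartAt_chartPoint hy2]
  rw [h2.fderiv_eq]
  have h4 : HasFDerivAt (fun y => L (y - extChartAt (𝓡 n) x x)) L (extChartAt (𝓡 n) x x) :=
    L.hasFDerivAt.comp (extChartAt (𝓡 n) x x) ((hasFDerivAt_id _).sub_const _)
  rw [h4.fderiv]
  have h5 := chartTan_fieldCoord X hy
  have h6 : ∀ x', x' = x → (ξ (X x') : ℂ) = (ξ (X x) : ℂ) := fun x' h => by rw [h]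
  exact (congrArg (fun v => ((ξ v) : ℂ)) h5).trans (h6 _ (chartPoint_extChartAt hx))

/-- A test function that is concentrated near `{t = t₀}` after the shift by `k`. -/
def shiftedTest (g : Diffeo n M) (k : ℤ) (t₀ : ℝ) (f : M → ℂ) (ρ : ℝ → ℂ) : M × ℝ → ℂ :=
  fun p => f (iter g (-k) p.1) * ρ (p.2 - t₀ - k)

variable {ρ : ℝ → ℂ}

theorem contMDiff_shiftedTest (g : Diffeo n M) (k : ℤ) (t₀ : ℝ)
    (hf : SmoothFn[n] f) (hρ : ContDiff ℝ ∞ ρ) :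
    CylSmooth (n := n) (shiftedTest g k t₀ f ρ) :=
  contMDiff_complex_mul ((hf.comp (contMDiff_iter g (-k))).comp contMDiff_fst)
    ((hρ.comp ((contDiff_id.sub contDiff_const).sub contDiff_const)).contMDiff.comp contMDiff_snd)

theorem hasCompactSupport_shiftedTest (g : Diffeo n M) (k : ℤ) (t₀ : ℝ)
    (hρ : HasCompactSupport ρ) : HasCompactSupport (shiftedTest g k t₀ f ρ) := by
  refine HasCompactSupport.intro ((isCompact_univ).prod
    (hρ.image (continuous_id.add (continuous_const (y := t₀ + k))))) fun p hp => ?_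
  rw [shiftedTest, (image_eq_zero_of_notMem_tsupport fun h1 => hp ⟨trivial, _, h1, by simp⟩),
    mul_zero]

theorem CylDiffOp.apply_prod (P : CylDiffOp n M) (f : M → ℂ) {ρ : ℝ → ℂ}
    (hf : SmoothFn[n] f) (x : M) (t : ℝ) :
    P.apply (fun p => f p.1 * ρ p.2) (x, t) = (fieldDeriv P.X f x + I * fieldDeriv P.Y f x
      + P.c x * f x) * ρ t + P.a x * (f x * deriv ρ t) + P.b x * t * (f x * ρ t) := by
  have hm : ∀ X : ∀ x : M, TangentSpace (𝓡 n) x,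
      fieldDeriv X (fun x => f x * ρ t) x = fieldDeriv X f x * ρ t := by
    intro X; rw [fieldDeriv_mul hf contMDiff_const]
    have : fieldDeriv X (fun _ => ρ t) x = 0 := by
      unfold fieldDeriv; rw [mfderiv_const]; rfl
    rw [this, mul_zero, add_zero]
  have h1 : P.toDiffOp.apply (fun x => f x * ρ t) x = fieldDeriv P.X f x * ρ t
      + I * (fieldDeriv P.Y f x * ρ t) + P.c x * (f x * ρ t) := by
    rw [DiffOp.apply_eq, hm, hm]
  unfold CylDiffOp.apply
  simp only [h1, (deriv_const_mul_field _)]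
  ring

theorem CylDiffOp.apply_cylShift_shiftedTest (P : CylDiffOp n M) (k k' : ℤ) (x : M) (t : ℝ)
    (hf : SmoothFn[n] f) :
    P.apply (cylShift g k' (shiftedTest g k t f ρ)) (x, t)
      = (fieldDeriv P.X (fun x => f (iter g (-k) (iter g k' x))) x
          + I * fieldDeriv P.Y (fun x => f (iter g (-k) (iter g k' x))) x
          + P.c x * f (iter g (-k) (iter g k' x))) * ρ (t + (k' - t - k))
        + P.a x * (f (iter g (-k) (iter g k' x)) * deriv ρ (t + (k' - t - k)))
        + P.b x * t * (f (iter g (-k) (iter g k' x)) * ρ (t + (k' - t - k))) := by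
  have hsh : cylShift g k' (shiftedTest g k t f ρ)
      = fun p => (fun x => f (iter g (-k) (iter g k' x))) p.1
        * (fun s => ρ (s + (k' - t - k))) p.2 := by
    funext p
    simp only [cylShift, shiftedTest]; congr 2; ring
  have h1 := P.apply_prod _ (ρ := fun s => ρ (s + (k' - t - k))) ((hf.comp (contMDiff_iter g
    (-k))).comp (contMDiff_iter g k')) x t
  rw [deriv_comp_add_const] at h1
  rw [hsh]
  exact h1

theorem CylShiftOp.apply_shiftedTest (B : CylShiftOp n M) (i j : Fin 2) (k : ℤ) (x : M) (t : ℝ)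
    (hf : SmoothFn[n] f) (hρ : tsupport ρ ⊆ ball 0 1) :
    B.apply g i j (shiftedTest g k t f ρ) (x, t) = if k ∈ B.supp then
      (fieldDeriv (B.op k i j).X f x + I * fieldDeriv (B.op k i j).Y f x
        + (B.op k i j).c x * f x) * ρ 0 + (B.op k i j).a x * (f x * deriv ρ 0)
        + (B.op k i j).b x * t * (f x * ρ 0) else 0 := by
  have hval := fun k' => (B.op k' i j).apply_cylShift_shiftedTest (g := g) (ρ := ρ) k k' x t hf
  have hzero : ∀ k', k' ≠ k →
      (B.op k' i j).apply (cylShift g k' (shiftedTest g k t f ρ)) (x, t) = 0 := by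
    intro k' hk
    have h1 : t + (k' - t - k) ∉ tsupport ρ := by
      intro h1
      have h2 := mem_ball_zero_iff.1 (hρ h1)
      have h3 : t + (k' - t - k) = ((k' - k : ℤ) : ℝ) := by push_cast; ring
      rw [h3, Real.norm_eq_abs, ← Int.cast_abs] at h2
      have h4 : |k' - k| < 1 := by exact_mod_cast h2
      exact hk (sub_eq_zero.1 (Int.abs_lt_one_iff.1 h4))
    rw [hval, (image_eq_zero_of_notMem_tsupport h1), (image_eq_zero_of_notMem_tsupport fun h4 => h1
      (tsupport_deriv_subset h4))]; ring
  unfold CylShiftOp.apply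
  split_ifs with hk
  · rw [sum_eq_single k (fun k' _ hk' => hzero k' hk') fun h0 => absurd hk h0, hval]
    have h1 : t + (k - t - k) = 0 := by ring
    simp only [iter_neg_iter, h1]
  · exact sum_eq_zero fun k' hk' => hzero k' fun h0 => hk (h0 ▸ hk')

theorem CylShiftOp.symbol_eq_of_apply_eq (B B' : CylShiftOp n M) (i j : Fin 2)
    (hB : ∀ u : M × ℝ → ℂ, CylSmooth (n := n) u → HasCompactSupport u →
      B.apply g i j u = B'.apply g i j u) (k : ℤ) (x : M) (ξ : Covec n) (w : Fin 2 → ℝ) :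
    (if k ∈ B.supp then (B.op k i j).symbol x ξ w else 0)
      = if k ∈ B'.supp then (B'.op k i j).symbol x ξ w else 0 := by
  have key : ∀ (f : M → ℂ) (ρ : ℝ → ℂ) (t : ℝ), SmoothFn[n] f →
      ContDiff ℝ ∞ ρ → HasCompactSupport ρ → tsupport ρ ⊆ ball 0 1 → _ = _ :=
    fun f ρ t hf hρ hρc hρs => (B.apply_shiftedTest i j k x t hf hρs).symm.trans
      ((congrFun (hB _ (contMDiff_shiftedTest g k t hf hρ)
        (hasCompactSupport_shiftedTest g k t hρc)) (x, t)).trans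
        (B'.apply_shiftedTest i j k x t hf hρs))
  let φ : ContDiffBump (0 : ℝ) := ⟨1 / 4, 1 / 2, by norm_num, by norm_num⟩
  have hφs : ContDiff ℝ ∞ fun s => ((φ s : ℝ) : ℂ) := ofRealCLM.contDiff.comp φ.contDiff
  have hφc : HasCompactSupport fun s => ((φ s : ℝ) : ℂ) := φ.hasCompactSupport.comp_left ofReal_zero
  have hφt : tsupport (fun s => ((φ s : ℝ) : ℂ)) ⊆ ball 0 1 := by
    refine (tsupport_comp_subset (g := fun r : ℝ => (r : ℂ)) ofReal_zero φ).trans ?_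
    rw [φ.tsupport_eq]; exact Metric.closedBall_subset_ball (by norm_num)
  have hφ0 : φ 0 = 1 := φ.one_of_mem_closedBall (Metric.mem_closedBall_self (by norm_num))
  have hφd : deriv (fun s => ((φ s : ℝ) : ℂ)) 0 = 0 := by
    have h1 : (fun s => ((φ s : ℝ) : ℂ)) =ᶠ[𝓝 0] fun _ => 1 := by
      filter_upwards [φ.eventuallyEq_one] with s hs
      rw [hs]; simp
    rw [h1.deriv_eq, deriv_const]
  have hψs : ContDiff ℝ ∞ fun s : ℝ => (s : ℂ) * ((φ s : ℝ) : ℂ) := ofRealCLM.contDiff.mul hφs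
  have hψc : HasCompactSupport fun s : ℝ => (s : ℂ) * ((φ s : ℝ) : ℂ) := hφc.mul_left
  have hψt : tsupport (fun s : ℝ => (s : ℂ) * ((φ s : ℝ) : ℂ)) ⊆ ball 0 1 :=
    (tsupport_mul_subset_right).trans hφt
  have hψd : deriv (fun s : ℝ => (s : ℂ) * ((φ s : ℝ) : ℂ)) 0 = 1 := by
    have h1 := (ofRealCLM.hasDerivAt (x := (0 : ℝ))).mul (hφs.differentiable (by simp) 0).hasDerivAt
    refine h1.deriv.trans ?_; simp [hφ0]
  have hone : SmoothFn[n] fun _ : M => (1 : ℂ) := contMDiff_const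
  have hX1 : ∀ X : ∀ x : M, TangentSpace (𝓡 n) x, fieldDeriv X (fun _ : M => (1 : ℂ)) x = 0 := by
    intro X; unfold fieldDeriv; rw [mfderiv_const]; rfl
  obtain ⟨f, hf, hf0, hfX⟩ := exists_fieldDeriv_eq x ξ
  have e1 := key f _ 0 hf hφs hφc hφt
  have e2 := key _ _ 0 hone hφs hφc hφt
  have e3 := key _ _ 1 hone hφs hφc hφt
  have e4 := key _ _ 0 hone hψs hψc hψt
  simp only [hf0, hfX, hX1, hφ0, hφd, hψd, ofReal_zero, ofReal_one, mul_zero, mul_one, add_zero,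
    zero_add] at e1 e2 e3 e4
  have hs : ∀ P : CylDiffOp n M, P.symbol x ξ w = I * ((ξ (P.X x) : ℂ)
      + I * (ξ (P.Y x) : ℂ)) + P.a x * (I * (w 1 : ℂ)) + P.b x * (w 0 : ℂ) :=
    fun P => rfl
  rw [hs, hs]
  split_ifs at e1 e2 e3 e4 ⊢ with h1 h2 h2
  · rw [e1, e4, show (B.op k i j).b x = (B'.op k i j).b x by linear_combination e3 - e2]
  · rw [e1, e4, show (B.op k i j).b x = 0 by linear_combination e3 - e2]
    ring
  · rw [← e1, ← e4, show (B'.op k i j).b x = 0 by linear_combination e2 - e3]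
    ring
  · rfl

theorem IsFormalAdjoint.unique {P Q Q' : (M × ℝ → ℂ) → M × ℝ → ℂ} (hQ : IsFormalAdjoint (n := n) h P
    Q)
    (hQ' : IsFormalAdjoint h P Q') {v : M × ℝ → ℂ} (hv : CylSmooth (n := n) v)
    (hvc : HasCompactSupport v) (h1 : Continuous (Q v)) (h2 : Continuous (Q' v)) :
    Q v = Q' v := by
  refine sub_eq_zero.1 (eq_zero_of_cylInner h (h1.sub h2) fun u hu huc => ?_)
  have hZ : ∀ {W : M × ℝ → ℂ}, Continuous W → Continuous fun p => u p * conj (W p) := fun hW =>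
    hu.continuous.mul (continuous_conj.comp hW)
  have hc : ∀ {W : M × ℝ → ℂ}, HasCompactSupport fun p => u p * conj (W p) := fun
    {W} => huc.mul_right
  have h3 : cylInner h u (Q v) = cylInner h u (Q v - Q' v) + cylInner h u (Q' v) := by
    have hi1 := integrable_riemannIntegral h (hZ (h1.sub h2)) hc
    have hi2 := integrable_riemannIntegral h (hZ h2) hc
    refine Eq.trans ?_ (integral_add hi1 hi2)
    refine integral_congr_ae (Eventually.of_forall fun t => ?_)
    have hs := fun {W : M × ℝ → ℂ} (hW : Continuous W) => (hZ hW).comp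
      (continuous_id.prodMk (continuous_const (y := t)))
    refine Eq.trans ?_ (riemannIntegral_add h (hs (h1.sub h2)) (hs h2)); simp only; congr 1
    funext x
    simp only [Pi.sub_apply, map_sub]; ring
  rw [← hQ u v hu huc hv hvc, ← hQ' u v hu huc hv hvc] at h3
  exact right_eq_add.1 h3

theorem IsExternalProduct.symbolFun_eq {B B' : CylShiftOp n M}
    (hB : IsExternalProduct h g D B) (hB' : IsExternalProduct h g D B') :
    B.symbolFun g = B'.symbolFun g := by
  have h00 : ∀ i j : Fin 2, ∀ u : M × ℝ → ℂ, CylSmooth (n := n) u → HasCompactSupport u →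
      B.apply g i j u = B'.apply g i j u := by
    intro i j u hu huc
    have hc := hu.continuous_matrixApply g B
    have hc' := hu.continuous_matrixApply g B'
    fin_cases i <;> fin_cases j
    · exact (hB.entry00 u hu).trans (hB'.entry00 u hu).symm
    · exact (hB.entry01 u hu).trans (hB'.entry01 u hu).symm
    · exact neg_injective (hB.entry10.unique hB'.entry10 hu huc (hc 1 0).neg (hc' 1 0).neg)
    · exact hB.entry11.unique hB'.entry11 hu huc (hc 1 1) (hc' 1 1)
  funext x ξ w
  ext1 i j
  exact shiftSum_congr fun k m => CylShiftOp.symbol_eq_of_apply_eq B B' i j (h00 i j) k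
    (iter g m x) (codiff g m x ξ) w

theorem DiffOp.toCyl_symbol_ite (p : Prop) [Decidable p] (P : DiffOp n M) (x : M)
    (ξ : TangentSpace (𝓡 n) x →L[ℝ] ℝ) (w : Fin 2 → ℝ) :
    ((if p then P else DiffOp.zero n M).toCyl 0 0).symbol x ξ w
      = if p then P.symbol x ξ else 0 := by
  rw [DiffOp.toCyl_symbol, zero_mul, zero_mul, add_zero, add_zero]
  split_ifs
  · rfl
  · exact DiffOp.zero_symbol _ _

theorem DiffOp.adjoint_symbol (h : Metric n M) (P : DiffOp n M) (x : M)
    (ξ : TangentSpace (𝓡 n) x →L[ℝ] ℝ) : (P.adjoint h).symbol x ξ = conj (P.symbol x ξ) := by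
  have h1 : ξ ((P.adjoint h).X x) = -ξ (P.X x) := map_neg ξ _
  simp only [DiffOp.symbol, h1, map_mul, map_add, Complex.conj_I, Complex.conj_ofReal]
  push_cast
  simp only [DiffOp.adjoint]
  ring

theorem DiffOp.push_symbol (P : DiffOp n M) (g : Diffeo n M) (k : ℤ) (x : M)
    (ξ : TangentSpace (𝓡 n) x →L[ℝ] ℝ) :
    (P.push g k).symbol x ξ = P.symbol (iter g (-k) x) (codiff g (-k) x ξ) := by
  have h1 := P.symbol_codiff g (-k) x ξ
  rw [neg_neg] at h1
  exact h1.symm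

theorem symbol_adjointOp (D : ShiftOp n M) (m k : ℤ) (x : M) (ξ : TangentSpace (𝓡 n) x →L[ℝ] ℝ) :
    (D.adjointOp h g m).symbol (iter g k x) (codiff g k x ξ)
      = conj ((D.op m).symbol (iter g (-m + k) x) (codiff g (-m + k) x ξ)) := by
  rw [ShiftOp.adjointOp, DiffOp.push_symbol, DiffOp.adjoint_symbol]
  exact congrArg _ ((D.op m).symbol_codiff_add g (-m) k x ξ)

theorem symbolFun_offDiag (D : ShiftOp n M) (i j : Fin 2) (b : ℂ)
    (hij : ∀ k, (externalProduct h g D).op k i j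
      = (DiffOp.zero n M).toCyl (if k = 0 then 1 else 0) (if k = 0 then b else 0))
    (x : M) (ξ : TangentSpace (𝓡 n) x →L[ℝ] ℝ) (w : Fin 2 → ℝ) :
    (externalProduct h g D).symbolFun g x ξ w i j
      = (I * (w 1 : ℂ) + b * (w 0 : ℂ)) • (1 : BoundedOp) := by
  refine shiftSum_eq_of_coeff fun k l => ?_
  have h1 : coeff ((I * (w 1) + b * (w 0)) • 1) k l
      = if k + 0 = l then I * (w 1) + b * (w 0) else 0 := by
    simp [coeff, lp.single_apply, single_apply]
  rw [h1, sum_eq_single 0]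
  · rw [hij, DiffOp.toCyl_symbol, if_pos rfl, if_pos rfl, one_mul, DiffOp.zero_symbol, zero_add]
  · intro m _ hm; rw [hij, DiffOp.toCyl_symbol, if_neg hm, if_neg hm, DiffOp.zero_symbol]; simp
  · intro h0
    exact absurd (Finset.mem_union_right _ (Finset.mem_union_right _
      (Finset.mem_singleton_self _))) h0

theorem IsIsometry.symbolFun_externalProduct (hg : IsIsometry h g) (D : ShiftOp n M) :
    (externalProduct h g D).symbolFun g = extSymbol g D := by
  classical
  funext x ξ w
  ext1 i j
  fin_cases i <;> fin_cases j
  · refine shiftSum_congr fun k m => ?_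
    have hsub : k ∈ D.supp → k ∈ (externalProduct h g D).supp := fun hk =>
      Finset.mem_union_left _ hk
    change (if k ∈ (externalProduct h g D).supp then
      ((if k ∈ D.supp then D.op k else DiffOp.zero n M).toCyl 0 0).symbol _ _ w else 0) = _
    rw [DiffOp.toCyl_symbol_ite]
    by_cases hk : k ∈ D.supp
    · rw [if_pos (hsub hk)]
    · rw [if_neg hk, ite_self]
  · refine (symbolFun_offDiag D 0 1 1 (fun k => rfl) x ξ w).trans ?_
    refine congrArg (fun a : ℂ => a • (1 : BoundedOp)) ?_
    simp only [extraComplex]; ring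
  · refine (symbolFun_offDiag D 1 0 (-1) (fun k => rfl) x ξ w).trans ?_
    refine Eq.trans ?_ (neg_smul (conj (extraComplex w)) (1 : BoundedOp))
    refine congrArg (fun a : ℂ => a • (1 : BoundedOp)) ?_
    simp [extraComplex]; ring
  · refine shiftSum_eq_of_coeff fun k l => ?_
    change coeff (star (D.symbol g x ξ)) k l = ∑ m ∈ D.supp ∪ (D.supp.image (-·) ∪ {0}),
      if k + m = l then ((if -m ∈ D.supp then D.adjointOp h g (-m) else DiffOp.zero n M).toCyl 0 0
        ).symbol (iter g k x) (codiff g k x ξ) w else 0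
    simp only [DiffOp.toCyl_symbol_ite]
    have hsub : D.supp.image (-·) ⊆ D.supp ∪ (D.supp.image (-·) ∪ {0}) :=
      Finset.subset_union_left.trans Finset.subset_union_right
    rw [coeff_star, ← Finset.sum_subset hsub, Finset.sum_image neg_injective.injOn]
    · refine (congrArg conj (hg.coeff_symbol D x ξ l k)).trans ?_; rw [map_sum]
      refine sum_congr rfl fun m hm => ?_
      rw [neg_neg, if_pos hm, symbol_adjointOp]
      by_cases hkl : l + m = k
      · obtain rfl : l = -m + k := by omega
        rw [if_pos hkl, if_pos (by omega)]
      · rw [if_neg hkl, if_neg (by omega), map_zero]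
    · intro m _ hm
      have h0 : -m ∉ D.supp := fun h0 => hm (Finset.mem_image.2 ⟨-m, h0, neg_neg m⟩)
      rw [if_neg h0, ite_self]

end Uniqueness

/-! ### Antiderivations on functions with values in an algebra of forms -/

section Antiderivation

variable {𝒜 : Type*} [NormedRing 𝒜] [NormedAlgebra ℝ 𝒜] {d : ℕ}

/-- The differential `∑ₗ eₗ ∂ₗ X`. -/
def extD (e : Fin d → 𝒜) (X : (Fin d → ℝ) → 𝒜) (z : Fin d → ℝ) : 𝒜 :=
  ∑ l, e l * fderiv ℝ X z (Pi.single l 1)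

variable {e : Fin d → 𝒜} {X Y m u : (Fin d → ℝ) → 𝒜} {z : Fin d → ℝ} {Ω : Set (Fin d → ℝ)}

theorem extD_congr (h : X =ᶠ[𝓝 z] Y) : extD e X z = extD e Y z := by
  simp only [extD, h.fderiv_eq]

theorem extD_add (hX : DifferentiableAt ℝ X z) (hY : DifferentiableAt ℝ Y z) :
    extD e (fun z => X z + Y z) z = extD e X z + extD e Y z := by
  simp only [extD, ← sum_add_distrib, ← mul_add]
  rw [fderiv_fun_add hX hY]
  rfl

theorem extD_mul (hX : DifferentiableAt ℝ X z) (hY : DifferentiableAt ℝ Y z) {s : ℝ}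
    (hs : ∀ l, e l * X z = s • (X z * e l)) :
    extD e (fun z => X z * Y z) z = extD e X z * Y z + s • (X z * extD e Y z) := by
  simp only [extD, sum_mul, mul_sum, smul_sum, ← sum_add_distrib]
  refine sum_congr rfl fun l _ => ?_
  rw [fderiv_fun_mul' hX hY]
  simp only [_root_.add_apply, _root_.smul_apply, smul_eq_mul, MulOpposite.smul_eq_mul_unop,
    MulOpposite.unop_op, mul_add, ← mul_assoc, hs, smul_mul_assoc]
  abel

theorem extD_const_mul (a : 𝒜) (ha : ∀ l, Commute (e l) a) (hX : DifferentiableAt ℝ X z) :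
    extD e (fun z => a * X z) z = a * extD e X z := by
  have h := extD_mul (e := e) (differentiableAt_const a) hX fun l => by
    rw [one_smul]; exact ha l
  rw [h, one_smul, add_eq_right]
  simp [extD]

theorem contDiffOn_extD (hΩ : IsOpen Ω) (hX : SmoothOn X Ω) : SmoothOn (extD e X) Ω := by
  refine ContDiffOn.sum fun l _ => contDiffOn_const.mul ?_
  exact (hX.fderivOn hΩ).clm_apply contDiffOn_const

theorem extD_extD (he : ∀ k l, e k * e l = -(e l * e k)) (hΩ : IsOpen Ω) (hX : SmoothOn X Ω)
    (hz : z ∈ Ω) : extD e (extD e X) z = 0 := by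
  have hX1 := (hX.contDiffAt (hΩ.mem_nhds hz))
  have hd := (hX.fderivOn hΩ).diffAt hΩ hz
  have h1 : ∀ k, fderiv ℝ (extD e X) z (Pi.single k 1)
      = ∑ l, e l * fderiv ℝ (fderiv ℝ X) z (Pi.single k 1) (Pi.single l 1) := by
    intro k
    have h3 := (HasFDerivAt.fun_sum fun l (_ : l ∈ Finset.univ) => (fun l =>
      (((ContinuousLinearMap.mul ℝ 𝒜 (e l)).comp (ContinuousLinearMap.apply ℝ 𝒜 (Pi.single l 1 : Fin
      d → ℝ))).hasFDerivAt).comp z hd.hasFDerivAt) l).fderiv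
    refine (congrArg (fun L => L (Pi.single k 1)) h3).trans ?_
    simp
  have hsymm : ∀ k l, fderiv ℝ (fderiv ℝ X) z (Pi.single k 1) (Pi.single l 1)
      = fderiv ℝ (fderiv ℝ X) z (Pi.single l 1) (Pi.single k 1) := fun k l =>
    hX1.isSymmSndFDerivAt (by
      rw [minSmoothness_of_isRCLikeNormedField]; exact WithTop.coe_le_coe.2 le_top) _ _
  have h4 : extD e (extD e X) z = -extD e (extD e X) z := by
    have h5 : extD e (extD e X) z = ∑ k, ∑ l,
        e k * e l * fderiv ℝ (fderiv ℝ X) z (Pi.single k 1) (Pi.single l 1) := by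
      unfold extD at h1 ⊢; simp only [h1, mul_sum, ← mul_assoc]
    rw [h5, ← sum_neg_distrib]; refine sum_comm.trans (sum_congr rfl fun k _ => ?_)
    rw [← sum_neg_distrib]
    refine sum_congr rfl fun l _ => ?_
    rw [he l k, hsymm l k, neg_mul]
  have h6 : (2 : ℝ) • extD e (extD e X) z = 0 := by
    rw [two_smul]
    nth_rw 1 [h4]
    exact neg_add_cancel _
  exact (smul_eq_zero.1 h6).resolve_left (by norm_num)

/-- The logarithmic differentials `u dm` and `dm u` of a function `m` with inverse `u`. -/
def logD (e : Fin d → 𝒜) (m u : (Fin d → ℝ) → 𝒜) (z : Fin d → ℝ) : 𝒜 := u z * extD e m z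

def logD' (e : Fin d → 𝒜) (m u : (Fin d → ℝ) → 𝒜) (z : Fin d → ℝ) : 𝒜 := extD e m z * u z

/-- Smooth functions `m` and `u` of degree zero, inverse to each other, on an open set. -/
structure IsInvPair (e : Fin d → 𝒜) (m u : (Fin d → ℝ) → 𝒜) (Ω : Set (Fin d → ℝ)) : Prop where
  anticomm : ∀ k l, e k * e l = -(e l * e k)
  isOpen : IsOpen Ω
  smooth_m : SmoothOn m Ω
  smooth_u : SmoothOn u Ω
  mul_inv : ∀ z ∈ Ω, m z * u z = 1
  inv_mul : ∀ z ∈ Ω, u z * m z = 1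
  comm_m : ∀ z ∈ Ω, ∀ l v, Commute (e l) (fderiv ℝ m z v)
  comm_u : ∀ z ∈ Ω, ∀ l, Commute (e l) (u z)

namespace IsInvPair

variable (hI : IsInvPair e m u Ω) (hz : z ∈ Ω)
include hI hz

theorem mul_extD (l : Fin d) : e l * extD e m z = (-1 : ℝ) • (extD e m z * e l) := by
  simp only [extD, mul_sum, sum_mul, smul_sum]
  refine sum_congr rfl fun k _ => ?_
  rw [← mul_assoc, hI.anticomm l k, mul_assoc (e k), ← (hI.comm_m z hz l _).eq, neg_smul, one_smul,
    neg_mul, mul_assoc]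

theorem mul_logD (l : Fin d) : e l * logD e m u z = (-1 : ℝ) • (logD e m u z * e l) := by
  rw [logD, ← mul_assoc, (hI.comm_u z hz l).eq, mul_assoc, hI.mul_extD hz, mul_smul_comm, mul_assoc]

theorem mul_logD' (l : Fin d) : e l * logD' e m u z = (-1 : ℝ) • (logD' e m u z * e l) := by
  rw [logD', ← mul_assoc, hI.mul_extD hz, smul_mul_assoc, mul_assoc,
    (hI.comm_u z hz l).eq, mul_assoc]

theorem differentiableAt_m : DifferentiableAt ℝ m z := hI.smooth_m.diffAt hI.isOpen hz

theorem differentiableAt_u : DifferentiableAt ℝ u z := hI.smooth_u.diffAt hI.isOpen hz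

theorem differentiableAt_extD : DifferentiableAt ℝ (extD e m) z :=
  (contDiffOn_extD hI.isOpen hI.smooth_m).diffAt hI.isOpen hz

theorem extD_u : extD e u z = -(u z * extD e m z * u z) := by
  have h1 : extD e (fun z => u z * m z) z = 0 := by
    have : (fun z => u z * m z) =ᶠ[𝓝 z] fun _ => 1 := by
      filter_upwards [hI.isOpen.mem_nhds hz] with y hy using hI.inv_mul y hy
    rw [extD_congr this]; simp [extD]
  rw [extD_mul (hI.differentiableAt_u hz) (hI.differentiableAt_m hz) (fun l => by
    rw [one_smul]; exact hI.comm_u z hz l), one_smul] at h1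
  calc extD e u z = extD e u z * (m z * u z) := by rw [hI.mul_inv z hz, mul_one]
    _ = -(u z * extD e m z * u z) := by
      rw [← mul_assoc, eq_neg_of_add_eq_zero_left h1, neg_mul]

theorem extD_logD : extD e (logD e m u) z = -(logD e m u z ^ 2) := by
  have h1 := extD_mul (e := e) (hI.differentiableAt_u hz) (hI.differentiableAt_extD hz) (fun l => by
    rw [one_smul]; exact hI.comm_u z hz l)
  rw [extD_extD hI.anticomm hI.isOpen hI.smooth_m hz, mul_zero, smul_zero, add_zero, hI.extD_u
    hz] at h1
  refine h1.trans ?_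
  simp only [logD, pow_two, neg_mul, mul_assoc]

theorem extD_logD' : extD e (logD' e m u) z = logD' e m u z ^ 2 := by
  have h1 := extD_mul (hI.differentiableAt_extD hz) (hI.differentiableAt_u hz) (hI.mul_extD hz)
  rw [extD_extD hI.anticomm hI.isOpen hI.smooth_m hz, zero_mul, zero_add, hI.extD_u hz] at h1
  refine h1.trans ?_
  simp only [logD', pow_two, mul_neg, neg_smul, one_smul, neg_neg, mul_assoc]

end IsInvPair

theorem IsInvPair.contDiffOn_logD (h : IsInvPair e m u Ω) : SmoothOn (logD e m u) Ω :=
  h.smooth_u.mul (contDiffOn_extD h.isOpen h.smooth_m)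

theorem IsInvPair.contDiffOn_logD' (h : IsInvPair e m u Ω) : SmoothOn (logD' e m u) Ω :=
  (contDiffOn_extD h.isOpen h.smooth_m).mul h.smooth_u

theorem extD_pow (hΩ : IsOpen Ω) (hX : SmoothOn X Ω) (hz : z ∈ Ω) {s : ℝ}
    (hs : ∀ l, e l * X z = (-1 : ℝ) • (X z * e l)) (hd : extD e X z = s • X z ^ 2) (k : ℕ) :
    extD e (fun z => X z ^ (2 * k)) z = 0 ∧
      extD e (fun z => X z ^ (2 * k + 1)) z = s • X z ^ (2 * k + 2) := by
  have step : ∀ k, extD e (fun z => X z ^ (k + 1)) z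
      = s • X z ^ (k + 2) - X z * extD e (fun z => X z ^ k) z := by
    intro k; simp only [pow_succ' _ k]
    rw [extD_mul (hX.diffAt hΩ hz) ((fun k => (hX.pow k).diffAt hΩ hz) k) hs, hd, neg_smul,
      one_smul, ← sub_eq_add_neg, smul_mul_assoc,
      ← pow_add, add_comm 2 k]
  induction k with
  | zero =>
    have h0 : extD e (fun z => X z ^ (2 * 0)) z = 0 := by simp [extD]
    refine ⟨h0, ?_⟩; rw [step, h0]; simp
  | succ k ih =>
    have h1 : extD e (fun z => X z ^ (2 * (k + 1))) z = 0 := by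
      rw [mul_add, mul_one, step (2 * k + 1), ih.2, mul_smul_comm, ← pow_succ', sub_self]
    refine ⟨h1, ?_⟩; rw [step, h1, mul_zero, sub_zero]

end Antiderivation

/-! ### The normed algebra of operator valued forms -/

section NormedForms

theorem matrix_norm_entry_le {κ α : Type*} [Fintype κ] [DecidableEq κ] [NormedRing α]
    (A : Matrix κ κ α) (i j : κ) :
    ‖A i j‖ ≤ (linftyOpNormedRing (n := κ) (α := α)).norm A := by
  let _ : NormedRing (Matrix κ κ α) := linftyOpNormedRing
  rw [Matrix.linfty_opNorm_def]
  exact_mod_cast (Finset.single_le_sum (f := fun j => ‖A i j‖₊) (fun _ _ => zero_le)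
    (Finset.mem_univ j)).trans (Finset.le_sup (f := fun i => ∑ j, ‖A i j‖₊) (Finset.mem_univ i))

theorem matrix_norm_le_sum {κ α : Type*} [Fintype κ] [DecidableEq κ] [NormedRing α]
    (A : Matrix κ κ α) :
    (linftyOpNormedRing (n := κ) (α := α)).norm A ≤ ∑ i, ∑ j, ‖A i j‖ := by
  let _ : NormedRing (Matrix κ κ α) := linftyOpNormedRing
  have h1 : (Finset.univ.sup fun i => ∑ j, ‖A i j‖₊) ≤ ∑ i, ∑ j, ‖A i j‖₊ :=
    Finset.sup_le fun i _ => Finset.single_le_sum (f := fun i => ∑ j, ‖A i j‖₊)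
      (fun _ _ => zero_le) (Finset.mem_univ i)
  rw [Matrix.linfty_opNorm_def]
  have := NNReal.coe_le_coe.2 h1
  push_cast at this
  exact_mod_cast this

variable {d : ℕ}

def formBasis (d : ℕ) : Module.Basis (Finset (Fin d)) ℂ (Forms d) :=
  (Pi.basisFun ℂ (Fin d)).ExteriorAlgebra

variable (N d) in
/-- The left regular representation of the algebra of operator valued forms. -/
def formRep : OpForms N d →ₐ[ℂ] Matrix (Finset (Fin d)) (Finset (Fin d)) (OpMatrix N) :=
  (matrixEquivTensor (Finset (Fin d)) ℂ (OpMatrix N)).symm.toAlgHom.comp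
    (Algebra.TensorProduct.map (AlgHom.id ℂ _) (Algebra.leftMulMatrix (formBasis d)))

theorem formRep_tmul (a : OpMatrix N) (f : Forms d) (s t : Finset (Fin d)) :
    formRep N d (a ⊗ₜ f) s t = (formBasis d).repr (f * formBasis d t) s • a := by
  rw [← Algebra.leftMulMatrix_eq_repr_mul]
  have h1 : formRep N d (a ⊗ₜ f) = a • (Algebra.leftMulMatrix (formBasis d) f).map
      (algebraMap ℂ (OpMatrix N)) :=
    matrixEquivTensor_apply_symm _ _ _ a (Algebra.leftMulMatrix (formBasis d) f)
  rw [h1, Matrix.smul_apply, Matrix.map_apply, smul_eq_mul, Algebra.smul_def, Algebra.commutes]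

theorem formRep_injective : Injective (formRep N d) :=
  (matrixEquivTensor (Finset (Fin d)) ℂ (OpMatrix N)).symm.injective.comp
    (Module.Flat.lTensor_preserves_injective_linearMap (M := OpMatrix N)
      (Algebra.leftMulMatrix (formBasis d)).toLinearMap
      (Algebra.leftMulMatrix_injective (formBasis d)))

/-- The norm of the regular representation. -/
instance opFormsNormedRing : NormedRing (OpForms N d) :=
  let _ : NormedRing (OpMatrix N) := linftyOpNormedRing
  let _ : NormedRing (Matrix (Finset (Fin d)) (Finset (Fin d)) (OpMatrix N)) := linftyOpNormedRing
  NormedRing.induced (OpForms N d) _ (formRep N d) formRep_injective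

instance opFormsNormedAlgebra : NormedAlgebra ℂ (OpForms N d) where
  norm_smul_le a X := by
    let _ : NormedRing (OpMatrix N) := linftyOpNormedRing
    let _ : NormedAlgebra ℂ (OpMatrix N) := Matrix.linftyOpNormedAlgebra
    let _ : NormedRing (Matrix (Finset (Fin d)) (Finset (Fin d)) (OpMatrix N)) := linftyOpNormedRing
    let _ : NormedAlgebra ℂ (Matrix (Finset (Fin d)) (Finset (Fin d))
      (OpMatrix N)) := Matrix.linftyOpNormedAlgebra
    change ‖formRep N d (a • X)‖ ≤ ‖a‖ * ‖formRep N d X‖; rw [map_smul]; exact norm_smul_le a _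

instance opFormsNormedAlgebraReal : NormedAlgebra ℝ (OpForms N d) := NormedAlgebra.complexToReal

instance opFormsModuleReal : Module ℝ (OpForms N d) :=
    opFormsNormedAlgebraReal.toNormedSpace.toModule

instance opFormsSMulReal : SMul ℝ (OpForms N d) := opFormsModuleReal.toSMul

instance opFormsIsScalarTower : IsScalarTower ℝ ℝ (OpForms N d) := IsScalarTower.left _

instance : NonUnitalNonAssocSemiring (OpForms N d) := inferInstance
instance : NonUnitalNonAssocRing (OpForms N d) := inferInstance
instance : Semiring (OpForms N d) := inferInstance
instance : Ring (OpForms N d) := inferInstance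
instance : AddCommMonoid (OpForms N d) := inferInstance
instance : AddCommGroup (OpForms N d) := inferInstance
instance : Monoid (OpForms N d) := inferInstance
instance : Mul (OpForms N d) := inferInstance
instance : Module ℂ (OpForms N d) := inferInstance
instance : Algebra ℂ (OpForms N d) := inferInstance
instance : MulAction ℝ (OpForms N d) := inferInstance
instance : SMulCommClass ℝ (OpForms N d) (OpForms N d) := inferInstance
instance : IsScalarTower ℝ (OpForms N d) (OpForms N d) := inferInstance
set_option synthInstance.maxHeartbeats 200000 in
instance : Module.IsTorsionFree ℝ (OpForms N d) := inferInstance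

theorem norm_formRep_le (X : OpForms N d) (s t : Finset (Fin d)) (i j : Fin N) :
    ‖formRep N d X s t i j‖ ≤ ‖X‖ := by
  let _ : NormedRing (OpMatrix N) := linftyOpNormedRing
  exact (matrix_norm_entry_le _ i j).trans (matrix_norm_entry_le (formRep N d X) s t)

theorem norm_le_sum_formRep (X : OpForms N d) :
    ‖X‖ ≤ ∑ s, ∑ t, ∑ i, ∑ j, ‖formRep N d X s t i j‖ := by
  let _ : NormedRing (OpMatrix N) := linftyOpNormedRing
  refine (matrix_norm_le_sum (formRep N d X)).trans ?_
  exact sum_le_sum fun s _ => sum_le_sum fun t _ => matrix_norm_le_sum _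

/-- The form `E_{ij}(a) ⊗ f`, where `E_{ij}(a)` has the only entry `a`. -/
def opSingle (i j : Fin N) (f : Forms d) : BoundedOp →L[ℂ] OpForms N d :=
  LinearMap.mkContinuousOfExistsBound
    ((TensorProduct.mk ℂ _ _).flip f ∘ₗ Matrix.singleLinearMap ℂ i j) (by
    refine ⟨∑ s, ∑ t, ∑ _i' : Fin N, ∑ _j' : Fin N, ‖(formBasis d).repr (f * formBasis d t) s‖,
      fun a => ?_⟩
    refine (norm_le_sum_formRep _).trans ?_; simp only [sum_mul]
    refine sum_le_sum fun s _ => sum_le_sum fun t _ => sum_le_sum fun i' _ =>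
      sum_le_sum fun j' _ => ?_
    refine (congrArg norm (congrFun (congrFun (formRep_tmul (Matrix.single i j a) f s t) i') j')
      ).le.trans ?_
    rw [Matrix.smul_apply, norm_smul]; refine mul_le_mul_of_nonneg_left ?_ (norm_nonneg _)
    rw [Matrix.single_apply]; split_ifs
    · exact le_rfl
    · rw [norm_zero]; exact norm_nonneg _)

theorem opSingle_apply (i j : Fin N) (f : Forms d) (a : BoundedOp) :
    opSingle i j f a = Matrix.single i j a ⊗ₜ f := rfl

theorem tmul_eq_sum (A : OpMatrix N) (f : Forms d) :
    (A ⊗ₜ f : OpForms N d) = ∑ i, ∑ j, opSingle i j f (A i j) := by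
  conv_lhs => rw [Matrix.matrix_eq_sum_single A]
  simp only [TensorProduct.sum_tmul, opSingle_apply]

/-- A scalar form as an operator valued form. -/
def opForm : Forms d →ₐ[ℂ] OpForms N d := Algebra.TensorProduct.includeRight

/-- A matrix of operators as a form of degree zero. -/
def opMat : OpMatrix N →ₐ[ℂ] OpForms N d := Algebra.TensorProduct.includeLeft

theorem opForm_apply (f : Forms d) : (opForm f : OpForms N d) = 1 ⊗ₜ f := rfl

theorem opMat_apply (a : OpMatrix N) : (opMat a : OpForms N d) = a ⊗ₜ 1 := rfl

theorem opMat_mul_opForm (a : OpMatrix N) (f : Forms d) : opMat a * opForm f = a ⊗ₜ f := by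
  rw [opMat_apply, opForm_apply, tmul_mul_tmul, mul_one, one_mul]

theorem commute_opForm_opMat (a : OpMatrix N) (f : Forms d) :
    Commute (opForm f : OpForms N d) (opMat a) := by
  rw [Commute, SemiconjBy, opMat_mul_opForm, opMat_apply, opForm_apply,
    tmul_mul_tmul, mul_one, one_mul]

theorem opMat_eq_sum (A : OpMatrix N) :
    (opMat A : OpForms N d) = ∑ i, ∑ j, opSingle i j 1 (A i j) := tmul_eq_sum A 1

theorem formTrace_tmul (a : OpMatrix N) (f : Forms d) :
    formTrace N d (a ⊗ₜ f) = trace00 N a • f := by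
  simp [formTrace]

theorem formTrace_opForm_mul (f : Forms d) (X : OpForms N d) :
    formTrace N d (opForm f * X) = f * formTrace N d X := by
  induction X using induction_on with
  | zero => simp
  | tmul a g =>
    rw [opForm_apply, tmul_mul_tmul, one_mul, formTrace_tmul, formTrace_tmul, mul_smul_comm]
  | add X Y hX hY => rw [mul_add, map_add, hX, hY, map_add, mul_add]

theorem formTrace_mul_opForm (f : Forms d) (X : OpForms N d) :
    formTrace N d (X * opForm f) = formTrace N d X * f := by
  induction X using induction_on with
  | zero => simp
  | tmul a g =>
    rw [opForm_apply, tmul_mul_tmul, mul_one, formTrace_tmul, formTrace_tmul, smul_mul_assoc]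
  | add X Y hX hY => rw [add_mul, map_add, hX, hY, map_add, add_mul]

/-- The functional that integrates operator valued forms pointwise. -/
def topTrace (N d : ℕ) : OpForms N d →L[ℂ] ℂ :=
  LinearMap.mkContinuousOfExistsBound (topCoeff d ∘ₗ formTrace N d) (by
    refine ⟨∑ s, ‖topCoeff d (formBasis d s)‖ * ∑ t, ‖(formBasis d).repr 1 t‖ * N, fun X => ?_⟩
    have h1 : topCoeff d (formTrace N d X) = ∑ s, topCoeff d (formBasis d s)
        * ∑ t, (formBasis d).repr 1 t * trace00 N (formRep N d X s t) := by
      induction X using induction_on with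
      | zero => simp
      | tmul a f =>
        have h2 : ∀ s, (formBasis d).repr f s
            = ∑ t, (formBasis d).repr 1 t * (formBasis d).repr (f * formBasis d t) s := by
          intro s
          have h3 : f = ∑ t, (formBasis d).repr 1 t • (f * formBasis d t) := by
            conv_lhs => rw [← mul_one f, ← (formBasis d).sum_repr 1, mul_sum]
            simp only [mul_smul_comm]
          conv_lhs => rw [h3]
          simp [Finset.sum_apply]
        simp only [formRep_tmul, map_smul, smul_eq_mul]; rw [formTrace_tmul, map_smul]
        conv_lhs => rw [← (formBasis d).sum_repr f]
        rw [map_sum, smul_eq_mul, mul_sum]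
        refine sum_congr rfl fun s _ => ?_
        rw [map_smul, h2 s, smul_eq_mul, sum_mul, mul_sum, mul_sum]
        exact sum_congr rfl fun t _ => by ring
      | add X Y hX hY =>
        simp only [map_add, hX, hY, Matrix.add_apply, mul_add, sum_add_distrib]
    change ‖topCoeff d (formTrace N d X)‖ ≤ _; rw [h1, sum_mul]
    refine (norm_sum_le _ _).trans (sum_le_sum fun s _ => ?_)
    rw [norm_mul, mul_assoc, sum_mul]
    refine mul_le_mul_of_nonneg_left ((norm_sum_le _ _).trans (sum_le_sum fun t _ => ?_))
      (norm_nonneg _)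
    rw [norm_mul, mul_assoc]; refine mul_le_mul_of_nonneg_left ?_ (norm_nonneg _)
    have h4 : trace00 N (formRep N d X s t) = ∑ i, coeff (formRep N d X s t i i) 0 0 := rfl
    rw [h4]
    refine (norm_sum_le _ _).trans ((sum_le_sum (g := fun _ => ‖X‖) fun i _ =>
      (norm_coeff_le _ 0 0).trans (norm_formRep_le X s t i i)).trans ?_)
    simp)

theorem topTrace_apply (X : OpForms N d) : topTrace N d X = topCoeff d (formTrace N d X) := rfl

end NormedForms

/-! ### Pullback of forms, and the algebra of operator valued forms -/

section FormAlgebra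

variable {d d' d'' : ℕ}

theorem topCoeff_ιMulti (v : Fin d → Fin d → ℂ) :
    topCoeff d (ιMulti ℂ d v) = Matrix.det (of v) := by
  rw [topCoeff, ExteriorAlgebra.liftAlternating_apply_ιMulti, Pi.single_eq_same]
  rfl

theorem topCoeff_ιMulti_of_ne {k : ℕ} (hk : k ≠ d) (v : Fin k → Fin d → ℂ) :
    topCoeff d (ιMulti ℂ k v) = 0 := by
  rw [topCoeff, ExteriorAlgebra.liftAlternating_apply_ιMulti, Pi.single_eq_of_ne hk]
  rfl

def pullMat (A : (Fin d → ℝ) →L[ℝ] (Fin d' → ℝ)) : Matrix (Fin d') (Fin d) ℂ :=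
  of fun l k => ((A (Pi.single k 1) l : ℝ) : ℂ)

/-- The pullback of forms along a linear map. -/
def pull (A : (Fin d → ℝ) →L[ℝ] (Fin d' → ℝ)) : Forms d' →ₐ[ℂ] Forms d :=
  ExteriorAlgebra.map (pullMat A).vecMulLinear

theorem pull_dz (A : (Fin d → ℝ) →L[ℝ] (Fin d' → ℝ)) (l : Fin d') :
    pull A (dz l) = ∑ k, ((A (Pi.single k 1) l : ℝ) : ℂ) • dz k := by
  have h1 : (pullMat A).vecMulLinear (Pi.single l 1)
      = ∑ k, ((A (Pi.single k 1) l : ℝ) : ℂ) • (Pi.single k 1) := by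
    rw [Matrix.vecMulLinear_apply, Matrix.single_one_vecMul]; funext k
    simp [pullMat, Finset.sum_apply, single_apply, Matrix.row]
  rw [pull, dz, map_apply_ι, h1, map_sum]
  simp
  rfl

theorem pull_ιMulti (A : (Fin d → ℝ) →L[ℝ] (Fin d' → ℝ)) {k : ℕ} (v : Fin k → Fin d' → ℂ) :
    pull A (ιMulti ℂ k v) = ιMulti ℂ k fun i l => (of v * pullMat A) i l := by
  rw [pull, ExteriorAlgebra.map_apply_ιMulti]
  rfl

theorem topCoeff_pull (A : (Fin d → ℝ) →L[ℝ] (Fin d → ℝ)) (x : Forms d) :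
    topCoeff d (pull A x) = (A.det : ℂ) * topCoeff d x := by
  suffices h : topCoeff d ∘ₗ (pull A).toLinearMap = A.det • topCoeff d by
    exact congrArg (fun L => L x) h
  refine lhom_ext fun k => ?_
  ext v
  change topCoeff d (pull A (ιMulti ℂ k v)) = A.det * topCoeff d (ιMulti ℂ k v)
  rw [pull_ιMulti]
  by_cases hk : k = d
  · subst hk
    have h2 : (pullMat A).det = A.det := by
      have h3 : pullMat A = (LinearMap.toMatrix' A.toLinearMap).map (algebraMap ℝ ℂ) := by
        ext i j; simp [pullMat, LinearMap.toMatrix'_apply]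
      rw [h3, ← RingHom.mapMatrix_apply, ← RingHom.map_det, LinearMap.det_toMatrix']; rfl
    rw [topCoeff_ιMulti, topCoeff_ιMulti, ← h2, mul_comm]; exact Matrix.det_mul _ _
  · rw [topCoeff_ιMulti_of_ne hk, topCoeff_ιMulti_of_ne hk, mul_zero]

variable (d) in
def initCoord : (Fin (d + 1) → ℝ) →L[ℝ] (Fin d → ℝ) :=
  ContinuousLinearMap.pi fun l => proj l.castSucc

variable (d) in
/-- The inclusion of the hyperplane on which the last coordinate vanishes. -/
def snocZero : (Fin d → ℝ) →L[ℝ] (Fin (d + 1) → ℝ) :=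
  ContinuousLinearMap.pi (Fin.snoc (fun l => proj l) 0)

theorem initCoord_apply (z : Fin (d + 1) → ℝ) (l : Fin d) : initCoord d z l = z l.castSucc := rfl

theorem snocZero_castSucc (z : Fin d → ℝ) (l : Fin d) : snocZero d z l.castSucc = z l := by
  simp [snocZero]

theorem snocZero_last (z : Fin d → ℝ) : snocZero d z (last d) = 0 := by
  simp [snocZero]

theorem pull_initCoord_dz (l : Fin d) : pull (initCoord d) (dz l) = dz l.castSucc := by
  rw [pull_dz, sum_eq_single l.castSucc]
  · simp [initCoord_apply]
  · intro k _ hk; simp [initCoord_apply, hk.symm]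
  · simp

theorem pull_snocZero_dz_castSucc (l : Fin d) : pull (snocZero d) (dz l.castSucc) = dz l := by
  rw [pull_dz, sum_eq_single l]
  · simp [snocZero_castSucc]
  · intro k _ hk; simp [snocZero_castSucc, hk.symm]
  · simp

theorem pull_snocZero_dz_last : pull (snocZero d) (dz (last d)) = 0 := by
  rw [pull_dz]
  simp [snocZero_last]

theorem pullMat_initCoord_castSucc (l : Fin d) (k : Fin d) :
    pullMat (initCoord d) l k.castSucc = if l = k then 1 else 0 := by
  simp only [pullMat, of_apply, initCoord_apply, single_apply, Fin.castSucc_inj]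
  split_ifs <;> simp

theorem topCoeff_last_mul (x : Forms d) :
    topCoeff (d + 1) (dz (last d) * pull (initCoord d) x) = (-1) ^ d * topCoeff d x := by
  suffices h : topCoeff (d + 1) ∘ₗ LinearMap.mulLeft ℂ (dz (last d)) ∘ₗ
      (pull (initCoord d)).toLinearMap = ((-1) ^ d : ℂ) • topCoeff d by
    exact congrArg (fun L => L x) h
  refine lhom_ext fun k => ?_
  ext v
  change topCoeff (d + 1) (dz (last d) * pull (initCoord d) (ιMulti ℂ k v))
    = (-1) ^ d * topCoeff d (ιMulti ℂ k v)
  have h1 : dz (last d) * ιMulti ℂ k (fun i l => (of v * pullMat (initCoord d)) i l)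
      = ιMulti ℂ (k + 1) (Matrix.vecCons (Pi.single (last d) 1)
        (fun i l => (of v * pullMat (initCoord d)) i l)) := by
    rw [ExteriorAlgebra.ιMulti_succ_apply]; rfl
  rw [pull_ιMulti, h1]
  by_cases hk : k = d
  · subst hk
    rw [topCoeff_ιMulti, topCoeff_ιMulti, Matrix.det_succ_row_zero, sum_eq_single (last k)]
    · have h2 : (of (Matrix.vecCons (Pi.single (last k) 1)
          (fun i l => (of v * pullMat (initCoord k)) i l))).submatrix Fin.succ (last k).succAbove
          = of v := by
        ext i j; change (of v * pullMat (initCoord k)) i ((last k).succAbove j) = v i j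
        rw [Fin.succAbove_last, Matrix.mul_apply]; simp [pullMat_initCoord_castSucc]
      rw [h2]; simp
    · intro j _ hj; simp [hj]
    · simp
  · rw [topCoeff_ιMulti_of_ne hk, topCoeff_ιMulti_of_ne (by omega), mul_zero]

/-! The grading involution -/

/-- The grading involution of the algebra of forms. -/
def formInv (d : ℕ) : Forms d →ₐ[ℂ] Forms d := ExteriorAlgebra.map (-LinearMap.id)

theorem formInv_ι (v : Fin d → ℂ) : formInv d (ι ℂ v) = -ι ℂ v := by
  rw [formInv, map_apply_ι]
  simp

theorem mul_ι (f : Forms d) (v : Fin d → ℂ) :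
    f * ExteriorAlgebra.ι ℂ v = ExteriorAlgebra.ι ℂ v * formInv d f := by
  induction f using ExteriorAlgebra.induction with
  | algebraMap r => rw [AlgHom.commutes, Algebra.commutes]
  | ι x =>
    rw [formInv_ι, mul_neg, eq_neg_iff_add_eq_zero, ι_add_mul_swap]
  | mul a b ha hb => rw [mul_assoc, hb, ← mul_assoc, ha, mul_assoc, map_mul]
  | add a b ha hb => rw [add_mul, ha, hb, map_add, mul_add]

theorem formInv_formInv (f : Forms d) : formInv d (formInv d f) = f := by
  have h1 := map_comp_map (-LinearMap.id : (Fin d → ℂ) →ₗ[ℂ] _) (-LinearMap.id)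
  have h2 : (-LinearMap.id : (Fin d → ℂ) →ₗ[ℂ] _) ∘ₗ (-LinearMap.id) = LinearMap.id := by
    ext; simp
  rw [h2, ExteriorAlgebra.map_id] at h1
  exact congrArg (fun L => L f) h1

theorem ι_mul (f : Forms d) (v : Fin d → ℂ) : ι ℂ v * f = formInv d f * ι ℂ v := by
  rw [mul_ι, formInv_formInv]

theorem last_mul_pull (x : Forms (d + 1)) : dz (last d) * x
    = dz (last d) * pull (initCoord d) (pull (snocZero d) x) := by
  induction x using ExteriorAlgebra.induction with
  | algebraMap r => simp
  | ι v =>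
    have hv : ExteriorAlgebra.ι ℂ v = ∑ l, v l • dz l := by
      conv_lhs => rw [← Finset.univ_sum_single v]
      rw [map_sum]
      refine sum_congr rfl fun l _ => ?_
      rw [dz, ← map_smul, ← Pi.single_smul, smul_eq_mul, mul_one]
    rw [hv, Fin.sum_univ_castSucc]
    simp only [map_add, map_sum, map_smul, pull_snocZero_dz_castSucc, pull_initCoord_dz,
      pull_snocZero_dz_last, smul_zero, add_zero, mul_add]
    have h1 : dz (last d) * dz (last d) = 0 := ι_sq_zero _
    rw [mul_smul_comm, h1, smul_zero, add_zero]
  | mul a b ha hb =>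
    rw [← mul_assoc, ha, dz, ι_mul, mul_assoc, ← dz, hb, dz, ← mul_assoc, ← ι_mul, mul_assoc,
      map_mul, map_mul]
  | add a b ha hb => rw [mul_add, ha, hb, map_add, map_add, mul_add]

theorem prod_dz_eq_zero {k : ℕ} (hk : d < k) (s : Fin k → Fin d) :
    (List.ofFn fun i => dz (s i)).prod = 0 := by
  have h1 : ¬Injective fun i => (Pi.single (s i) 1 : Fin d → ℂ) := by
    intro h
    simpa using not_lt.2 (Fintype.card_le_of_injective s (fun i j hij => h (by simp only [hij])))
      |>.elim (by simpa using hk)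
  exact (ιMulti_apply _).symm.trans (ExteriorAlgebra.ιMulti_eq_zero_of_not_inj h1)

end FormAlgebra

/-! ### Naturality of operator valued forms -/

section OpFormMaps

variable {d d' : ℕ}

def pullOp (A : (Fin d → ℝ) →L[ℝ] (Fin d' → ℝ)) : OpForms N d' →ₐ[ℂ] OpForms N d :=
  Algebra.TensorProduct.map (AlgHom.id ℂ _) (pull A)

theorem pullOp_opMat (A : (Fin d → ℝ) →L[ℝ] (Fin d' → ℝ)) (a : OpMatrix N) :
    pullOp A (opMat a) = opMat a := by
  rw [opMat_apply, pullOp, map_tmul, map_one]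
  rfl

theorem pullOp_opForm (A : (Fin d → ℝ) →L[ℝ] (Fin d' → ℝ)) (f : Forms d') :
    pullOp A (opForm f : OpForms N d') = opForm (pull A f) := by
  rw [opForm_apply, pullOp, map_tmul, map_one]
  rfl

theorem formTrace_pullOp (A : (Fin d → ℝ) →L[ℝ] (Fin d' → ℝ)) (X : OpForms N d') :
    formTrace N d (pullOp A X) = pull A (formTrace N d' X) := by
  induction X using induction_on with
  | zero => simp
  | tmul a f =>
    rw [pullOp, map_tmul, formTrace_tmul, formTrace_tmul, map_smul]; rfl
  | add X Y hX hY => simp only [map_add, hX, hY]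

def shiftConjHom (m : ℤ) : BoundedOp →ₐ[ℂ] BoundedOp :=
  AlgHom.ofLinearMap (shiftConj m).toLinearMap (shiftConj_one m) (shiftConj_mul m)

/-- Conjugation of operator valued forms by a shift. -/
def shiftForm (m : ℤ) : OpForms N d →ₐ[ℂ] OpForms N d :=
  Algebra.TensorProduct.map (shiftConjHom m).mapMatrix (AlgHom.id ℂ _)

theorem shiftForm_opMat (m : ℤ) (a : OpMatrix N) :
    shiftForm m (opMat a : OpForms N d) = opMat (a.map (shiftConj m)) := rfl

theorem shiftForm_opForm (m : ℤ) (f : Forms d) :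
    shiftForm m (opForm f : OpForms N d) = opForm f := by
  rw [opForm_apply, shiftForm, map_tmul, map_one]
  rfl

/-- The projection to the basis vector of index `k`. -/
def unitProj (k : ℤ) : BoundedOp := weightedShift 0 (boundedSeq (Pi.single k 1))

theorem boundedSeq_single (k i : ℤ) : boundedSeq (Pi.single k (1 : ℂ)) i = (Pi.single k 1 :
    ℤ → ℂ) i :=
  boundedSeq_apply (C := 1) (fun m => by
    rcases eq_or_ne m k with rfl | h
    · simp
    · simp [h]) i

theorem coeff_unitProj (k i j : ℤ) : coeff (unitProj k) i j = if i = k ∧ j = k then 1 else 0 := by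
  rw [unitProj, coeff_weightedShift, boundedSeq_single, add_zero, single_apply]
  grind

theorem shiftConj_unitProj (m k : ℤ) : shiftConj m (unitProj k) = unitProj (k - m) :=
  boundedOp_ext fun i j => by
    simp only [coeff_shiftConj, coeff_unitProj, eq_sub_iff_add_eq]

theorem coeff_mul_unitProj_mul (a b : BoundedOp) (k i j : ℤ) :
    coeff (a * unitProj k * b) i j = coeff a i k * coeff b k j := by
  have h1 : ∀ l, coeff (a * unitProj k) i l = if l = k then coeff a i k else 0 := by
    intro l
    refine (hasSum_coeff_mul a (unitProj k) i l).unique ?_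
    convert hasSum_ite_eq k (if l = k then coeff a i k else 0) using 2 with m
    rw [coeff_unitProj]
    by_cases hm : m = k <;> by_cases hl : l = k <;> simp [hm, hl]
  refine (hasSum_coeff_mul (a * unitProj k) b i j).unique ?_
  convert hasSum_ite_eq k (coeff a i k * coeff b k j) using 2 with m
  rw [h1]
  by_cases hm : m = k <;> simp [hm]

/-- The projection to the basis vectors of index `k`, as a form. -/
def projForm (N d : ℕ) (k : ℤ) : OpForms N d := opMat (Matrix.diagonal fun _ => unitProj k)

theorem shiftForm_projForm (m k : ℤ) : shiftForm m (projForm N d k) = projForm N d (k - m) := by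
  rw [projForm, shiftForm_opMat, Matrix.diagonal_map (map_zero _)]
  simp only [shiftConj_unitProj, projForm]

theorem trace00_mul_projection (a b : OpMatrix N) (k : ℤ) :
    trace00 N (a * Matrix.diagonal (fun _ => unitProj k) * b)
      = trace00 N ((b * Matrix.diagonal (fun _ => unitProj 0) * a).map (shiftConj k)) := by
  have h1 : ∀ (a b) (k l) (i : Fin N),
      coeff ((a * Matrix.diagonal (fun _ => unitProj k) * b : Matrix _ _ BoundedOp) i i) l l
        = ∑ j, coeff (a i j) l k * coeff (b j i) k l := by
    intro a b k l i; rw [Matrix.mul_apply, ← coeffL_apply, map_sum]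
    simp only [Matrix.mul_diagonal, coeffL_apply, coeff_mul_unitProj_mul]
  change ∑ i, coeff ((a * Matrix.diagonal (fun _ => unitProj k) * b : Matrix _ _ BoundedOp) i i) 0 0
    = ∑ i, coeff (shiftConj k ((b * Matrix.diagonal (fun _ => unitProj 0) * a :
      Matrix _ _ BoundedOp) i i)) 0 0
  simp only [coeff_shiftConj, zero_add, h1]
  rw [sum_comm]
  simp only [mul_comm]

/-- The two factors may be exchanged under the trace, up to the sign `s`. -/
def IsSwap (s : ℂ) (Y Z : OpForms N d) : Prop := ∀ k, formTrace N d (Y * projForm N d k * Z)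
    = s • formTrace N d (shiftForm k (Z * projForm N d 0 * Y))

theorem formTrace_shiftForm_opForm_mul (k : ℤ) (f : Forms d) (X : OpForms N d) :
    formTrace N d (shiftForm k (opForm f * X)) = f * formTrace N d (shiftForm k X) := by
  rw [map_mul, shiftForm_opForm, formTrace_opForm_mul]

theorem isSwap_opMat (Y : OpForms N d) (b : OpMatrix N) : IsSwap 1 Y (opMat b) := by
  intro k
  rw [one_smul]
  induction Y using induction_on with
  | zero => simp
  | tmul a f =>
    have h1 : ∀ k, (a ⊗ₜ f) * projForm N d k * opMat b
        = opForm f * opMat (a * Matrix.diagonal (fun _ => unitProj k) * b) := by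
      intro k
      rw [← opMat_mul_opForm, projForm, mul_assoc, mul_assoc, ← map_mul,
        (commute_opForm_opMat _ f).eq, ← mul_assoc, ← map_mul, ← mul_assoc,
        ← (commute_opForm_opMat _ f).eq]
    have h2 : opMat b * projForm N d 0 * (a ⊗ₜ f)
        = opForm f * opMat (b * Matrix.diagonal (fun _ => unitProj 0) * a) := by
      rw [← opMat_mul_opForm, projForm, ← map_mul, ← mul_assoc, ← map_mul,
        ← (commute_opForm_opMat _ f).eq]
    rw [h1, h2, formTrace_shiftForm_opForm_mul, formTrace_opForm_mul, shiftForm_opMat, opMat_apply,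
      opMat_apply, formTrace_tmul, formTrace_tmul, trace00_mul_projection]
  | add X Y hX hY =>
    simp only [add_mul, mul_add, map_add, hX, hY]

theorem isSwap_sum {ι : Type*} {K : Finset ι} {s : ℂ} {Y : OpForms N d} {f : ι → Forms d}
    {b : ι → OpMatrix N}
    (h : ∀ l ∈ K, Y * opForm (f l) = s • (opForm (f l) * Y)) :
    IsSwap s Y (∑ l ∈ K, opForm (f l) * opMat (b l)) := by
  intro k
  simp only [mul_sum, sum_mul, map_sum, smul_sum]
  refine sum_congr rfl fun l hl => ?_
  have h1 : Y * projForm N d k * (opForm (f l) * opMat (b l))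
      = s • (opForm (f l) * (Y * projForm N d k * opMat (b l))) := by
    rw [projForm, ← mul_assoc, mul_assoc Y, ← (commute_opForm_opMat _ (f l)).eq, ← mul_assoc,
      h l hl]
    simp only [smul_mul_assoc, mul_assoc]
  rw [h1, map_smul, formTrace_opForm_mul, isSwap_opMat Y (b l) k, one_smul,
    ← formTrace_shiftForm_opForm_mul]
  simp only [mul_assoc]

/-! The differential -/

variable (N d) in
def opDz (l : Fin d) : OpForms N d := opForm (dz l)

theorem dz_mul_dz (k l : Fin d) : (dz k * dz l : Forms d) = -(dz l * dz k) :=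
  eq_neg_of_add_eq_zero_left (ι_add_mul_swap _ _)

theorem opDz_anticomm (k l : Fin d) : opDz N d k * opDz N d l = -(opDz N d l * opDz N d k) := by
  rw [opDz, opDz, ← map_mul, dz_mul_dz, map_neg, map_mul]

variable {A : (Fin d → ℝ) → OpMatrix N} {z : Fin d → ℝ}

theorem hasFDerivAt_opMat (hA : ∀ i j, DifferentiableAt ℝ (fun z => A z i j) z) :
    HasFDerivAt (fun z => (opMat (A z) : OpForms N d)) (∑ i, ∑ j,
      ((opSingle i j (1 : Forms d)).restrictScalars ℝ).comp (fderiv ℝ (fun z => A z i j) z)) z := by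
  simp only [opMat_eq_sum]
  exact HasFDerivAt.fun_sum fun i _ => HasFDerivAt.fun_sum fun j _ =>
    ((opSingle i j 1).restrictScalars ℝ).hasFDerivAt.comp z (hA i j).hasFDerivAt

theorem fderiv_opMat (hA : ∀ i j, DifferentiableAt ℝ (fun z => A z i j) z) (v : Fin d → ℝ) :
    fderiv ℝ (fun z => (opMat (A z) : OpForms N d)) z v
      = opMat (of fun i j => fderiv ℝ (fun z => A z i j) z v) := by
  rw [(hasFDerivAt_opMat hA).fderiv, opMat_eq_sum]
  simp only [_root_.sum_apply]
  rfl

theorem contDiffOn_opMat {Ω : Set (Fin d → ℝ)} (hA : ∀ i j, SmoothOn (fun z => A z i j) Ω) :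
    SmoothOn (fun z => (opMat (A z) : OpForms N d)) Ω := by
  simp only [opMat_eq_sum]
  exact ContDiffOn.sum fun i _ => ContDiffOn.sum fun j _ =>
    ((opSingle i j 1).restrictScalars ℝ).contDiff.comp_contDiffOn (hA i j)

theorem extD_opMat (hA : ∀ i j, DifferentiableAt ℝ (fun z => A z i j) z) :
    extD (opDz N d) (fun z => opMat (A z)) z = ∑ l, opForm (dz l) *
      opMat (of fun i j => fderiv ℝ (fun z => A z i j) z (Pi.single l 1)) := by
  simp only [extD, fderiv_opMat hA, opDz]

theorem map_eq_sum_single {E : Type*} [AddCommGroup E] [Module ℝ E] [TopologicalSpace E]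
    (L : (Fin d → ℝ) →L[ℝ] E) (v : Fin d → ℝ) : L v = ∑ l, v l • L (Pi.single l 1) := by
  conv_lhs => rw [← Finset.univ_sum_single v]
  rw [map_sum]
  refine sum_congr rfl fun l _ => ?_
  rw [← map_smul, ← Pi.single_smul, smul_eq_mul, mul_one]

theorem pullOp_extD {A' : (Fin d' → ℝ) → OpMatrix N}
    {Φ : (Fin d → ℝ) → Fin d' → ℝ} {L : (Fin d → ℝ) →L[ℝ] (Fin d' → ℝ)} (hΦ : HasFDerivAt Φ L z)
    (hA' : ∀ i j, DifferentiableAt ℝ (fun z => A' z i j) (Φ z)) :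
    pullOp L (extD (opDz N d') (fun z => opMat (A' z)) (Φ z))
      = extD (opDz N d) (fun z => opMat (A' (Φ z))) z := by
  have h1 : ∀ i j, HasFDerivAt (fun z => A' (Φ z) i j)
      ((fderiv ℝ (fun z => A' z i j) (Φ z)).comp L) z := fun i j =>
    (hA' i j).hasFDerivAt.comp z hΦ
  rw [extD_opMat hA', extD_opMat fun i j => (h1 i j).differentiableAt]
  simp only [map_sum, map_mul, pullOp_opMat, pullOp_opForm, pull_dz, map_smul, sum_mul]
  rw [sum_comm]
  refine sum_congr rfl fun k _ => ?_
  simp only [smul_mul_assoc]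
  simp only [← mul_smul_comm, ← mul_sum, ← map_smul, ← map_sum]
  congr 2
  ext1 i j
  rw [Matrix.sum_apply, of_apply, (h1 i j).fderiv, comp_apply,
    map_eq_sum_single (fderiv ℝ (fun z => A' z i j) (Φ z)) (L (Pi.single k 1))]
  rfl

theorem shiftForm_extD (m : ℤ) (hA : ∀ i j, DifferentiableAt ℝ (fun z => A z i j) z) :
    shiftForm m (extD (opDz N d) (fun z => opMat (A z)) z)
      = extD (opDz N d) (fun z => opMat ((A z).map (shiftConj m))) z := by
  have h1 := fun i j => ((shiftConj m).restrictScalars ℝ).hasFDerivAt.comp z (hA i j).hasFDerivAt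
  rw [extD_opMat hA, extD_opMat (A := fun z => (A z).map (shiftConj m))
    fun i j => (h1 i j).differentiableAt]
  simp only [map_sum, map_mul, shiftForm_opMat, shiftForm_opForm]
  refine sum_congr rfl fun l _ => ?_
  congr 2
  ext1 i j
  rw [Matrix.map_apply, of_apply, of_apply]
  exact (congrArg (fun L => L (Pi.single l 1)) (h1 i j).fderiv).symm

/-- The differential of a real function. -/
def dScalar (f : (Fin d → ℝ) → ℝ) (z : Fin d → ℝ) : Forms d :=
  ∑ l, ((fderiv ℝ f z (Pi.single l 1) : ℝ) : ℂ) • dz l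

theorem pull_dScalar {f : (Fin d' → ℝ) → ℝ} {Φ : (Fin d → ℝ) → Fin d' → ℝ}
    {L : (Fin d → ℝ) →L[ℝ] (Fin d' → ℝ)} (hΦ : HasFDerivAt Φ L z)
    (hf : DifferentiableAt ℝ f (Φ z)) :
    pull L (dScalar f (Φ z)) = dScalar (fun z => f (Φ z)) z := by
  have h1 : HasFDerivAt (fun z => f (Φ z)) ((fderiv ℝ f (Φ z)).comp L) z := hf.hasFDerivAt.comp z hΦ
  rw [dScalar, dScalar, h1.fderiv]
  simp only [map_sum, map_smul, pull_dz, smul_sum, smul_smul]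
  rw [sum_comm]
  refine sum_congr rfl fun k _ => ?_
  rw [← sum_smul, comp_apply, map_eq_sum_single (fderiv ℝ f (Φ z))]
  push_cast
  simp only [smul_eq_mul, mul_comm, ofReal_mul]

theorem dScalar_congr {f f' : (Fin d → ℝ) → ℝ} (h : f =ᶠ[𝓝 z] f') : dScalar f z = dScalar f' z := by
  simp only [dScalar, h.fderiv_eq]

theorem opForm_dScalar {f : (Fin d → ℝ) → ℝ} (hf : DifferentiableAt ℝ f z) :
    (opForm (dScalar f z) : OpForms N d) = extD (opDz N d) (fun z => f z • 1) z := by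
  rw [dScalar, map_sum, extD]
  refine sum_congr rfl fun l _ => ?_
  rw [(hf.hasFDerivAt.smul_const 1).fderiv, map_smul, opDz,
    ContinuousLinearMap.smulRight_apply, mul_smul_comm, mul_one, coe_smul]

theorem dScalar_comp {f : (Fin d → ℝ) → ℝ} {k : ℝ → ℝ} (hk : DifferentiableAt ℝ k (f z))
    (hf : DifferentiableAt ℝ f z) :
    dScalar (fun z => k (f z)) z = ((deriv k (f z) : ℝ) : ℂ) • dScalar f z := by
  have h1 := hk.hasDerivAt.comp_hasFDerivAt z hf.hasFDerivAt
  have h2 : fderiv ℝ (fun z => k (f z)) z = deriv k (f z) • fderiv ℝ f z := h1.fderiv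
  simp only [dScalar, h2, smul_sum, smul_smul, _root_.smul_apply, smul_eq_mul, ofReal_mul]

end OpFormMaps

/-! ### Forms on the base -/

section BaseForms

variable {d d' k : ℕ}

theorem expand_eq_ιMulti (v : Fin n → Fin d → ℂ) (φ : Model n [⋀^Fin k]→L[ℝ] ℂ) :
    expand (fun i => ι ℂ (v i)) φ = ((k.factorial : ℂ))⁻¹ • ∑ s : Fin k → Fin n,
      φ (fun i => single (s i) 1) • ιMulti ℂ k fun i => v (s i) := by
  rfl

theorem model_eq_sum_single (v : Model n) : v = ∑ j, v j • (single j (1 : ℝ)) := by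
  ext i
  simp [Finset.sum_apply, single_apply]

theorem map_expand (L : (Fin d' → ℂ) →ₗ[ℂ] (Fin d → ℂ)) {v : Fin n → Fin d → ℂ}
    {v' : Fin n → Fin d' → ℂ} (J : ModelEnd n)
    (hL : ∀ i, L (v' i) = ∑ j, ((J (single j 1) i : ℝ) : ℂ) • v j)
    (φ : Model n [⋀^Fin k]→L[ℝ] ℂ) :
    ExteriorAlgebra.map L (expand (fun i => ι ℂ (v' i)) φ)
      = expand (fun i => ι ℂ (v i)) (φ.compContinuousLinearMap J) := by
  rw [expand_eq_ιMulti, expand_eq_ιMulti, map_smul, map_sum]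
  congr 1
  have h1 : ∀ s : Fin k → Fin n, ExteriorAlgebra.map L (ιMulti ℂ k fun i => v' (s i))
      = ∑ t : Fin k → Fin n, (∏ i, ((J (single (t i) 1) (s i) : ℝ) : ℂ))
        • ιMulti ℂ k fun i => v (t i) := by
    intro s; rw [ExteriorAlgebra.map_apply_ιMulti]; simp only [Function.comp_def, hL]
    refine ((ιMulti ℂ k).toMultilinearMap.map_sum (fun i j =>
      ((J (single j 1) (s i) : ℝ) : ℂ) • v j)).trans ?_
    exact sum_congr rfl fun t _ => (ιMulti ℂ k).toMultilinearMap.map_smul_univ _ fun i => v (t i)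
  have h2 : ∀ t : Fin k → Fin n, φ (fun i => J (single (t i) 1))
      = ∑ s : Fin k → Fin n, (∏ i, ((J (single (t i) 1) (s i) : ℝ) : ℂ))
        * φ fun i => single (s i) 1 := by
    intro t
    have h3 : (fun i => J (single (t i) 1)) = fun i => ∑ j,
        J (single (t i) 1) j • (single j 1 : Model n) :=
      funext fun i => model_eq_sum_single _
    rw [h3]
    refine (φ.toMultilinearMap.map_sum (fun i j =>
      J (single (t i) 1) j • (single j 1 : Model n))).trans ?_
    refine sum_congr rfl fun s _ => (φ.toMultilinearMap.map_smul_univ _ _).trans ?_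
    rw [real_smul, Complex.ofReal_prod]; rfl
  simp only [map_smul, h1, smul_sum, smul_smul]
  rw [sum_comm]
  refine sum_congr rfl fun t _ => ?_
  rw [← sum_smul]
  congr 1
  refine Eq.trans ?_ (h2 t).symm
  exact sum_congr rfl fun s _ => mul_comm _ _

theorem sum_mul_expand (v : Fin n → Fin d → ℂ) (D : Model n →L[ℝ] (Model n [⋀^Fin k]→L[ℝ] ℂ)) :
    ∑ j, ι ℂ (v j) * expand (fun i => ι ℂ (v i)) (D (single j 1)) = expand (fun i => ι ℂ (v i))
        (alternatizeUncurryFin D) := by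
  set S : Forms d := ∑ j, ∑ t : Fin k → Fin n, D (single j 1) (fun i => single (t i) 1)
      • (ι ℂ (v j) * ιMulti ℂ k fun i => v (t i)) with hS
  have h1 : ∀ p : Fin (k + 1), ∑ s : Fin (k + 1) → Fin n, ((-1) ^ (p : ℕ) •
      D (single (s p) 1) (p.removeNth fun i => single (s i) 1))
        • ιMulti ℂ (k + 1) (fun i => v (s i)) = S := by
    intro p; rw [← (Fin.insertNthEquiv (fun _ => Fin n) p).sum_comp, Fintype.sum_prod_type]
    refine sum_congr rfl fun j _ => sum_congr rfl fun t _ => ?_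
    have h2 : (fun i => v ((Fin.insertNthEquiv (fun _ => Fin n) p) (j, t) i))
        = p.insertNth (v j) fun i => v (t i) := by
      funext i
      refine Fin.succAboveCases p ?_ (fun i => ?_) i <;> simp [Fin.insertNthEquiv]
    have h3 : (p.removeNth fun i => (single
        ((Fin.insertNthEquiv (fun _ => Fin n) p) (j, t) i) 1 : Model n))
        = fun i => single (t i) 1 := by
      funext i
      simp [Fin.removeNth, Fin.insertNthEquiv]
    have h4 : (Fin.insertNthEquiv (fun _ => Fin n) p) (j, t) p = j := by
      simp [Fin.insertNthEquiv]
    rw [h2, h3, h4, smul_assoc, smul_comm, AlternatingMap.neg_one_pow_smul_map_insertNth,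
      ExteriorAlgebra.ιMulti_succ_apply]
    rfl
  have h5 : expand (fun i => ι ℂ (v i)) (alternatizeUncurryFin D)
      = (((k + 1).factorial : ℂ))⁻¹ • ((k + 1 : ℕ) : ℂ) • S := by
    rw [expand_eq_ιMulti]; congr 1
    simp only [ContinuousAlternatingMap.alternatizeUncurryFin_apply, sum_smul]; rw [sum_comm]
    simp only [h1]
    rw [Finset.sum_const, Finset.card_univ, Fintype.card_fin, Nat.cast_smul_eq_nsmul]
  rw [h5, smul_smul]
  have h6 : (((k + 1).factorial : ℂ))⁻¹ * ((k + 1 : ℕ) : ℂ) = ((k.factorial : ℂ))⁻¹ := by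
    rw [Nat.factorial_succ, Nat.cast_mul, mul_inv, mul_comm, ← mul_assoc, mul_inv_cancel₀, one_mul]
    exact_mod_cast Nat.succ_ne_zero k
  rw [h6, hS, smul_sum]
  refine sum_congr rfl fun j _ => ?_
  rw [expand_eq_ιMulti, mul_smul_comm, mul_sum]
  simp

end BaseForms

section Pullback

theorem TotalForm.IsInvariant.iter (hT : T.IsInvariant g) (k : ℕ) (m : ℤ) (x : M) :
    (T k (iter g m x)).compContinuousLinearMap (iterDiff g m x) = T k x := by
  have h1 : ∀ x, (T k (ShiftIndex.iter g 1 x)).compContinuousLinearMap (iterDiff g 1 x) = T k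
    x := by
    intro x
    have h2 : ∀ f : M → M, f = g → (T k (f x)).compContinuousLinearMap
        (mfderiv (𝓡 n) (𝓡 n) f x) = T k x := by
      rintro f rfl
      exact hT k x
    exact h2 _ (iter_one g)
  have h0 : (T k (ShiftIndex.iter g 0 x)).compContinuousLinearMap (iterDiff g 0 x) = T k x := by
    have h2 : ∀ f : M → M, f = id → (T k (f x)).compContinuousLinearMap
        (mfderiv (𝓡 n) (𝓡 n) f x) = T k x := by
      rintro f rfl
      rw [mfderiv_id]; rfl
    exact h2 _ (iter_zero g)
  have h3 : ∀ m x, (T k (ShiftIndex.iter g (1 + m) x)).compContinuousLinearMap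
      (iterDiff g (1 + m) x)
      = (T k (ShiftIndex.iter g m x)).compContinuousLinearMap (iterDiff g m x) := by
    intro m x; rw [iterDiff_add, ← h1 (ShiftIndex.iter g m x)]
    have h4 : ∀ x', x' = ShiftIndex.iter g 1 (ShiftIndex.iter g m x) →
        (T k x').compContinuousLinearMap
          ((iterDiff g 1 (ShiftIndex.iter g m x)).comp (iterDiff g m x))
        = ((T k (ShiftIndex.iter g 1 (ShiftIndex.iter g m x))).compContinuousLinearMap
          (iterDiff g 1 (ShiftIndex.iter g m x))).compContinuousLinearMap (iterDiff g m x) := by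
      rintro _ rfl
      rfl
    exact h4 _ (iter_add g 1 m x)
  induction m using Int.induction_on with
  | zero => exact h0
  | succ i ih => rw [add_comm, h3, ih]
  | pred i ih =>
    rw [← h3, show 1 + (-(i : ℤ) - 1) = -i by ring, ih]

theorem TotalForm.IsInvariant.local_trans (hT : T.IsInvariant g) (k : ℕ) (hy :
    y ∈ transDom g m c c') :
    (T.local k c' (trans g m c c' y)).compContinuousLinearMap (transDiff g m c c' y)
      = T.local k c y := by
  have h1 := chartTan_transDiff hy
  have h2 : ∀ x', x' = ShiftIndex.iter g m (chartPoint c y) → (T k x').compContinuousLinearMap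
      ((chartTan c' (trans g m c c' y)).comp (transDiff g m c c' y)) = T.local k c y := by
    rintro _ rfl
    rw [h1]
    exact congrArg (fun φ =>
      φ.compContinuousLinearMap (chartTan c y)) (hT.iter k m (chartPoint c y))
  exact h2 _ (chartPoint_trans hy)

/-- The vector that gives the form `dyᵢ` on the cotangent bundle. -/
def baseVec (n q : ℕ) (i : Fin n) : Fin (2 * n + q) → ℂ := Pi.single ⟨2 * i, by omega⟩ 1

theorem pullback_eq (T : TotalForm n M) (c : M) (z : Coord n q) :
    pullback q T c z = ∑ k ∈ Finset.range (n + 1),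
      expand (fun i => ι ℂ (baseVec n q i)) (T.local k c (baseCoord z)) := rfl

variable (n q) in
def baseCoordL : (Coord n q) →L[ℝ] Model n :=
  (fst ℝ _ _).comp (coordEquiv n q).toContinuousLinearMap

theorem baseCoordL_single (l : Fin (2 * n + q)) : baseCoordL n q (Pi.single l 1)
    = ∑ j : Fin n, if (⟨2 * (j : ℕ), by omega⟩ : Fin (2 * n + q)) = l then
      single j (1 : ℝ) else 0 := by
  refine (model_eq_sum_single _).trans (sum_congr rfl fun j _ => ?_)
  change (Pi.single l 1 : Coord n q) ⟨2 * j, by omega⟩ • _ = _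
  rw [single_apply]
  split_ifs <;> simp

/-- The pullback of forms from the base along a map that covers a map of the base. -/
theorem pull_expand {q' k : ℕ} {Φ : (Fin (2 * n + q') → ℝ) → Coord n q}
    {f : Model n → Model n} {z : Fin (2 * n + q') → ℝ}
    {L : (Fin (2 * n + q') → ℝ) →L[ℝ] (Coord n q)} {J : ModelEnd n}
    (hΦ : HasFDerivAt Φ L z) (hf : HasFDerivAt f J (baseCoord z))
    (hΦf : (fun z => baseCoord (Φ z)) =ᶠ[𝓝 z] fun z => f (baseCoord z))
    (φ : Model n [⋀^Fin k]→L[ℝ] ℂ) :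
    pull L (expand (fun i => ι ℂ (baseVec n q i)) φ)
      = expand (fun i => ι ℂ (baseVec n q' i)) (φ.compContinuousLinearMap J) := by
  refine map_expand _ J (fun i => ?_) φ
  have h1 : (baseCoordL n q).comp L = J.comp (baseCoordL n q') := by
    exact (((baseCoordL n q).hasFDerivAt.comp z hΦ).congr_of_eventuallyEq hΦf.symm).unique
      (HasFDerivAt.comp z hf (baseCoordL n q').hasFDerivAt)
  have h4 : ∀ v, L v ⟨2 * i, by omega⟩ = J (baseCoordL n q' v) i := fun v =>
    congrArg (fun A : (Fin (2 * n + q') → ℝ) →L[ℝ] Model n => A v i) h1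
  have h5 : ∀ l : Fin (2 * n + q'), ∀ v : Fin n → ℂ, (∑ j, v j • baseVec n q' j) l
      = ∑ j : Fin n, if (⟨2 * j, by omega⟩ : Fin (2 * n + q')) = l then v j else 0 := by
    intro l v; simp [Finset.sum_apply, baseVec, single_apply, eq_comm]
  funext l
  rw [h5, Matrix.vecMulLinear_apply, baseVec, Matrix.single_one_vecMul]
  change ((L (Pi.single l 1) ⟨2 * i, by omega⟩ : ℝ) : ℂ) = _
  rw [h4]
  rw [baseCoordL_single, map_sum]
  have h7 : ∀ x : Fin n → Model n, (∑ j, x j) i = ∑ j, x j i := fun x => by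
    simp [Finset.sum_apply]
  rw [h7, ofReal_sum]
  refine sum_congr rfl fun j _ => ?_
  split_ifs <;> simp

theorem TotalForm.IsInvariant.pull_pullback (hT : T.IsInvariant g) (hz :
    z ∈ cotransDom q g m c c') :
    pull (fderiv ℝ (cotrans g m c c') z) (pullback q T c' (cotrans g m c c' z))
      = pullback q T c z := by
  rw [pullback_eq, pullback_eq, map_sum]
  refine sum_congr rfl fun k _ => ?_
  rw [pull_expand (hasFDerivAt_cotrans hz) (hasFDerivAt_trans hz)
    (Eventually.of_forall fun z => baseCoord_cotrans), baseCoord_cotrans, hT.local_trans k hz]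

def expandOp (N q k : ℕ) : (Model n [⋀^Fin k]→L[ℝ] ℂ) →L[ℝ] OpForms N (2 * n + q) :=
  ∑ s : Fin k → Fin n, (ContinuousLinearMap.toSpanSingleton ℂ (((k.factorial : ℂ))⁻¹ •
    opForm (ιMulti ℂ k fun i => baseVec n q (s i)) : OpForms N (2 * n + q))
      |>.restrictScalars ℝ).comp (ContinuousAlternatingMap.apply ℝ (Model n) ℂ
        fun i => single (s i) 1)

theorem expandOp_apply (k : ℕ) (φ : Model n [⋀^Fin k]→L[ℝ] ℂ) :
    expandOp N q k φ = opForm (expand (fun i => ι ℂ (baseVec n q i)) φ) := by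
  rw [expand_eq_ιMulti, map_smul, map_sum, smul_sum, expandOp, _root_.sum_apply]
  refine sum_congr rfl fun s _ => ?_
  rw [map_smul, smul_comm]
  rfl

theorem opForm_pullback (T : TotalForm n M) (c : M) (z : Coord n q) :
    (opForm (pullback q T c z) : OpForms N (2 * n + q))
      = ∑ k ∈ Finset.range (n + 1), expandOp N q k (T.local k c (baseCoord z)) := by
  simp only [pullback_eq, map_sum, expandOp_apply]

theorem TotalForm.IsSmooth.contDiffOn_pullback (hT : T.IsSmooth) (c : M) :
    SmoothOn (fun z => (opForm (pullback q T c z) : OpForms N (2 * n + q)))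
      {z | baseCoord z ∈ chartDomain c} := by
  simp only [opForm_pullback]
  exact ContDiffOn.sum fun k _ => (expandOp N q k).contDiff.comp_contDiffOn
    ((hT k c).comp contDiff_baseCoord.contDiffOn fun _ hz => hz)

theorem TotalForm.IsClosed.extD_pullback (hT : T.IsClosed) (hTs : T.IsSmooth)
    (hz : baseCoord z ∈ chartDomain c) :
    extD (opDz N (2 * n + q)) (fun z => opForm (pullback q T c z)) z = 0 := by
  have h1 : ∀ k, HasFDerivAt (fun z => expandOp N q k (T.local k c (baseCoord z)))
      ((expandOp N q k).comp ((fderiv ℝ (T.local k c) (baseCoord z)).comp (baseCoordL n q)))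
        z := fun k =>
    (expandOp N q k).hasFDerivAt.comp z (((hTs k c).diffAt (isOpen_chartDomain c)
      hz).hasFDerivAt.comp z
      (baseCoordL n q).hasFDerivAt)
  simp only [opForm_pullback]
  rw [extD, (HasFDerivAt.fun_sum fun k _ => h1 k).fderiv]
  simp only [_root_.sum_apply, mul_sum]
  rw [sum_comm]
  refine sum_eq_zero fun k _ => ?_
  have h2 := congrArg (opForm (N := N)) (sum_mul_expand (baseVec n q)
    (fderiv ℝ (T.local k c) (baseCoord z)))
  have h3 : alternatizeUncurryFin (fderiv ℝ (T.local k c) (baseCoord z)) = 0 := hT k c _ hz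
  rw [h3] at h2
  have h4 : (opForm (expand (k := k + 1) (fun i => ι ℂ (baseVec n q i)) 0) :
      OpForms N (2 * n + q)) = 0 := by rw [← expandOp_apply, map_zero]
  rw [h4, map_sum] at h2
  simp only [map_mul, ← expandOp_apply] at h2
  rw [← h2]
  simp only [comp_apply, baseCoordL_single, map_sum, mul_sum]
  rw [sum_comm]
  refine sum_congr rfl fun j _ => ?_
  rw [sum_eq_single (⟨2 * j, by omega⟩ : Fin (2 * n + q))]
  · simp; rfl
  · intro l _ hl; rw [if_neg (Ne.symm hl)]; simp
  · simp

end Pullback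

/-! ### Integrals of operator valued forms -/

section ConeIntegrals

theorem IsIsometry.chartRadius_cotrans (hg : IsIsometry h g) (hz : z ∈ cotransDom q g m c c') :
    chartRadius h c' (cotrans g m c c' z) = chartRadius h c z := by
  have h1 : baseCoord (cotrans g m c c' z) ∈ chartDomain c' := by
    rw [baseCoord_cotrans]; exact trans_mem hz
  rw [chartRadius_eq h h1, chartRadius_eq h hz.1, hg.fibreNormSq_cotrans hz, extraCoord_cotrans]

theorem continuousOn_chartRadius (h : Metric n M) (c : M) :
    ContinuousOn (chartRadius (q := q) h c) {z | baseCoord z ∈ chartDomain c} := by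
  have h1 : ContinuousOn (fun z : Coord n q => sqrt
      (fibreNormSq h c (baseCoord z) (fibreVec z) + ∑ j, extraCoord z j ^ 2))
      {z | baseCoord z ∈ chartDomain c} := by
    refine ((contDiffOn_fibreNormSq_coord q h c).continuousOn.add ?_).sqrt
    exact (continuous_finsetSum _ fun j _ => ((continuous_apply j).comp
      contDiff_extraCoord.continuous).pow 2).continuousOn
  exact h1.congr fun z hz => chartRadius_eq h hz

theorem mem_coneDomain_of_chartRadius_pos (hz : baseCoord z ∈ chartDomain c)
    (hr : 0 < chartRadius h c z) : z ∈ coneDomain q c := by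
  refine ⟨hz, ?_⟩
  by_contra hc
  push Not at hc
  rw [← fibreVec_eq_zero] at hc
  rw [chartRadius_eq h hz, hc.1, hc.2] at hr
  have h0 := fibreNormSq_smul h c (baseCoord z) 0 0
  simp at h0
  simp [h0] at hr

theorem cotrans_mem_coneDomain_iff (hz : z ∈ cotransDom q g m c c') :
    cotrans g m c c' z ∈ coneDomain q c' ↔ z ∈ coneDomain q c := by
  have h1 : ∀ {m : ℤ} {c c' : M} {z : Coord n q}, z ∈ cotransDom q g m c c' →
      cotrans g m c c' z ∈ coneDomain q c' → z ∈ coneDomain q c := by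
    intro m c c' z hz h
    refine ⟨hz.1, ?_⟩
    by_contra hc
    push Not at hc
    refine h.2.elim (fun h2 => h2 ?_) fun h2 => h2 (by rw [extraCoord_cotrans]; exact hc.2)
    rw [← fibreVec_eq_zero, fibreVec_cotrans, fibreVec_eq_zero.2 hc.1, map_zero]
  refine ⟨h1 hz, fun h => h1 (cotrans_mem hz) ?_⟩
  rwa [cotrans_neg_cotrans hz]

theorem isCompact_cone (h : Metric n M) {K : Set (Model n)} (hK : IsCompact K)
    (hKc : K ⊆ chartDomain c) (a b : ℝ) :
    IsCompact {z : Coord n q | baseCoord z ∈ K ∧ chartRadius h c z ∈ Icc a b} := by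
  obtain ⟨l, hl, hl'⟩ := (hK.prod (isCompact_sphere 0 1)).exists_forall_le' ((contDiffOn_fibreNormSq
    h c).continuousOn.mono (prod_mono hKc (subset_univ _)))
    fun p hp => fibreNormSq_pos h (hKc hp.1) (Metric.ne_of_mem_sphere hp.2 one_ne_zero)
  have h1 : ∀ y ∈ K, ∀ η : Model n, l * ‖η‖ ^ 2 ≤ fibreNormSq h c y η := by
    intro y hy η
    rcases eq_or_ne η 0 with rfl | hη
    · simpa using fibreNormSq_nonneg h (hKc hy) 0
    · have h2 := hl' (y, ‖η‖⁻¹ • η) ⟨hy, by simp [norm_smul, hη]⟩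
      rw [fibreNormSq_smul] at h2
      have h3 := norm_pos_iff.2 hη
      calc l * ‖η‖ ^ 2 ≤ ‖η‖⁻¹ ^ 2 * fibreNormSq h c y η * ‖η‖ ^ 2 := by gcongr
        _ = fibreNormSq h c y η := by field_simp
  refine ((hK.prod ((isCompact_closedBall 0 (sqrt (b ^ 2 / l))).prod
    (isCompact_closedBall 0 |b|))).image (coordEquiv n q).symm.continuous).of_isClosed_subset
      (((continuousOn_chartRadius h c).mono fun z hz => hKc hz).preimage_isClosed_of_isClosed
      (hK.isClosed.preimage contDiff_baseCoord.continuous) isClosed_Icc) ?_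
  rintro z ⟨hz, -, hz'⟩
  refine ⟨coordEquiv n q z, ⟨hz, ?_, ?_⟩, (coordEquiv n q).symm_apply_apply z⟩
  all_goals
    rw [chartRadius_eq h (hKc hz)] at hz'
    have h4 := Real.sqrt_le_iff.1 hz'
    have h5 := fibreNormSq_nonneg h (hKc hz) (fibreVec z)
    have h6 : 0 ≤ ∑ j, extraCoord z j ^ 2 := sum_nonneg fun j _ => sq_nonneg _
    rw [coordEquiv_apply, mem_closedBall_zero_iff]
  · refine Real.le_sqrt_of_sq_le ((le_div_iff₀' hl).2 ((h1 _ hz _).trans ?_)); linarith [h4.2]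
  · refine (pi_norm_le_iff_of_nonneg (abs_nonneg b)).2 fun j => ?_
    have h7 := Finset.single_le_sum (f := fun j => extraCoord z j ^ 2) (fun j _ => sq_nonneg _)
      (Finset.mem_univ j)
    exact sq_le_sq.1 (by linarith [h4.2])

/-- Invariant open sets in the charts of the cotangent bundle. -/
structure IsInvDomain (g : Diffeo n M) (Ω : M → Set (Coord n q)) : Prop where
  isOpen : ∀ c, IsOpen (Ω c)
  subset : ∀ c, Ω c ⊆ coneDomain q c
  cotrans_mem_iff : ∀ {m c c' z}, z ∈ cotransDom q g m c c' → (cotrans g m c c' z ∈ Ω c' ↔ z ∈ Ω c)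

/-- Smooth invariant operator valued forms. -/
structure IsInvForm (g : Diffeo n M) (Ω : M → Set (Coord n q))
    (X : M → Coord n q → OpForms N (2 * n + q)) : Prop where
  smooth : ∀ c, SmoothOn (X c) (Ω c)
  invariant : ∀ {m c c' z}, z ∈ cotransDom q g m c c' → z ∈ Ω c →
    pullOp (fderiv ℝ (cotrans g m c c') z) (X c' (cotrans g m c c' z)) = shiftForm m (X c z)

variable {Ω : M → Set (Coord n q)} {X Y Z F T : M → Coord n q → OpForms N (2 * n + q)}

namespace IsInvForm

theorem add (hX : IsInvForm g Ω X) (hY : IsInvForm g Ω Y) :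
    IsInvForm g Ω fun c z => X c z + Y c z where
  smooth c := (hX.smooth c).add (hY.smooth c)
  invariant hz hz' := by rw [map_add, map_add, hX.invariant hz hz', hY.invariant hz hz']

theorem mul (hX : IsInvForm g Ω X) (hY : IsInvForm g Ω Y) :
    IsInvForm g Ω fun c z => X c z * Y c z where
  smooth c := (hX.smooth c).mul (hY.smooth c)
  invariant hz hz' := by rw [map_mul, map_mul, hX.invariant hz hz', hY.invariant hz hz']

theorem smul (hX : IsInvForm g Ω X) (a : ℂ) : IsInvForm g Ω fun c z => a • X c z where
  smooth c := contDiffOn_const.fun_smul (hX.smooth c)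
  invariant hz hz' := by rw [map_smul, map_smul, hX.invariant hz hz']

theorem pow (hX : IsInvForm g Ω X) (k : ℕ) : IsInvForm g Ω fun c z => X c z ^ k where
  smooth c := (hX.smooth c).pow k
  invariant hz hz' := by rw [map_pow, map_pow, hX.invariant hz hz']

theorem opMat_of {A : M → Coord n q → OpMatrix N}
    (hs : ∀ c i j, SmoothOn (fun z => A c z i j) (Ω c))
    (hA : ∀ {m c c' z}, z ∈ cotransDom q g m c c' → z ∈ Ω c →
      A c' (cotrans g m c c' z) = (A c z).map (shiftConj m)) :
    IsInvForm g Ω fun c z => opMat (A c z) where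
  smooth c := contDiffOn_opMat (hs c)
  invariant hz hz' := by rw [pullOp_opMat, hA hz hz', shiftForm_opMat]

theorem extD_of (hΩ : IsInvDomain g Ω) {A : M → Coord n q → OpMatrix N}
    (hs : ∀ c i j, SmoothOn (fun z => A c z i j) (Ω c))
    (hA : ∀ {m c c' z}, z ∈ cotransDom q g m c c' → z ∈ Ω c →
      A c' (cotrans g m c c' z) = (A c z).map (shiftConj m)) :
    IsInvForm g Ω fun c z => extD (opDz N _) (fun z => opMat (A c z)) z where
  smooth c := contDiffOn_extD (hΩ.isOpen c) (contDiffOn_opMat (hs c))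
  invariant {m c c' z} hz hz' := by
    have hd : ∀ {c z}, z ∈ Ω c → ∀ i j, DifferentiableAt ℝ (fun z => A c z i j) z :=
      fun {c z} hz i j => (hs c i j).diffAt (hΩ.isOpen c) hz
    rw [pullOp_extD (A' := A c') (hasFDerivAt_cotrans hz) (hd ((hΩ.cotrans_mem_iff hz).2 hz')),
      shiftForm_extD m (hd hz')]
    refine extD_congr ?_
    filter_upwards [isOpen_cotransDom.mem_nhds hz, (hΩ.isOpen c).mem_nhds hz'] with y hy hy'
    rw [hA hy hy']

theorem scalar {f : M → Coord n q → Forms (2 * n + q)}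
    (hs : ∀ c, SmoothOn (fun z => (opForm (f c z) : OpForms N (2 * n + q))) (Ω c))
    (hf : ∀ {m c c' z}, z ∈ cotransDom q g m c c' → z ∈ Ω c →
      pull (fderiv ℝ (cotrans g m c c') z) (f c' (cotrans g m c c' z)) = f c z) :
    IsInvForm (N := N) g Ω fun c z => opForm (f c z) where
  smooth := hs
  invariant hz hz' := by rw [pullOp_opForm, hf hz hz', shiftForm_opForm]

end IsInvForm

theorem cotrans_mem_domain (hz : z ∈ cotransDom q g m c c') :
    cotrans g m c c' z ∈ (cotangentLift q g).domain c' := (cotrans_mem hz).1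

/-- A form that vanishes outside of a compact subset of `Ω` over the support of the partition of
unity. -/
structure IsSupportedIn (Ω : M → Set (Coord n q))
    (F : M → Coord n q → OpForms N (2 * n + q)) : Prop where
  zero_off : ∀ c z, baseCoord z ∈ chartDomain c → z ∉ Ω c → F c z = 0
  compact : ∀ c, ∃ K, IsCompact K ∧ K ⊆ Ω c ∧
    ∀ z ∈ Ω c, baseCoord z ∈ partSupport n c → z ∉ K → F c z = 0

theorem IsSupportedIn.mul_right (hF : IsSupportedIn Ω F) :
    IsSupportedIn Ω fun c z => F c z * X c z where
  zero_off c z hz hz' := by rw [hF.zero_off c z hz hz', zero_mul]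
  compact c := by
    obtain ⟨K, hK, hKΩ, h0⟩ := hF.compact c
    exact ⟨K, hK, hKΩ, fun z hz hz' hzK => by rw [h0 z hz hz' hzK, zero_mul]⟩

theorem IsSupportedIn.integrableOn {E : Type*} [NormedAddCommGroup E]
    (hF : IsSupportedIn Ω F) {G : (Coord n q) → E} (hG : ContinuousOn G (Ω c))
    (h0 : ∀ z, baseCoord z ∈ chartDomain c → F c z = 0 ∨ baseCoord z ∉ partSupport n c → G z = 0) :
    IntegrableOn G ((cotangentLift q g).domain c) := by
  obtain ⟨K, hK, hKΩ, hK0⟩ := hF.compact c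
  refine ((hG.mono hKΩ).integrableOn_compact hK).of_forall_sdiff_eq_zero
    ChartLift.isOpen_domain.measurableSet fun z hz => h0 z hz.1 ?_
  by_cases hz1 : z ∈ Ω c
  · by_cases hz2 : baseCoord z ∈ partSupport n c
    · exact Or.inl (hK0 z hz1 hz2 hz.2)
    · exact Or.inr hz2
  · exact Or.inl (hF.zero_off c z hz.1 hz1)

theorem continuousOn_part (hΩ : IsInvDomain g Ω) (c : M) : ContinuousOn (fun z =>
    (chartPartition n M c ((cotangentLift q g).point c z) : ℂ)) (Ω c) := by
  have h1 := ChartLift.continuousOn_partition (L := cotangentLift q g) 0 c c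
  exact h1.mono fun z hz => (hΩ.subset c hz).1

theorem part_mul_eq_zero {G : ℂ} (hz : baseCoord z ∈ chartDomain c)
    (h0 : G = 0 ∨ baseCoord z ∉ partSupport n c) :
    (chartPartition n M c ((cotangentLift q g).point c z) : ℂ) * G = 0 := by
  rcases h0 with h0 | h0
  · rw [h0, mul_zero]
  · have h1 : chartPartition n M c ((cotangentLift q g).point c z) = 0 :=
      chartPartition_eq_zero_of_chart hz h0
    rw [h1, ofReal_zero, zero_mul]

theorem IsSupportedIn.hasTotal (hΩ : IsInvDomain g Ω) (hF : IsSupportedIn Ω F)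
    (hs : ∀ c, ContinuousOn (F c) (Ω c)) :
    (cotangentLift q g).HasTotal fun c z => topTrace N _ (F c z) := by
  intro c
  refine hF.integrableOn ((continuousOn_part hΩ c).mul ((topTrace N _).continuous.comp_continuousOn
    (hs c))) fun z hz h0 => part_mul_eq_zero hz (h0.imp (fun h => ?_) id)
  exact (congrArg (topTrace N _) h).trans (map_zero _)

end ConeIntegrals

/-! ### The trace property -/

section TraceProperty

variable {d : ℕ}

theorem hasSum_trace00 (a b : OpMatrix N) :
    HasSum (fun k => trace00 N (a * Matrix.diagonal (fun _ => unitProj k) * b)) (trace00 N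
    (a * b)) := by
  have h2 : ∀ a b : OpMatrix N, trace00 N (a * b) = ∑ i, ∑ j, coeff (a i j * b j i) 0 0 := by
    intro a b; change ∑ i, coeff ((a * b) i i) 0 0 = _
    refine sum_congr rfl fun i _ => ?_
    rw [Matrix.mul_apply, ← coeffL_apply, map_sum]; rfl
  simpa only [h2, Matrix.mul_diagonal, coeff_mul_unitProj_mul] using (hasSum_sum fun i _ =>
    hasSum_sum fun j _ => hasSum_coeff_mul _ _ _ _)

theorem hasSum_topTrace (f t : Forms d) (Y Z : OpForms N d) :
    HasSum (fun k => topTrace N d (opForm f * (Y * projForm N d k * Z) * opForm t))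
      (topTrace N d (opForm f * (Y * Z) * opForm t)) := by
  induction Y using induction_on with
  | zero => simp
  | add Y Y' hY hY' => simpa only [add_mul, mul_add, map_add] using hY.add hY'
  | tmul a u =>
    induction Z using induction_on with
    | zero => simp
    | add Z Z' hZ hZ' => simpa only [add_mul, mul_add, map_add] using hZ.add hZ'
    | tmul b v =>
      have h1 : ∀ p : OpMatrix N,
          topTrace N d (opForm f * ((a ⊗ₜ u) * opMat p * (b ⊗ₜ v)) * opForm t)
            = trace00 N (a * p * b) * topCoeff d (f * (u * v) * t) := by
        intro p
        rw [opMat_apply, tmul_mul_tmul, tmul_mul_tmul,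
          mul_one, topTrace_apply, formTrace_mul_opForm, formTrace_opForm_mul, formTrace_tmul,
          mul_smul_comm, smul_mul_assoc, map_smul, smul_eq_mul]
      have h2 := h1 1
      rw [map_one, mul_one, mul_one] at h2; rw [h2]; simp only [projForm, h1]
      exact (hasSum_trace00 a b).mul_right _

theorem exists_norm_sum_projForm_le (N d : ℕ) :
    ∃ C, ∀ s : Finset ℤ, ‖∑ k ∈ s, projForm N d k‖ ≤ C := by
  refine ⟨∑ i : Fin N, ‖opSingle i i (1 : Forms d)‖ * (‖weightedShift 0‖ * 1), fun s => ?_⟩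
  have h1 : ∑ k ∈ s, projForm N d k = ∑ i : Fin N, opSingle i i 1
      (weightedShift 0 (∑ k ∈ s, boundedSeq (Pi.single k 1))) := by
    simp; rw [sum_comm]
    refine sum_congr rfl fun k _ => ?_
    rw [projForm, opMat_eq_sum]
    refine sum_congr rfl fun i _ => ?_
    rw [sum_eq_single i, Matrix.diagonal_apply_eq]
    · rfl
    · intro j _ hj; rw [Matrix.diagonal_apply_ne' _ hj, map_zero]
    · simp
  have h2 : ‖∑ k ∈ s, boundedSeq (Pi.single k (1 : ℂ))‖ ≤ 1 := by
    refine (norm_le zero_le_one).2 fun i => ?_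
    rw [BoundedContinuousFunction.sum_apply]
    simp only [boundedSeq_single, single_apply, Finset.sum_ite_eq]; split_ifs <;> simp
  rw [h1]
  refine (norm_sum_le _ _).trans (sum_le_sum fun i _ => ?_)
  refine ((opSingle i i 1).le_opNorm _).trans ?_
  gcongr
  exact ((weightedShift 0).le_opNorm _).trans (by gcongr)

variable {Ω : M → Set (Coord n q)} {f t : M → Coord n q → Forms (2 * n + q)}
  {Y Z : M → Coord n q → OpForms N (2 * n + q)}

variable (g) in
/-- The integral of `f ∧ tr X ∧ t` over the cotangent bundle. -/
def totalTrace (f t : M → Coord n q → Forms (2 * n + q))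
    (X : M → Coord n q → OpForms N (2 * n + q)) : ℂ :=
  (cotangentLift q g).total fun c z => topTrace N _ (opForm (f c z) * X c z * opForm (t c z))

theorem hasTotal_mul_mul (P : OpForms N (2 * n + q)) (hΩ : IsInvDomain g Ω)
    (hf : IsInvForm (N := N) g Ω fun c z => opForm (f c z))
    (ht : IsInvForm (N := N) g Ω fun c z => opForm (t c z))
    (hfs : IsSupportedIn (N := N) Ω fun c z => opForm (f c z))
    (hY : IsInvForm g Ω Y) (hZ : IsInvForm g Ω Z) : (cotangentLift q g).HasTotal fun c z =>
      topTrace N _ (opForm (f c z) * (Y c z * P * Z c z) * opForm (t c z)) := by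
  refine (hfs.mul_right.mul_right).hasTotal hΩ fun c => ?_
  exact ((hf.smooth c).continuousOn.mul (((hY.smooth c).continuousOn.mul continuousOn_const).mul
    (hZ.smooth c).continuousOn)).mul (ht.smooth c).continuousOn

theorem hasSum_totalTrace (hΩ : IsInvDomain g Ω)
    (hf : IsInvForm (N := N) g Ω fun c z => opForm (f c z))
    (ht : IsInvForm (N := N) g Ω fun c z => opForm (t c z))
    (hfs : IsSupportedIn (N := N) Ω fun c z => opForm (f c z))
    (hY : IsInvForm g Ω Y) (hZ : IsInvForm g Ω Z) :
    HasSum (fun k => totalTrace g f t fun c z => Y c z * projForm N _ k * Z c z)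
      (totalTrace g f t fun c z => Y c z * Z c z) := by
  obtain ⟨C, hC⟩ := exists_norm_sum_projForm_le N (2 * n + q)
  have hT := fun P => hasTotal_mul_mul P hΩ hf ht hfs hY hZ
  unfold totalTrace
  simp only [ChartLift.total_eq_sum]
  refine hasSum_sum fun c _ => ?_
  have h1 : ∀ s : Finset ℤ, ∑ k ∈ s, ∫ z in (cotangentLift q g).domain c,
      (chartPartition n M c ((cotangentLift q g).point c z) : ℂ) * topTrace N _
        (opForm (f c z) * (Y c z * projForm N _ k * Z c z) * opForm (t c z))
      = ∫ z in (cotangentLift q g).domain c,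
        (chartPartition n M c ((cotangentLift q g).point c z) : ℂ) * topTrace N _
        (opForm (f c z) * (Y c z * (∑ k ∈ s, projForm N _ k) * Z c z) * opForm (t c z)) := by
    intro s; rw [← integral_finsetSum _ fun k _ => hT _ c]
    simp only [← mul_sum, ← map_sum, ← sum_mul]
  unfold HasSum
  simp only [h1]
  refine tendsto_integral_filter_of_dominated_convergence
    (fun z => ‖(chartPartition n M c ((cotangentLift q g).point c z) : ℂ)‖ * (‖topTrace N
    (2 * n + q)‖ * (‖(opForm (f c z) : OpForms N (2 * n + q))‖ * (‖Y c z‖ * C * ‖Z c z‖)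
        * ‖(opForm (t c z) : OpForms N (2 * n + q))‖)))
    (Eventually.of_forall fun s => (hT _ c).1) (Eventually.of_forall fun s =>
      Eventually.of_forall fun z => ?_) ?_ (Eventually.of_forall fun z => ?_)
  · rw [norm_mul]; gcongr; refine ((topTrace N _).le_opNorm _).trans ?_; gcongr
    refine (norm_mul_le _ _).trans ?_; gcongr; refine (norm_mul_le _ _).trans ?_; gcongr
    refine (norm_mul_le _ _).trans ?_; gcongr; refine (norm_mul_le _ _).trans ?_; gcongr; exact hC s
  · refine hfs.integrableOn ?_ fun z hz h0 => ?_
    · exact (continuousOn_part hΩ c).norm.mul (continuousOn_const.mul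
        (((hf.smooth c).continuousOn.norm.mul (((hY.smooth c).continuousOn.norm.mul
        continuousOn_const).mul (hZ.smooth c).continuousOn.norm)).mul
    (ht.smooth c).continuousOn.norm))
    · have h2 := part_mul_eq_zero (G := ((‖(opForm (f c z) :
        OpForms N (2 * n + q))‖ : ℝ) : ℂ)) (g := g) hz (h0.imp (fun h => by
          simp only [h, norm_zero, ofReal_zero]) id)
      rcases mul_eq_zero.1 h2 with h2 | h2
      · simp only [h2, norm_zero, zero_mul]
      · simp only [Complex.ofReal_eq_zero.1 h2, zero_mul, mul_zero]
  · have h2 := (hasSum_topTrace (f c z) (t c z) (Y c z) (Z c z)).mul_left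
      (chartPartition n M c ((cotangentLift q g).point c z) : ℂ)
    refine h2.congr fun s => ?_
    simp only [← mul_sum, ← map_sum, ← sum_mul]

theorem totalTrace_mul_comm (hΩ : IsInvDomain g Ω)
    (hf : IsInvForm (N := N) g Ω fun c z => opForm (f c z))
    (ht : IsInvForm (N := N) g Ω fun c z => opForm (t c z))
    (hfs : IsSupportedIn (N := N) Ω fun c z => opForm (f c z))
    (hY : IsInvForm g Ω Y) (hZ : IsInvForm g Ω Z) {s : ℂ}
    (hs : ∀ c, ∀ z ∈ Ω c, IsSwap s (Y c z) (Z c z)) :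
    totalTrace g f t (fun c z => Y c z * Z c z) = s * totalTrace g f t fun c z => Z c z * Y c
      z := by
  refine (hasSum_totalTrace hΩ hf ht hfs hY hZ).unique ?_
  have h1 := ((Equiv.neg ℤ).hasSum_iff.2 (hasSum_totalTrace hΩ hf ht hfs hZ hY)).mul_left s
  refine Eq.subst (motive := fun F => HasSum F _) (funext fun k => Eq.symm ?_) h1
  rw [Function.comp_apply, Equiv.neg_apply]
  have h2 : s * totalTrace g f t (fun c z => Z c z * projForm N _ (-k) * Y c z)
      = (cotangentLift q g).total fun c z => s * topTrace N _ (opForm (f c z)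
        * (Z c z * projForm N _ (-k) * Y c z) * opForm (t c z)) := by
    rw [totalTrace, ChartLift.total_eq_sum, ChartLift.total_eq_sum, mul_sum]
    refine sum_congr rfl fun c _ => ?_
    rw [← integral_const_mul]
    exact integral_congr_ae (Eventually.of_forall fun z => mul_left_comm _ _ _)
  rw [h2]
  refine ChartLift.total_eq_of_lift (hasTotal_mul_mul _ hΩ hf ht hfs hY hZ)
    (fun c => ?_) k fun c c' z hz => ?_
  · exact ((hasTotal_mul_mul (projForm N _ (-k)) hΩ hf ht hfs hZ hY c).const_mul s).congr
      (Eventually.of_forall fun z => mul_left_comm _ _ _)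
  · have hz := hz
    have h4 : (fderiv ℝ ((cotangentLift q g).lift k c c') z).det = 1 := det_fderiv_cotrans hz
    rw [h4, abs_one, one_smul]
    change _ = s * topTrace N _ (opForm (f c' (cotrans g k c c' z)) * _ * _)
    by_cases hz' : z ∈ Ω c
    · have h5 := hs c z hz' k
      have h6 : ∀ u : OpForms N (2 * n + q), topTrace N _ (pullOp (fderiv ℝ (cotrans g k c c') z) u)
          = topTrace N _ u := by
        intro u
        rw [topTrace_apply, formTrace_pullOp, topCoeff_pull, det_fderiv_cotrans hz,
          ofReal_one, one_mul, topTrace_apply]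
      have h7 := hf.invariant hz hz'
      have h8 := ht.invariant hz hz'
      rw [shiftForm_opForm] at h7 h8
      have h9 : pullOp (fderiv ℝ (cotrans g k c c') z) (Z c' (cotrans g k c c' z)
          * projForm N _ (-k) * Y c' (cotrans g k c c' z))
          = shiftForm k (Z c z * projForm N _ 0 * Y c z) := by
        have h10 : projForm N (2 * n + q) (-k) = shiftForm k (projForm N _ 0) := by
          rw [shiftForm_projForm, zero_sub]
        rw [map_mul, map_mul, hZ.invariant hz hz', hY.invariant hz hz', projForm, pullOp_opMat,
          ← projForm, h10, ← map_mul, ← map_mul]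
      have h11 : topTrace N _ (opForm (f c' (cotrans g k c c' z)) * (Z c' (cotrans g k c c' z)
          * projForm N _ (-k) * Y c' (cotrans g k c c' z)) * opForm (t c' (cotrans g k c c' z)))
          = topTrace N _ (opForm (f c z) * shiftForm k (Z c z * projForm N _ 0 * Y c z)
            * opForm (t c z)) := by
        rw [← h6, map_mul (pullOp _), map_mul (pullOp _), h9, h7, h8]
      refine Eq.trans ?_ (congrArg (s * ·) h11.symm)
      simp only [topTrace_apply, formTrace_mul_opForm, formTrace_opForm_mul, h5, mul_smul_comm,
        smul_mul_assoc, map_smul, smul_eq_mul]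
    · have h5 := hfs.zero_off c z hz.1 hz'
      rw [h5, (hfs.zero_off c' _ (cotrans_mem_domain hz) fun h => hz' ((hΩ.cotrans_mem_iff hz).1
        h))]; simp

end TraceProperty

/-! ### The theorem of Stokes -/

section Stokes

variable {d : ℕ}

theorem integral_topTrace_extD_eq_zero {H : (Fin d → ℝ) → OpForms N d} (hH : ContDiff ℝ ∞ H)
    (hc : HasCompactSupport H) : ∫ z, topTrace N d (extD (opDz N d) H z) = 0 := by
  have h1 : ∀ l z, HasFDerivAt (fun z => topTrace N d (opDz N d l * H z))
      (((topTrace N d).restrictScalars ℝ).comp ((ContinuousLinearMap.mul ℝ _ (opDz N d l)).comp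
        (fderiv ℝ H z))) z := fun l z => ((topTrace N d).restrictScalars ℝ).hasFDerivAt.comp z
    ((ContinuousLinearMap.mul ℝ _ (opDz N d l)).hasFDerivAt.comp z
      (hH.differentiable (by simp) z).hasFDerivAt)
  have hs : ∀ l, ContDiff ℝ ∞ fun z => topTrace N d (opDz N d l * H z) := fun l =>
    ((topTrace N d).restrictScalars ℝ).contDiff.comp (contDiff_const.mul hH)
  have hcs := fun l => hc.comp_left (g := fun X => topTrace N d (opDz N d l * X)) (by simp)
  have hi : ∀ l, Integrable fun z => fderiv ℝ (fun z => topTrace N d (opDz N d l * H z)) z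
      (Pi.single l 1) := fun l =>
    (((hs l).continuous_fderiv
    (by simp)).clm_apply continuous_const).integrable_of_hasCompactSupport
      ((hcs l).fderiv_apply ℝ _)
  have h2 : ∀ z, topTrace N d (extD (opDz N d) H z)
      = ∑ l, fderiv ℝ (fun z => topTrace N d (opDz N d l * H z)) z (Pi.single l 1) := by
    intro z; rw [extD, map_sum]; exact sum_congr rfl fun l _ => by rw [(h1 l z).fderiv]; rfl
  simp only [h2]
  rw [integral_finsetSum _ fun l _ => hi l]
  refine sum_eq_zero fun l _ => ?_
  have key := integral_mul_fderiv_eq_neg_fderiv_mul_of_integrable (μ := volume)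
    (f := fun _ => 1) (g := fun z => topTrace N d (opDz N d l * H z)) (v := Pi.single l 1)
    (by simp) (by simpa using hi l)
    (by simpa using (hs l).continuous.integrable_of_hasCompactSupport (hcs l))
    (fun _ _ => differentiableAt_const _) fun z _ => (hs l).differentiable (by simp) z
  simpa using key

theorem extD_smul {𝒜 : Type*} [NormedRing 𝒜] [NormedAlgebra ℝ 𝒜] {e : Fin d → 𝒜}
    {f : (Fin d → ℝ) → ℝ} {X : (Fin d → ℝ) → 𝒜} {z : Fin d → ℝ}
    (hf : DifferentiableAt ℝ f z) (hX : DifferentiableAt ℝ X z) :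
    extD e (fun z => f z • X z) z = extD e (fun z => f z • (1 : 𝒜)) z * X z + f z • extD e X z := by
  have h2 := extD_mul (e := e) (hf.smul_const 1) hX (fun l => by
    rw [one_smul, mul_smul_comm, smul_mul_assoc, one_mul, mul_one])
  simpa only [one_smul, smul_mul_assoc, one_mul] using h2

variable {Ω : M → Set (Coord n q)} {G : M → Coord n q → OpForms N (2 * n + q)}

/-- A function of the partition of unity in the coordinates of the cotangent bundle. -/
def partFun (q : ℕ) (c₀ c : M) (z : Coord n q) : ℝ :=
  chartPartition n M c₀ (chartPoint c (baseCoord z))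

theorem contDiffOn_partFun (q : ℕ) (c₀ c : M) :
    SmoothOn (partFun (n := n) q c₀ c) {z | baseCoord z ∈ chartDomain c} :=
  (contDiffOn_comp_chartPoint (chartPartition n M c₀).contMDiff c).comp
    contDiff_baseCoord.contDiffOn fun _ hz => hz

theorem isOpen_baseDomain (c : M) : IsOpen {z : Coord n q | baseCoord z ∈ chartDomain c} :=
  (isOpen_chartDomain c).preimage contDiff_baseCoord.continuous

theorem differentiableAt_partFun (c₀ : M) (hz : baseCoord z ∈ chartDomain c) :
    DifferentiableAt ℝ (partFun q c₀ c) z :=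
  (contDiffOn_partFun q c₀ c).diffAt (isOpen_baseDomain c) hz

theorem dScalar_partFun_eq_zero {c₀ : M} (hz : baseCoord z ∈ chartDomain c)
    (h0 : chartPoint c (baseCoord z) ∉ tsupport (chartPartition n M c₀)) :
    dScalar (partFun q c₀ c) z = 0 := by
  have h1 : partFun q c₀ c =ᶠ[𝓝 z] fun _ => 0 := by
    exact (((continuousOn_chartPoint c).comp contDiff_baseCoord.continuous.continuousOn (fun _ hz =>
      hz)).continuousAt ((isOpen_baseDomain c).mem_nhds hz)).eventually
      (notMem_tsupport_iff_eventuallyEq.1 h0)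
  rw [dScalar_congr h1]
  simp [dScalar]

theorem contDiffOn_dScalar {f : (Fin d → ℝ) → ℝ} {U : Set (Fin d → ℝ)} (hU : IsOpen U)
    (hf : SmoothOn f U) :
    SmoothOn (fun z => (opForm (dScalar f z) : OpForms N d)) U := by
  refine (contDiffOn_extD (e := opDz N d) (X := fun z => f z • 1) hU
    (hf.fun_smul contDiffOn_const)).congr fun z hz => ?_
  exact opForm_dScalar (hf.diffAt hU hz)

theorem IsSupportedIn.eventually_eq_zero (hG : IsSupportedIn Ω G)
    {K : Set (Coord n q)} (hK : IsCompact K)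
    (hK0 : ∀ z ∈ Ω c, baseCoord z ∈ partSupport n c → z ∉ K → G c z = 0) (hzK : z ∉ K)
    (hz : baseCoord z ∈ chartDomain c) (hz0 : partFun q c c z ≠ 0) : G c =ᶠ[𝓝 z] fun _ => 0 := by
  filter_upwards [hK.isClosed.isOpen_compl.mem_nhds hzK, (isOpen_baseDomain c).mem_nhds hz,
    ((contDiffOn_partFun q c c).continuousOn.continuousAt
      ((isOpen_baseDomain c).mem_nhds hz)).eventually_ne hz0] with y hy hy' hy0
  by_cases hyΩ : y ∈ Ω c
  · exact hK0 y hyΩ (by_contra fun h => hy0 (chartPartition_eq_zero_of_chart hy' h)) hy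
  · exact hG.zero_off c y hy' hyΩ

theorem integral_part_mul_extD (hΩ : IsInvDomain g Ω) (hG : IsInvForm g Ω G)
    (hs : IsSupportedIn Ω G) (c : M) :
    IntegrableOn (fun z => (partFun q c c z : ℂ) * topTrace N _ (extD (opDz N _) (G c) z))
      ((cotangentLift q g).domain c) ∧
    IntegrableOn (fun z => topTrace N _ (opForm (dScalar (partFun q c c) z) * G c z))
      ((cotangentLift q g).domain c) ∧
    ∫ z in (cotangentLift q g).domain c,
        (partFun q c c z : ℂ) * topTrace N _ (extD (opDz N _) (G c) z)
      = -∫ z in (cotangentLift q g).domain c,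
        topTrace N _ (opForm (dScalar (partFun q c c) z) * G c z) := by
  obtain ⟨K, hK, hKΩ, hK0⟩ := hs.compact c
  have hsub : Ω c ⊆ {z | baseCoord z ∈ chartDomain c} := fun z hz => (hΩ.subset c hz).1
  have hψ := (contDiffOn_partFun q c c).mono hsub
  have hd : ∀ z, z ∈ (cotangentLift q g).domain c → z ∉ K →
      (partFun q c c z) * topTrace N _ (extD (opDz N _) (G c) z) = 0 := by
    intro z hz hzK
    by_cases hz0 : partFun q c c z = 0
    · rw [hz0, ofReal_zero, zero_mul]
    · rw [extD_congr (hs.eventually_eq_zero hK hK0 hzK hz hz0)]; simp [extD]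
  have hd' : ∀ z, z ∈ (cotangentLift q g).domain c → z ∉ K →
      topTrace N _ (opForm (dScalar (partFun q c c) z) * G c z) = 0 := by
    intro z hz hzK
    by_cases hzs : baseCoord z ∈ partSupport n c
    · have : G c z = 0 := by
        by_cases hzΩ : z ∈ Ω c
        · exact hK0 z hzΩ hzs hzK
        · exact hs.zero_off c z hz hzΩ
      rw [this, mul_zero, map_zero]
    · rw [(fun z hz hzs => dScalar_partFun_eq_zero hz fun h => hzs ⟨_, h, extChartAt_chartPoint hz⟩)
        z hz hzs, map_zero, zero_mul, map_zero]
  have hint : ∀ {f : (Coord n q) → ℂ}, ContinuousOn f (Ω c) →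
      (∀ z ∈ (cotangentLift q g).domain c, z ∉ K → f z = 0) →
      IntegrableOn f ((cotangentLift q g).domain c) := fun hf h0 =>
    ((hf.mono hKΩ).integrableOn_compact hK).of_forall_sdiff_eq_zero
      ChartLift.isOpen_domain.measurableSet fun z hz => h0 z hz.1 hz.2
  have hi1 : IntegrableOn (fun z => (partFun q c c z) * topTrace N _ (extD (opDz N _) (G c) z))
      ((cotangentLift q g).domain c) := hint
    ((continuous_ofReal.comp_continuousOn hψ.continuousOn).mul
    ((topTrace N _).continuous.comp_continuousOn
      (contDiffOn_extD (hΩ.isOpen c) (hG.smooth c)).continuousOn)) hd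
  have hi2 : IntegrableOn (fun z => topTrace N _ (opForm (dScalar (partFun q c c) z) * G c z))
      ((cotangentLift q g).domain c) := hint ((topTrace N _).continuous.comp_continuousOn
    ((contDiffOn_dScalar (hΩ.isOpen c) hψ).mul (hG.smooth c)).continuousOn) hd'
  refine ⟨hi1, hi2, ?_⟩
  rw [eq_neg_iff_add_eq_zero, ← integral_add hi1 hi2]
  have h0 : ∀ z ∈ Ω c, z ∉ K → partFun q c c z • G c z = 0 := by
    intro z hz hzK
    by_cases hz0 : partFun q c c z = 0
    · rw [hz0, zero_smul]
    · rw [(hs.eventually_eq_zero hK hK0 hzK (hsub hz) hz0).eq_of_nhds]; exact smul_zero _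
  have hHs := tsupport_indicator_subset hK h0
  refine Eq.trans ?_ (integral_topTrace_extD_eq_zero (contDiff_indicator (hΩ.isOpen c) hK hKΩ
    (hψ.fun_smul (hG.smooth c)) h0)
    (hK.of_isClosed_subset (isClosed_tsupport _) hHs))
  refine Eq.trans ?_ (setIntegral_eq_integral_of_forall_compl_eq_zero
    (s := (cotangentLift q g).domain c) fun z hz => ?_)
  · refine setIntegral_congr_fun ChartLift.isOpen_domain.measurableSet fun z hz => ?_
    by_cases hzK : z ∈ K
    · have h1 : (Ω c).indicator (fun z => partFun q c c z • G c z) =ᶠ[𝓝 z]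
          fun z => partFun q c c z • G c z := by
        filter_upwards [(hΩ.isOpen c).mem_nhds (hKΩ hzK)] with y hy using indicator_of_mem hy _
      rw [extD_congr h1, extD_smul (differentiableAt_partFun c hz) ((hG.smooth c).diffAt (hΩ.isOpen
        c) (hKΩ hzK)),
        ← opForm_dScalar (differentiableAt_partFun c hz), map_add, ← coe_smul,
        map_smul, smul_eq_mul, add_comm]
    · rw [hd z hz hzK, hd' z hz hzK, extD_congr (notMem_tsupport_iff_eventuallyEq.1
        fun h => hzK (hHs h))]
      simp [extD]
  · rw [extD_congr (notMem_tsupport_iff_eventuallyEq.1 fun h => hz (hsub (hKΩ (hHs h))))]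
    simp [extD]

/-- The theorem of Stokes. -/
theorem total_extD_eq_zero (hΩ : IsInvDomain g Ω) (hG : IsInvForm g Ω G) (hs : IsSupportedIn Ω G) :
    (cotangentLift q g).total (fun c z => topTrace N _ (extD (opDz N _) (G c) z)) = 0 := by
  let P : M → M → Coord n q → ℂ := fun c₀ c z =>
    topTrace N _ (opForm (dScalar (partFun q c₀ c) z) * G c z)
  have hP : ∀ c₀, (cotangentLift q g).HasTotal (P c₀) := fun c₀ c =>
    hs.integrableOn ((continuousOn_part hΩ c).mul ((topTrace N _).continuous.comp_continuousOn
      ((contDiffOn_dScalar (hΩ.isOpen c) ((fun c₀ c => (contDiffOn_partFun q c₀ c).mono fun z hz =>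
        (hΩ.subset c hz).1) c₀ c)).mul (hG.smooth c)).continuousOn))
      fun z hz h0 => part_mul_eq_zero hz (h0.imp (fun h => by
        simp only [P]; rw [h, mul_zero, map_zero]) id)
  have h1 : ∀ c₀, (cotangentLift q g).total (P c₀)
      = ∫ z in (cotangentLift q g).domain c₀, P c₀ c₀ z := by
    intro c₀
    refine ChartLift.total_eq_of_support (fun c' z hz => ?_) (fun c' z hz hz' => ?_)
      (integral_part_mul_extD hΩ hG hs c₀).2.1
    · have hz := hz
      have h4 : (fderiv ℝ ((cotangentLift q g).lift 0 c₀ c') z).det = 1 := det_fderiv_cotrans hz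
      rw [h4, abs_one, one_smul]
      change topTrace N _ (opForm (dScalar (partFun q c₀ c₀) z) * G c₀ z) = topTrace N _
        (opForm (dScalar (partFun q c₀ c') (cotrans g 0 c₀ c' z)) * G c' (cotrans g 0 c₀ c' z))
      by_cases hzΩ : z ∈ Ω c₀
      · have h5 := hG.invariant hz hzΩ
        have h6 : pull (fderiv ℝ (cotrans g 0 c₀ c') z)
            (dScalar (partFun q c₀ c') (cotrans g 0 c₀ c' z)) = dScalar (partFun q c₀ c₀) z := by
          rw [pull_dScalar (hasFDerivAt_cotrans hz)
            (differentiableAt_partFun c₀ (cotrans_mem_domain hz))]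
          refine dScalar_congr ?_
          filter_upwards [isOpen_cotransDom.mem_nhds hz] with y hy
          rw [partFun, partFun, baseCoord_cotrans, chartPoint_trans hy, iter_zero, id]
        have h7 : ∀ X : OpForms N (2 * n + q), formTrace N _ (shiftForm 0 X) = formTrace N _ X := by
          intro X
          induction X using induction_on with
          | zero => simp
          | add X Y hX hY => rw [map_add, map_add, map_add, hX, hY]
          | tmul a f =>
            rw [← opMat_mul_opForm, map_mul, shiftForm_opMat, shiftForm_opForm]
            have : a.map (shiftConj 0) = a := by
              ext1 i j
              refine boundedOp_ext fun k l => ?_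
              rw [Matrix.map_apply, coeff_shiftConj, add_zero, add_zero]
            rw [this]
        rw [topTrace_apply, topTrace_apply, ← one_mul (topCoeff _ (formTrace _ _ (opForm
          (dScalar (partFun q c₀ c') _) * _))), ← ofReal_one, ← det_fderiv_cotrans hz,
          ← topCoeff_pull, ← formTrace_pullOp, map_mul (pullOp _), pullOp_opForm, h6, h5,
          formTrace_opForm_mul, formTrace_opForm_mul, h7]
      · rw [hs.zero_off c₀ z hz.1 hzΩ, hs.zero_off c' _ (cotrans_mem_domain hz) fun h =>
          hzΩ ((hΩ.cotrans_mem_iff hz).1 h)]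
        simp
    · simp only [P]
      rw [dScalar_partFun_eq_zero hz fun h => hz' (chartPartition_subordinate n M c₀ h), map_zero,
        zero_mul, map_zero]
  have h2 : (cotangentLift q g).total (fun c z => topTrace N _ (extD (opDz N _) (G c) z))
      = -∑ c ∈ chartIndex n M, (cotangentLift q g).total (P c) := by
    rw [ChartLift.total_eq_sum, ← sum_neg_distrib]
    refine sum_congr rfl fun c _ => ?_
    rw [h1]; exact (integral_part_mul_extD hΩ hG hs c).2.2
  rw [h2, neg_eq_zero]
  simp only [ChartLift.total_eq_sum]
  rw [sum_comm]
  refine sum_eq_zero fun c _ => ?_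
  rw [← integral_finsetSum _ fun c₀ _ => hP c₀ c]
  refine setIntegral_eq_zero_of_forall_eq_zero fun z hz => ?_
  have h3 : ∑ c₀ ∈ chartIndex n M, dScalar (partFun q c₀ c) z = 0 := by
    have h4 : HasFDerivAt (fun z => ∑ c₀ ∈ chartIndex n M, partFun q c₀ c z)
        (∑ c₀ ∈ chartIndex n M, fderiv ℝ (partFun q c₀ c) z) z :=
      HasFDerivAt.fun_sum fun c₀ _ => (differentiableAt_partFun c₀ hz).hasFDerivAt
    have h5 : (fun z => ∑ c₀ ∈ chartIndex n M, partFun q c₀ c z)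
        = fun _ => 1 := funext fun z => sum_chartPartition _
    rw [h5] at h4
    have h6 := h4.unique (hasFDerivAt_const 1 z)
    simp only [dScalar]; rw [sum_comm]
    refine sum_eq_zero fun l _ => ?_
    rw [← sum_smul, ← ofReal_sum, ← _root_.sum_apply, h6]; simp
  simp only [P, ← mul_sum, ← map_sum, ← sum_mul, h3]
  simp

end Stokes

/-! ### Logarithmic differentials of invariant functions -/

section RingLemmas

variable {R : Type*} [Ring R]

theorem pow_mul_of_anticomm {x e : R} (h : x * e = -(e * x)) (p : ℕ) :
    x ^ p * e = (-1) ^ p * (e * x ^ p) := by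
  induction p with
  | zero => simp
  | succ p ih => rw [pow_succ, mul_assoc, h, mul_neg, ← mul_assoc, ih, pow_succ]; noncomm_ring

theorem neg_one_pow_smul (𝕜 : Type*) [CommRing 𝕜] [Algebra 𝕜 R] (p : ℕ) (x : R) :
    (-1 : 𝕜) ^ p • x = (-1) ^ p * x := by
  rw [Algebra.smul_def, map_pow, map_neg, map_one]

/-- The sum `∑ₚ (-1)ᵖ xᵖ b xᴷ⁻¹⁻ᵖ`. -/
def altSum (x b : R) (K : ℕ) : R := ∑ p ∈ Finset.range K, (-1) ^ p * (x ^ p * b * x ^ (K - 1 - p))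

theorem altSum_succ (x b : R) (K : ℕ) : altSum x b (K + 1) = b * x ^ K - x * altSum x b K := by
  rw [altSum, Finset.sum_range_succ', altSum, mul_sum, sub_eq_add_neg, add_comm, ← sum_neg_distrib]
  congr 1
  · simp
  · refine sum_congr rfl fun p _ => ?_
    rw [show K + 1 - 1 - (p + 1) = K - 1 - p by omega, pow_succ', pow_succ' x,
      ← mul_assoc x, ((Commute.neg_one_right x).pow_right p).eq]
    noncomm_ring

theorem add_pow_of_anticomm {x b θ : R} (hx : x * θ = -(θ * x)) (hb : Commute θ b) (hθ : θ * θ = 0)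
    (K : ℕ) : (x + θ * b) ^ K = x ^ K + θ * altSum x b K := by
  induction K with
  | zero => simp [altSum]
  | succ K ih =>
    have h1 : θ * b * (θ * altSum x b K) = 0 := by
      rw [hb.eq, mul_assoc, ← mul_assoc θ θ, hθ, zero_mul, mul_zero]
    have h2 : x * (θ * altSum x b K) = -(θ * (x * altSum x b K)) := by
      rw [← mul_assoc, hx, neg_mul, mul_assoc]
    rw [pow_succ', ih, altSum_succ, add_mul, mul_add, mul_add, h1, h2, pow_succ']
    noncomm_ring

theorem mul_odd_of_anticomm {x b e : R} (hx : x * e = -(e * x)) (hb : Commute e b) {p r j : ℕ}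
    (hpr : p + 1 + r = 2 * j) : x ^ p * b * x ^ r * e = -(e * (x ^ p * b * x ^ r)) := by
  have h1 : (-1 : R) ^ r * (-1) ^ p = -1 := by
    rw [← pow_add, Odd.neg_one_pow ⟨j - 1, by omega⟩]
  calc x ^ p * b * x ^ r * e = (-1) ^ r * (x ^ p * b * (e * x ^ r)) := by
        rw [mul_assoc, pow_mul_of_anticomm hx, ← mul_assoc _ ((-1) ^ r),
          ((Commute.neg_one_right (x ^ p * b)).pow_right r).eq, mul_assoc]
    _ = (-1) ^ r * (x ^ p * e * (b * x ^ r)) := by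
        rw [mul_assoc (x ^ p), ← mul_assoc b, ← hb.eq]; simp only [mul_assoc]
    _ = ((-1) ^ r * (-1) ^ p) * (e * (x ^ p * b * x ^ r)) := by
        rw [pow_mul_of_anticomm hx]; simp only [mul_assoc]
    _ = -(e * (x ^ p * b * x ^ r)) := by rw [h1, neg_one_mul]

end RingLemmas

section InvMat

variable {P Q : M → Coord n q → OpMatrix N}

theorem isInvDomain_cone : IsInvDomain g (coneDomain (n := n) (M := M) q) :=
  ⟨isOpen_coneDomain q, fun _ => subset_rfl, cotrans_mem_coneDomain_iff⟩

/-- Smooth invariant functions with values in matrices of operators, inverse to each other. -/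
structure IsInvMat (g : Diffeo n M)
    (P Q : M → Coord n q → OpMatrix N) : Prop where
  smooth : ∀ c i j, SmoothOn (fun z => P c z i j) (coneDomain q c)
  smooth_inv : ∀ c i j, SmoothOn (fun z => Q c z i j) (coneDomain q c)
  mul_inv : ∀ c, ∀ z ∈ coneDomain q c, P c z * Q c z = 1
  inv_mul : ∀ c, ∀ z ∈ coneDomain q c, Q c z * P c z = 1
  invariant : ∀ {m c c' z}, z ∈ cotransDom q g m c c' → z ∈ coneDomain q c →
    P c' (cotrans g m c c' z) = (P c z).map (shiftConj m)

/-- The form `P⁻¹ dP`. -/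
def symD (P Q : M → Coord n q → OpMatrix N) (c : M) (z : Coord n q) : OpForms N (2 * n + q) :=
  logD (opDz N _) (fun z => opMat (P c z)) (fun z => opMat (Q c z)) z

def symD' (P Q : M → Coord n q → OpMatrix N) (c : M) (z : Coord n q) : OpForms N (2 * n + q) :=
  logD' (opDz N _) (fun z => opMat (P c z)) (fun z => opMat (Q c z)) z

namespace IsInvMat

variable (hI : IsInvMat g P Q)
include hI

theorem differentiableAt (hz : z ∈ coneDomain q c) (i j : Fin N) :
    DifferentiableAt ℝ (fun z => P c z i j) z :=
  (hI.smooth c i j).diffAt (isOpen_coneDomain q c) hz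

theorem isInvPair (c : M) : IsInvPair (opDz N (2 * n + q)) (fun z => opMat (P c z))
    (fun z => opMat (Q c z)) (coneDomain q c) where
  anticomm := opDz_anticomm
  isOpen := isOpen_coneDomain q c
  smooth_m := contDiffOn_opMat (hI.smooth c)
  smooth_u := contDiffOn_opMat (hI.smooth_inv c)
  mul_inv z hz := by rw [← map_mul, hI.mul_inv c z hz, map_one]
  inv_mul z hz := by rw [← map_mul, hI.inv_mul c z hz, map_one]
  comm_m z hz l v := by
    rw [fderiv_opMat (hI.differentiableAt hz)]; exact commute_opForm_opMat _ _
  comm_u z _ l := commute_opForm_opMat _ _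

theorem inv_invariant (hz : z ∈ cotransDom q g m c c') (hz' : z ∈ coneDomain q c) :
    Q c' (cotrans g m c c' z) = (Q c z).map (shiftConj m) := by
  have h1 := hI.inv_mul c' _ ((cotrans_mem_coneDomain_iff hz).2 hz')
  have h2 : (P c z).map (shiftConj m) * (Q c z).map (shiftConj m) = 1 :=
    (map_mul (shiftConjHom m).mapMatrix _ _).symm.trans
      ((congrArg _ (hI.mul_inv c z hz')).trans (map_one _))
  rw [hI.invariant hz hz'] at h1
  rw [← mul_one (Q c' _), ← h2, ← mul_assoc, h1, one_mul]

theorem isInvForm : IsInvForm g (coneDomain q) fun c z => opMat (P c z) :=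
  .opMat_of hI.smooth hI.invariant

theorem isInvForm_inv : IsInvForm g (coneDomain q) fun c z => opMat (Q c z) :=
  .opMat_of hI.smooth_inv hI.inv_invariant

theorem isInvForm_symD : IsInvForm g (coneDomain q) (symD P Q) :=
  hI.isInvForm_inv.mul (.extD_of isInvDomain_cone hI.smooth hI.invariant)

theorem isInvForm_symD' : IsInvForm g (coneDomain q) (symD' P Q) :=
  (IsInvForm.extD_of isInvDomain_cone hI.smooth hI.invariant).mul hI.isInvForm_inv

theorem symD_eq_sum (hz : z ∈ coneDomain q c) : symD P Q c z = ∑ l, opForm (dz l) *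
    opMat (Q c z * of fun i j => fderiv ℝ (fun z => P c z i j) z (Pi.single l 1)) := by
  rw [symD, logD, extD_opMat (hI.differentiableAt hz), mul_sum]
  refine sum_congr rfl fun l _ => ?_
  rw [← mul_assoc, ← (commute_opForm_opMat _ _).eq, mul_assoc, map_mul]

theorem symD'_eq_sum (hz : z ∈ coneDomain q c) : symD' P Q c z = ∑ l, opForm (dz l) *
    opMat ((of fun i j => fderiv ℝ (fun z => P c z i j) z (Pi.single l 1)) * Q c z) := by
  rw [symD', logD', extD_opMat (hI.differentiableAt hz), sum_mul]
  exact sum_congr rfl fun l _ => by rw [mul_assoc, map_mul]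

theorem symD_mul_dz (hz : z ∈ coneDomain q c) (l : Fin (2 * n + q)) :
    symD P Q c z * opDz N _ l = -(opDz N _ l * symD P Q c z) := by
  rw [symD, (hI.isInvPair c).mul_logD hz l, neg_smul, neg_neg]
  exact (one_smul ℝ _).symm

theorem mul_symD_pow (hz : z ∈ coneDomain q c) (k : ℕ) :
    opMat (P c z) * symD P Q c z ^ k = symD' P Q c z ^ k * opMat (P c z) := by
  refine SemiconjBy.pow_right (a := opMat (P c z)) (x := symD P Q c z) ?_ k
  rw [SemiconjBy, symD, symD', logD, logD', ← mul_assoc, ← map_mul, hI.mul_inv c z hz, mul_assoc,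
    ← map_mul, hI.inv_mul c z hz, map_one, one_mul, mul_one]

end IsInvMat

variable {f t : M → Coord n q → Forms (2 * n + q)} {X X' : M → Coord n q → OpForms N (2 * n + q)}

/-- The scalar forms that occur in the integrals. -/
structure IsWeight (N : ℕ) (g : Diffeo n M)
    (f t : M → Coord n q → Forms (2 * n + q)) : Prop where
  left : IsInvForm (N := N) g (coneDomain q) fun c z => opForm (f c z)
  right : IsInvForm (N := N) g (coneDomain q) fun c z => opForm (t c z)
  supported : IsSupportedIn (N := N) (coneDomain q) fun c z => opForm (f c z)

theorem totalTrace_smul (a : ℂ) :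
    totalTrace g f t (fun c z => a • X c z) = a * totalTrace g f t X := by
  simp only [totalTrace, ChartLift.total_eq_sum, mul_sum]
  refine sum_congr rfl fun c _ => ?_
  rw [← integral_const_mul]
  simp only [mul_smul_comm, smul_mul_assoc, map_smul, smul_eq_mul, mul_left_comm]

namespace IsWeight

variable (hw : IsWeight N g f t)
include hw

theorem hasTotal (hX : IsInvForm g (coneDomain q) X) : (cotangentLift q g).HasTotal fun c z =>
    topTrace N _ (opForm (f c z) * X c z * opForm (t c z)) :=
  hw.supported.mul_right.mul_right.hasTotal isInvDomain_cone fun c =>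
    (((hw.left.mul hX).mul hw.right).smooth c).continuousOn

theorem totalTrace_congr (hX : ∀ c, ∀ z ∈ coneDomain q c, topTrace N _ (opForm (f c z) * X c z *
    opForm (t c z)) = topTrace N _ (opForm (f c z) * X' c z * opForm (t c z))) :
    totalTrace g f t X = totalTrace g f t X' := by
  rw [totalTrace, totalTrace, ChartLift.total_eq_sum, ChartLift.total_eq_sum]
  refine sum_congr rfl fun c _ => setIntegral_congr_fun ChartLift.isOpen_domain.measurableSet
    fun z hz => congrArg _ ?_
  by_cases hz' : z ∈ coneDomain q c
  · exact hX c z hz'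
  · have h0 := hw.supported.zero_off c z hz hz'
    simp only [h0, zero_mul]

theorem totalTrace_add (hX : IsInvForm g (coneDomain q) X) (hX' : IsInvForm g (coneDomain q) X') :
    totalTrace g f t (fun c z => X c z + X' c z) = totalTrace g f t X + totalTrace g f t X' := by
  simp only [totalTrace, ChartLift.total_eq_sum, ← sum_add_distrib]
  refine sum_congr rfl fun c _ => ?_
  rw [← integral_add (hw.hasTotal hX c) (hw.hasTotal hX' c)]
  simp only [mul_add, add_mul, map_add]

theorem trace_conj (h : IsInvMat g P Q) {E : OpMatrix N}
    (hE : ∀ m, E.map (shiftConj m) = E) (k : ℕ) :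
    totalTrace g f t (fun c z => opMat E * symD' P Q c z ^ k)
      = totalTrace g f t fun c z => opMat (Q c z * E * P c z) * symD P Q c z ^ k := by
  have hE' : IsInvForm g (coneDomain q) fun _ _ => opMat E :=
    .opMat_of (fun _ _ _ => contDiffOn_const) fun _ _ => (hE _).symm
  have h1 := totalTrace_mul_comm (Y := fun c z => opMat E * (opMat (P c z) * symD P Q c z ^ k))
    (Z := fun c z => opMat (Q c z)) isInvDomain_cone hw.left hw.right hw.supported
    (hE'.mul (h.isInvForm.mul (h.isInvForm_symD.pow k))) h.isInvForm_inv
    fun c z _ => isSwap_opMat _ (Q c z)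
  rw [one_mul] at h1
  have h2 : ∀ c, ∀ z ∈ coneDomain q c, opMat E * symD' P Q c z ^ k
      = opMat E * (opMat (P c z) * symD P Q c z ^ k) * opMat (Q c z) := fun c z hz => by
    rw [h.mul_symD_pow hz, mul_assoc, mul_assoc, ← map_mul, h.mul_inv c z hz, map_one, mul_one]
  rw [hw.totalTrace_congr (X := fun c z => opMat E * symD' P Q c z ^ k)
    fun c z hz => by rw [h2 c z hz], h1]
  simp only [map_mul, mul_assoc]

theorem trace_alt (h : IsInvMat g P Q) {b : M → Coord n q → OpMatrix N}
    (hb : IsInvForm g (coneDomain q) fun c z => opMat (b c z)) {p r j : ℕ} (hpr : p + r = 2 * j) :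
    totalTrace g f t (fun c z => (-1) ^ p * (symD P Q c z ^ p * opMat (b c z) * symD P Q c z ^ r))
      = totalTrace g f t fun c z => opMat (b c z) * symD P Q c z ^ (2 * j) := by
  induction p generalizing r with
  | zero => simp [← hpr]
  | succ p ih =>
    rw [← ih (r := r + 1) (by omega)]
    have h1 := totalTrace_mul_comm (s := -1) isInvDomain_cone hw.left hw.right hw.supported
      ((fun p r => ((h.isInvForm_symD.pow p).mul hb).mul (h.isInvForm_symD.pow r)) p r)
        h.isInvForm_symD fun c z hz => by
        refine Eq.subst (motive := IsSwap (-1) _) (h.symD_eq_sum hz).symm (isSwap_sum fun l _ => ?_)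
        rw [neg_one_smul]
        exact mul_odd_of_anticomm (h.symD_mul_dz hz l) (commute_opForm_opMat _ _) hpr
    have h2 : ∀ c z, (-1) ^ (p + 1) * (symD P Q c z ^ (p + 1) * opMat (b c z) * symD P Q c z ^ r)
        = (-1 : ℂ) ^ (p + 1) • (symD P Q c z * (symD P Q c z ^ p * opMat
    (b c z) * symD P Q c z ^ r)) := by
      intro c z; rw [pow_succ' (symD P Q c z)]; simp only [mul_assoc, neg_one_pow_smul]
    have h3 : ∀ c z, (-1) ^ p * (symD P Q c z ^ p * opMat (b c z) * symD P Q c z ^ (r + 1))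
        = (-1 : ℂ) ^ p • (symD P Q c z ^ p * opMat (b c z) * symD P Q c z ^ r * symD P Q c z) := by
      intro c z; rw [pow_succ (symD P Q c z)]; simp only [mul_assoc, neg_one_pow_smul]
    simp only [h2, h3]; rw [totalTrace_smul, totalTrace_smul, h1]; ring

theorem trace_altSum (h : IsInvMat g P Q) {b : M → Coord n q → OpMatrix N}
    (hb : IsInvForm g (coneDomain q) fun c z => opMat (b c z)) (j : ℕ) :
    totalTrace g f t (fun c z => altSum (symD P Q c z) (opMat (b c z)) (2 * j + 1))
      = (2 * j + 1 : ℕ) * totalTrace g f t fun c z => opMat (b c z) * symD P Q c z ^ (2 * j) := by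
  have h1 : ∀ p, (cotangentLift q g).HasTotal fun c z => topTrace N _ (opForm (f c z) *
      ((-1) ^ p * (symD P Q c z ^ p * opMat (b c z) * symD P Q c z ^ (2 * j + 1 - 1 - p))) *
      opForm (t c z)) := by
    intro p; simp only [← neg_one_pow_smul ℂ]
    exact hw.hasTotal ((((h.isInvForm_symD.pow p).mul hb).mul (h.isInvForm_symD.pow _)).smul _)
  calc _ = ∑ p ∈ Finset.range (2 * j + 1), totalTrace g f t fun c z =>
        (-1) ^ p * (symD P Q c z ^ p * opMat (b c z) * symD P Q c z ^ (2 * j + 1 - 1 - p)) := by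
        simp only [totalTrace, ChartLift.total_eq_sum]; rw [sum_comm]
        refine sum_congr rfl fun c _ => ?_
        rw [← integral_finsetSum _ fun p _ => h1 p c]
        simp only [altSum, mul_sum, sum_mul, map_sum]
    _ = _ := by
        rw [sum_congr rfl fun p hp => hw.trace_alt h hb (j := j)
          (r := 2 * j + 1 - 1 - p) (by have := Finset.mem_range.1 hp; omega)]
        rw [Finset.sum_const, Finset.card_range, nsmul_eq_mul]

end IsWeight

end InvMat

/-! ### The symbols in charts -/

section ChartSymbols

variable {d : ℕ}

theorem ι_eq_sum_dz (v : Fin d → ℂ) : ι ℂ v = ∑ l, v l • dz l := by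
  conv_lhs => rw [← Finset.univ_sum_single v]
  rw [map_sum]
  refine sum_congr rfl fun l _ => ?_
  rw [dz, ← map_smul, ← Pi.single_smul, smul_eq_mul, mul_one]

theorem dScalar_eq_ι (f : (Fin d → ℝ) → ℝ) (z : Fin d → ℝ) :
    dScalar f z = ι ℂ fun l => ((fderiv ℝ f z (Pi.single l 1) : ℝ) : ℂ) :=
  (ι_eq_sum_dz _).symm

theorem opDz_mul_ι (l : Fin d) (v : Fin d → ℂ) : opDz N d l * opForm (ι ℂ v)
    = -(opForm (ι ℂ v) * opDz N d l) := by
  rw [opDz, dz, ← map_mul opForm, ← map_mul opForm, ← map_neg opForm, eq_neg_of_add_eq_zero_left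
    (ι_add_mul_swap _ _)]

theorem chartCov_ne_zero_or (h : Metric n M) (hz : z ∈ coneDomain q c) :
    chartCov c (baseCoord z) (fibreVec z) ≠ 0 ∨ extraCoord z ≠ 0 :=
  radius_ne_zero h (chartPoint c (baseCoord z)) (chartRadius_pos h hz).ne'

theorem isInvMat_inChart {a : OpFunction n M q N} (ha : IsInvertibleSymbol h g a)
    (hs : ∀ c i j, SmoothOn (fun z => inChart h a c z i j) (coneDomain q c))
    (hi : ∀ c i j, SmoothOn (fun z => Ring.inverse (inChart h a c z) i j) (coneDomain q c))
    (hu : ∀ c, ∀ z ∈ coneDomain q c, IsUnit (inChart h a c z)) :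
    IsInvMat g (inChart h a) fun c z => Ring.inverse (inChart h a c z) where
  smooth := hs
  smooth_inv := hi
  mul_inv c z hz := mul_inverse_cancel _ (hu c z hz)
  inv_mul c z hz := inverse_mul_cancel _ (hu c z hz)
  invariant {m c c' z} hz hz' := by
    rw [inChart_cotrans h a hz]
    refine Matrix.ext fun i j => boundedOp_ext fun k l => ?_
    exact (ha.1.invariant _ _ _ (chartCov_ne_zero_or h hz') i j m k l).trans
      (coeff_shiftConj _ _ _ _).symm

theorem tmul_dz (a : OpMatrix N) (l : Fin d) :
    (a ⊗ₜ dz l : OpForms N d) = opForm (dz l) * opMat a := by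
  rw [(commute_opForm_opMat a _).eq, opMat_mul_opForm]

theorem logDifferential_eq_symD {a : OpFunction n M q N}
    (ha : IsInvMat g (inChart h a) fun c z => Ring.inverse (inChart h a c z))
    (hz : z ∈ coneDomain q c) : logDifferential h a c z
      = symD (inChart h a) (fun c z => Ring.inverse (inChart h a c z)) c z := by
  rw [ha.symD_eq_sum hz]
  simp only [logDifferential, tmul_dz]

theorem IsIsometry.isInvMat_symbolFun (hg : IsIsometry h g) (hD : D.IsElliptic g) :
    IsInvMat g (inChart h (D.symbolFun g)) fun c z => Ring.inverse (inChart h (D.symbolFun g) c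
      z) := by
  have hu : ∀ c, ∀ z ∈ coneDomain 0 c,
      IsUnit ((((chartRadius h c z)⁻¹ : ℝ) : ℂ) • D.chartSymbol g c z) := fun c z hz =>
    isUnit_ofReal_smul (inv_ne_zero (chartRadius_pos h hz).ne') (hD.isUnit_chartSymbol hz.1
      ((fibreVec_ne_zero_or hz).resolve_right fun h => h (elim _ _)))
  let b : M → Coord n 0 → Matrix (Fin 1) (Fin 1) BoundedOp := fun c z => of
    fun _ _ => Ring.inverse ((((chartRadius h c z)⁻¹ : ℝ) : ℂ) • D.chartSymbol g c z)
  have hb : ∀ c, ∀ z ∈ coneDomain 0 c, inChart h (D.symbolFun g) c z * b c z = 1 ∧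
      b c z * inChart h (D.symbolFun g) c z = 1 := fun c z hz => by
    constructor <;> refine Matrix.ext fun i j => ?_ <;>
    rw [Matrix.mul_apply, Finset.univ_unique, Finset.sum_singleton, hg.inChart_symbolFun,
      elim i j, Matrix.one_apply_eq]
    · exact mul_inverse_cancel _ (hu c z hz)
    · exact inverse_mul_cancel _ (hu c z hz)
  refine isInvMat_inChart (hg.isInvertibleSymbol_symbolFun hD) (fun c i j => ?_) (fun c i j => ?_)
    fun c z hz => ⟨⟨_, b c z, (hb c z hz).1, (hb c z hz).2⟩, rfl⟩
  · exact ((hg.isGood_scaledSymbol D c).contDiffOn).congr fun z _ => hg.inChart_symbolFun D c z i j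
  · refine (((hg.isGood_scaledSymbol D c).inverse (hu c)).contDiffOn).congr fun z hz => ?_
    rw [ring_inverse_eq (hb c z hz).1 (hb c z hz).2]; rfl

theorem IsIsometry.isInvMat_extSymbol (hg : IsIsometry h g) (hD : D.IsElliptic g) :
    IsInvMat g (inChart h (extSymbol g D)) fun c z => Ring.inverse (inChart h (extSymbol g D) c
      z) := by
  have hu := fun c z hz =>
    hD.isUnit_or_chart (c := c) (z := z) hz (inv_ne_zero (chartRadius_pos h hz).ne')
  refine isInvMat_inChart (hg.isInvertibleSymbol_extSymbol hD) (fun c i j => ?_) (fun c i j => ?_)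
    fun c z hz => ?_
  · refine (isGood_extMatrix (hg.isGood_scaledSymbol D c)
    (contDiffOn_scaledExtra h c) i j).contDiffOn.congr fun z _ => ?_
    rw [hg.inChart_extSymbol]
  · refine (isGood_extMatrixInv (hg.isGood_scaledSymbol D c) (contDiffOn_scaledExtra h c) (hu c)
      i j).contDiffOn.congr fun z hz => ?_
    rw [hg.inChart_extSymbol, ringInverse_extMatrix (hu c z hz)]
  · rw [hg.inChart_extSymbol]
    exact ⟨⟨_, _, extMatrix_mul_inv (hu c z hz), inv_mul_extMatrix (hu c z hz)⟩, rfl⟩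

/-- The form `κ(r) dr`. -/
def radialForm (h : Metric n M) (κ : ℝ → ℝ) (c : M) (z : Coord n q) : Forms (2 * n + q) :=
  ((κ (chartRadius h c z) : ℝ) : ℂ) • dRadius h c z

theorem differentiableAt_chartRadius (h : Metric n M) (hz : z ∈ coneDomain q c) :
    DifferentiableAt ℝ (chartRadius h c) z :=
  (contDiffOn_chartRadius h c).diffAt (isOpen_coneDomain q c) hz

theorem radialForm_eq_ι (h : Metric n M) (κ : ℝ → ℝ) (c : M) (z : Coord n q) :
    ∃ v, radialForm h κ c z = ι ℂ v :=
  ⟨_, (congrArg _ (dScalar_eq_ι _ z)).trans (map_smul _ _ _).symm⟩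

theorem IsIsometry.isWeight_radialForm (hg : IsIsometry h g) (N : ℕ) (hκ : ContDiff ℝ ∞ κ)
    (hκ0 : ∀ x, x ∉ Icc 1 2 → κ x = 0) (hT : T.IsSmooth) (hTg : T.IsInvariant g) :
    IsWeight N g (radialForm (q := q) h κ) (pullback q T) where
  left := by
    refine .scalar (fun c => ?_) fun {m c c' z} hz hz' => ?_
    · simp only [radialForm, map_smul]
      exact (ofRealCLM.contDiff.comp_contDiffOn (hκ.comp_contDiffOn
        (contDiffOn_chartRadius h c))).fun_smul (contDiffOn_dScalar (isOpen_coneDomain q c)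
        (contDiffOn_chartRadius h c))
    · rw [radialForm, map_smul, hg.chartRadius_cotrans hz, radialForm]
      refine congrArg _ ((pull_dScalar (hasFDerivAt_cotrans hz) (differentiableAt_chartRadius h
        ((cotrans_mem_coneDomain_iff hz).2 hz'))).trans (dScalar_congr ?_))
      filter_upwards [isOpen_cotransDom.mem_nhds hz] with y hy using hg.chartRadius_cotrans hy
  right := .scalar (fun c => (hT.contDiffOn_pullback c).mono fun _ hz => hz.1)
    fun hz _ => hTg.pull_pullback hz
  supported := by
    have h0 : ∀ c z, chartRadius h c z ∉ Icc 1 2 →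
        (opForm (radialForm h κ c z) : OpForms N (2 * n + q)) = 0 := fun c z hz => by
      rw [radialForm, hκ0 _ hz, ofReal_zero, zero_smul, map_zero]
    refine ⟨fun c z hz hz' => h0 c z fun hr => hz' (mem_coneDomain_of_chartRadius_pos hz
      (one_pos.trans_le hr.1)), fun c => ⟨_, isCompact_cone h (isCompact_partSupport c)
      (partSupport_subset c) 1 2, fun z hz => mem_coneDomain_of_chartRadius_pos
      (partSupport_subset c hz.1) (one_pos.trans_le hz.2.1), fun z _ hz hzK => h0 c z fun hr =>
      hzK ⟨hz, hr⟩⟩⟩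

theorem extD_radialForm (h : Metric n M) (hκ : ContDiff ℝ ∞ κ) (hz : z ∈ coneDomain q c) :
    extD (opDz N _) (fun z => opForm (radialForm h κ c z)) z = 0 := by
  have hr := differentiableAt_chartRadius h hz
  have hs := contDiffOn_dScalar (N := N) (isOpen_coneDomain q c) (contDiffOn_chartRadius h c)
  have h1 : (fun z => (opForm (radialForm h κ c z) : OpForms N (2 * n + q)))
      = fun z => κ (chartRadius h c z) • opForm (dRadius h c z) := by
    funext z
    rw [radialForm, map_smul, coe_smul]
  have h2 : extD (opDz N _) (fun z => opForm (dRadius h c z)) z = 0 := by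
    rw [extD_congr (Y := extD (opDz N _) fun z => chartRadius h c z • 1)]
    · exact extD_extD opDz_anticomm (isOpen_coneDomain q c)
        ((contDiffOn_chartRadius h c).fun_smul contDiffOn_const) hz
    · filter_upwards [(isOpen_coneDomain q c).mem_nhds hz] with y hy
      exact opForm_dScalar (differentiableAt_chartRadius h hy)
  have hκd := hκ.differentiable (by simp) (chartRadius h c z)
  have h3 : dScalar (chartRadius h c) z * dRadius h c z = 0 := by
    change dScalar (chartRadius h c) z * dScalar (chartRadius h c) z = 0
    rw [dScalar_eq_ι, ι_sq_zero]
  have h4 := extD_smul (e := opDz N _) (f := fun z => κ (chartRadius h c z))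
    (X := fun z => opForm (dRadius h c z)) (hκd.comp z hr)
    (hs.diffAt (isOpen_coneDomain q c) hz)
  rw [h1, h4, h2]
  refine (congrArg₂ (· + ·) ?_ (smul_zero _)).trans (add_zero _)
  erw [← opForm_dScalar (f := fun z => κ (chartRadius h c z)) (hκd.comp z hr), ← map_mul,
    dScalar_comp hκd hr, smul_mul_assoc, h3, smul_zero, map_zero]

end ChartSymbols

/-! ### Rotations of the extra coordinates -/

section Transvection

variable {d : ℕ}

/-- The linear map `x ↦ x + φ(x) v`. -/
def transvect (φ : (Fin d → ℝ) →ₗ[ℝ] ℝ) (v : Fin d → ℝ) : (Fin d → ℝ) →L[ℝ] (Fin d → ℝ) :=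
  LinearMap.toContinuousLinearMap (LinearMap.transvection φ v)

theorem det_transvect (φ : (Fin d → ℝ) →ₗ[ℝ] ℝ) (v : Fin d → ℝ) : (transvect φ v).det = 1 + φ v :=
  LinearMap.transvection.det φ v

/-- The form with the components of `φ`. -/
def dualForm (φ : (Fin d → ℝ) →ₗ[ℝ] ℝ) : Forms d := ∑ k, ((φ (Pi.single k 1) : ℝ) : ℂ) • dz k

theorem pull_transvect_dz (φ : (Fin d → ℝ) →ₗ[ℝ] ℝ) (v : Fin d → ℝ) (l : Fin d) :
    pull (transvect φ v) (dz l) = dz l + (v l : ℂ) • dualForm φ := by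
  rw [pull_dz, dualForm, smul_sum]
  have h1 : ∀ k, ((transvect φ v (Pi.single k 1) l : ℝ) : ℂ) • (dz k)
      = (if l = k then dz k else 0) + (v l : ℂ) • ((φ (Pi.single k 1) : ℝ) : ℂ) • dz k := by
    intro k; change (((Pi.single k 1 : Fin d → ℝ) l + φ (Pi.single k 1) * v l : ℝ) : ℂ) • _ = _
    rw [Complex.ofReal_add, add_smul, single_apply, ofReal_mul, smul_smul, mul_comm (v l : ℂ)]
    split_ifs <;> simp
  simp only [h1, sum_add_distrib, Finset.sum_ite_eq, Finset.mem_univ, if_true]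

theorem pull_transvect_dScalar {f : (Fin d → ℝ) → ℝ} {z v : Fin d → ℝ} (φ : (Fin d → ℝ) →ₗ[ℝ] ℝ)
    (h0 : fderiv ℝ f z v = 0) : pull (transvect φ v) (dScalar f z) = dScalar f z := by
  rw [map_eq_sum_single] at h0
  have h1 := congrArg (fun x : ℝ => (x : ℂ)) h0
  simp at h1
  simp only [dScalar, map_sum, map_smul, pull_transvect_dz, smul_add, sum_add_distrib,
    smul_smul, ← sum_smul, mul_comm _ ((v _) : ℂ), h1, zero_smul, add_zero]

end Transvection

section Rotation

variable {z : Coord n 2}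

/-- The rotation of the extra coordinates by an angle. -/
def rotate (z : Coord n 2) (t : ℝ) : Coord n 2 :=
  (coordEquiv n 2).symm (baseCoord z, fibreVec z, ![cos t * extraCoord z 0 - sin t *
    extraCoord z 1, sin t * extraCoord z 0 + cos t * extraCoord z 1])

def rotVec (z : Coord n 2) : Coord n 2 :=
  (coordEquiv n 2).symm (0, 0, ![-extraCoord z 1, extraCoord z 0])

theorem rotate_zero (z : Coord n 2) : rotate z 0 = z := by
  rw [rotate, ContinuousLinearEquiv.symm_apply_eq, coordEquiv_apply]
  refine congrArg _ (congrArg _ (funext fun j => ?_))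
  fin_cases j <;> simp

theorem hasDerivAt_rotate (z : Coord n 2) : HasDerivAt (rotate z) (rotVec z) 0 := by
  refine (coordEquiv n 2).symm.hasFDerivAt.comp_hasDerivAt 0
    ((hasDerivAt_const _ _).prodMk ((hasDerivAt_const _ _).prodMk (hasDerivAt_pi.2 fun j => ?_)))
  have hc := Real.hasDerivAt_cos 0
  have hs := Real.hasDerivAt_sin 0
  fin_cases j
  · simpa using (hc.mul_const (extraCoord z 0)).fun_sub (hs.mul_const (extraCoord z 1))
  · simpa using (hs.mul_const (extraCoord z 0)).fun_add (hc.mul_const (extraCoord z 1))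

theorem extraCoord_rotate (t : ℝ) : extraCoord (rotate z t) = ![cos t * extraCoord z 0 -
    sin t * extraCoord z 1, sin t * extraCoord z 0 + cos t * extraCoord z 1] :=
  extraCoord_symm _

theorem chartRadius_rotate (h : Metric n M) (hz : z ∈ coneDomain 2 c) (t : ℝ) :
    chartRadius h c (rotate z t) = chartRadius h c z := by
  have h1 : baseCoord (rotate z t) = baseCoord z := baseCoord_symm _
  rw [chartRadius_eq h (by rw [h1]; exact hz.1), chartRadius_eq h hz.1, h1, extraCoord_rotate,
    show fibreVec (rotate z t) = fibreVec z from fibreVec_symm _, Fin.sum_univ_two,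
      Fin.sum_univ_two]
  congr 2
  simp
  linear_combination (extraCoord z 0 ^ 2 + extraCoord z 1 ^ 2) * Real.sin_sq_add_cos_sq t

theorem extraComplex_rotate (t : ℝ) : extraComplex (extraCoord (rotate z t))
    = exp (t * I) * extraComplex (extraCoord z) := by
  rw [extraCoord_rotate, Complex.exp_mul_I]
  simp only [extraComplex, Matrix.cons_val_zero, Matrix.cons_val_one]
  push_cast
  linear_combination (-Complex.sin t * extraCoord z 1) * Complex.I_sq

def cornerMat : Matrix (Fin 2) (Fin 2) BoundedOp := !![1, 0; 0, 0]

theorem cornerMat_map (m : ℤ) : cornerMat.map (shiftConj m) = cornerMat := by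
  ext1 i j
  fin_cases i <;> fin_cases j <;> simp [cornerMat, shiftConj_one]

theorem fderiv_chartRadius_rotVec (h : Metric n M) (hz : z ∈ coneDomain 2 c) :
    fderiv ℝ (chartRadius h c) z (rotVec z) = 0 := by
  have h1 := HasFDerivAt.comp_hasDerivAt_of_eq 0
    (differentiableAt_chartRadius h hz).hasFDerivAt (hasDerivAt_rotate z) (rotate_zero z).symm
  refine h1.unique ?_
  have h2 : chartRadius h c ∘ rotate z = fun _ => chartRadius h c z :=
    funext fun t => chartRadius_rotate h hz t
  rw [h2]
  exact hasDerivAt_const _ _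

theorem IsIsometry.fderiv_extSymbol_rotVec (hg : IsIsometry h g) (hD : D.IsElliptic g)
    (hz : z ∈ coneDomain 2 c) (i j : Fin 2) :
    fderiv ℝ (fun z => inChart h (extSymbol g D) c z i j) z (rotVec z) = (I •
      (cornerMat * inChart h (extSymbol g D) c z - inChart h (extSymbol g D) c z * cornerMat) :
        Matrix (Fin 2) (Fin 2) BoundedOp) i j := by
  have h1 := HasFDerivAt.comp_hasDerivAt_of_eq 0
    ((hg.isInvMat_extSymbol hD).differentiableAt hz i j).hasFDerivAt (hasDerivAt_rotate z)
    (rotate_zero z).symm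
  refine h1.unique ?_
  set a := (((chartRadius h c z)⁻¹ : ℝ) : ℂ) • D.chartSymbol g c z with ha
  set b := (((chartRadius h c z)⁻¹ : ℝ) : ℂ) * extraComplex (extraCoord z) with hb
  have h2 : ∀ t, inChart h (extSymbol g D) c (rotate z t) = extMatrix a (exp (t * I) * b) := by
    intro t
    rw [hg.inChart_extSymbol, chartRadius_rotate h hz, extraComplex_rotate, hb, mul_left_comm, ha,
      ShiftOp.chartSymbol, ShiftOp.chartSymbol, show baseCoord (rotate z t) = baseCoord z from
      baseCoord_symm _, show fibreVec (rotate z t) = fibreVec z from fibreVec_symm _]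
  have h3 : HasDerivAt (fun t : ℝ => exp (t * I) * b) (I * b) 0 := by
    simpa using (((ofRealCLM.hasDerivAt (x := 0)).mul_const I).cexp).mul_const b
  have h4 : (fun z => inChart h (extSymbol g D) c z i j) ∘ rotate z
      = fun t : ℝ => extMatrix a (exp (t * I) * b) i j := funext fun t => by
    rw [Function.comp_apply, h2]
  have h5 : inChart h (extSymbol g D) c z = extMatrix a b := hg.inChart_extSymbol D c z
  rw [h4, h5]
  fin_cases i <;> fin_cases j
  · simpa [cornerMat, extMatrix, Matrix.mul_apply] using hasDerivAt_const 0 a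
  · simpa [cornerMat, extMatrix, Matrix.mul_apply, smul_smul] using h3.smul_const 1
  · have h6 := (h3.star.smul_const (1 : BoundedOp)).fun_neg
    simpa [cornerMat, extMatrix, Matrix.mul_apply, smul_smul] using h6
  · simpa [cornerMat, extMatrix, Matrix.mul_apply] using hasDerivAt_const 0 (star a)

def extraSq (z : Coord n 2) : ℝ := extraCoord z 0 ^ 2 + extraCoord z 1 ^ 2

/-- The form `t dτ - τ dt`. -/
def angleForm (z : Coord n 2) : Forms (2 * n + 2) :=
  (extraCoord z 0 : ℂ) • dz (natAdd (2 * n) 1) - (extraCoord z 1 : ℂ) • dz (natAdd (2 * n) 0)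

/-- The linear form `-(t dτ - τ dt) / (t² + τ²)`. -/
def angleDual (z : Coord n 2) : (Coord n 2) →ₗ[ℝ] ℝ :=
  (-(extraSq z)⁻¹) • (extraCoord z 0 • LinearMap.proj (natAdd (2 * n) 1)
    - extraCoord z 1 • LinearMap.proj (natAdd (2 * n) 0))

theorem angleDual_rotVec (hz : extraSq z ≠ 0) : angleDual z (rotVec z) = -1 := by
  have h2 : ∀ j, rotVec z (natAdd (2 * n) j) = ![-extraCoord z 1, extraCoord z 0] j :=
    fun j => congrFun (extraCoord_symm _) j
  simp only [angleDual, LinearMap.smul_apply, LinearMap.sub_apply, LinearMap.proj_apply, h2,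
    Matrix.cons_val_zero, Matrix.cons_val_one, smul_eq_mul]
  unfold extraSq at hz ⊢
  field_simp
  ring

theorem sum_single_smul_dz {d : ℕ} (i : Fin d) :
    ∑ k, (((Pi.single k (1 : ℝ) : Fin d → ℝ) i : ℝ) : ℂ) • (dz k : Forms d) = dz i := by
  rw [sum_eq_single i] <;> simp +contextual [eq_comm]

theorem dualForm_angleDual : dualForm (angleDual z) = (-(extraSq z : ℂ)⁻¹) • angleForm z := by
  have h1 : ∀ k : Fin (2 * n + 2), ((angleDual z (Pi.single k 1) : ℝ) : ℂ) • (dz k)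
      = (-(extraSq z : ℂ)⁻¹) • ((extraCoord z 0 : ℂ) • (((Pi.single k 1 : Coord n 2)
          (natAdd (2 * n) 1) : ℝ) : ℂ) • dz k - (extraCoord z 1 : ℂ) • (((Pi.single k 1 :
          Coord n 2) (natAdd (2 * n) 0) : ℝ) : ℂ) • dz k) := by
    intro k
    simp only [angleDual, LinearMap.smul_apply, LinearMap.sub_apply, LinearMap.proj_apply,
      smul_eq_mul]
    push_cast; rw [mul_smul, sub_smul, mul_smul, mul_smul]
  rw [dualForm]
  simp only [h1]
  rw [← smul_sum, Finset.sum_sub_distrib, ← smul_sum, ← smul_sum,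
    sum_single_smul_dz, sum_single_smul_dz]
  rfl

theorem pull_transvect_pullback (T : TotalForm n M) (φ : (Coord n 2) →ₗ[ℝ] ℝ) :
    pull (transvect φ (rotVec z)) (pullback 2 T c z) = pullback 2 T c z := by
  rw [pullback_eq, map_sum]
  refine sum_congr rfl fun k _ => ?_
  have h1 : HasFDerivAt (fun y => transvect φ (rotVec z) y) (transvect φ (rotVec z)) z :=
    (transvect φ (rotVec z)).hasFDerivAt
  refine pull_expand (J := .id ℝ _) h1 (hasFDerivAt_id _) (Eventually.of_forall fun y => ?_) _
  have h2 : baseCoordL n 2 (rotVec z) = 0 := baseCoord_symm _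
  change baseCoordL n 2 (y + φ y • rotVec z) = baseCoordL n 2 y
  rw [map_add, map_smul, h2, smul_zero, add_zero]

variable (h D g) in
/-- The form `P⁻¹ dP` for the symbol `P` of the external product. -/
def extForm : M → Coord n 2 → OpForms 2 (2 * n + 2) :=
  symD (inChart h (extSymbol g D)) fun c z => Ring.inverse (inChart h (extSymbol g D) c z)

variable (h D g) in
/-- The function `P⁻¹ E P - E`. -/
def extDefect (c : M) (z : Coord n 2) : Matrix (Fin 2) (Fin 2) BoundedOp :=
  Ring.inverse (inChart h (extSymbol g D) c z) * cornerMat * inChart h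
    (extSymbol g D) c z - cornerMat

theorem IsIsometry.pullOp_extForm (hg : IsIsometry h g) (hD : D.IsElliptic g)
    (hz : z ∈ coneDomain 2 c) (φ : (Coord n 2) →ₗ[ℝ] ℝ) :
    pullOp (transvect φ (rotVec z)) (extForm g h D c z) = extForm g h D c z
      + (I • opForm (dualForm φ)) * opMat (extDefect g h D c z) := by
  have hP := hg.isInvMat_extSymbol hD
  set Q := Ring.inverse (inChart h (extSymbol g D) c z) with hQ
  have h1 : ∑ l, (rotVec z l : ℂ) • (Q * of fun i j => fderiv ℝ (fun z => inChart h
      (extSymbol g D) c z i j) z (Pi.single l 1)) = I • extDefect g h D c z := by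
    simp only [← mul_smul_comm]; rw [← mul_sum]
    have h2 : ∑ l, (rotVec z l : ℂ) • (of fun i j => fderiv ℝ (fun z => inChart h
        (extSymbol g D) c z i j) z (Pi.single l 1)) = I • (cornerMat * inChart h
        (extSymbol g D) c z - inChart h (extSymbol g D) c z * cornerMat) := by
      ext1 i j
      rw [← hg.fderiv_extSymbol_rotVec hD hz, map_eq_sum_single (fderiv ℝ _ z), Matrix.sum_apply]
      rfl
    rw [h2, mul_smul_comm, mul_sub, ← mul_assoc, ← mul_assoc, hP.inv_mul c z hz, one_mul]; rfl
  rw [extForm, hP.symD_eq_sum hz]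
  simp only [map_sum, map_mul, pullOp_opForm, pullOp_opMat, pull_transvect_dz, map_add, map_smul,
    add_mul, sum_add_distrib]
  congr 1
  rw [smul_mul_assoc, ← mul_smul_comm, ← map_smul, ← h1, map_sum, mul_sum]
  simp only [map_smul, map_mul, mul_smul_comm, smul_mul_assoc, hQ]

theorem IsIsometry.topTrace_extForm_pow (hg : IsIsometry h g) (hD : D.IsElliptic g)
    (hz : z ∈ coneDomain 2 c) (κ : ℝ → ℝ) (T : TotalForm n M) (K : ℕ) :
    (extraSq z : ℂ) * topTrace 2 _ (opForm (radialForm h κ c z) * extForm g h D c z ^ K *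
        opForm (pullback 2 T c z))
      = I * topTrace 2 _ (opForm (radialForm h κ c z * angleForm z) *
        altSum (extForm g h D c z) (opMat (extDefect g h D c z)) K * opForm (pullback 2 T c
          z)) := by
  by_cases hs : extraSq z = 0
  · have h0 : extraCoord z 0 = 0 ∧ extraCoord z 1 = 0 := by
      unfold extraSq at hs
      constructor <;> nlinarith [sq_nonneg (extraCoord z 0), sq_nonneg (extraCoord z 1)]
    simp [hs, angleForm, h0.1, h0.2]
  have hs' : (extraSq z : ℂ) ≠ 0 := by exact_mod_cast hs
  set Ω := extForm g h D c z with hΩ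
  set θ : OpForms 2 (2 * n + 2) := I • opForm (dualForm (angleDual z)) with hθ
  have h1 : topTrace 2 _ (opForm (radialForm h κ c z) * (Ω + θ * opMat (extDefect g h D c z)) ^ K *
      opForm (pullback 2 T c z)) = 0 := by
    have h2 : pull (transvect (angleDual z) (rotVec z)) (radialForm h κ c z) = radialForm h κ c
      z := by
      rw [radialForm, map_smul]
      exact congrArg _ (pull_transvect_dScalar _ (fderiv_chartRadius_rotVec h hz))
    rw [hθ, hΩ, ← hg.pullOp_extForm hD hz, ← h2, ← pull_transvect_pullback T (angleDual z),
      ← pullOp_opForm, ← pullOp_opForm, ← map_pow, ← map_mul (pullOp _), ← map_mul (pullOp _),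
      topTrace_apply, formTrace_pullOp, topCoeff_pull, det_transvect, angleDual_rotVec hs]
    simp
  obtain ⟨v, hv⟩ : ∃ v, dualForm (angleDual z) = ι ℂ v := ⟨_, (ι_eq_sum_dz _).symm⟩
  have h3 : Ω * θ = -(θ * Ω) := by
    rw [hΩ, hθ, hv, extForm, (hg.isInvMat_extSymbol hD).symD_eq_sum hz, sum_mul,
      mul_sum, ← sum_neg_distrib]
    refine sum_congr rfl fun l _ => ?_
    have h4 := opDz_mul_ι (N := 2) l v
    rw [opDz] at h4
    rw [mul_assoc, ← ((commute_opForm_opMat _ _).smul_left I).eq, ← mul_assoc, mul_smul_comm,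
      h4, smul_neg, neg_mul, smul_mul_assoc, smul_mul_assoc, mul_assoc, ← smul_mul_assoc]
  have h5 : θ * θ = 0 := by
    rw [hθ, hv, smul_mul_assoc, mul_smul_comm, ← map_mul opForm, ι_sq_zero]; simp
  rw [add_pow_of_anticomm h3 ((commute_opForm_opMat _ _).smul_left _) h5, mul_add, add_mul, map_add,
    hθ, dualForm_angleDual] at h1
  rw [eq_neg_of_add_eq_zero_left h1]
  simp only [map_smul, smul_mul_assoc, mul_smul_comm, smul_eq_mul, map_mul, mul_assoc]
  field_simp

end Rotation

/-! ### The regularized angular form -/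

theorem extD_mul_mul_mul {𝒜 : Type*} [NormedRing 𝒜] [NormedAlgebra ℝ 𝒜] {d : ℕ} {e : Fin d → 𝒜}
    {F β W T : (Fin d → ℝ) → 𝒜} {z : Fin d → ℝ}
    (hF : ∀ l, e l * F z = (-1 : ℝ) • (F z * e l)) (hβ : ∀ l, e l * β z = (-1 : ℝ) • (β z * e l))
    (hW : ∀ l, e l * W z = (-1 : ℝ) • (W z * e l)) (hF' : DifferentiableAt ℝ F z)
    (hβ' : DifferentiableAt ℝ β z) (hW' : DifferentiableAt ℝ W z) (hT' : DifferentiableAt ℝ T z)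
    (hF0 : extD e F z = 0) (hT0 : extD e T z = 0) :
    extD e (fun z => F z * (β z * (W z * T z))) z
      = F z * β z * extD e W z * T z - F z * extD e β z * W z * T z := by
  rw [extD_mul hF' (hβ'.fun_mul (hW'.fun_mul hT')) hF,
    extD_mul hβ' (hW'.fun_mul hT') hβ, extD_mul hW' hT' hW, hF0, hT0]
  simp only [neg_smul, one_smul, mul_zero, smul_zero, add_zero, mul_add, mul_neg, mul_assoc,
    zero_mul]
  abel

section Regularization

variable {z : Coord n 2} {t : ℝ}

/-- The function `t² / (1 + t² s)` of the square `s` of the length of the extra coordinates. -/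
def cutoff (t : ℝ) (z : Coord n 2) : ℝ := t ^ 2 * (1 + t ^ 2 * extraSq z)⁻¹

/-- The function `2 t² / (1 + t² s)²`. -/
def bump (t : ℝ) (z : Coord n 2) : ℝ := 2 * t ^ 2 * ((1 + t ^ 2 * extraSq z) ^ 2)⁻¹

theorem one_add_extraSq_pos (t : ℝ) (z : Coord n 2) : 0 < 1 + t ^ 2 * extraSq z := by
  unfold extraSq
  positivity

/-- The regularization of the form `(t dτ - τ dt) / (t² + τ²)`. -/
def regAngle (t : ℝ) (z : Coord n 2) : Forms (2 * n + 2) := (cutoff t z : ℂ) • angleForm z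

theorem hasFDerivAt_extraCoord (j : Fin 2) : HasFDerivAt (fun z : Coord n 2 => extraCoord z j)
    (proj (R := ℝ) (φ := fun _ => ℝ) (natAdd (2 * n) j)) z :=
  (proj (φ := fun _ => ℝ) (natAdd (2 * n) j)).hasFDerivAt

theorem dScalar_extraCoord (j : Fin 2) :
    dScalar (fun z : Coord n 2 => extraCoord z j) z = dz (natAdd (2 * n) j) := by
  rw [dScalar, (hasFDerivAt_extraCoord j).fderiv]
  exact sum_single_smul_dz _

theorem opForm_regAngle (t : ℝ) (z : Coord n 2) : (opForm (regAngle t z) : OpForms N _)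
    = (cutoff t z * extraCoord z 0) • opForm (dz (natAdd (2 * n) 1))
      + (cutoff t z * extraCoord z 1) • opForm (-dz (natAdd (2 * n) 0)) := by
  rw [regAngle, angleForm, sub_eq_add_neg, ← smul_neg, smul_add, smul_smul, smul_smul, map_add,
    map_smul, map_smul, ← ofReal_mul, ← ofReal_mul, coe_smul, coe_smul]

theorem contDiff_cutoff_mul (t : ℝ) (j : Fin 2) :
    ContDiff ℝ ∞ fun z : Coord n 2 => cutoff t z * extraCoord z j := by
  have h1 : ∀ j, ContDiff ℝ ∞ fun z : Coord n 2 => extraCoord z j := fun j => contDiff_apply ℝ ℝ _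
  exact (contDiff_const.mul ((contDiff_const.add (contDiff_const.mul
    (((h1 0).pow 2).add ((h1 1).pow 2)))).inv fun z => (one_add_extraSq_pos t z).ne')).mul (h1 j)

theorem contDiff_opForm_regAngle (t : ℝ) : ContDiff ℝ ∞
    fun z : Coord n 2 => (opForm (regAngle t z) : OpForms N (2 * n + 2)) := by
  simp only [opForm_regAngle]
  exact ((contDiff_cutoff_mul t 0).fun_smul contDiff_const).add
    ((contDiff_cutoff_mul t 1).fun_smul contDiff_const)

theorem hasFDerivAt_cutoff_mul (t : ℝ) (j : Fin 2) : HasFDerivAt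
    (fun z => cutoff t z * extraCoord z j)
    (cutoff t z • proj (R := ℝ) (φ := fun _ => ℝ) (natAdd (2 * n) j)
      + extraCoord z j • ((-(2 * cutoff t z ^ 2)) •
      (extraCoord z 0 • proj (R := ℝ) (φ := fun _ => ℝ) (natAdd (2 * n) 0)
      + extraCoord z 1 • proj (R := ℝ) (φ := fun _ => ℝ) (natAdd (2 * n) 1)))) z := by
  have h1 := ((hasFDerivAt_extraCoord 0).pow 2).fun_add ((hasFDerivAt_extraCoord (z := z) 1).pow 2)
  have h2 := ((hasDerivAt_inv (one_add_extraSq_pos t z).ne').comp_hasFDerivAt z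
    ((h1.const_mul (t ^ 2)).const_add 1)).const_mul (t ^ 2)
  refine (h2.fun_mul (hasFDerivAt_extraCoord j)).congr_fderiv (ContinuousLinearMap.ext fun v => ?_)
  have := (one_add_extraSq_pos t z).ne'
  simp [cutoff]
  field_simp
  simp only [extraSq]
  ring

theorem dScalar_cutoff_mul (t : ℝ) (j : Fin 2) : dScalar (fun z => cutoff t z * extraCoord z j) z
    = (cutoff t z : ℂ) • dz (natAdd (2 * n) j) + (extraCoord z j : ℂ) • (-(2 * (cutoff t z :
    ℂ) ^ 2)) • ((extraCoord z 0 : ℂ) • dz (natAdd (2 * n) 0) + (extraCoord z 1 : ℂ) •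
        dz (natAdd (2 * n) 1)) := by
  rw [dScalar, (hasFDerivAt_cutoff_mul t j).fderiv]
  simp only [← sum_single_smul_dz (natAdd (2 * n) _), smul_sum, ← sum_add_distrib,
    smul_smul, ← add_smul]
  refine sum_congr rfl fun l _ => ?_
  congr 1
  simp
  push_cast
  ring

theorem extD_regAngle (t : ℝ) (z : Coord n 2) : extD (opDz N _) (fun z => opForm (regAngle t z)) z
      = opForm ((bump t z : ℂ) • (dz (natAdd (2 * n) 0) * dz (natAdd (2 * n) 1))) := by
  have hd : ∀ i u, DifferentiableAt ℝ
      (fun z => (cutoff t z * extraCoord z i) • (opForm u : OpForms N (2 * n + 2))) z := fun i u =>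
    (hasFDerivAt_cutoff_mul t i).differentiableAt.smul_const _
  have h1 : ∀ i u, extD (opDz N (2 * n + 2)) (fun z => (cutoff t z * extraCoord z i) • opForm u) z
      = opForm (dScalar (fun z => cutoff t z * extraCoord z i) z * u) := fun i u => by
    have h2 := extD_smul (e := opDz N (2 * n + 2)) (X := fun _ => opForm u) (z := z)
      (f := fun z => cutoff t z * extraCoord z i)
      (hasFDerivAt_cutoff_mul t i).differentiableAt (differentiableAt_const _)
    rw [h2, ← opForm_dScalar (hasFDerivAt_cutoff_mul t i).differentiableAt, map_mul]
    refine (congrArg _ ?_).trans (add_zero _); simp [extD]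
  have h0 : ∀ l, (dz l * dz l : Forms (2 * n + 2)) = 0 := fun l => ι_sq_zero _
  simp only [opForm_regAngle]
  rw [extD_add (hd 0 _) (hd 1 _), h1, h1, ← map_add, dScalar_cutoff_mul, dScalar_cutoff_mul]
  refine congrArg _ ?_
  have := Complex.ofReal_ne_zero.2 (one_add_extraSq_pos t z).ne'
  simp only [add_mul, mul_neg, smul_mul_assoc, h0, smul_zero, smul_add, add_zero, zero_add,
    dz_mul_dz (natAdd (2 * n) 1) (natAdd (2 * n) 0), bump, cutoff]
  match_scalars
  field_simp
  unfold extraSq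
  push_cast
  ring

theorem isInvForm_regAngle (N : ℕ) (t : ℝ) : IsInvForm (N := N) g (coneDomain (n := n) (M := M) 2)
    fun _ z => opForm (regAngle t z) := by
  refine .scalar (fun _ => (contDiff_opForm_regAngle t).contDiffOn) fun {m c c' z} hz hz' => ?_
  have h2 := fun j => by
    refine (congrArg _ (dScalar_extraCoord j).symm).trans ((pull_dScalar (hasFDerivAt_cotrans hz)
      (hasFDerivAt_extraCoord j).differentiableAt).trans ((dScalar_congr ?_).trans
      (dScalar_extraCoord j)))
    exact Eventually.of_forall fun y => congrFun (extraCoord_cotrans ..) j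
  rw [regAngle, regAngle, angleForm, angleForm, map_smul, map_sub, map_smul, map_smul, h2, h2]
  simp only [cutoff, extraSq, (extraCoord_cotrans ..)]

theorem IsWeight.mul_regAngle {f s : M → Coord n 2 → Forms (2 * n + 2)} (hw : IsWeight N g f s) (t :
    ℝ) : IsWeight N g (fun c z => f c z * regAngle t z) s where
  left := by simpa only [map_mul] using hw.left.mul (isInvForm_regAngle N t)
  right := hw.right
  supported := by simpa only [map_mul] using hw.supported.mul_right

theorem total_congr {G G' : M → Coord n q → ℂ}
    (h : ∀ c z, baseCoord z ∈ chartDomain c → G c z = G' c z) :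
    (cotangentLift q g).total G = (cotangentLift q g).total G' := by
  rw [ChartLift.total_eq_sum, ChartLift.total_eq_sum]
  exact sum_congr rfl fun c _ => setIntegral_congr_fun ChartLift.isOpen_domain.measurableSet
    fun z hz => congrArg _ (h c z hz)

theorem total_sub {G G' : M → Coord n q → ℂ} (hG : (cotangentLift q g).HasTotal G)
    (hG' : (cotangentLift q g).HasTotal G') : (cotangentLift q g).total (fun c z => G c z - G' c z)
      = (cotangentLift q g).total G - (cotangentLift q g).total G' := by
  simp only [ChartLift.total_eq_sum, ← Finset.sum_sub_distrib]
  refine sum_congr rfl fun c _ => ?_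
  rw [← integral_sub (hG c) (hG' c)]
  simp only [mul_sub]

variable (h D g) in
def extForm' : M → Coord n 2 → OpForms 2 (2 * n + 2) :=
  symD' (inChart h (extSymbol g D)) fun c z => Ring.inverse (inChart h (extSymbol g D) c z)

variable (h D g) in
/-- The form `E ((dP P⁻¹)ᵏ + (P⁻¹ dP)ᵏ)`. -/
def cornerForm (k : ℕ) (c : M) (z : Coord n 2) : OpForms 2 (2 * n + 2) :=
  opMat cornerMat * (extForm' g h D c z ^ k + extForm g h D c z ^ k)

theorem isInvForm_cornerMat (g : Diffeo n M) :
    IsInvForm (N := 2) g (coneDomain (n := n) (M := M) 2) fun _ _ => opMat cornerMat :=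
  .opMat_of (fun _ _ _ => contDiffOn_const) fun _ _ => (cornerMat_map _).symm

theorem IsIsometry.isInvForm_cornerForm (hg : IsIsometry h g) (hD : D.IsElliptic g) (k : ℕ) :
    IsInvForm g (coneDomain 2) (cornerForm g h D k) :=
  (isInvForm_cornerMat g).mul (((hg.isInvMat_extSymbol hD).isInvForm_symD'.pow k).add
    ((hg.isInvMat_extSymbol hD).isInvForm_symD.pow k))

theorem IsIsometry.total_cutoff (hg : IsIsometry h g) (hD : D.IsElliptic g) (hκ : ContDiff ℝ ∞ κ)
    (hκ0 : ∀ x, x ∉ Icc 1 2 → κ x = 0) (hT : T.IsSmooth) (hTg : T.IsInvariant g) (t : ℝ) (j : ℕ) :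
    (cotangentLift 2 g).total (fun c z => ((cutoff t z * extraSq z : ℝ) : ℂ) * topTrace 2 _
        (opForm (radialForm h κ c z) * extForm g h D c z ^ (2 * j + 1) * opForm (pullback 2 T c z)))
      = I * (2 * j + 1 : ℕ) * (totalTrace g (fun c z => radialForm h κ c z * regAngle t z)
          (pullback 2 T) (fun c z => opMat cornerMat * extForm' g h D c z ^ (2 * j))
        - totalTrace g (fun c z => radialForm h κ c z * regAngle t z)
          (pullback 2 T) fun c z => opMat cornerMat * extForm g h D c z ^ (2 * j)) := by
  have hP := hg.isInvMat_extSymbol hD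
  have hw0 := hg.isWeight_radialForm (q := 2) 2 hκ hκ0 hT hTg
  have hw := hw0.mul_regAngle t
  have hE := isInvForm_cornerMat g
  have hQ : IsInvForm g (coneDomain 2) fun c z => opMat (Ring.inverse (inChart h
    (extSymbol g D) c z) * cornerMat * inChart h (extSymbol g D) c z) := by
    simpa only [map_mul] using (hP.isInvForm_inv.mul hE).mul hP.isInvForm
  have hd : IsInvForm g (coneDomain 2) fun c z => opMat (extDefect g h D c z) := by
    simpa only [extDefect, map_sub, neg_one_smul, ← sub_eq_add_neg] using hQ.add (hE.smul (-1))
  have h1 := hw.trace_altSum hP hd j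
  have h2 := hw.totalTrace_add (hd.mul (hP.isInvForm_symD.pow (2 * j)))
    (hE.mul (hP.isInvForm_symD.pow (2 * j)))
  have h3 : ∀ c z, (opMat (extDefect g h D c z) + opMat cornerMat : OpForms 2 (2 * n + 2)) = opMat
      (Ring.inverse (inChart h (extSymbol g D) c z) * cornerMat * inChart h (extSymbol g D) c z) :=
    fun c z => by rw [← map_add, extDefect, sub_add_cancel]
  simp only [← add_mul, h3] at h2
  rw [← hw.trace_conj hP cornerMat_map] at h2
  rw [extForm', extForm, h2, add_sub_cancel_right, mul_assoc, ← h1, ← totalTrace_smul]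
  refine total_congr fun c z hz => ?_
  by_cases hz' : z ∈ coneDomain 2 c
  · have h3 := hg.topTrace_extForm_pow hD hz' κ T (2 * j + 1)
    rw [ofReal_mul, mul_assoc]
    refine (congrArg _ h3).trans ?_
    simp only [regAngle, mul_smul_comm, smul_mul_assoc, map_smul, smul_eq_mul]
    exact mul_left_comm _ _ _
  · have h0 := hw0.supported.zero_off c z hz hz'
    simp only [map_mul, h0, zero_mul, map_zero, mul_zero]

theorem opDz_mul_radialForm (h : Metric n M) (κ : ℝ → ℝ) (c : M) (z : Coord n 2) (l : Fin
    (2 * n + 2)) : opDz N _ l * opForm (radialForm h κ c z)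
      = (-1 : ℝ) • (opForm (radialForm h κ c z) * opDz N _ l) := by
  obtain ⟨v, hv⟩ := radialForm_eq_ι h κ c z
  rw [hv, opDz_mul_ι]
  exact (neg_one_smul ℝ _).symm

theorem opDz_mul_regAngle (t : ℝ) (z : Coord n 2) (l : Fin (2 * n + 2)) :
    opDz N _ l * opForm (regAngle t z) = (-1 : ℝ) • (opForm (regAngle t z) * opDz N _ l) := by
  rw [regAngle, angleForm, dz, dz, ← map_smul, ← map_smul, ← map_sub, ← map_smul, opDz_mul_ι]
  exact (neg_one_smul ℝ _).symm

theorem IsIsometry.extD_cornerForm (hg : IsIsometry h g) (hD : D.IsElliptic g) (hz :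
    z ∈ coneDomain 2 c)
    (k : ℕ) : (∀ l, opDz 2 _ l * cornerForm g h D (2 * k + 1) c z
        = (-1 : ℝ) • (cornerForm g h D (2 * k + 1) c z * opDz 2 _ l)) ∧
      extD (opDz 2 _) (cornerForm g h D (2 * k + 1) c) z
        = opMat cornerMat * extForm' g h D c z ^ (2 * (k + 1))
          - opMat cornerMat * extForm g h D c z ^ (2 * (k + 1)) := by
  have hP := hg.isInvMat_extSymbol hD
  have hp := hP.isInvPair c
  have ho : Odd (2 * k + 1) := ⟨k, rfl⟩
  have hodd : ∀ {x e : OpForms 2 (2 * n + 2)}, e * x = (-1 : ℝ) • (x * e) →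
      e * x ^ (2 * k + 1) = -(x ^ (2 * k + 1) * e) := fun {x e} hx => by
    have h1 : x * e = -(e * x) := by rw [hx, neg_smul, neg_neg]; exact (one_smul ℝ _).symm
    rw [pow_mul_of_anticomm h1, ho.neg_one_pow, neg_one_mul, neg_neg]
  have hs : ∀ {x : (Coord n 2) → OpForms 2 (2 * n + 2)},
      SmoothOn x (coneDomain 2 c) → DifferentiableAt ℝ (fun z => x z ^ (2 * k + 1)) z :=
    fun hx => (hx.pow _).diffAt hp.isOpen hz
  have ha := hp.contDiffOn_logD'
  have hb := hp.contDiffOn_logD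
  constructor
  · intro l
    rw [cornerForm, ← mul_assoc, opDz, (commute_opForm_opMat _ _).eq, mul_assoc, mul_add,
      mul_assoc, add_mul]
    refine (congrArg _ (congrArg₂ (· + ·) (hodd (hp.mul_logD' hz l)) (hodd
    (hp.mul_logD hz l)))).trans ?_
    simp only [neg_smul, ← neg_add, mul_neg]; exact congrArg _ (one_smul ℝ _).symm
  · have h1 := (extD_pow hp.isOpen ha hz (hp.mul_logD' hz)
      ((hp.extD_logD' hz).trans (one_smul ℝ _).symm) k).2
    have h2 := (extD_pow hp.isOpen hb hz (s := -1) (hp.mul_logD hz)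
      ((hp.extD_logD hz).trans (neg_one_smul ℝ _).symm) k).2
    have h3 := extD_const_mul (e := opDz 2 (2 * n + 2)) (opMat cornerMat)
      (fun l => commute_opForm_opMat _ _) ((hs ha).fun_add (hs hb))
    refine h3.trans ?_; rw [extD_add (hs ha) (hs hb), h1, h2, ← mul_sub, sub_eq_add_neg]
    exact congrArg _ (congrArg₂ (· + ·) (one_smul ℝ _) (neg_one_smul ℝ _))

theorem IsIsometry.total_cutoff_eq (hg : IsIsometry h g) (hD : D.IsElliptic g) (hκ : ContDiff ℝ ∞ κ)
    (hκ0 : ∀ x, x ∉ Icc 1 2 → κ x = 0) (hT : T.IsSmooth) (hT0 : T.IsClosed) (hTg : T.IsInvariant g)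
    (t : ℝ) (j : ℕ) :
    (cotangentLift 2 g).total (fun c z => ((cutoff t z * extraSq z : ℝ) : ℂ) * topTrace 2 _
        (opForm (radialForm h κ c z) * extForm g h D c z ^ (2 * (j + 1) + 1) *
          opForm (pullback 2 T c z)))
      = I * (2 * (j + 1) + 1 : ℕ) * (cotangentLift 2 g).total fun c z => (bump t z : ℂ) *
        topTrace 2 _ (opForm (radialForm h κ c z * (dz (natAdd (2 * n) 0) *
          dz (natAdd (2 * n) 1))) * cornerForm g h D (2 * j + 1) c z *
          opForm (pullback 2 T c z)) := by
  have hP := hg.isInvMat_extSymbol (h := h) hD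
  have hw0 := hg.isWeight_radialForm (q := 2) 2 hκ hκ0 hT hTg
  have hw := hw0.mul_regAngle t
  have hE := isInvForm_cornerMat g
  have hX : IsInvForm g (coneDomain 2) fun c z => opMat cornerMat *
      extForm g h D c z ^ (2 * (j + 1)) := hE.mul (hP.isInvForm_symD.pow (2 * (j + 1)))
  have hX' : IsInvForm g (coneDomain 2) fun c z => opMat cornerMat *
      extForm' g h D c z ^ (2 * (j + 1)) := hE.mul (hP.isInvForm_symD'.pow (2 * (j + 1)))
  have hW := hg.isInvForm_cornerForm (h := h) hD (2 * j + 1)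
  rw [hg.total_cutoff hD hκ hκ0 hT hTg]
  congr 1
  have h1 := total_extD_eq_zero isInvDomain_cone (hw0.left.mul ((isInvForm_regAngle 2 t).mul
    (hW.mul hw0.right))) hw0.supported.mul_right
  have h2 := hw.hasTotal hX'
  have h3 := hw.hasTotal hX
  have h4 := (hw0.supported.mul_right (X := fun c z => extD (opDz 2 _) (fun z => opForm
    (regAngle t z)) z * (cornerForm g h D (2 * j + 1) c z * opForm (pullback 2 T c z)))).hasTotal
    (isInvDomain_cone (g := g))
    fun c => (hw0.left.smooth c).continuousOn.mul ((contDiffOn_extD isOpen_univ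
      (contDiff_opForm_regAngle t).contDiffOn).continuousOn.mono (subset_univ _) |>.mul
      ((hW.smooth c).continuousOn.mul (hw0.right.smooth c).continuousOn))
  have h23 := fun c => ((h2 c).sub (h3 c)).congr_fun (fun z _ => (mul_sub _ _ _).symm)
    ChartLift.isOpen_domain.measurableSet
  rw [totalTrace, totalTrace, ← total_sub h2 h3, ← sub_eq_zero, ← h1]
  refine Eq.trans (congrArg _ (total_congr fun c z _ => ?_)) ((total_sub h23 h4).symm.trans
    (total_congr fun c z hz => ?_))
  · rw [extD_regAngle]
    simp only [map_mul, map_smul, mul_smul_comm, smul_mul_assoc, smul_eq_mul, mul_assoc]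
  · by_cases hz' : z ∈ coneDomain 2 c
    · have hd : ∀ {G : M → Coord n 2 → OpForms 2 (2 * n + 2)},
          IsInvForm g (coneDomain 2) G → DifferentiableAt ℝ (G c) z := fun hG =>
        ((hG.smooth c).contDiffAt ((isOpen_coneDomain 2 c).mem_nhds hz')).differentiableAt (by simp)
      obtain ⟨h5, h6⟩ := hg.extD_cornerForm (h := h) hD hz' j
      rw [extD_mul_mul_mul (opDz_mul_radialForm h κ c z) (opDz_mul_regAngle t z) h5 (hd hw0.left)
        (hd (isInvForm_regAngle 2 t)) (hd hW) (hd hw0.right) (extD_radialForm h hκ hz')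
        (hT0.extD_pullback hT hz), h6]
      simp only [map_mul, mul_sub, sub_mul, map_sub, mul_assoc]
    · have h0 := hw0.supported.zero_off c z hz hz'
      have h7 : (fun z => (opForm (radialForm h κ c z) : OpForms 2 (2 * n + 2)) * (opForm
    (regAngle t z) *
          (cornerForm g h D (2 * j + 1) c z * opForm (pullback 2 T c z)))) =ᶠ[𝓝 z] fun _ => 0 := by
        have h8 : chartRadius h c z < 1 := lt_of_not_ge fun h => hz'
          (mem_coneDomain_of_chartRadius_pos hz (one_pos.trans_le h))
        filter_upwards [((continuousOn_chartRadius h c).continuousAt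
          ((isOpen_baseDomain c).mem_nhds hz)).eventually_lt continuousAt_const h8] with y hy
        rw [radialForm, hκ0 _ fun h => hy.not_ge h.1, ofReal_zero, zero_smul, map_zero, zero_mul]
      rw [extD_congr h7]; simp [extD, h0, map_mul]

end Regularization

/-! ### Concentration of the regularized form -/

section Concentration

theorem integral_inv_one_add_normSq_sq : ∫ w : ℂ, Real.pi⁻¹ * ((1 + ‖w‖ ^ 2) ^ 2)⁻¹ = 1 := by
  have h1 : ∀ x : ℝ, HasDerivAt (fun x => -(2 * (1 + x ^ 2))⁻¹) (x * ((1 + x ^ 2) ^ 2)⁻¹) x := by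
    intro x
    have h2 := (((hasDerivAt_pow 2 x).const_add 1).const_mul 2).fun_inv (by positivity)
    refine h2.fun_neg.congr_deriv ?_
    field_simp; ring
  have h3 : ∫ x in Ioi 0, x * ((1 + x ^ 2) ^ 2)⁻¹ = 0 - -(2 * (1 + (0 : ℝ) ^ 2))⁻¹ := by
    refine integral_Ioi_of_hasDerivAt_of_nonneg' (fun x _ => h1 x) (fun x hx => ?_) ?_
    · have : 0 < x := hx
      positivity
    · rw [← neg_zero]; refine (tendsto_inv_atTop_zero.comp ?_).neg
      exact (tendsto_atTop_add_const_left _ _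
    (tendsto_pow_atTop two_ne_zero)).const_mul_atTop two_pos
  rw [integral_const_mul, integral_fun_norm_addHaar (μ := volume) fun x => ((1 + x ^ 2) ^ 2)⁻¹]
  have h4 : (volume : Measure ℂ).real (ball 0 1) = Real.pi := by
    simp [Measure.real, Complex.volume_ball]
  rw [h4, Complex.finrank_real_complex]
  simp only [Nat.add_one_sub_one, pow_one, smul_eq_mul, h3]
  simp
  have := Real.pi_ne_zero
  field_simp

variable {z : Coord n 2}

/-- The inclusion of the zero section in the direction of the extra coordinates. -/
def extraZero (n : ℕ) : (Coord n 0) →L[ℝ] (Coord n 2) :=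
  (snocZero (2 * n + 1)).comp (snocZero (2 * n))

/-- Coordinates with the extra coordinates combined into a complex number. -/
def joinExtra (p : (Fin (2 * n) → ℝ) × ℂ) : Coord n 2 := Fin.append p.1 ![p.2.re, p.2.im]

theorem measurePreserving_joinExtra : MeasurePreserving (joinExtra (n := n)) := by
  have h1 := (volume_measurePreserving_piCongrLeft (fun _ => ℝ) finSumFinEquiv).comp
    ((volume_measurePreserving_sumPiEquivProdPi_symm (fun _ : Fin (2 * n) ⊕ Fin 2 => ℝ)).comp
      ((MeasurePreserving.id volume).prod Complex.volume_preserving_equiv_pi))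
  refine (congrArg (fun F => MeasurePreserving F volume volume) (funext fun p => ?_)).mp h1
  refine funext fun l => ?_
  obtain ⟨l, rfl⟩ := finSumFinEquiv.surjective l
  simp
  erw [MeasurableEquiv.piCongrLeft_apply_apply]
  rcases l with l | l
  · simp [joinExtra]; rfl
  · simp [joinExtra]; rfl

theorem continuous_joinExtra : Continuous (joinExtra (n := n)) := by
  refine continuous_pi fun l => ?_
  refine Fin.addCases (fun l => ?_) (fun l => ?_) l
  · simp only [joinExtra, Fin.append_left]; fun_prop
  · simp only [joinExtra, Fin.append_right]
    fin_cases l <;> simp <;> fun_prop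

theorem extraCoord_joinExtra (p : (Fin (2 * n) → ℝ) × ℂ) :
    extraCoord (joinExtra p) = ![p.2.re, p.2.im] :=
  funext fun _ => Fin.append_right _ _ _

theorem joinExtra_zero (y : Fin (2 * n) → ℝ) : joinExtra (y, 0) = extraZero n y := by
  refine funext fun l => ?_
  refine Fin.lastCases ?_ (fun l => Fin.lastCases ?_ (fun l => ?_) l) l
  · exact (Fin.append_right _ _ 1).trans (snocZero_last (d := 2 * n + 1) _).symm
  · refine (Fin.append_right _ _ 0).trans ?_
    exact ((snocZero_castSucc (d := 2 * n + 1) _ _).trans (snocZero_last (d := 2 * n) _)).symm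
  · refine (Fin.append_left _ _ l).trans ?_
    exact ((snocZero_castSucc (d := 2 * n + 1) _ _).trans (snocZero_castSucc (d := 2 * n) _ _)).symm

theorem tendsto_integral_bump {f : (Coord n 2) → ℂ} (hf : Continuous f)
    (hc : HasCompactSupport f) : Tendsto (fun t => ∫ z, (bump t z : ℂ) * f z) atTop
      (𝓝 (2 * Real.pi * ∫ y, f (extraZero n y))) := by
  have hinj : Injective (joinExtra) := fun p p' h => by
    refine Prod.ext (funext fun l => ?_) (Complex.ext ?_ ?_)
    · simpa [joinExtra] using congrFun h (Fin.castAdd 2 l)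
    · simpa [joinExtra] using congrFun h (natAdd (2 * n) 0)
    · simpa [joinExtra] using congrFun h (natAdd (2 * n) 1)
  have hemb := continuous_joinExtra.measurableEmbedding hinj
  have hp := measurePreserving_joinExtra (n := n)
  have hbc : ∀ t, Continuous fun z => (bump t z : ℂ) := fun t => by
    have h1 : ∀ j, Continuous fun z : Coord n 2 => extraCoord z j := fun j => continuous_apply _
    refine continuous_ofReal.comp (continuous_const.mul (Continuous.inv₀ ((continuous_const.add
      (continuous_const.mul (((h1 0).pow 2).add ((h1 1).pow 2)))).pow 2) fun z =>
      (pow_pos (one_add_extraSq_pos t z) 2).ne'))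
  have hi : Integrable fun p : (Fin (2 * n) → ℝ) × ℂ => f (joinExtra p) :=
    (hp.integrable_comp_emb hemb).2 (hf.integrable_of_hasCompactSupport hc)
  have hib : ∀ t, Integrable fun p : (Fin (2 * n) → ℝ) × ℂ => (bump t (joinExtra p) : ℂ) * f
    (joinExtra p) :=
    fun t => (hp.integrable_comp_emb hemb).2
      (((hbc t).mul hf).integrable_of_hasCompactSupport hc.mul_left)
  have hg : Continuous fun w => ∫ y : Fin (2 * n) → ℝ, f (joinExtra (y, w)) := by
    have hk : IsCompact ((fun z l => z (Fin.castAdd 2 l)) '' tsupport f) :=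
      hc.isCompact.image (continuous_pi fun l => continuous_apply _)
    refine continuousOn_univ.1 (continuousOn_integral_of_compact_support hk
      (hf.comp (continuous_joinExtra.comp continuous_swap)).continuousOn fun w y _ hy => ?_)
    refine image_eq_zero_of_notMem_tsupport fun h => hy ⟨_, h, funext fun l => ?_⟩
    exact Fin.append_left _ _ l
  have key := tendsto_integral_comp_smul_smul_of_integrable
    (φ := fun w => Real.pi⁻¹ * ((1 + ‖w‖ ^ 2) ^ 2)⁻¹) (fun w => by positivity)
    integral_inv_one_add_normSq_sq ?_ hi.integral_prod_right hg.continuousAt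
  · have h2 := key.const_mul (2 * Real.pi : ℂ)
    simp only [joinExtra_zero] at h2
    refine h2.congr fun t => ?_
    rw [← hp.integral_comp hemb]; refine Eq.trans ?_ (integral_prod_symm _ (hib t)).symm
    rw [← integral_const_mul]; refine integral_congr_ae (Eventually.of_forall fun w => ?_)
    simp only [Complex.finrank_real_complex, real_smul]; rw [← mul_assoc, ← integral_const_mul]
    refine integral_congr_ae (Eventually.of_forall fun y => ?_)
    simp only; congr 1; rw [bump, extraSq, extraCoord_joinExtra]
    have h3 : ‖t * w‖ ^ 2 = t ^ 2 * (w.re ^ 2 + w.im ^ 2) := by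
      rw [norm_mul, mul_pow, norm_real, Real.norm_eq_abs, sq_abs, Complex.sq_norm,
        Complex.normSq_apply]
      ring
    rw [h3]
    have := Real.pi_ne_zero
    simp only [Matrix.cons_val_zero, Matrix.cons_val_one]; norm_cast; field_simp
  · have h1 := (tendsto_inv_atTop_zero.comp (tendsto_atTop_add_const_left _ 1
      ((tendsto_pow_atTop two_ne_zero).comp (tendsto_norm_cobounded_atTop (E := ℂ))))).const_mul
        Real.pi⁻¹
    rw [mul_zero] at h1; refine squeeze_zero (fun w => by positivity) (fun w => ?_) h1
    simp; rw [mul_left_comm]; refine mul_le_mul_of_nonneg_left ?_ (inv_nonneg.2 Real.pi_pos.le)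
    rw [← div_eq_mul_inv, div_le_iff₀ (by positivity)]
    field_simp; linarith

end Concentration

/-! ### Restriction to the zero section -/

section Corner

variable {d d' d'' : ℕ}

theorem pull_comp (A : (Fin d' → ℝ) →L[ℝ] (Fin d'' → ℝ)) (B : (Fin d → ℝ) →L[ℝ] (Fin d' → ℝ))
    (x : Forms d'') : pull (A.comp B) x = pull B (pull A x) := by
  have h1 : pullMat (A.comp B) = pullMat A * pullMat B := by
    ext l k; rw [Matrix.mul_apply]; simp only [pullMat, of_apply, comp_apply]
    rw [map_eq_sum_single A (B (Pi.single k 1)), Finset.sum_apply, ofReal_sum]; simp [mul_comm]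
  have h2 : (pullMat (A.comp B)).vecMulLinear
      = (pullMat B).vecMulLinear ∘ₗ (pullMat A).vecMulLinear :=
    LinearMap.ext fun v => by
      rw [h1]; exact (Matrix.vecMul_vecMul v (pullMat A) (pullMat B)).symm
  rw [pull, h2, ← map_comp_map]
  rfl

/-- The inclusion of the operators as the upper left corner. -/
def cornerL : Matrix (Fin 1) (Fin 1) BoundedOp →ₗ[ℂ] Matrix (Fin 2) (Fin 2) BoundedOp where
  toFun a := !![a 0 0, 0; 0, 0]
  map_add' a b := by ext1 i j; fin_cases i <;> fin_cases j <;> simp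
  map_smul' r a := by ext1 i j; fin_cases i <;> fin_cases j <;> simp

/-- The inclusion of the operator valued forms as the upper left corner. -/
def cornerOp (d : ℕ) : OpForms 1 d →ₗ[ℂ] OpForms 2 d := cornerL.rTensor (Forms d)

theorem formTrace_cornerOp (X : OpForms 1 d) : formTrace 2 d (cornerOp d X) = formTrace 1 d X := by
  induction X using induction_on with
  | zero => simp
  | tmul a f =>
    rw [cornerOp, rTensor_tmul, formTrace_tmul, formTrace_tmul]; congr 1
    change ∑ i, coeff ((!![a 0 0, 0; 0, 0] : Matrix (Fin 2) (Fin 2) BoundedOp) i i) 0 0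
      = ∑ i, coeff (a i i) 0 0
    rw [Fin.sum_univ_two, Fin.sum_univ_one]; simp [coeff]
  | add X Y hX hY => rw [map_add, map_add, map_add, hX, hY]

theorem cornerOp_mul_sum {ι : Type*} {K : Finset ι} {f : ι → Forms d}
    {A : ι → Matrix (Fin 1) (Fin 1) BoundedOp} {B : ι → Matrix (Fin 2) (Fin 2) BoundedOp}
    (h0 : ∀ l, B l 0 0 = A l 0 0) (h1 : ∀ l, B l 0 1 = 0) (X : OpForms 1 d) :
    cornerOp d X * ∑ l ∈ K, opForm (f l) * opMat (B l)
      = cornerOp d (X * ∑ l ∈ K, opForm (f l) * opMat (A l)) := by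
  simp only [mul_sum, map_sum]
  refine sum_congr rfl fun l _ => ?_
  rw [(commute_opForm_opMat _ _).eq,
    (commute_opForm_opMat _ _).eq, opMat_mul_opForm, opMat_mul_opForm]
  induction X using induction_on with
  | zero => simp
  | tmul a g =>
    rw [cornerOp, rTensor_tmul, tmul_mul_tmul, tmul_mul_tmul, rTensor_tmul]; congr 1
    ext1 i j
    rw [Matrix.mul_apply]
    fin_cases i <;> fin_cases j <;> simp [cornerL, h0, h1, Matrix.mul_apply]
  | add X Y hX hY => rw [map_add, add_mul, add_mul, map_add, hX, hY]

theorem cornerMat_mul_pow {ι : Type*} {K : Finset ι} {f : ι → Forms d}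
    {A : ι → Matrix (Fin 1) (Fin 1) BoundedOp} {B : ι → Matrix (Fin 2) (Fin 2) BoundedOp}
    (h0 : ∀ l, B l 0 0 = A l 0 0) (h1 : ∀ l, B l 0 1 = 0) (k : ℕ) :
    opMat cornerMat * (∑ l ∈ K, opForm (f l) * opMat (B l)) ^ k
      = cornerOp d ((∑ l ∈ K, opForm (f l) * opMat (A l)) ^ k) := by
  induction k with
  | zero =>
    rw [pow_zero, pow_zero, mul_one]; change opMat cornerMat = cornerL 1 ⊗ₜ 1; rw [opMat_apply]; rfl
  | succ k ih => rw [pow_succ, ← mul_assoc, ih, cornerOp_mul_sum h0 h1, ← pow_succ]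

end Corner

section Slice

variable {y : Coord n 0}

theorem topCoeff_extra (x : Forms (2 * n + 2)) : topCoeff (2 * n + 2) (dz (natAdd (2 * n) 0) *
    dz (natAdd (2 * n) 1) * x) = topCoeff (2 * n + 0) (pull (extraZero n) x) := by
  have h1 : ∀ {d : ℕ} x, topCoeff (d + 1) (dz (last d) * x)
      = (-1) ^ d * topCoeff d (pull (snocZero d) x) := fun {d} x => by
    rw [last_mul_pull, topCoeff_last_mul]
  rw [dz_mul_dz, neg_mul, map_neg, mul_assoc, show natAdd (2 * n) 1 = last (2 * n + 1)
    from rfl, h1, map_mul, show natAdd (2 * n) 0 = (last (2 * n)).castSucc from rfl,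
    pull_snocZero_dz_castSucc, h1, extraZero, pull_comp]
  simp [pow_succ, pow_mul]

theorem extraZero_castAdd (l : Fin (2 * n)) : extraZero n y (Fin.castAdd 2 l) = y l :=
  (snocZero_castSucc (d := 2 * n + 1) _ _).trans (snocZero_castSucc (d := 2 * n) _ _)

theorem baseCoord_extraZero (y : Coord n 0) : baseCoord (extraZero n y) = baseCoord y :=
  congrArg (toLp 2) (funext fun i => extraZero_castAdd ⟨2 * i, by omega⟩)

theorem fibreCoord_extraZero (y : Coord n 0) : fibreCoord (extraZero n y) = fibreCoord y :=
  funext fun i => extraZero_castAdd ⟨2 * i + 1, by omega⟩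

theorem extraCoord_extraZero (y : Coord n 0) : extraCoord (extraZero n y) = 0 := by
  rw [← joinExtra_zero, extraCoord_joinExtra]
  simp

theorem extraZero_mem_coneDomain : extraZero n y ∈ coneDomain 2 c ↔ y ∈ coneDomain 0 c := by
  have h0 : extraCoord y = 0 := elim _ _
  simp only [coneDomain, mem_ofPred_eq, baseCoord_extraZero, fibreCoord_extraZero,
    extraCoord_extraZero, h0]; simp

theorem chartRadius_extraZero (h : Metric n M) (c : M) (y : Coord n 0) :
    chartRadius h c (extraZero n y) = chartRadius h c y := by
  have h1 := congrArg₂ (fun b f => sqrt (covectorNormSq h (chartPoint c b) (chartCovector c b f)))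
    (baseCoord_extraZero y) (fibreCoord_extraZero y)
  simpa [chartRadius, radius, extraCoord_extraZero] using h1

theorem pull_extraZero_radialForm (hy : y ∈ coneDomain 0 c) :
    pull (extraZero n) (radialForm h κ c (extraZero n y)) = radialForm h κ c y := by
  rw [radialForm, map_smul, radialForm, chartRadius_extraZero]
  refine congrArg _ ((pull_dScalar (extraZero n).hasFDerivAt (differentiableAt_chartRadius h
    (extraZero_mem_coneDomain.2 hy))).trans ?_)
  simp only [chartRadius_extraZero]
  rfl

theorem pull_extraZero_pullback (T : TotalForm n M) (c : M) (y : Coord n 0) :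
    pull (extraZero n) (pullback 2 T c (extraZero n y)) = pullback 0 T c y := by
  rw [pullback_eq, map_sum, pullback_eq, baseCoord_extraZero]
  exact sum_congr rfl fun k _ => pull_expand (z := y) (J := .id ℝ _)
    (extraZero n).hasFDerivAt (hasFDerivAt_id _) (Eventually.of_forall baseCoord_extraZero) _

variable (h D g) in
/-- The form `a⁻¹ da` for the symbol `a` of `D`. -/
def baseForm : M → Coord n 0 → OpForms 1 (2 * n + 0) :=
  symD (inChart h (D.symbolFun g)) fun c z => Ring.inverse (inChart h (D.symbolFun g) c z)

variable (h D g) in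
def baseForm' : M → Coord n 0 → OpForms 1 (2 * n + 0) :=
  symD' (inChart h (D.symbolFun g)) fun c z => Ring.inverse (inChart h (D.symbolFun g) c z)

theorem IsIsometry.pullOp_cornerForm (hg : IsIsometry h g) (hD : D.IsElliptic g)
    (hy : y ∈ coneDomain 0 c) (k : ℕ) :
    pullOp (extraZero n) (cornerForm g h D k c (extraZero n y))
      = cornerOp _ (baseForm' g h D c y ^ k + baseForm g h D c y ^ k) := by
  have hP := hg.isInvMat_extSymbol (h := h) hD
  have ha := hg.isInvMat_symbolFun (h := h) hD
  have hz := extraZero_mem_coneDomain.2 hy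
  set a := inChart h (D.symbolFun g) c with ha'
  set P := inChart h (extSymbol g D) c with hP'
  have h1 : ∀ y, P (extraZero n y) = extMatrix (a y 0 0) 0 := fun y => by
    rw [hP', ha', hg.inChart_extSymbol, hg.inChart_symbolFun, chartRadius_extraZero,
      extraCoord_extraZero, extraComplex_eq_zero.2 rfl, mul_zero]
    exact congrArg (fun s => extMatrix (_ • s) 0) (congrArg₂ (fun b v => D.symbol g (chartPoint c b)
      (chartCov c b v)) (baseCoord_extraZero y) (congrArg (toLp 2) (fibreCoord_extraZero y)))
  have h00 : ∀ l, fderiv ℝ (fun y => P (extraZero n y) 0 0) y (Pi.single l 1)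
      = fderiv ℝ (fun y => a y 0 0) y (Pi.single l 1) := fun l => by
    simp only [h1]; rfl
  have h01 : ∀ l, fderiv ℝ (fun y => P (extraZero n y) 0 1) y (Pi.single l 1) = 0 := fun l => by
    simp [h1, extMatrix]
  have h2 : Ring.inverse (P (extraZero n y)) 0 0 = Ring.inverse (a y) 0 0 ∧
      Ring.inverse (P (extraZero n y)) 0 1 = 0 := by
    have e1 : a y 0 0 * Ring.inverse (a y) 0 0 = 1 := by
      simpa [Matrix.mul_apply] using congrFun (congrFun (ha.mul_inv c y hy) 0) 0
    have e2 : Ring.inverse (a y) 0 0 * a y 0 0 = 1 := by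
      simpa [Matrix.mul_apply] using congrFun (congrFun (ha.inv_mul c y hy) 0) 0
    have e3 := congrArg star e1
    have e4 := congrArg star e2
    rw [star_mul, star_one] at e3 e4
    rw [h1, ring_inverse_eq (y := !![Ring.inverse (a y) 0 0, 0; 0, star (Ring.inverse (a y) 0 0)])]
    · simp
    all_goals
      ext1 i j
      fin_cases i <;> fin_cases j <;> simp [extMatrix, Matrix.mul_apply, e1, e2, e3, e4]
  have h3 : pullOp (extraZero n) (extD (opDz 2 _) (fun z => opMat (P z)) (extraZero n y))
      = ∑ l, opForm (dz l) * opMat (of fun i j => fderiv ℝ (fun y => P (extraZero n y) i j) y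
        (Pi.single l 1)) := by
    have hd := hP.differentiableAt hz
    exact (pullOp_extD (extraZero n).hasFDerivAt hd).trans (extD_opMat (A := fun y => P
    (extraZero n y)) fun i j => (hd i j).comp y (extraZero n).differentiableAt)
  rw [cornerForm, map_mul, map_add, map_pow, map_pow, pullOp_opMat, mul_add, map_add]
  congr 1
  · rw [extForm', symD', logD', map_mul, h3, pullOp_opMat, sum_mul, baseForm', ha.symD'_eq_sum hy]
    simp only [mul_assoc, ← map_mul]; refine cornerMat_mul_pow (fun l => ?_) (fun l => ?_) k
    · rw [Matrix.mul_apply, Matrix.mul_apply, Fin.sum_univ_two, Fin.sum_univ_one, of_apply,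
        of_apply, of_apply, h00, h01, h2.1, zero_mul, add_zero]
    · rw [Matrix.mul_apply, Fin.sum_univ_two, of_apply, of_apply, h01, h2.2, mul_zero,
        zero_mul, add_zero]
  · rw [extForm, symD, logD, map_mul, h3, pullOp_opMat, mul_sum, baseForm, ha.symD_eq_sum hy]
    simp only [← mul_assoc, ← (commute_opForm_opMat _ _).eq]; simp only [mul_assoc, ← map_mul]
    refine cornerMat_mul_pow (fun l => ?_) (fun l => ?_) k
    · rw [Matrix.mul_apply, Matrix.mul_apply, Fin.sum_univ_two, Fin.sum_univ_one, of_apply,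
        of_apply, of_apply, h00, h2.1, h2.2, zero_mul, add_zero]
    · rw [Matrix.mul_apply, Fin.sum_univ_two, of_apply, of_apply, h01, h2.2, mul_zero,
        zero_mul, add_zero]

theorem IsIsometry.topTrace_slice (hg : IsIsometry h g) (hD : D.IsElliptic g)
    (hy : y ∈ coneDomain 0 c) (k : ℕ) :
    topTrace 2 _ (opForm (radialForm h κ c (extraZero n y) * (dz (natAdd (2 * n) 0) *
        dz (natAdd (2 * n) 1))) * cornerForm g h D k c (extraZero n y) *
        opForm (pullback 2 T c (extraZero n y)))
      = topTrace 1 _ (opForm (radialForm h κ c y) *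
    (baseForm' g h D c y ^ k + baseForm g h D c y ^ k) * opForm (pullback 0 T c y)) := by
  have h1 : ∀ f : Forms (2 * n + 2), (∃ v, f = ι ℂ v) → f * (dz (natAdd (2 * n) 0) *
      dz (natAdd (2 * n) 1)) = dz (natAdd (2 * n) 0) * dz (natAdd (2 * n) 1) * f := by
    rintro f ⟨v, rfl⟩
    have h2 : ∀ l, ι ℂ v * dz l = -(dz l * ι ℂ v) := fun l =>
      eq_neg_of_add_eq_zero_left (ι_add_mul_swap _ _)
    rw [← mul_assoc, h2, neg_mul, mul_assoc, h2, mul_neg, neg_neg, mul_assoc]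
  rw [topTrace_apply, formTrace_mul_opForm, formTrace_opForm_mul, h1 _ (radialForm_eq_ι h κ c _),
    mul_assoc, mul_assoc, topCoeff_extra, map_mul (pull _), map_mul (pull _),
    pull_extraZero_radialForm hy, pull_extraZero_pullback, ← formTrace_pullOp,
    hg.pullOp_cornerForm hD hy, formTrace_cornerOp, topTrace_apply, formTrace_mul_opForm,
    formTrace_opForm_mul, mul_assoc]

end Slice

/-! ### Limits of integrals over the cotangent bundle -/

section Limits

theorem exists_smooth_approx : ∃ κ : ℕ → ℝ → ℝ, (∀ i, ContDiff ℝ ∞ (κ i)) ∧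
    (∀ i x, x ∉ Icc 1 2 → κ i x = 0) ∧ (∀ i x, |κ i x| ≤ 1) ∧
    ∀ x, Tendsto (fun i => κ i x) atTop (𝓝 ((Ioo 1 2).indicator 1 x)) := by
  have h1 : ∀ i : ℕ, (0 : ℝ) < 1 / (i + 3) ∧ (1 : ℝ) / (i + 3) ≤ 1 / 3 := fun i =>
    ⟨by positivity, one_div_le_one_div_of_le (by norm_num) (by linarith [i.cast_nonneg (α := ℝ)])⟩
  let b : ℕ → ContDiffBump (3 / 2 : ℝ) := fun i =>
    ⟨1 / 2 - 1 / (i + 3), 1 / 2, by linarith [h1 i], by linarith [h1 i]⟩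
  refine ⟨fun i => b i, fun i => (b i).contDiff, fun i x hx => (b i).zero_of_le_dist ?_,
    fun i x => ?_, fun x => ?_⟩
  · by_contra hc
    rw [not_le, Real.dist_eq, abs_lt] at hc
    exact hx ⟨by linarith [hc.1, show (b i).rOut = 1 / 2 from rfl],
      by linarith [hc.2, show (b i).rOut = 1 / 2 from rfl]⟩
  · rw [abs_of_nonneg (b i).nonneg]; exact (b i).le_one
  · by_cases hx : x ∈ Ioo 1 2
    · rw [indicator_of_mem hx, Pi.one_apply]
      have h2 : |x - 3 / 2| < 1 / 2 := abs_lt.2 ⟨by linarith [hx.1], by linarith [hx.2]⟩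
      have h3 : Tendsto (fun i : ℕ => (1 : ℝ) / (i + 3)) atTop (𝓝 0) :=
        tendsto_const_nhds.div_atTop (tendsto_atTop_add_const_right _ _ tendsto_natCast_atTop_atTop)
      refine tendsto_const_nhds.congr' ?_
      filter_upwards [h3.eventually_lt_const (sub_pos.2 h2)] with i hi
      refine ((b i).one_of_mem_closedBall ?_).symm; rw [Metric.mem_closedBall, Real.dist_eq]
      change _ ≤ 1 / 2 - 1 / (i + 3 : ℝ); linarith
    · rw [indicator_of_notMem hx]
      refine tendsto_const_nhds.congr fun i => ((b i).zero_of_le_dist ?_).symm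
      by_contra hc
      rw [not_le, Real.dist_eq, abs_lt] at hc
      exact hx ⟨by linarith [hc.1, show (b i).rOut = 1 / 2 from rfl],
        by linarith [hc.2, show (b i).rOut = 1 / 2 from rfl]⟩

theorem tendsto_total {ι : Type*} {l : Filter ι} [l.IsCountablyGenerated]
    {G : M → Coord n q → ℂ} (hG : (cotangentLift q g).HasTotal G)
    {w : ι → M → Coord n q → ℝ} {w₀ : M → Coord n q → ℝ}
    (hw : ∀ i c, ContinuousOn (w i c) {z | baseCoord z ∈ chartDomain c})
    (hb : ∀ i c z, |w i c z| ≤ 1)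
    (hl : ∀ c, ∀ᵐ z, Tendsto (fun i => w i c z) l (𝓝 (w₀ c z))) :
    Tendsto (fun i => (cotangentLift q g).total fun c z => (w i c z : ℂ) * G c z) l
      (𝓝 ((cotangentLift q g).total fun c z => (w₀ c z : ℂ) * G c z)) := by
  have h0 : ∀ a c z, (chartPartition n M c ((cotangentLift q g).point c z) : ℂ) * (a * G c z)
      = a * ((chartPartition n M c ((cotangentLift q g).point c z) : ℂ) * G c z) := fun a c z =>
    mul_left_comm _ _ _
  simp only [ChartLift.total_eq_sum, h0]
  refine tendsto_finsetSum _ fun c _ => tendsto_integral_filter_of_dominated_convergence _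
    (Eventually.of_forall fun i => ?_)
    (Eventually.of_forall fun i => Eventually.of_forall fun z => ?_)
    (hG c).norm ?_
  · exact ((continuous_ofReal.comp_continuousOn (hw i c)).aestronglyMeasurable
      (isOpen_baseDomain c).measurableSet).mul (hG c).aestronglyMeasurable
  · rw [norm_mul, norm_real]; exact mul_le_of_le_one_left (norm_nonneg _) (hb i c z)
  · filter_upwards [ae_restrict_of_ae (hl c)] with z hz
    exact ((continuous_ofReal.tendsto _).comp hz).mul_const _

theorem sphereIntegral_eq_total (h : Metric n M) (g : Diffeo n M)
    (φ : M → Coord n q → Forms (2 * n + q)) :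
    sphereIntegral h φ = (cotangentLift q g).total fun c z =>
      (((Ioo 1 2).indicator 1 (chartRadius h c z) : ℝ) : ℂ) * topCoeff _ (dRadius h c z * φ c
        z) := by
  refine finsum_congr fun c => ?_
  refine Eq.trans ?_ (setIntegral_congr_fun (ChartLift.isOpen_domain (L := cotangentLift q g)
   ).measurableSet (f := ({z : Coord n q | baseCoord z ∈ chartDomain c}
      ∩ chartRadius h c ⁻¹' Ioo 1 2).indicator fun z =>
      (chartPartition n M c (chartPoint c (baseCoord z)) : ℂ)
      * topCoeff (2 * n + q) (dRadius h c z * φ c z)) fun z hz => ?_)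
  · rw [setIntegral_indicator (((continuousOn_chartRadius h c).isOpen_inter_preimage
      (isOpen_baseDomain c) isOpen_Ioo).measurableSet)]; congr 2; ext z
    exact ⟨fun hz => ⟨hz.1, hz.1, hz.2⟩, fun hz => ⟨hz.1, hz.2.2⟩⟩
  · have hz : baseCoord z ∈ chartDomain c := hz
    by_cases hr : chartRadius h c z ∈ Ioo 1 2
    · rw [indicator_of_mem (show z ∈ _ ∩ chartRadius h c ⁻¹' Ioo 1 2 from ⟨hz, hr⟩)]
      simp only [indicator_of_mem hr 1, Pi.one_apply, ofReal_one, one_mul]; rfl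
    · rw [indicator_of_notMem fun h => hr h.2]
      simp only [indicator_of_notMem hr 1, ofReal_zero, zero_mul, mul_zero]

theorem tendsto_totalTrace_radialForm (h : Metric n M) (hT : T.IsSmooth)
    {X : M → Coord n q → OpForms N (2 * n + q)} (hX : IsInvForm g (coneDomain q) X)
    {κ : ℕ → ℝ → ℝ} (hκ : ∀ i, ContDiff ℝ ∞ (κ i)) (hκ0 : ∀ i x, x ∉ Icc 1 2 → κ i x = 0)
    (hκ1 : ∀ i x, |κ i x| ≤ 1)
    (hκ2 : ∀ x, Tendsto (fun i => κ i x) atTop (𝓝 ((Ioo 1 2).indicator 1 x))) :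
    Tendsto (fun i => totalTrace g (radialForm h (κ i)) (pullback q T) X) atTop
      (𝓝 (sphereIntegral h fun c z => formTrace N _ (X c z) * pullback q T c z)) := by
  let G : M → Coord n q → ℂ := fun c z =>
    (((Icc 1 2).indicator 1 (chartRadius h c z) : ℝ) : ℂ) * topCoeff _ (dRadius h c z *
      (formTrace N _ (X c z) * pullback q T c z))
  have h0 : ∀ c z, topTrace N _ (opForm (dRadius h c z) * X c z * opForm (pullback q T c z))
      = topCoeff _ (dRadius h c z * (formTrace N _ (X c z) * pullback q T c z)) := fun c z => by
    rw [topTrace_apply, formTrace_mul_opForm, formTrace_opForm_mul, mul_assoc]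
  have hG : (cotangentLift q g).HasTotal G := by
    intro c
    have h1 : ContinuousOn (fun z => (chartPartition n M c ((cotangentLift q g).point c z) : ℂ) *
        topTrace N _ (opForm (dRadius h c z) * X c z * opForm (pullback q T c z)))
        (coneDomain q c) := (continuousOn_part (isInvDomain_cone) c).mul
      ((topTrace N _).continuous.comp_continuousOn
        (((contDiffOn_dScalar (isOpen_coneDomain q c) (contDiffOn_chartRadius h c)).continuousOn.mul
        (hX.smooth c).continuousOn).mul
    ((hT.contDiffOn_pullback c).continuousOn.mono fun _ hz => hz.1)))
    have hc := isCompact_cone (q := q) h (isCompact_partSupport c) (partSupport_subset c) 1 2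
    refine (((h1.mono (fun z hz => mem_coneDomain_of_chartRadius_pos (partSupport_subset c hz.1)
      (one_pos.trans_le hz.2.1))).integrableOn_compact hc).congr_fun (fun z hz => ?_)
      hc.measurableSet).of_forall_sdiff_eq_zero ChartLift.isOpen_domain.measurableSet fun z hz => ?_
    · simp only [G, h0]; rw [indicator_of_mem hz.2, Pi.one_apply, ofReal_one, one_mul]
    · refine part_mul_eq_zero hz.1 ?_
      by_contra hc
      rw [not_or, not_not] at hc; refine hc.1 ?_; simp only [G]
      rw [indicator_of_notMem fun h => hz.2 ⟨hc.2, h⟩, ofReal_zero, zero_mul]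
  have h2 := tendsto_total hG (w := fun i c z => κ i (chartRadius h c z))
    (fun i c => (hκ i).continuous.comp_continuousOn (continuousOn_chartRadius h c))
    (fun i c z => hκ1 i _) fun c => Eventually.of_forall fun z => hκ2 _
  rw [sphereIntegral_eq_total h g]
  refine (h2.congr fun i => total_congr fun c z _ => ?_).trans_eq ?_
  · simp only [G]
    by_cases hr : chartRadius h c z ∈ Icc 1 2
    · rw [indicator_of_mem hr, ← h0, radialForm, map_smul, smul_mul_assoc, smul_mul_assoc, map_smul,
        smul_eq_mul]
      simp
    · rw [hκ0 i _ hr, radialForm, hκ0 i _ hr]; simp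
  · congr 1
    refine total_congr fun c z _ => ?_
    simp only [G]; rw [← mul_assoc, ← ofReal_mul]; congr 2
    by_cases hr : chartRadius h c z ∈ Ioo 1 2
    · rw [indicator_of_mem (Ioo_subset_Icc_self hr), Pi.one_apply, mul_one]
    · rw [indicator_of_notMem hr, zero_mul]

theorem tendsto_total_bump {X : M → Coord n 2 → OpForms N (2 * n + 2)}
    (hX : ∀ c, SmoothOn (X c) (coneDomain 2 c)) (hs : IsSupportedIn (coneDomain 2) X) :
    Tendsto (fun t => (cotangentLift 2 g).total fun c z => (bump t z : ℂ) * topTrace N _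
    (X c z)) atTop
      (𝓝 (2 * Real.pi * (cotangentLift 0 g).total fun c y => topTrace N _ (X c (extraZero n
        y)))) := by
  simp only [ChartLift.total_eq_sum, mul_sum]
  refine tendsto_finsetSum _ fun c _ => ?_
  obtain ⟨K, hK, hKΩ, hK0⟩ := hs.compact c
  let f : (Coord n 2) → ℂ := (coneDomain 2 c).indicator fun z =>
    (partFun 2 c c z) * topTrace N _ (X c z)
  have h0 : ∀ z ∈ coneDomain 2 c, z ∉ K → (partFun 2 c c z) * topTrace N _ (X c z) = 0 :=
    fun z hz hzK => part_mul_eq_zero (g := g) hz.1 (by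
      by_cases hp : baseCoord z ∈ partSupport n c
      · exact .inl (by rw [hK0 z hz hp hzK, map_zero])
      · exact .inr hp)
  have hfd : ∀ z, baseCoord z ∈ chartDomain c → f z = (partFun 2 c c z) * topTrace N _ (X c z) := by
    intro z hz
    by_cases hz' : z ∈ coneDomain 2 c
    · exact indicator_of_mem hz' _
    · rw [hs.zero_off c z hz hz', map_zero, mul_zero]; exact indicator_of_notMem hz' _
  have hf0 : ∀ z, baseCoord z ∉ chartDomain c → f z = 0 := fun z hz =>
    indicator_of_notMem (fun h => hz h.1) _
  have hf : ContDiff ℝ ∞ f := contDiff_indicator (isOpen_coneDomain 2 c) hK hKΩ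
    ((ofRealCLM.contDiff.comp_contDiffOn ((contDiffOn_partFun 2 c c).mono (fun z hz => hz.1))).mul
    (((topTrace N _).restrictScalars ℝ).contDiff.comp_contDiffOn (hX c))) h0
  refine ((tendsto_integral_bump hf.continuous (hK.of_isClosed_subset (isClosed_tsupport _)
    (tsupport_indicator_subset hK h0))).congr fun t => ?_).trans_eq ?_
  · rw [← setIntegral_eq_integral_of_forall_compl_eq_zero (s := (cotangentLift 2 g).domain c)
      fun z hz => by rw [hf0 z hz, mul_zero]]
    refine setIntegral_congr_fun ChartLift.isOpen_domain.measurableSet fun z hz => ?_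
    simp only [hfd z hz]; exact mul_left_comm _ _ _
  · rw [← setIntegral_eq_integral_of_forall_compl_eq_zero (s := (cotangentLift 0 g).domain c)
      fun y hy => hf0 _ (by rw [baseCoord_extraZero]; exact hy)]
    congr 2
    refine setIntegral_congr_fun ChartLift.isOpen_domain.measurableSet fun y hy => ?_
    rw [hfd _ (by rw [baseCoord_extraZero]; exact hy), partFun, baseCoord_extraZero]
    rfl

theorem IsIsometry.totalTrace_extForm (hg : IsIsometry h g) (hD : D.IsElliptic g) (hκ :
    ContDiff ℝ ∞ κ)
    (hκ0 : ∀ x, x ∉ Icc 1 2 → κ x = 0) (hT : T.IsSmooth) (hT0 : T.IsClosed) (hTg :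
    T.IsInvariant g) :
    totalTrace g (radialForm h κ) (pullback 2 T) (fun c z => extForm g h D c z ^ (2 * 0 + 1)) = 0 ∧
    ∀ j, totalTrace g (radialForm h κ) (pullback 2 T) (fun c z => extForm g h D c z ^ (2 *
    (j + 1) + 1))
      = 4 * Real.pi * I * (2 * (j + 1) + 1 : ℕ) * totalTrace g (radialForm h κ) (pullback 0 T)
        fun c z => baseForm g h D c z ^ (2 * j + 1) := by
  have hP := hg.isInvMat_extSymbol (h := h) hD
  have ha := hg.isInvMat_symbolFun (h := h) hD
  have hw := hg.isWeight_radialForm (q := 2) 2 hκ hκ0 hT hTg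
  have hw0 := hg.isWeight_radialForm (q := 0) 1 hκ hκ0 hT hTg
  have h1 : ∀ K, Tendsto (fun t => (cotangentLift 2 g).total fun c z =>
      ((cutoff t z * extraSq z : ℝ) : ℂ) * topTrace 2 _ (opForm (radialForm h κ c z) *
        extForm g h D c z ^ K * opForm (pullback 2 T c z))) atTop
      (𝓝 (totalTrace g (radialForm h κ) (pullback 2 T) fun c z => extForm g h D c z ^ K)) := fun
        K => by
    have h2 := tendsto_total (l := atTop) (hw.hasTotal (hP.isInvForm_symD.pow K))
      (w := fun t _ z => cutoff t z * extraSq z) (w₀ := fun _ _ => 1) (fun t _ => by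
        have h3 : ∀ j, ContDiff ℝ ∞ fun z : Coord n 2 => cutoff t z * extraCoord z j *
            extraCoord z j := fun j => (contDiff_cutoff_mul t j).mul (contDiff_apply ℝ ℝ _)
        refine ((h3 0).add (h3 1)).continuous.continuousOn.congr fun z _ => ?_
        simp only [extraSq]
        ring) (fun t _ z => ?_) fun _ => ?_
    · simp only [ofReal_one, one_mul] at h2; exact h2
    · have h3 : 0 ≤ extraSq z := by
        unfold extraSq; positivity
      have h4 := one_add_extraSq_pos t z
      rw [cutoff, abs_of_nonneg (by positivity), mul_right_comm, ← div_eq_mul_inv, div_le_one h4]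
      linarith
    · filter_upwards [compl_mem_ae_iff.2 (Measure.pi_hyperplane (fun _ => volume)
        (natAdd (2 * n) (0 : Fin 2)) (0 : ℝ))] with z hz
      have h3 : 0 < extraSq z := by
        have h5 : 0 < extraCoord z 0 ^ 2 := sq_pos_of_ne_zero hz
        unfold extraSq; positivity
      have h4 := (tendsto_inv_atTop_zero.comp (tendsto_atTop_add_const_left _ (1 : ℝ)
        ((tendsto_pow_atTop two_ne_zero).atTop_mul_const h3))).const_sub 1
      rw [sub_zero] at h4
      refine h4.congr fun t => ?_
      have := (one_add_extraSq_pos t z).ne'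
      simp only [Function.comp_apply, cutoff]; field_simp; ring
  refine ⟨tendsto_nhds_unique (h1 _) (tendsto_const_nhds.congr fun t => ?_), fun j => ?_⟩
  · rw [hg.total_cutoff hD hκ hκ0 hT hTg]; simp
  · refine tendsto_nhds_unique (h1 _) ?_
    have hW := hg.isInvForm_cornerForm (h := h) hD (2 * j + 1)
    have h2 := tendsto_total_bump (g := g) (X := fun c z => opForm (radialForm h κ c z) * (opForm
    (dz (natAdd (2 * n) 0) * dz (natAdd (2 * n) 1)) * (cornerForm g h D (2 * j + 1) c z *
      opForm (pullback 2 T c z)))) (fun c => (hw.left.smooth c).mul (contDiffOn_const.mul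
      ((hW.smooth c).mul (hw.right.smooth c)))) hw.supported.mul_right
    have h3 := h2.const_mul (I * (2 * (j + 1) + 1 : ℕ))
    refine (h3.congr fun t => ?_).trans_eq ?_
    · rw [hg.total_cutoff_eq hD hκ hκ0 hT hT0 hTg]; simp only [map_mul opForm, mul_assoc]
    · have h4 : (cotangentLift 0 g).total (fun c y => topTrace 2 _ (opForm (radialForm h κ c
          (extraZero n y)) * (opForm (dz (natAdd (2 * n) 0) * dz (natAdd (2 * n) 1)) *
          (cornerForm g h D (2 * j + 1) c (extraZero n y) * opForm (pullback 2 T c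
    (extraZero n y)))))) = totalTrace g (radialForm h κ) (pullback 0 T) fun c y =>
            baseForm' g h D c y ^ (2 * j + 1) + baseForm g h D c y ^ (2 * j + 1) := by
        refine total_congr fun c y hy => ?_
        by_cases hy' : y ∈ coneDomain 0 c
        · rw [← hg.topTrace_slice hD hy']; simp only [map_mul opForm, mul_assoc]
        · have h5 := hw.supported.zero_off c (extraZero n y) (by rwa [baseCoord_extraZero])
            fun h => hy' (extraZero_mem_coneDomain.1 h)
          have h6 := hw0.supported.zero_off c y hy hy'
          simp only [h5, h6, zero_mul, map_zero]
      have h7 := hw0.trace_conj ha (E := 1) (fun m => map_one (shiftConjHom m).mapMatrix)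
        (2 * j + 1)
      have h8 : totalTrace g (radialForm h κ) (pullback 0 T) (fun c y => baseForm' g h D c y ^
        (2 * j + 1)) = totalTrace g (radialForm h κ) (pullback 0 T) fun c y => baseForm g h D c y ^
    (2 * j + 1) := by
        simp only [map_one, one_mul, mul_one] at h7
        refine h7.trans (hw0.totalTrace_congr fun c z hz => ?_)
        rw [ha.inv_mul c z hz, map_one, one_mul]; rfl
      have h9 := (hw0.totalTrace_add (ha.isInvForm_symD'.pow (2 * j + 1))
        (ha.isInvForm_symD.pow (2 * j + 1))).trans
        (congrArg (· + _) h8)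
      rw [h4]; refine congrArg 𝓝 ((congrArg (fun x => _ * (_ * x)) h9).trans ?_)
      change _ * (_ * (_ + totalTrace g (radialForm h κ) (pullback 0 T) fun c y =>
        baseForm g h D c y ^ (2 * j + 1))) = _
      ring

end Limits

/-! ### The comparison of the indices -/

section Comparison

theorem pow_eq_zero_of_lt {d k : ℕ} {B : Fin d → OpMatrix N} (hk : d < k) :
    (∑ l, opForm (dz l) * opMat (B l)) ^ k = 0 := by
  have h1 : ∀ k, (∑ l, opForm (dz l) * opMat (B l)) ^ k ∈ Submodule.span ℂ {x : OpForms N d |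
      ∃ (s : Fin k → Fin d) (b : OpMatrix N),
        x = opForm (List.ofFn fun i => dz (s i)).prod * opMat b} := by
    intro k
    induction k with
    | zero => exact Submodule.subset_span ⟨Fin.elim0, 1, by simp⟩
    | succ k ih =>
      rw [pow_succ', sum_mul]
      refine Submodule.sum_mem _ fun l _ => ?_
      have h2 := Submodule.mem_map_of_mem (f := LinearMap.mulLeft ℂ (opForm (dz l) * opMat (B l)))
        ih
      rw [Submodule.map_span] at h2; refine Submodule.span_mono ?_ h2
      rintro _ ⟨_, ⟨s, b, rfl⟩, rfl⟩
      refine ⟨Fin.cons l s, B l * b, ?_⟩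
      rw [LinearMap.mulLeft_apply, List.ofFn_succ, List.prod_cons, map_mul opForm, map_mul opMat,
        mul_assoc, ← mul_assoc (opMat _), ← (commute_opForm_opMat _ _).eq, mul_assoc, mul_assoc]
      simp
  have h3 := h1 k
  rw [Submodule.span_eq_bot.2, Submodule.mem_bot] at h3
  · exact h3
  · rintro _ ⟨s, b, rfl⟩
    rw [prod_dz_eq_zero hk, map_zero, zero_mul]

/-- The integral of `tr ((a⁻¹ da)ᵏ) ∧ T` over the sphere bundle. -/
def symbolMoment (h : Metric n M) (T : TotalForm n M) (a : OpFunction n M q N) (k : ℕ) : ℂ :=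
  sphereIntegral h fun c z => formTrace N (2 * n + q)
    (logDifferential h a c z ^ k) * pullback q T c z

theorem symbolMoment_eq (g : Diffeo n M) {a : OpFunction n M q N} {k : ℕ}
    {X : M → Coord n q → OpForms N (2 * n + q)}
    (hX : ∀ c, ∀ z ∈ coneDomain q c, logDifferential h a c z ^ k = X c z) : symbolMoment h T a k
      = sphereIntegral h fun c z => formTrace N _ (X c z) * pullback q T c z := by
  rw [symbolMoment, sphereIntegral_eq_total h g, sphereIntegral_eq_total h g]
  refine total_congr fun c z hz => ?_
  by_cases hr : chartRadius h c z ∈ Ioo 1 2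
  · rw [hX c z (mem_coneDomain_of_chartRadius_pos hz (one_pos.trans hr.1))]
  · simp [indicator_of_notMem hr 1]

theorem topIndex_eq (h : Metric n M) (T : TotalForm n M) (a : OpFunction n M q N) :
    topIndex h T a = ∑ i ∈ Finset.range (n + q), indexConst (i + 1) * symbolMoment h T a
    (2 * i + 1) := by
  have h1 : Finset.Icc 1 (n + q) = Finset.Ico 1 (n + q + 1) := rfl
  rw [topIndex, h1, Finset.sum_Ico_eq_sum_range, Nat.add_sub_cancel]
  refine sum_congr rfl fun i _ => ?_
  rw [add_comm 1 i]
  rfl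

theorem IsIsometry.symbolMoment_symbolFun_eq_zero (hg : IsIsometry h g) (hD : D.IsElliptic g) {k :
    ℕ}
    (hk : 2 * n < k) : symbolMoment h T (D.symbolFun g) k = 0 := by
  have ha := hg.isInvMat_symbolFun hD
  rw [symbolMoment_eq (X := fun _ _ => 0) g fun c z hz => by
    rw [logDifferential_eq_symD ha hz, ha.symD_eq_sum hz]; exact pow_eq_zero_of_lt (d := 2 * n + 0)
      hk, sphereIntegral_eq_total h g, ChartLift.total_eq_sum]
  simp

theorem IsIsometry.symbolMoment_extSymbol (hg : IsIsometry h g) (hD : D.IsElliptic g)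
    (hT : T.IsSmooth) (hT0 : T.IsClosed) (hTg : T.IsInvariant g) :
    symbolMoment h T (extSymbol g D) (2 * 0 + 1) = 0 ∧
    ∀ j, symbolMoment h T (extSymbol g D) (2 * (j + 1) + 1) = 4 * Real.pi * I *
      (2 * (j + 1) + 1 : ℕ) * symbolMoment h T (D.symbolFun g) (2 * j + 1) := by
  have hP := hg.isInvMat_extSymbol hD
  have ha := hg.isInvMat_symbolFun hD
  obtain ⟨κ, hκ, hκ0, hκ1, hκ2⟩ := exists_smooth_approx
  have h1 : ∀ k, Tendsto (fun i => totalTrace g (radialForm h (κ i)) (pullback 2 T)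
      fun c z => extForm g h D c z ^ k) atTop (𝓝 (symbolMoment h T (extSymbol g D) k)) := fun
        k => by
    rw [symbolMoment_eq g fun c z hz => by rw [logDifferential_eq_symD hP hz]]
    exact tendsto_totalTrace_radialForm h hT (hP.isInvForm_symD.pow k) hκ hκ0 hκ1 hκ2
  have h2 : ∀ k, Tendsto (fun i => totalTrace g (radialForm h (κ i)) (pullback 0 T)
      fun c z => baseForm g h D c z ^ k) atTop (𝓝 (symbolMoment h T (D.symbolFun g) k)) := fun
        k => by
    rw [symbolMoment_eq g fun c z hz => by rw [logDifferential_eq_symD ha hz]]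
    exact tendsto_totalTrace_radialForm h hT (ha.isInvForm_symD.pow k) hκ hκ0 hκ1 hκ2
  have h3 := fun i => hg.totalTrace_extForm hD (hκ i) (hκ0 i) hT hT0 hTg
  exact ⟨tendsto_nhds_unique (h1 _) (tendsto_const_nhds.congr fun i => (h3 i).1.symm),
    fun j => tendsto_nhds_unique (h1 _) (((h2 _).const_mul _).congr fun i => ((h3 i).2 j).symm)⟩

theorem indexConst_succ (j : ℕ) : indexConst (j + 1 + 1) * (4 * Real.pi * I *
    (2 * (j + 1) + 1 : ℕ)) = indexConst (j + 1) := by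
  have h1 : (2 * (j + 1 + 1) - 1).factorial = (2 * (j + 1) + 1) * ((2 * (j + 1)) *
    (2 * j + 1).factorial) := by
    rw [show 2 * (j + 1 + 1) - 1 = 2 * j + 1 + 1 +
      1 by omega, Nat.factorial_succ, Nat.factorial_succ]
    rfl
  have h2 : (2 * (j + 1) - 1).factorial = (2 * j + 1).factorial := rfl
  have hπ := Complex.ofReal_ne_zero.2 Real.pi_ne_zero
  have hf : ((2 * j + 1).factorial : ℂ) ≠ 0 := Nat.cast_ne_zero.2 (Nat.factorial_ne_zero _)
  have hj : (j + 1) ≠ 0 := Nat.cast_add_one_ne_zero j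
  have hj' : (2 * (j + 1) + 1 : ℂ) ≠ 0 := by exact_mod_cast Nat.succ_ne_zero (2 * (j + 1))
  have hI := Complex.I_ne_zero
  rw [indexConst, indexConst, h1, h2, Nat.add_sub_cancel, Nat.add_sub_cancel, Nat.factorial_succ j]
  push_cast at hj' ⊢
  generalize (2 * ((j : ℂ) + 1) + 1) = y at *
  field_simp
  ring

theorem IsIsometry.topIndex_extSymbol (hg : IsIsometry h g) (hD : D.IsElliptic g)
    (hT : T.IsSmooth) (hT0 : T.IsClosed) (hTg : T.IsInvariant g) :
    topIndex h T (D.symbolFun g) = topIndex h T (extSymbol g D) := by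
  obtain ⟨h1, h2⟩ := hg.symbolMoment_extSymbol hD hT hT0 hTg
  rw [topIndex_eq, topIndex_eq]
  refine Eq.trans ?_ (Finset.sum_range_succ' (fun i => indexConst (i + 1) *
    symbolMoment h T (extSymbol g D) (2 * i + 1)) (n + 1)).symm
  rw [h1, mul_zero, add_zero, Finset.sum_range_succ, h2 n, hg.symbolMoment_symbolFun_eq_zero hD
    (Nat.lt_succ_self _), mul_zero, mul_zero, add_zero, add_zero]
  refine sum_congr rfl fun j _ => ?_
  rw [h2, ← mul_assoc, indexConst_succ]

end Comparison

end ShiftIndex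

end

theorem mainTheorem3 {n : ℕ} {M : Type*} [TopologicalSpace M]
    [ChartedSpace (EuclideanSpace ℝ (Fin n)) M] [IsManifold (𝓡 n) ∞ M]
    [CompactSpace M] [T2Space M]
    (h : ShiftIndex.Metric n M) (g : M ≃ₘ^∞⟮𝓡 n, 𝓡 n⟯ M) (hg : ShiftIndex.IsIsometry h g)
    (D : ShiftIndex.ShiftOp n M) (hD : D.IsElliptic g)
    (T : ShiftIndex.TotalForm n M) (hT : T.RepresentsTodd h) (hTg : T.IsInvariant g) :
    (∃ B : ShiftIndex.CylShiftOp n M, ShiftIndex.IsExternalProduct h g D B) ∧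
    ∀ B : ShiftIndex.CylShiftOp n M, ShiftIndex.IsExternalProduct h g D B →
      ShiftIndex.IsInvertibleSymbol h g (D.symbolFun g) ∧
      ShiftIndex.IsInvertibleSymbol h g (B.symbolFun g) ∧
      ShiftIndex.topIndex h T (D.symbolFun g) = ShiftIndex.topIndex h T (B.symbolFun g) := by
  refine ⟨⟨_, hg.isExternalProduct_externalProduct D⟩, fun B hB => ?_⟩
  rw [hB.symbolFun_eq (hg.isExternalProduct_externalProduct D), hg.symbolFun_externalProduct D]
  exact ⟨hg.isInvertibleSymbol_symbolFun hD, hg.isInvertibleSymbol_extSymbol hD,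
    hg.topIndex_extSymbol hD hT.1 hT.2.1 hTg⟩
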